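/- **Setting.** Write $\langle x\rangle=(1+|x|^2)^{1/2}$. Let $n\in\mathbb N$, $\alpha\in\mathbb R$ with $n>2\alpha>2$. For $z\in\mathbb C\setminus[0,\infty)$ let $\mathcal R_0(z)=((-\Delta)^\alpha-z)^{-1}$ on $\mathbb R^n$, where $(-\Delta)^\alpha$ is the Fourier multiplier $|\xi|^{2\alpha}$; its integral kernel $\mathcal R_0(z)(x,y)$, $x\ne y$, is the limit as $\delta\to0^+$ of $(2\pi)^{-n}\int_{\mathbb R^n}e^{i(x-y)\cdot\xi}\,\frac{e^{-\delta|\xi|^2}}{|\xi|^{2\alpha}-z}\,d\xi$. For $\lambda>0$ put $\mathcal R_0^\pm(\lambda^{2\alpha})(x,y)=\lim_{\varepsilon\to0^+}\mathcal R_0(\lambda^{2\alpha}\pm i\varepsilon)(x,y)$. Let $V:\mathbb R^n\to\mathbb R$ be measurable with $|V(x)|\le C\langle x\rangle^{-\beta}$ for some $C$ and some $\beta>n$, and put $v=|V|^{1/2}$. Let $\lambda_0>0$ and let $\chi:\mathbb R\to\mathbb R$ be even and smooth with $\chi(\lambda)=1$ for $|\lambda|<\lambda_0$ and $\chi(\lambda)=0$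 for $|\lambda|>2\lambda_0$. An operator on $L^2(\mathbb R^n)$ with kernel $T(x,y)$ is called absolutely bounded if the operator with kernel $|T(x,y)|$ is bounded on $L^2(\mathbb R^n)$. **Proposition 3.1.** Let $\eta>0$, and let $\Gamma(\lambda)$, $0<\lambda<2\lambda_0$, be absolutely bounded operators with kernels $\Gamma(\lambda)(x,y)$ which, for almost every $(x,y)$, are $\lceil\frac n2\rceil+1$ times differentiable in $\lambda$. Let $$\widetilde\Gamma(x,y)=\sup_{0<\lambda<2\lambda_0}\Big[|\Gamma(\lambda)(x,y)|+\sup_{1\le k\le\lceil n/2\rceil+1}\big|\lambda^{k-\eta}\,\partial_\lambda^k\Gamma(\lambda)(x,y)\big|\Big].$$ If $2\alpha<n<4\alpha$, assume that the operator with kernel $\widetilde\Gamma$ is bounded on $L^2(\mathbb R^n)$. If $n\ge4\alpha$, assume that there are $C$ and $\epsilon>0$ with $\widetilde\Gamma(x,y)\le C\langle x\rangle^{-\frac n2-\epsilon}\langle y\rangle^{-\frac n2-\epsilon}$ for almost every $(x,y)$. Then, for all $x,y\in\mathbb R^n$, the integral $$K(x,y)=\int_0^\infty\chi(\lambda)\lambda^{2\alpha-1}\int_{\mathbb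 R^{2n}}\mathcal R_0^+(\lambda^{2\alpha})(x,z_1)\,v(z_1)\,\Gamma(\lambda)(z_1,z_2)\,v(z_2)\,\big[\mathcal R_0^+(\lambda^{2\alpha})-\mathcal R_0^-(\lambda^{2\alpha})\big](z_2,y)\,dz_1\,dz_2\,d\lambda$$ converges absolutely, and the operator with kernel $K$ is bounded on $L^p(\mathbb R^n)$ for every $1\le p\le\infty$: there is a constant $C_p$ such that for every $f\in L^p(\mathbb R^n)$ the integral $\int K(x,y)f(y)\,dy$ converges absolutely for almost every $x$ and defines a function in $L^p(\mathbb R^n)$ of norm at most $C_p\|f\|_{L^p}$. -/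

import Mathlib

open MeasureTheory Set Filter Topology
open scoped NNReal ENNReal ContDiff FourierTransform

/-- `ℝⁿ` with its Euclidean norm. -/
abbrev Rn (n : ℕ) : Type := EuclideanSpace ℝ (Fin n)

noncomputable section

/-- The Japanese bracket `⟨x⟩ = (1 + |x|²)^{1/2}`. -/
def bracket {n : ℕ} (x : Rn n) : ℝ := Real.sqrt (1 + ‖x‖ ^ 2)

/-- The kernel, as a function of the difference `x` of the two space variables, of
`e^{δΔ} ((-Δ)^α - z)⁻¹`, that is, the inverse Fourier transform of its symbol. With Mathlib's
normalisation `e^{2π i x·ξ}` of the Fourier transform, `-Δ` has symbol `(2π|ξ|)²`.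
For `δ > 0` and non-real `z` the symbol is integrable. -/
def regResolventKernel {n : ℕ} (α δ : ℝ) (z : ℂ) (x : Rn n) : ℂ :=
  𝓕⁻ (fun ξ : Rn n =>
    (Real.exp (-δ * (2 * Real.pi * ‖ξ‖) ^ 2) : ℂ) /
      (((2 * Real.pi * ‖ξ‖) ^ (2 * α) : ℝ) - z)) x

/-- The kernel of the free resolvent `R₀(z) = ((-Δ)^α - z)⁻¹`, `z ∉ [0,∞)`, off the diagonal:
the pointwise limit, as `δ → 0+`, of the kernels of `e^{δΔ} R₀(z)` (the symbol of `R₀(z)` alone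
need not be integrable). -/
def resolventKernel {n : ℕ} (α : ℝ) (z : ℂ) (x : Rn n) : ℂ :=
  limUnder (𝓝[>] (0 : ℝ)) (fun δ : ℝ => regResolventKernel α δ z x)

/-- The kernel of `R₀⁺(lam^{2α}) = R₀(lam^{2α} + i0)`. -/
def resolventPlus {n : ℕ} (α lam : ℝ) (x : Rn n) : ℂ :=
  limUnder (𝓝[>] (0 : ℝ)) (fun ε : ℝ =>
    resolventKernel α (((lam ^ (2 * α) : ℝ) : ℂ) + (ε : ℂ) * Complex.I) x)

/-- The kernel of `R₀⁻(lam^{2α}) = R₀(lam^{2α} - i0)`. -/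
def resolventMinus {n : ℕ} (α lam : ℝ) (x : Rn n) : ℂ :=
  limUnder (𝓝[>] (0 : ℝ)) (fun ε : ℝ =>
    resolventKernel α (((lam ^ (2 * α) : ℝ) : ℂ) - (ε : ℂ) * Complex.I) x)

/-- The operator with the nonnegative kernel `G` is bounded on `L²(ℝⁿ)`. For a nonnegative
measurable kernel it is enough to test on nonnegative functions. -/
def PosKernelBoundedOnL2 {n : ℕ} (G : Rn n → Rn n → ℝ≥0∞) : Prop :=
  AEMeasurable (fun z : Rn n × Rn n => G z.1 z.2) volume ∧
  ∃ C : ℝ≥0, ∀ f : Rn n → ℝ≥0∞, Measurable f →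
    ∫⁻ x, (∫⁻ y, G x y * f y) ^ 2 ≤ C * ∫⁻ y, f y ^ 2

/-- The operator with kernel `T` is absolutely bounded: `|T(x,y)|` is the kernel of a bounded
operator on `L²(ℝⁿ)`. -/
def AbsolutelyBounded {n : ℕ} (T : Rn n → Rn n → ℂ) : Prop :=
  AEStronglyMeasurable (fun z : Rn n × Rn n => T z.1 z.2) volume ∧
  PosKernelBoundedOnL2 (fun x y => ‖T x y‖ₑ)

/-- The operator `f ↦ ∫ K(·,y) f(y) dy` is (defined by an absolutely convergent integral almost
everywhere and) bounded on `L^p(ℝⁿ)`. -/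
def KernelBoundedOnLp {n : ℕ} (K : Rn n → Rn n → ℂ) (p : ℝ≥0∞) : Prop :=
  ∃ C : ℝ≥0, ∀ f : Rn n → ℂ, MemLp f p volume →
    (∀ᵐ x, Integrable (fun y => K x y * f y) volume) ∧
    MemLp (fun x => ∫ y, K x y * f y) p volume ∧
    eLpNorm (fun x => ∫ y, K x y * f y) p volume ≤ C * eLpNorm f p volume

/-- The number `⌈n/2⌉ + 1` of derivatives in the spectral variable. -/
def numDeriv (n : ℕ) : ℕ := ⌈(n : ℝ) / 2⌉₊ + 1

/-- `Γ̃(x,y)`: the supremum over `0 < lam < Λ` of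
`|Γ(lam)(x,y)| + sup_{1 ≤ k ≤ ⌈n/2⌉+1} |lam^{k-η} ∂^k Γ(lam)(x,y)|`, with values in `[0,∞]`. -/
def gammaTilde {n : ℕ} (η Λ : ℝ) (Γ : ℝ → Rn n → Rn n → ℂ) (x y : Rn n) : ℝ≥0∞ :=
  ⨆ lam ∈ Ioo (0 : ℝ) Λ,
    (‖Γ lam x y‖ₑ +
      ⨆ k ∈ Icc 1 (numDeriv n),
        ‖((lam ^ ((k : ℝ) - η) : ℝ) : ℂ) * iteratedDeriv k (fun t => Γ t x y) lam‖ₑ)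

/-- The integrand, in `z = (z₁,z₂)`, of the kernel at `(x,y)` of the composition
`R₀⁺(lam^{2α}) v Γ(lam) v [R₀⁺(lam^{2α}) - R₀⁻(lam^{2α})]`, where `v = |V|^{1/2}`. -/
def compositionIntegrand {n : ℕ} (α : ℝ) (V : Rn n → ℝ) (Γ : ℝ → Rn n → Rn n → ℂ)
    (lam : ℝ) (x y : Rn n) (z : Rn n × Rn n) : ℂ :=
  resolventPlus α lam (x - z.1) * (Real.sqrt |V z.1| : ℂ) * Γ lam z.1 z.2 *
    (Real.sqrt |V z.2| : ℂ) * (resolventPlus α lam (z.2 - y) - resolventMinus α lam (z.2 - y))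

/-- The low energy kernel
`K(x,y) = ∫₀^∞ χ(lam) lam^{2α-1} [R₀⁺ v Γ(lam) v [R₀⁺ - R₀⁻]](x,y) dlam`. -/
def lowEnergyKernel {n : ℕ} (α : ℝ) (χ : ℝ → ℝ) (V : Rn n → ℝ) (Γ : ℝ → Rn n → Rn n → ℂ)
    (x y : Rn n) : ℂ :=
  ∫ lam in Ioi (0 : ℝ), ((χ lam * lam ^ (2 * α - 1) : ℝ) : ℂ) *
    ∫ z : Rn n × Rn n, compositionIntegrand α V Γ lam x y z

end

open scoped Real Complex
open Complex (real_smul norm_of_nonneg ofRealCLM continuous_ofReal I norm_exp_ofReal_mul_I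
  ofReal_zero ofReal_one cpow_def_of_ne_zero exp_add ofReal_cpow slitPlane mem_slitPlane_iff
  re_ofReal_mul im_ofReal_mul norm_cpow_real norm_exp neg_re one_re one_im add_re add_im mul_im
  ofReal_re ofReal_im I_re I_im ofReal_pow I_sq ofReal_exp ofReal_neg continuous_re abs_re_le_norm
  sub_re exp_zero norm_I norm_real exp_nat_mul norm_ofNat conj_ofNat exp_ofReal_mul_I_re log_im
  exp_log hasStrictDerivAt_cpow_const conj_ofReal exp_conj conj_I)
open Real (norm_eq_abs mul_rpow exp_pos rpow_add rpow_natCast rpow_mul rpow_pos_of_pos rpow_zero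
  rpow_neg div_rpow rpow_le_rpow one_le_rpow fourier_eq fourierChar exp_le_one_iff pi_pos sqrt
  sq_sqrt Gamma rpow_nonneg log exp_le_exp rpow_sub_one sqrt_nonneg)
open ENNReal (ofReal ofReal_le_ofReal ofReal_mul ofReal_ne_top ofReal_add coe_toNNReal mul_ne_top
  rpow_one mul_lt_top coe_lt_top coe_ne_top)

noncomputable section

/-- The order of the Macdonald and Bessel functions in dimension `n`. -/
notation:max "ord(" n ")" => ((n : ℝ) - 3) / 2

/-- Real powers of complex numbers. -/
notation:75 z:76 " ^ᵣ " s:max => z ^ ((s : ℝ) : ℂ)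

lemma ae_mem_Ioi {a : ℝ} : ∀ᵐ t ∂(volume.restrict (Ioi a)), t ∈ Ioi a :=
  ae_restrict_mem measurableSet_Ioi

lemma ae_mem_Ioo {a b : ℝ} : ∀ᵐ t ∂(volume.restrict (Ioo a b)), t ∈ Ioo a b :=
  ae_restrict_mem measurableSet_Ioo

/-- On the set `s`, the function `b` has `N` derivatives with `|b^{(k)}(t)| ≤ β(t) t^{-k}`. -/
def SymBound (s : Set ℝ) : ℕ → (ℝ → ℝ) → (ℝ → ℂ) → Prop
  | 0, β, b => ∀ t ∈ s, ‖b t‖ ≤ β t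
  | N + 1, β, b => (∀ t ∈ s, ‖b t‖ ≤ β t) ∧ (∀ t ∈ s, DifferentiableAt ℝ b t) ∧
      SymBound s N (fun t => β t / t) (deriv b)

namespace SymBound

variable {s s' : Set ℝ} {N : ℕ} {β β' : ℝ → ℝ} {b b' : ℝ → ℂ}

lemma norm_le (h : SymBound s N β b) {t : ℝ} (ht : t ∈ s) : ‖b t‖ ≤ β t := by
  cases N with
  | zero => exact h t ht
  | succ N => exact h.1 t ht

lemma mono (h : SymBound s N β b) (hs : s' ⊆ s) (hs' : s' ⊆ Ioi 0) (hβ : ∀ t ∈ s', β t ≤ β' t) :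
    SymBound s' N β' b := by
  induction N generalizing β β' b with
  | zero => exact fun t ht => (h t (hs ht)).trans (hβ t ht)
  | succ N ih =>
    refine ⟨fun t ht => (h.1 t (hs ht)).trans (hβ t ht), fun t ht => h.2.1 t (hs ht),
      ih h.2.2 fun t ht => ?_⟩
    have : 0 < t := hs' ht
    have := hβ t ht; gcongr

lemma of_succ (h : SymBound s (N + 1) β b) : SymBound s N β b := by
  induction N generalizing β b with
  | zero => exact h.1
  | succ N ih => exact ⟨h.1, h.2.1, ih h.2.2⟩

lemma union (h : SymBound s N β b) (h' : SymBound s' N β b) : SymBound (s ∪ s') N β b := by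
  induction N generalizing β b with
  | zero => exact fun t ht => ht.elim (h t) (h' t)
  | succ N ih =>
    exact ⟨fun t ht => ht.elim (h.1 t) (h'.1 t), fun t ht => ht.elim (h.2.1 t) (h'.2.1 t),
      ih h.2.2 h'.2.2⟩

lemma congr (hs : IsOpen s) (h : SymBound s N β b) (hb : ∀ t ∈ s, b' t = b t) :
    SymBound s N β b' := by
  induction N generalizing β b b' with
  | zero => exact fun t ht => by rw [hb t ht]; exact h t ht
  | succ N ih =>
    have key : ∀ t ∈ s, b' =ᶠ[𝓝 t] b := fun t ht => by
      filter_upwards [hs.mem_nhds ht] with u hu using hb u hu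
    exact ⟨fun t ht => by rw [hb t ht]; exact h.1 t ht,
      fun t ht => (h.2.1 t ht).congr_of_eventuallyEq (key t ht),
      ih h.2.2 fun t ht => (key t ht).deriv_eq⟩

lemma zero (hs : s ⊆ Ioi 0) (hβ : ∀ t ∈ s, 0 ≤ β t) : SymBound s N β (fun _ => 0) := by
  induction N generalizing β with
  | zero => intro t ht; simpa using hβ t ht
  | succ N ih =>
    refine ⟨fun t ht => by simpa using hβ t ht, fun t _ => differentiableAt_const _, ?_⟩
    have : deriv (fun _ : ℝ => (0 : ℂ)) = fun _ => 0 := by simp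
    rw [this]
    exact ih fun t ht => div_nonneg (hβ t ht) (le_of_lt (hs ht))

lemma const (hs : s ⊆ Ioi 0) (c : ℂ) : SymBound s N (fun _ => ‖c‖) (fun _ => c) := by
  cases N with
  | zero => intro t ht; simp
  | succ N =>
    refine ⟨fun t ht => by simp, fun t _ => differentiableAt_const _, ?_⟩
    have : deriv (fun _ : ℝ => c) = fun _ => 0 := by simp
    rw [this]
    exact zero hs fun t ht => div_nonneg (norm_nonneg _) (le_of_lt (hs ht))

lemma add (hs : IsOpen s) (h : SymBound s N β b) (h' : SymBound s N β' b') :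
    SymBound s N (fun t => β t + β' t) (fun t => b t + b' t) := by
  induction N generalizing β b β' b' with
  | zero => exact fun t ht => (norm_add_le _ _).trans (add_le_add (h t ht) (h' t ht))
  | succ N ih =>
    refine ⟨fun t ht => (norm_add_le _ _).trans (add_le_add (h.1 t ht) (h'.1 t ht)),
      fun t ht => (h.2.1 t ht).add (h'.2.1 t ht), ?_⟩
    have := ih h.2.2 h'.2.2
    simp only [← add_div] at this
    exact this.congr hs fun t ht => deriv_fun_add (h.2.1 t ht) (h'.2.1 t ht)

lemma mul (hs : IsOpen s) (hs0 : s ⊆ Ioi 0) (h : SymBound s N β b) (h' : SymBound s N β' b') :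
    SymBound s N (fun t => 2 ^ N * (β t * β' t)) (fun t => b t * b' t) := by
  induction N generalizing β b β' b' with
  | zero =>
    intro t ht
    have h1 := h t ht
    have h2 := h' t ht
    simp only [norm_mul, pow_zero, one_mul]
    have := (norm_nonneg _).trans h1; gcongr
  | succ N ih =>
    refine ⟨fun t ht => ?_, fun t ht => (h.2.1 t ht).mul (h'.2.1 t ht), ?_⟩
    · have h1 := h.1 t ht
      have h2 := h'.1 t ht
      have h3 := (norm_nonneg _).trans h1
      have h4 := (norm_nonneg _).trans h2
      have : (1 : ℝ) ≤ 2 ^ (N + 1) := one_le_pow₀ (by norm_num)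
      rw [norm_mul]
      calc ‖b t‖ * ‖b' t‖ ≤ β t * β' t := by gcongr
        _ ≤ 2 ^ (N + 1) * (β t * β' t) := le_mul_of_one_le_left (by positivity) this
    · have h1 := ih h.2.2 h'.of_succ
      have h2 := ih h.of_succ h'.2.2
      refine ((h1.add hs h2).congr hs fun t ht =>
        deriv_fun_mul (h.2.1 t ht) (h'.2.1 t ht)).mono Subset.rfl hs0 fun t ht => ?_
      apply le_of_eq; field_simp; ring

lemma const_mul (hs : IsOpen s) (hs0 : s ⊆ Ioi 0) (h : SymBound s N β b) (c : ℂ) :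
    SymBound s N (fun t => ‖c‖ * β t) (fun t => c * b t) := by
  induction N generalizing β b with
  | zero => intro t ht; rw [norm_mul]; exact mul_le_mul_of_nonneg_left (h t ht) (norm_nonneg c)
  | succ N ih =>
    refine ⟨fun t ht => ?_, fun t ht => (h.2.1 t ht).const_mul c, ?_⟩
    · rw [norm_mul]; exact mul_le_mul_of_nonneg_left (h.1 t ht) (norm_nonneg c)
    · refine ((ih h.2.2).congr hs fun t ht => deriv_const_mul c (h.2.1 t ht)).mono Subset.rfl hs0
        fun t ht => le_of_eq (by ring)

lemma comp_mul {r : ℝ} (hr : 0 < r) (h : SymBound (Ioi 0) N β b) :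
    SymBound (Ioi 0) N (fun t => β (t * r)) (fun t => b (t * r)) := by
  induction N generalizing β b with
  | zero => exact fun t ht => h (t * r) (mul_pos ht hr)
  | succ N ih =>
    have hd : ∀ t ∈ Ioi 0, HasDerivAt (fun t => b (t * r)) (r * deriv b (t * r)) t := by
      intro t ht
      have h1 := (h.2.1 (t * r) (mul_pos ht hr)).hasDerivAt
      have h2 : HasDerivAt (fun t => t * r) r t := by simpa using (hasDerivAt_id t).mul_const r
      have h3 := HasDerivAt.scomp t h1 h2
      rw [real_smul] at h3
      exact h3
    refine ⟨fun t ht => h.1 (t * r) (mul_pos ht hr), fun t ht => (hd t ht).differentiableAt, ?_⟩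
    refine (((ih h.2.2).const_mul isOpen_Ioi Subset.rfl (r : ℂ)).congr isOpen_Ioi
      fun t ht => (hd t ht).deriv).mono Subset.rfl Subset.rfl fun t ht => le_of_eq ?_
    have : 0 < t := ht
    rw [norm_of_nonneg hr.le]; field_simp

lemma of_iteratedDeriv (hs : s ⊆ Ioi 0)
    (hd : ∀ k < N, ∀ t ∈ s, DifferentiableAt ℝ (iteratedDeriv k b) t)
    (hβ : ∀ k ≤ N, ∀ t ∈ s, ‖iteratedDeriv k b t‖ * t ^ k ≤ β t) : SymBound s N β b := by
  induction N generalizing β b with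
  | zero => intro t ht; simpa using hβ 0 le_rfl t ht
  | succ N ih =>
    refine ⟨fun t ht => by simpa using hβ 0 (by omega) t ht,
      fun t ht => by simpa using hd 0 (by omega) t ht, ih (fun k hk t ht => ?_) fun k hk t ht => ?_⟩
    · rw [← iteratedDeriv_succ']; exact hd (k + 1) (by omega) t ht
    · have h1 := hβ (k + 1) (by omega) t ht
      have : 0 < t := hs ht
      rw [← iteratedDeriv_succ', le_div_iff₀ this]
      rw [pow_succ] at h1; linarith

/-- The function `t` itself is a symbol. -/
lemma id (hs : s ⊆ Ioi 0) : SymBound s N (fun t => t) (fun t => (t : ℂ)) := by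
  have hder : deriv (fun t : ℝ => (t : ℂ)) = fun _ => 1 := by
    ext t; exact ofRealCLM.hasDerivAt.deriv
  cases N with
  | zero => intro t ht; have : 0 < t := hs ht; simp [abs_of_pos this]
  | succ N =>
    refine ⟨fun t ht => by have : 0 < t := hs ht; simp [abs_of_pos this],
      fun t _ => ofRealCLM.differentiableAt, ?_⟩
    rw [hder]
    refine (const hs 1).mono Subset.rfl hs fun t ht => ?_
    have : 0 < t := hs ht
    simp [this.ne']

/-- The derivative of a symbol, multiplied by `t`, is a symbol. -/
lemma id_mul_deriv (hs : IsOpen s) (hs0 : s ⊆ Ioi 0) (h : SymBound s (N + 1) β b) :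
    SymBound s N (fun t => 2 ^ N * β t) (fun t => (t : ℂ) * deriv b t) := by
  refine ((id hs0).mul hs hs0 h.2.2).mono Subset.rfl hs0 fun t ht => le_of_eq ?_
  have : 0 < t := hs0 ht; field_simp

end SymBound

lemma iteratedDeriv_comp_ofReal {F : ℂ → ℂ} {U : Set ℂ} (hU : IsOpen U)
    (hF : DifferentiableOn ℂ F U) (k : ℕ) :
    ∀ t : ℝ, (t : ℂ) ∈ U → iteratedDeriv k (fun t : ℝ => F t) t = iteratedDeriv k F (t : ℂ) ∧
      DifferentiableAt ℝ (iteratedDeriv k (fun t : ℝ => F t)) t := by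
  have hd : ∀ k, DifferentiableOn ℂ (iteratedDeriv k F) U := by
    intro k
    induction k with
    | zero => simpa using hF
    | succ k ih => rw [iteratedDeriv_succ]; exact ih.deriv hU
  have hO : IsOpen {t : ℝ | (t : ℂ) ∈ U} := hU.preimage continuous_ofReal
  induction k with
  | zero =>
    intro t ht
    simp only [iteratedDeriv_zero, true_and]
    exact ((hF.differentiableAt (hU.mem_nhds ht)).hasDerivAt.comp_ofReal).differentiableAt
  | succ k ih =>
    have key : ∀ t : ℝ, (t : ℂ) ∈ U →
        iteratedDeriv (k + 1) (fun t : ℝ => F t) t = iteratedDeriv (k + 1) F (t : ℂ) := by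
      intro t ht
      have h1 : iteratedDeriv k (fun t : ℝ => F t) =ᶠ[𝓝 t] fun t : ℝ => iteratedDeriv k F (t : ℂ) := by
        filter_upwards [hO.mem_nhds ht] with u hu using (ih u hu).1
      rw [iteratedDeriv_succ, h1.deriv_eq, iteratedDeriv_succ]
      exact (((hd k).differentiableAt (hU.mem_nhds ht)).hasDerivAt.comp_ofReal).deriv
    intro t ht
    refine ⟨key t ht, ?_⟩
    have h1 : iteratedDeriv (k + 1) (fun t : ℝ => F t) =ᶠ[𝓝 t]
        fun t : ℝ => iteratedDeriv (k + 1) F (t : ℂ) := by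
      filter_upwards [hO.mem_nhds ht] with u hu using key u hu
    refine DifferentiableAt.congr_of_eventuallyEq ?_ h1
    exact (((hd (k + 1)).differentiableAt (hU.mem_nhds ht)).hasDerivAt.comp_ofReal).differentiableAt

/-- Cauchy's estimates: a function which is holomorphic near the discs `|w - t| ≤ σ t` and bounded
there by `β t` is a symbol. -/
lemma SymBound.of_differentiableOn {F : ℂ → ℂ} {U : Set ℂ} (hU : IsOpen U)
    (hF : DifferentiableOn ℂ F U) {s : Set ℝ} (hs : s ⊆ Ioi 0) {σ : ℝ} (hσ : 0 < σ) (hσ1 : σ ≤ 1)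
    {β : ℝ → ℝ} (hsub : ∀ t ∈ s, Metric.closedBall (t : ℂ) (σ * t) ⊆ U)
    (hβ : ∀ t ∈ s, ∀ w ∈ Metric.closedBall (t : ℂ) (σ * t), ‖F w‖ ≤ β t) (N : ℕ) :
    SymBound s N (fun t => N.factorial / σ ^ N * β t) (fun t => F t) := by
  have hmem : ∀ t ∈ s, (t : ℂ) ∈ U := fun t ht =>
    hsub t ht (Metric.mem_closedBall_self (mul_nonneg hσ.le (le_of_lt (hs ht))))
  refine SymBound.of_iteratedDeriv hs
    (fun k _ t ht => (iteratedDeriv_comp_ofReal hU hF k t (hmem t ht)).2) fun k hk t ht => ?_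
  have ht0 : 0 < t := hs ht
  rw [(iteratedDeriv_comp_ofReal hU hF k t (hmem t ht)).1]
  have hR : 0 < σ * t := by positivity
  have hdc : DiffContOnCl ℂ F (Metric.ball (t : ℂ) (σ * t)) :=
    (hF.mono (hsub t ht)).diffContOnCl_ball Subset.rfl
  have h1 := Complex.norm_iteratedDeriv_le_of_forall_mem_sphere_norm_le k hR hdc
    fun w hw => hβ t ht w (Metric.sphere_subset_closedBall hw)
  have hβ0 : 0 ≤ β t := (norm_nonneg _).trans (hβ t ht t (Metric.mem_closedBall_self hR.le))
  calc _ ≤ k.factorial * β t / (σ * t) ^ k * t ^ k := by gcongr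
    _ = k.factorial / σ ^ k * β t := by rw [mul_pow]; field_simp
    _ ≤ N.factorial / σ ^ N * β t := by
      have h2 : (k.factorial : ℝ) ≤ N.factorial := by gcongr
      have h3 : σ ^ N ≤ σ ^ k := pow_le_pow_of_le_one hσ.le hσ1 hk; gcongr

/-! ### Cut-offs -/

/-- A smooth function equal to `1` on `(-∞,1]` and to `0` on `[2,∞)`. -/
def cutoff (t : ℝ) : ℂ := (Real.smoothTransition (2 - t) : ℝ)

lemma cutoff_one {t : ℝ} (ht : t ≤ 1) : cutoff t = 1 := by
  simp [cutoff, Real.smoothTransition.one_of_one_le (by linarith : 1 ≤ 2 - t)]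

lemma cutoff_zero {t : ℝ} (ht : 2 ≤ t) : cutoff t = 0 := by
  simp [cutoff, Real.smoothTransition.zero_of_nonpos (by linarith : 2 - t ≤ 0)]

lemma contDiff_cutoff : ContDiff ℝ ∞ cutoff := by
  unfold cutoff
  exact ofRealCLM.contDiff.comp
    (Real.smoothTransition.contDiff.comp (contDiff_const.sub contDiff_id))

lemma exists_bound_iteratedDeriv {g : ℝ → ℂ} (hg : ContDiff ℝ ∞ g) (N : ℕ) (a : ℝ) :
    ∃ C : ℝ, 0 ≤ C ∧ ∀ k ≤ N, ∀ t ∈ Icc 0 a, ‖iteratedDeriv k g t‖ ≤ C := by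
  have h : ∀ k, ∃ C : ℝ, ∀ t ∈ Icc 0 a, ‖iteratedDeriv k g t‖ ≤ C := fun k =>
    isCompact_Icc.exists_bound_of_continuousOn
      (hg.continuous_iteratedDeriv k (mod_cast le_top)).continuousOn
  choose C hC using h
  refine ⟨∑ k ∈ Finset.range (N + 1), |C k|, Finset.sum_nonneg fun _ _ => abs_nonneg _,
    fun k hk t ht => (hC k t ht).trans ((le_abs_self _).trans ?_)⟩
  exact Finset.single_le_sum (f := fun k => |C k|) (fun _ _ => abs_nonneg _)
    (Finset.mem_range.2 (by omega))

lemma ContDiff.differentiableAt_iteratedDeriv' {g : ℝ → ℂ} (hg : ContDiff ℝ ∞ g) (k : ℕ) (t : ℝ) :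
    DifferentiableAt ℝ (iteratedDeriv k g) t :=
  (hg.differentiable_iteratedDeriv k (mod_cast WithTop.coe_lt_top _)) t

lemma iteratedDeriv_eq_zero_of_eventuallyEq {g : ℝ → ℂ} {t : ℝ} {c : ℂ} (h : g =ᶠ[𝓝 t] fun _ => c)
    {k : ℕ} (hk : k ≠ 0 ∨ c = 0) : iteratedDeriv k g t = 0 := by
  rw [h.iteratedDeriv_eq, iteratedDeriv_const]
  rcases hk with hk | hk
  · simp [hk]
  · simp [hk]

lemma exists_symBound_cutoff (N : ℕ) : ∃ C > 0,
    SymBound (Ioi 0) N (fun t => C * (Iic 2).indicator 1 t) cutoff ∧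
    SymBound (Ioi 0) N (fun t => C * (Ici 1).indicator 1 t) (fun t => 1 - cutoff t) := by
  obtain ⟨C₁, h₁, hC₁⟩ := exists_bound_iteratedDeriv contDiff_cutoff N 2
  have hs : ContDiff ℝ ∞ fun t => 1 - cutoff t := contDiff_const.sub contDiff_cutoff
  obtain ⟨C₂, h₂, hC₂⟩ := exists_bound_iteratedDeriv hs N 2
  have hpow : ∀ k ≤ N, ∀ t : ℝ, 0 < t → t ≤ 2 → t ^ k ≤ 2 ^ N := fun k hk t h0 h2 =>
    (pow_le_pow_left₀ h0.le h2 k).trans (pow_le_pow_right₀ (by norm_num) hk)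
  have hN : (1 : ℝ) ≤ 2 ^ N := one_le_pow₀ (by norm_num)
  refine ⟨(C₁ + C₂ + 1) * 2 ^ N, by positivity, ?_, ?_⟩
  · refine SymBound.of_iteratedDeriv Subset.rfl
      (fun k _ t _ => contDiff_cutoff.differentiableAt_iteratedDeriv' k t) fun k hk t ht => ?_
    have ht0 : 0 < t := ht
    rcases le_or_gt t 2 with h2 | h2
    · rw [indicator_of_mem (show t ∈ Iic 2 from h2)]
      have := hC₁ k hk t ⟨ht0.le, h2⟩
      simp only [Pi.one_apply, mul_one]
      exact mul_le_mul (by linarith) (hpow k hk t ht0 h2) (by positivity) (by linarith)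
    · rw [indicator_of_notMem (by simpa using h2), iteratedDeriv_eq_zero_of_eventuallyEq
        (c := 0) ?_ (Or.inr rfl)]
      · simp
      · filter_upwards [Ioi_mem_nhds h2] with u hu using cutoff_zero (le_of_lt hu)
  · refine SymBound.of_iteratedDeriv Subset.rfl
      (fun k _ t _ => hs.differentiableAt_iteratedDeriv' k t) fun k hk t ht => ?_
    have ht0 : 0 < t := ht
    rcases lt_or_ge t 1 with h1 | h1
    · rw [indicator_of_notMem (by simpa using h1), iteratedDeriv_eq_zero_of_eventuallyEq
        (c := 0) ?_ (Or.inr rfl)]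
      · simp
      · filter_upwards [Iio_mem_nhds h1] with u hu
        simp [cutoff_one (le_of_lt hu)]
    rw [indicator_of_mem (show t ∈ Ici 1 from h1)]
    simp only [Pi.one_apply, mul_one]
    rcases le_or_gt t 2 with h2 | h2
    · have := hC₂ k hk t ⟨ht0.le, h2⟩
      exact mul_le_mul (by linarith) (hpow k hk t ht0 h2) (by positivity) (by linarith)
    · rcases eq_or_ne k 0 with rfl | hk0
      · simp only [iteratedDeriv_zero, cutoff_zero h2.le]
        simp only [sub_zero, norm_one, pow_zero, mul_one]; nlinarith
      · rw [iteratedDeriv_eq_zero_of_eventuallyEq (c := 1) ?_ (Or.inl hk0)]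
        · simp; positivity
        · filter_upwards [Ioi_mem_nhds h2] with u hu
          simp [cutoff_zero (le_of_lt hu)]

/-- A smooth function vanishing on `(Λ,∞)` is a symbol on `(0,Λ)`, with a weight vanishing at
`Λ`. -/
lemma exists_bound_iteratedDeriv_of_eq_zero {g : ℝ → ℂ} (hg : ContDiff ℝ ∞ g) {Λ : ℝ} (hΛ : 0 < Λ)
    (h0 : ∀ t, Λ < t → g t = 0) (N : ℕ) :
    ∃ C > 0, ∀ k ≤ N, ∀ t ∈ Ioo 0 Λ, ‖iteratedDeriv k g t‖ * t ^ k ≤ C * (Λ - t) := by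
  obtain ⟨C, hC, hb⟩ := exists_bound_iteratedDeriv hg (N + 1) Λ
  refine ⟨C * (1 + Λ) ^ N + 1, by positivity, fun k hk t ht => ?_⟩
  have hz : iteratedDeriv k g Λ = 0 := by
    have h1 : Tendsto (iteratedDeriv k g) (𝓝[>] Λ) (𝓝 (iteratedDeriv k g Λ)) :=
      ((hg.continuous_iteratedDeriv k (mod_cast le_top)).tendsto Λ).mono_left nhdsWithin_le_nhds
    refine tendsto_nhds_unique h1 (tendsto_const_nhds.congr' ?_)
    filter_upwards [self_mem_nhdsWithin] with u hu
    rw [iteratedDeriv_eq_zero_of_eventuallyEq (c := 0) ?_ (Or.inr rfl)]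
    filter_upwards [Ioi_mem_nhds hu] with v hv using h0 v hv
  have h2 := (convex_Icc 0 Λ).norm_image_sub_le_of_norm_deriv_le
    (f := iteratedDeriv k g) (C := C) (fun u _ => hg.differentiableAt_iteratedDeriv' k u)
    (fun u hu => by rw [← iteratedDeriv_succ]; exact hb (k + 1) (by omega) u hu)
    (right_mem_Icc.2 hΛ.le) ⟨ht.1.le, ht.2.le⟩
  rw [hz, sub_zero, norm_eq_abs, abs_sub_comm, abs_of_pos (sub_pos.2 ht.2)] at h2
  have h3 : t ^ k ≤ (1 + Λ) ^ N :=
    (pow_le_pow_left₀ ht.1.le (by linarith [ht.2]) k).trans (pow_le_pow_right₀ (by linarith) hk)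
  have h4 : 0 < Λ - t := sub_pos.2 ht.2
  have h5 : 0 ≤ t ^ k := pow_nonneg ht.1.le k
  calc _ ≤ (C * (Λ - t)) * (1 + Λ) ^ N := by gcongr
    _ ≤ _ := by nlinarith

/-! ### Oscillatory integrals -/

lemma SymBound.continuousOn {s : Set ℝ} {N : ℕ} {β : ℝ → ℝ} {b : ℝ → ℂ}
    (h : SymBound s (N + 1) β b) : ContinuousOn b s :=
  fun t ht => (h.2.1 t ht).continuousAt.continuousWithinAt

lemma SymBound.tendsto_zero {s : Set ℝ} {N : ℕ} {β : ℝ → ℝ} {b : ℝ → ℂ} (h : SymBound s N β b)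
    {l : Filter ℝ} (hs : s ∈ l) (hβ : Tendsto β l (𝓝 0)) : Tendsto b l (𝓝 0) := by
  refine squeeze_zero_norm' ?_ hβ
  filter_upwards [hs] with t ht using h.norm_le ht

lemma integrableOn_Ioo_of_bounded {f : ℝ → ℂ} {a c M : ℝ}
    (hf : AEStronglyMeasurable f (volume.restrict (Ioo a c)))
    (hM : ∀ᵐ t ∂(volume.restrict (Ioo a c)), ‖f t‖ ≤ M) : IntegrableOn f (Ioo a c) :=
  Integrable.mono' (g := fun _ => M) (integrable_const M) hf hM

lemma integral_mul_deriv_eq_neg_of_tendsto {Λ : ℝ} (hΛ : 0 < Λ) {f f' u u' : ℝ → ℂ}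
    (hf : ∀ t ∈ Ioo 0 Λ, HasDerivAt f (f' t) t) (hu : ∀ t ∈ Ioo 0 Λ, HasDerivAt u (u' t) t)
    (h1 : IntegrableOn (fun t => f' t * u t) (Ioo 0 Λ))
    (h2 : IntegrableOn (fun t => f t * u' t) (Ioo 0 Λ))
    (h0 : Tendsto (fun t => f t * u t) (𝓝[>] 0) (𝓝 0))
    (hΛ0 : Tendsto (fun t => f t * u t) (𝓝[<] Λ) (𝓝 0)) :
    ∫ t in Ioo 0 Λ, f t * u' t = -∫ t in Ioo 0 Λ, f' t * u t := by
  have h := intervalIntegral.integral_eq_sub_of_hasDerivAt_of_tendsto hΛ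
    (f := fun t => f t * u t) (f' := fun t => f' t * u t + f t * u' t)
    (fun t ht => (hf t ht).mul (hu t ht))
    ((intervalIntegrable_iff_integrableOn_Ioo_of_le hΛ.le).2 (h1.add h2)) h0 hΛ0
  rw [intervalIntegral.integral_of_le hΛ.le, integral_Ioc_eq_integral_Ioo,
    integral_add h1 h2, sub_zero] at h
  linear_combination h

lemma norm_integral_exp_mul_le_of_vanish {Λ : ℝ} (hΛ : 0 < Λ) {N : ℕ} {D : ℝ} (hD : D ≠ 0)
    {β : ℝ → ℝ} {b : ℝ → ℂ} (h : SymBound (Ioo 0 Λ) N β b) (hβ0 : ∀ᶠ t in 𝓝[>] 0, β t = 0)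
    (hβΛ : Tendsto β (𝓝[<] Λ) (𝓝 0)) (hM : ∃ M, ∀ t ∈ Ioo 0 Λ, β t ≤ M) :
    ‖∫ t in Ioo 0 Λ, cexp (I * (t * D : ℝ)) * b t‖ₑ ≤
      ofReal ((|D| ^ N)⁻¹) * ∫⁻ t in Ioo 0 Λ, ofReal (β t / t ^ N) := by
  have hnorm : ∀ t : ℝ, ‖cexp (I * (t * D : ℝ))‖ = 1 := fun t => by
    rw [mul_comm, norm_exp_ofReal_mul_I]
  induction N generalizing β b with
  | zero =>
    simp only [pow_zero, inv_one, ENNReal.ofReal_one, one_mul, div_one]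
    refine (enorm_integral_le_lintegral_enorm _).trans (setLIntegral_mono' measurableSet_Ioo
      fun t ht => ?_)
    rw [← ofReal_norm, norm_mul, hnorm, one_mul]
    exact ofReal_le_ofReal (h t ht)
  | succ N ih =>
    obtain ⟨M, hM⟩ := hM
    obtain ⟨δ, hδ, hδ0⟩ : ∃ δ > 0, ∀ t, 0 < t → t < δ → β t = 0 := by
      rw [eventually_nhdsWithin_iff, Metric.eventually_nhds_iff] at hβ0
      obtain ⟨δ, hδ, h0⟩ := hβ0
      refine ⟨δ, hδ, fun t h1 h2 => h0 ?_ h1⟩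
      rwa [Real.dist_eq, sub_zero, abs_of_pos h1]
    have hM0 : ∀ t ∈ Ioo 0 Λ, β t / t ≤ |M| / δ := by
      intro t ht
      rcases lt_or_ge t δ with h1 | h1
      · rw [hδ0 t ht.1 h1]; simp; positivity
      · have h2 := hM t ht
        have h3 : β t ≤ |M| := h2.trans (le_abs_self M)
        calc β t / t ≤ |M| / t := by have := ht.1; gcongr
          _ ≤ |M| / δ := by gcongr
    have hI := ih h.2.2 (by filter_upwards [hβ0] with t ht; simp [ht])
      (by
        rw [← zero_div Λ]
        exact hβΛ.div (tendsto_id.mono_left nhdsWithin_le_nhds) hΛ.ne') ⟨_, hM0⟩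
    have hc : I * (D : ℂ) ≠ 0 := by simp [hD]
    set e : ℝ → ℂ := fun t => cexp (I * (t * D : ℝ)) with he
    have hde : ∀ t, HasDerivAt (fun t => e t * (I * D)⁻¹) (e t) t := fun t => by
      have h1 : HasDerivAt (fun t => I * (t * D : ℝ)) (I * D) t := by
        simpa using (((hasDerivAt_id t).mul_const D).ofReal_comp).const_mul I
      exact (h1.cexp.mul_const (I * (D : ℂ))⁻¹).congr_deriv (mul_inv_cancel_right₀ hc _)
    have hec : Continuous e := by fun_prop
    have hint : ∀ (g : ℝ → ℂ) (M : ℝ), AEStronglyMeasurable g (volume.restrict (Ioo 0 Λ)) →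
        (∀ t ∈ Ioo 0 Λ, ‖g t‖ ≤ M) → IntegrableOn (fun t => g t * e t) (Ioo 0 Λ) := by
      intro g M hg hM
      refine integrableOn_Ioo_of_bounded (M := M) (hg.mul hec.aestronglyMeasurable) ?_
      filter_upwards [ae_mem_Ioo] with t ht
      rw [norm_mul, hnorm, mul_one]
      exact hM t ht
    have hint' := hint (deriv b) _ (measurable_deriv b).aestronglyMeasurable fun t ht =>
      (h.2.2.norm_le ht).trans (hM0 t ht)
    have hlim : ∀ l : Filter ℝ, Tendsto b l (𝓝 0) →
        Tendsto (fun t => b t * (e t * (I * D)⁻¹)) l (𝓝 0) := by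
      intro l hl
      rw [tendsto_zero_iff_norm_tendsto_zero] at hl ⊢
      simpa only [norm_mul, e, hnorm, one_mul, zero_mul] using hl.mul_const ‖(I * (D : ℂ))⁻¹‖
    have h2 := integral_mul_deriv_eq_neg_of_tendsto hΛ (fun t ht => (h.2.1 t ht).hasDerivAt)
      (fun t _ => hde t) (by simpa only [mul_assoc, IntegrableOn] using hint'.mul_const (I * (D : ℂ))⁻¹)
      (hint b M (h.continuousOn.aestronglyMeasurable measurableSet_Ioo) fun t ht =>
        (h.norm_le ht).trans (hM t ht))
      (hlim _ (h.tendsto_zero (Ioo_mem_nhdsGT hΛ)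
        (tendsto_const_nhds.congr' (by filter_upwards [hβ0] with t ht using ht.symm))))
      (hlim _ (h.tendsto_zero (Ioo_mem_nhdsLT hΛ) hβΛ))
    simp only [← mul_assoc, integral_mul_const, mul_comm _ (e _)] at h2
    rw [h2, enorm_neg, mul_comm, enorm_mul, ← ofReal_norm (I * (D : ℂ))⁻¹]
    have h3 : ‖(I * (D : ℂ))⁻¹‖ = |D|⁻¹ := by simp
    rw [h3]
    calc _ ≤ ofReal |D|⁻¹ * (ofReal ((|D| ^ N)⁻¹) *
          ∫⁻ t in Ioo 0 Λ, ofReal (β t / t / t ^ N)) := by gcongr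
      _ = _ := by
        rw [← mul_assoc, ← ofReal_mul (by positivity)]; congr 2
        · ring_nf
        · ring_nf

/-- The oscillatory integral of a symbol is controlled by the integral of its weight times
`(1+t|D|)^{-N}`. -/
lemma exists_norm_integral_exp_mul_le (N : ℕ) : ∃ C > 0, ∀ (Λ : ℝ), 0 < Λ →
    ∀ (D : ℝ) (β : ℝ → ℝ) (b : ℝ → ℂ), SymBound (Ioo 0 Λ) N β b →
    Tendsto β (𝓝[<] Λ) (𝓝 0) → (∃ M, ∀ t ∈ Ioo 0 Λ, β t ≤ M) →
    ‖∫ t in Ioo 0 Λ, cexp (I * (t * D : ℝ)) * b t‖ₑ ≤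
      ofReal C * ∫⁻ t in Ioo 0 Λ, ofReal (β t * ((1 + t * |D|) ^ N)⁻¹) := by
  obtain ⟨c, hc, hcut, hcut'⟩ := exists_symBound_cutoff N
  have hnorm : ∀ t D : ℝ, ‖cexp (I * (t * D : ℝ))‖ = 1 := fun t D => by
    rw [mul_comm, norm_exp_ofReal_mul_I]
  refine ⟨1 + c * 3 ^ N + 4 ^ N * c, by positivity, fun Λ hΛ D β b h hβΛ hM => ?_⟩
  have htriv : ‖∫ t in Ioo 0 Λ, cexp (I * (t * D : ℝ)) * b t‖ₑ ≤ ∫⁻ t in Ioo 0 Λ, ofReal (β t) := by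
    refine (enorm_integral_le_lintegral_enorm _).trans (setLIntegral_mono' measurableSet_Ioo
      fun t ht => ?_)
    rw [← ofReal_norm, norm_mul, hnorm, one_mul]
    exact ofReal_le_ofReal (h.norm_le ht)
  have hβn : ∀ t ∈ Ioo 0 Λ, 0 ≤ β t := fun t ht => (norm_nonneg _).trans (h.norm_le ht)
  have hC1 : (1 : ℝ) ≤ 1 + c * 3 ^ N + 4 ^ N * c := by
    have : 0 ≤ c * 3 ^ N + 4 ^ N * c := by positivity
    linarith
  rcases eq_or_ne D 0 with rfl | hD
  · refine htriv.trans ?_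
    simp only [abs_zero, mul_zero, add_zero, one_pow, inv_one, mul_one]
    exact le_mul_of_one_le_left zero_le (by simpa using hC1)
  rcases Nat.eq_zero_or_pos N with rfl | hN
  · refine htriv.trans ?_
    simp only [pow_zero, inv_one, mul_one]
    exact le_mul_of_one_le_left zero_le (by simpa using hC1)
  obtain ⟨N, rfl⟩ : ∃ k, N = k + 1 := ⟨N - 1, by omega⟩
  obtain ⟨M, hM⟩ := hM
  have hD' : 0 < |D| := abs_pos.2 hD
  have hsub : Ioo 0 Λ ⊆ Ioi 0 := Ioo_subset_Ioi_self
  have h1 := ((hcut.comp_mul hD').mono (β' := fun t => c * (Iic 2).indicator 1 (t * |D|))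
    hsub hsub fun t _ => le_rfl).mul isOpen_Ioo hsub h
  have h2 := ((hcut'.comp_mul hD').mono (β' := fun t => c * (Ici 1).indicator 1 (t * |D|))
    hsub hsub fun t _ => le_rfl).mul isOpen_Ioo hsub h
  have hcc : Continuous cutoff := contDiff_cutoff.continuous
  have hw : ∀ s : Set ℝ, ∀ t ∈ Ioo 0 Λ, 0 ≤ 2 ^ (N + 1) * (c * s.indicator 1 (t * |D|) * β t) ∧
      2 ^ (N + 1) * (c * s.indicator 1 (t * |D|) * β t) ≤ 2 ^ (N + 1) * (c * β t) := by
    intro s t ht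
    have := hβn t ht
    have h3 : 0 ≤ s.indicator (1 : ℝ → ℝ) (t * |D|) := indicator_nonneg (fun _ _ => zero_le_one) _
    have h4 : s.indicator (1 : ℝ → ℝ) (t * |D|) ≤ 1 :=
      indicator_le_self' (fun _ _ => zero_le_one) _
    refine ⟨by positivity, ?_⟩
    gcongr; nlinarith
  have hbb : IntegrableOn b (Ioo 0 Λ) := by
    refine integrableOn_Ioo_of_bounded (M := M)
      (h.continuousOn.aestronglyMeasurable measurableSet_Ioo) ?_
    filter_upwards [ae_mem_Ioo] with t ht
    exact (h.1 t ht).trans (hM t ht)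
  have hint1 : IntegrableOn (fun t => cexp (I * (t * D : ℝ)) *
      (cutoff (t * |D|) * b t)) (Ioo 0 Λ) := by
    refine integrableOn_Ioo_of_bounded (M := 2 ^ (N + 1) * (c * M)) ?_ ?_
    · exact (Continuous.aestronglyMeasurable (by fun_prop)).mul
        ((Continuous.aestronglyMeasurable (by fun_prop)).mul hbb.aestronglyMeasurable)
    · filter_upwards [ae_mem_Ioo] with t ht
      rw [norm_mul, hnorm, one_mul]
      exact (h1.norm_le ht).trans ((hw _ t ht).2.trans (by have := hM t ht; gcongr))
  have hint0 : IntegrableOn (fun t => cexp (I * (t * D : ℝ)) * b t) (Ioo 0 Λ) := by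
    refine hbb.bdd_mul (c := 1) (Continuous.aestronglyMeasurable (by fun_prop)) ?_
    filter_upwards with t
    rw [hnorm]
  have hint2 : IntegrableOn (fun t => cexp (I * (t * D : ℝ)) *
      ((1 - cutoff (t * |D|)) * b t)) (Ioo 0 Λ) := by
    refine (hint0.sub hint1).congr ?_
    filter_upwards with t
    simp only [Pi.sub_apply]; ring
  have hsplit : ∫ t in Ioo 0 Λ, cexp (I * (t * D : ℝ)) * b t =
      (∫ t in Ioo 0 Λ, cexp (I * (t * D : ℝ)) * (cutoff (t * |D|) * b t)) +
      ∫ t in Ioo 0 Λ, cexp (I * (t * D : ℝ)) * ((1 - cutoff (t * |D|)) * b t) := by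
    rw [← integral_add hint1 hint2]
    congr 1; ext t; ring
  rw [hsplit]
  refine (enorm_add_le _ _).trans ?_
  have e1 : ‖∫ t in Ioo 0 Λ, cexp (I * (t * D : ℝ)) * (cutoff (t * |D|) * b t)‖ₑ ≤
      ofReal (c * 3 ^ (N + 1)) * ∫⁻ t in Ioo 0 Λ, ofReal (β t * ((1 + t * |D|) ^ (N + 1))⁻¹) := by
    rw [← lintegral_const_mul' _ _ ofReal_ne_top]
    refine (enorm_integral_le_lintegral_enorm _).trans (setLIntegral_mono' measurableSet_Ioo
      fun t ht => ?_)
    rw [← ofReal_norm, norm_mul, hnorm, one_mul, ← ofReal_mul (by positivity), norm_mul]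
    apply ofReal_le_ofReal
    have h3 := hcut.norm_le (mul_pos ht.1 hD')
    have h4 := h.norm_le ht
    have h5 := hβn t ht
    have h7 : 0 < t * |D| := mul_pos ht.1 hD'
    rcases le_or_gt (t * |D|) 2 with h6 | h6
    · rw [indicator_of_mem (show t * |D| ∈ Iic 2 from h6)] at h3
      simp only [Pi.one_apply, mul_one] at h3
      have h8 : (1 + t * |D|) ^ (N + 1) ≤ 3 ^ (N + 1) :=
        pow_le_pow_left₀ (by positivity) (by linarith) _
      have h9 : (1 : ℝ) ≤ 3 ^ (N + 1) * ((1 + t * |D|) ^ (N + 1))⁻¹ := by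
        rw [← div_eq_mul_inv, le_div_iff₀ (by positivity)]; linarith
      calc _ ≤ c * β t := by gcongr
        _ ≤ c * β t * (3 ^ (N + 1) * ((1 + t * |D|) ^ (N + 1))⁻¹) :=
          le_mul_of_one_le_right (by positivity) h9
        _ = _ := by ring
    · rw [cutoff_zero h6.le]
      simp only [norm_zero, zero_mul]; positivity
  have e2 : ‖∫ t in Ioo 0 Λ, cexp (I * (t * D : ℝ)) *
      ((1 - cutoff (t * |D|)) * b t)‖ₑ ≤ ofReal (4 ^ (N + 1) * c) *
        ∫⁻ t in Ioo 0 Λ, ofReal (β t * ((1 + t * |D|) ^ (N + 1))⁻¹) := by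
    refine (norm_integral_exp_mul_le_of_vanish hΛ hD h2 ?_ ?_ ?_).trans ?_
    · have : Iio (|D|⁻¹) ∈ 𝓝[>] (0 : ℝ) := mem_nhdsWithin_of_mem_nhds (Iio_mem_nhds (by positivity))
      filter_upwards [this, self_mem_nhdsWithin] with t ht ht0
      have : t * |D| < 1 := by
        have h3 : t < |D|⁻¹ := ht
        rwa [← one_div, lt_div_iff₀ hD'] at h3
      rw [indicator_of_notMem (by simpa using this)]; simp
    · have h3 : Tendsto (fun t => 2 ^ (N + 1) * (c * β t)) (𝓝[<] Λ) (𝓝 0) := by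
        simpa using (hβΛ.const_mul c).const_mul (2 ^ (N + 1))
      refine squeeze_zero' ?_ ?_ h3
      · filter_upwards [Ioo_mem_nhdsLT hΛ] with t ht using (hw _ t ht).1
      · filter_upwards [Ioo_mem_nhdsLT hΛ] with t ht using (hw _ t ht).2
    · exact ⟨2 ^ (N + 1) * (c * M), fun t ht => (hw _ t ht).2.trans (by have := hM t ht; gcongr)⟩
    · rw [← lintegral_const_mul' _ _ ofReal_ne_top, ← lintegral_const_mul' _ _ ofReal_ne_top]
      refine setLIntegral_mono' measurableSet_Ioo fun t ht => ?_
      have h5 := hβn t ht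
      have h7 : 0 < t * |D| := mul_pos ht.1 hD'
      rw [← ofReal_mul (by positivity), ← ofReal_mul (by positivity)]
      apply ofReal_le_ofReal
      rcases lt_or_ge (t * |D|) 1 with h6 | h6
      · rw [indicator_of_notMem (by simpa using h6)]
        simp only [mul_zero, zero_mul, zero_div]; positivity
      · rw [indicator_of_mem (show t * |D| ∈ Ici 1 from h6)]
        have ht0 := ht.1
        have h8 : (1 + t * |D|) ^ (N + 1) ≤ (2 * (t * |D|)) ^ (N + 1) :=
          pow_le_pow_left₀ (by positivity) (by linarith) _
        have h9 : ((t * |D|) ^ (N + 1))⁻¹ ≤ 2 ^ (N + 1) * ((1 + t * |D|) ^ (N + 1))⁻¹ := by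
          rw [← div_eq_mul_inv, le_div_iff₀ (by positivity), inv_mul_le_iff₀ (by positivity)]
          rw [mul_pow] at h8; linarith
        calc _ = 2 ^ (N + 1) * c * β t * ((t * |D|) ^ (N + 1))⁻¹ := by
              simp only [Pi.one_apply]; rw [mul_pow]; field_simp
          _ ≤ 2 ^ (N + 1) * c * β t * (2 ^ (N + 1) * ((1 + t * |D|) ^ (N + 1))⁻¹) := by gcongr
          _ = _ := by
            rw [show (4 : ℝ) ^ (N + 1) = 2 ^ (N + 1) * 2 ^ (N + 1) by rw [← mul_pow]; norm_num]
            ring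
  refine (add_le_add e1 e2).trans ?_
  rw [← add_mul, ← ofReal_add (by positivity) (by positivity)]; gcongr; linarith

/-! ### Holomorphic parameter integrals -/

/-- Parameter integrals of holomorphic functions, dominated locally uniformly, are holomorphic. -/
lemma differentiableOn_integral_of_dominated {X : Type*} [MeasurableSpace X] {μ : Measure X}
    {F : ℂ → X → ℂ} {U : Set ℂ} (hU : IsOpen U)
    (hmeas : ∀ w ∈ U, AEStronglyMeasurable (F w) μ)
    (hF : ∀ᵐ x ∂μ, DifferentiableOn ℂ (fun w => F w x) U)
    (hb : ∀ w ∈ U, ∃ ε > 0, ∃ g : X → ℝ, Integrable g μ ∧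
      ∀ᵐ x ∂μ, ∀ w' ∈ Metric.ball w ε, w' ∈ U → ‖F w' x‖ ≤ g x) :
    DifferentiableOn ℂ (fun w => ∫ x, F w x ∂μ) U := by
  intro w hw
  obtain ⟨ε₁, hε₁, g, hg, hgb⟩ := hb w hw
  obtain ⟨ε₂, hε₂, hsub⟩ := Metric.isOpen_iff.1 hU w hw
  set ε := min ε₁ ε₂ / 2 with hε
  have hε0 : 0 < ε := by positivity
  have hlt1 : 2 * ε ≤ ε₁ := by grind
  have hlt2 : 2 * ε ≤ ε₂ := by grind
  have hsub' : Metric.ball w (2 * ε) ⊆ U := (Metric.ball_subset_ball hlt2).trans hsub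
  have hdiff : ∀ᵐ x ∂μ, ∀ v ∈ Metric.ball w ε,
      HasDerivAt (fun w => F w x) (deriv (fun w => F w x) v) v := by
    filter_upwards [hF] with x hx v hv
    have : v ∈ U := hsub' (Metric.ball_subset_ball (by linarith) hv)
    exact (hx.differentiableAt (hU.mem_nhds this)).hasDerivAt
  have hbound : ∀ᵐ x ∂μ, ∀ v ∈ Metric.ball w ε, ‖deriv (fun w => F w x) v‖ ≤ g x / (ε / 2) := by
    filter_upwards [hF, hgb] with x hx hgx v hv
    have hvs : Metric.closedBall v (ε / 2) ⊆ Metric.ball w (2 * ε) := by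
      intro u hu
      rw [Metric.mem_ball] at hv ⊢
      rw [Metric.mem_closedBall] at hu
      linarith [dist_triangle u v w]
    refine Complex.norm_deriv_le_of_forall_mem_sphere_norm_le (by positivity)
      ((hx.mono (hvs.trans hsub')).diffContOnCl_ball Subset.rfl) fun u hu => ?_
    have hu' := hvs (Metric.sphere_subset_closedBall hu)
    exact hgx u (Metric.ball_subset_ball hlt1 hu') (hsub' hu')
  have hint : Integrable (F w) μ := by
    refine hg.mono' (hmeas w hw) ?_
    filter_upwards [hgb] with x hx using hx w (Metric.mem_ball_self hε₁) hw
  have hmeas' : AEStronglyMeasurable (fun x => deriv (fun w => F w x) w) μ := by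
    have hseq : Tendsto (fun n : ℕ => ε / ((n : ℝ) + 2)) atTop (𝓝 0) := tendsto_const_nhds.div_atTop
        (tendsto_natCast_atTop_atTop.atTop_add tendsto_const_nhds)
    have hpos : ∀ n : ℕ, 0 < ε / ((n : ℝ) + 2) := fun n => by positivity
    refine aestronglyMeasurable_of_tendsto_ae atTop (f := fun n : ℕ => fun x =>
      (((ε / ((n : ℝ) + 2) : ℝ) : ℂ))⁻¹ • (F (w + ((ε / ((n : ℝ) + 2) : ℝ) : ℂ)) x - F w x))
      (fun n => ?_) ?_
    · have hball : w + ((ε / ((n : ℝ) + 2) : ℝ) : ℂ) ∈ Metric.ball w (2 * ε) := ?_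
      · exact ((hmeas _ (hsub' hball)).sub (hmeas w hw)).const_smul (((ε / ((n : ℝ) + 2) : ℝ) : ℂ))⁻¹
      rw [Metric.mem_ball, dist_eq_norm, add_sub_cancel_left, norm_of_nonneg (hpos n).le,
        div_lt_iff₀ (by positivity)]
      nlinarith [(Nat.cast_nonneg n : 0 ≤ n)]
    · filter_upwards [hdiff] with x hx
      have h1 := (hx w (Metric.mem_ball_self hε0)).tendsto_slope_zero
      refine h1.comp (tendsto_nhdsWithin_iff.2 ⟨?_, Eventually.of_forall fun n => ?_⟩)
      · have := (continuous_ofReal.tendsto 0).comp hseq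
        rwa [ofReal_zero] at this
      · exact Complex.ofReal_ne_zero.2 (hpos n).ne'
  refine ((hasDerivAt_integral_of_dominated_loc_of_deriv_le (𝕜 := ℂ) (F := F) (x₀ := w)
    (s := Metric.ball w ε) (bound := fun x => g x / (ε / 2))
    (F' := fun v x => deriv (fun w => F w x) v) (Metric.ball_mem_nhds w hε0) ?_ hint hmeas' hbound
    (hg.div_const _) hdiff).2).differentiableAt.differentiableWithinAt
  filter_upwards [hU.mem_nhds hw] with v hv using hmeas v hv

/-- Holomorphic functions which agree on the positive reals agree. -/
lemma eqOn_of_eq_on_pos {f g : ℂ → ℂ} {U : Set ℂ} (hU : IsOpen U) (hc : IsPreconnected U)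
    (h1 : (1 : ℂ) ∈ U) (hf : DifferentiableOn ℂ f U) (hg : DifferentiableOn ℂ g U)
    (h : ∀ t : ℝ, 0 < t → f t = g t) : EqOn f g U := by
  refine (hf.analyticOnNhd hU).eqOn_of_preconnected_of_frequently_eq (hg.analyticOnNhd hU) hc h1 ?_
  have h2 : Tendsto (fun t : ℝ => (t : ℂ)) (𝓝[≠] 1) (𝓝[≠] 1) := by
    refine tendsto_nhdsWithin_iff.2 ⟨?_, ?_⟩
    · have := continuous_ofReal.tendsto 1
      simp only [ofReal_one] at this
      exact this.mono_left nhdsWithin_le_nhds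
    · filter_upwards [self_mem_nhdsWithin] with t ht
      simpa using ht
  refine h2.frequently (Eventually.frequently ?_)
  filter_upwards [mem_nhdsWithin_of_mem_nhds (Ioi_mem_nhds (zero_lt_one (α := ℝ)))] with t ht
  exact h t ht

lemma ofReal_mul_cpow {r : ℝ} (hr : 0 < r) {z : ℂ} (hz : z ≠ 0) (s : ℂ) :
    ((r : ℂ) * z) ^ s = (r : ℂ) ^ s * z ^ s := by
  have hr' : (r : ℂ) ≠ 0 := mod_cast hr.ne'
  rw [cpow_def_of_ne_zero (mul_ne_zero hr' hz), Complex.log_ofReal_mul hr hz,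
    Complex.ofReal_log hr.le, add_mul, exp_add, ← cpow_def_of_ne_zero hr',
    ← cpow_def_of_ne_zero hz]

lemma ofReal_mul_cpow_ofReal {r : ℝ} (hr : 0 < r) {z : ℂ} (hz : z ≠ 0) (s : ℝ) :
    ((r : ℂ) * z) ^ (s : ℂ) = (r ^ s : ℝ) * z ^ (s : ℂ) := by
  rw [ofReal_mul_cpow hr hz, ofReal_cpow hr.le]

/-- Powers are dominated by exponentials. -/
lemma exists_rpow_le_exp (a : ℝ) {δ : ℝ} (hδ : 0 < δ) :
    ∃ C > 0, ∀ u : ℝ, 0 ≤ u → (1 + u) ^ a ≤ C * rexp (δ * u) := by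
  set b := max a 1 with hb
  have hb0 : 0 < b := lt_of_lt_of_le one_pos (le_max_right _ _)
  set m := max 1 (b / δ) with hm
  have hm0 : 0 < m := lt_of_lt_of_le one_pos (le_max_left _ _)
  refine ⟨m ^ b, by positivity, fun u hu => ?_⟩
  have h1 : (1 + u) ^ a ≤ (1 + u) ^ b :=
    Real.rpow_le_rpow_of_exponent_le (by linarith) (le_max_left _ _)
  have h2 : 1 + u ≤ m * rexp (δ / b * u) := by
    have h3 := Real.add_one_le_exp (δ / b * u)
    have h4 : 1 ≤ m := le_max_left _ _
    have h5 : b / δ ≤ m := le_max_right _ _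
    have h6 : u ≤ m * (δ / b * u) := by
      calc u = (b / δ) * (δ / b * u) := by field_simp
        _ ≤ _ := by gcongr
    nlinarith
  calc (1 + u) ^ a ≤ (1 + u) ^ b := h1
    _ ≤ (m * rexp (δ / b * u)) ^ b := by gcongr
    _ = m ^ b * rexp (δ * u) := by
      rw [mul_rpow hm0.le (exp_pos _).le, ← Real.exp_mul]
      congr 2; field_simp

lemma integrableOn_rpow_mul_exp (a : ℝ) {δ : ℝ} (hδ : 0 < δ) :
    IntegrableOn (fun u => (1 + u) ^ a * rexp (-δ * u)) (Ioi 0) := by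
  obtain ⟨C, hC, h⟩ := exists_rpow_le_exp a (half_pos hδ)
  refine Integrable.mono' ((exp_neg_integrableOn_Ioi 0 (half_pos hδ)).const_mul C) ?_ ?_
  · fun_prop
  · filter_upwards [ae_mem_Ioi] with u hu
    have hu0 : 0 < u := hu
    rw [Real.norm_of_nonneg (by positivity)]
    calc _ ≤ C * rexp (δ / 2 * u) * rexp (-δ * u) := by bound
      _ = _ := by rw [mul_assoc, ← Real.exp_add]; ring_nf

/-! ### Macdonald functions -/

/-- `∫₀^∞ e^{-u} (u(u+2w))^p du`. -/
def macF (p : ℝ) (w : ℂ) : ℂ :=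
  ∫ u in Ioi 0, (rexp (-u) : ℂ) * ((u : ℂ) * (u + 2 * w)) ^ (p : ℂ)

/-- `e^{-w} ∫₀^∞ e^{-u} (u(u+2w))^p du`, which is a multiple of `w^{p+1/2} K_{p+1/2}(w)`. -/
def mac (p : ℝ) (w : ℂ) : ℂ := cexp (-w) * macF p w

/-- The constant in the bound of `macF`. -/
def macConst (p : ℝ) : ℝ := ∫ u in Ioi 0, (1 + u) ^ (2 * p) * rexp (-1 * u)

lemma macConst_nonneg (p : ℝ) : 0 ≤ macConst p :=
  setIntegral_nonneg measurableSet_Ioi fun u hu => by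
    have : 0 < u := hu; positivity

lemma ofReal_add_mem_slitPlane {u : ℝ} (hu : 0 ≤ u) {w : ℂ} (hw : w ∈ slitPlane) :
    (u : ℂ) + 2 * w ∈ slitPlane := by
  rw [mem_slitPlane_iff] at hw ⊢
  rcases hw with h | h
  · left; simp; linarith
  · right; simpa using h

lemma ofReal_mul_add_mem_slitPlane {u : ℝ} (hu : 0 < u) {w : ℂ} (hw : w ∈ slitPlane) :
    (u : ℂ) * (u + 2 * w) ∈ slitPlane := by
  have h := ofReal_add_mem_slitPlane hu.le hw
  rw [mem_slitPlane_iff] at h ⊢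
  rcases h with h | h
  · simp_all
  · aesop

lemma norm_macF_integrand_le {p : ℝ} (hp : 0 ≤ p) (w : ℂ) {u : ℝ} (hu : 0 < u) :
    ‖(rexp (-u) : ℂ) * ((u : ℂ) * (u + 2 * w)) ^ (p : ℂ)‖ ≤
      (1 + 2 * ‖w‖) ^ p * ((1 + u) ^ (2 * p) * rexp (-1 * u)) := by
  rw [norm_mul, norm_cpow_real, norm_mul, norm_of_nonneg (exp_pos _).le, norm_of_nonneg hu.le]
  have h1 : ‖(u : ℂ) + 2 * w‖ ≤ u + 2 * ‖w‖ := by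
    refine (norm_add_le _ _).trans ?_
    rw [norm_of_nonneg hu.le, norm_mul]; simp
  have h2 : u * ‖(u : ℂ) + 2 * w‖ ≤ (1 + 2 * ‖w‖) * ((1 + u) * (1 + u)) := by
    have := norm_nonneg w
    calc _ ≤ u * (u + 2 * ‖w‖) := by gcongr
      _ ≤ (1 + u) * ((1 + 2 * ‖w‖) * (1 + u)) := by gcongr <;> nlinarith
      _ = _ := by ring
  have h3 : (u * ‖(u : ℂ) + 2 * w‖) ^ p ≤ (1 + 2 * ‖w‖) ^ p * (1 + u) ^ (2 * p) := by
    calc _ ≤ ((1 + 2 * ‖w‖) * ((1 + u) * (1 + u))) ^ p := by gcongr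
      _ = _ := by
        rw [mul_rpow (by positivity) (by positivity), mul_rpow (by positivity)
          (by positivity), ← rpow_add (by positivity), ← two_mul p]
  calc _ ≤ rexp (-u) * ((1 + 2 * ‖w‖) ^ p * (1 + u) ^ (2 * p)) := by gcongr
    _ = _ := by ring_nf

lemma continuousOn_macF_integrand (p : ℝ) {w : ℂ} (hw : w ∈ slitPlane) :
    ContinuousOn (fun u => (rexp (-u) : ℂ) * ((u : ℂ) * (u + 2 * w)) ^ (p : ℂ)) (Ioi 0) := by
  refine ContinuousOn.mul (by fun_prop) (ContinuousOn.cpow_const (by fun_prop) fun u hu => ?_)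
  exact ofReal_mul_add_mem_slitPlane hu hw

lemma norm_macF_le {p : ℝ} (hp : 0 ≤ p) (w : ℂ) : ‖macF p w‖ ≤ macConst p * (1 + 2 * ‖w‖) ^ p := by
  rw [mul_comm, macConst, ← integral_const_mul]
  refine norm_integral_le_of_norm_le ((integrableOn_rpow_mul_exp (2 * p) one_pos).const_mul _) ?_
  filter_upwards [ae_mem_Ioi] with u hu using norm_macF_integrand_le hp w hu

lemma norm_mac_le {p : ℝ} (hp : 0 ≤ p) (w : ℂ) :
    ‖mac p w‖ ≤ macConst p * (1 + 2 * ‖w‖) ^ p * rexp (-w.re) := by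
  rw [mac, norm_mul, norm_exp, neg_re, mul_comm]
  have := norm_macF_le hp w; gcongr

lemma differentiableOn_macF {p : ℝ} (hp : 0 ≤ p) : DifferentiableOn ℂ (macF p) slitPlane := by
  refine differentiableOn_integral_of_dominated Complex.isOpen_slitPlane
    (fun w hw => (continuousOn_macF_integrand p hw).aestronglyMeasurable measurableSet_Ioi) ?_ ?_
  · filter_upwards [ae_mem_Ioi] with u hu w hw
    refine DifferentiableAt.differentiableWithinAt ?_
    have h1 : DifferentiableAt ℂ (fun w : ℂ => (u : ℂ) * (u + 2 * w)) w := by fun_prop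
    exact (h1.cpow_const (ofReal_mul_add_mem_slitPlane hu hw)).const_mul _
  · intro w hw
    refine ⟨1, one_pos, _, (integrableOn_rpow_mul_exp (2 * p) one_pos).const_mul
      ((1 + 2 * (‖w‖ + 1)) ^ p), ?_⟩
    filter_upwards [ae_mem_Ioi] with u hu w' hw' _
    refine (norm_macF_integrand_le hp w' hu).trans ?_
    have hu0 : 0 < u := hu
    have : ‖w'‖ ≤ ‖w‖ + 1 := by
      rw [Metric.mem_ball, dist_eq_norm] at hw'
      linarith [norm_le_norm_add_norm_sub' w' w]
    gcongr

lemma differentiableOn_mac {p : ℝ} (hp : 0 ≤ p) : DifferentiableOn ℂ (mac p) slitPlane :=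
  DifferentiableOn.mul (by fun_prop) (differentiableOn_macF hp)

/-- Rescaling: `∫₀^∞ e^{-wy} (y(y+2z))^p dy = w^{-2p-1} ∫₀^∞ e^{-u} (u(u+2wz))^p du`. -/
lemma integral_exp_mul_cpow {p : ℝ} {w : ℝ} (hw : 0 < w) {z : ℂ} (hz : z ∈ slitPlane) :
    ∫ y in Ioi 0, (rexp (-(w * y)) : ℂ) * ((y : ℂ) * (y + 2 * z)) ^ (p : ℂ) =
      (w ^ (-(2 * p + 1)) : ℝ) * macF p (w * z) := by
  have h := integral_comp_mul_left_Ioi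
    (fun u => (rexp (-u) : ℂ) * ((u : ℂ) * (u + 2 * (w * z))) ^ (p : ℂ)) 0 hw
  simp only [mul_zero] at h
  have h2 : ∀ y ∈ Ioi 0, (rexp (-(w * y)) : ℂ) *
      ((w * y : ℝ) * (((w * y : ℝ) : ℂ) + 2 * (w * z))) ^ (p : ℂ) =
      ((w ^ (2 * p) : ℝ) : ℂ) * ((rexp (-(w * y)) : ℂ) * ((y : ℂ) * (y + 2 * z)) ^ (p : ℂ)) := by
    intro y hy
    have h3 : (w * y : ℝ) * (((w * y : ℝ) : ℂ) + 2 * (w * z)) =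
        (w ^ 2 : ℝ) * ((y : ℂ) * (y + 2 * z)) := by push_cast; ring
    rw [h3, ofReal_mul_cpow_ofReal (by positivity)
      (Complex.slitPlane_ne_zero (ofReal_mul_add_mem_slitPlane hy hz)), ← rpow_natCast,
      ← rpow_mul hw.le]
    push_cast; ring
  rw [setIntegral_congr_fun measurableSet_Ioi h2, integral_const_mul] at h
  rw [macF]
  have hne : ((w ^ (2 * p) : ℝ) : ℂ) ≠ 0 := by exact_mod_cast (rpow_pos_of_pos hw _).ne'
  have hw1 : w⁻¹ = w ^ (2 * p) * w ^ (-(2 * p + 1)) := by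
    rw [← rpow_add hw, ← Real.rpow_neg_one]; congr 1; ring
  rw [← mul_right_inj' hne, h, real_smul, hw1, Complex.ofReal_mul, mul_assoc]

/-! ### The Poisson integral of the Bessel function -/

/-- `∫_{-1}^1 e^{iwt} (1-t²)^p dt`. -/
def poissonG (p : ℝ) (w : ℂ) : ℂ :=
  ∫ t in (-1 : ℝ)..1, cexp (I * w * t) * ((1 - t ^ 2) ^ p : ℝ)

lemma norm_poissonG_integrand_le {p : ℝ} (hp : 0 ≤ p) (w : ℂ) {t : ℝ} (ht : t ∈ Icc (-1 : ℝ) 1) :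
    ‖cexp (I * w * t) * ((1 - t ^ 2) ^ p : ℝ)‖ ≤ rexp |w.im| := by
  have h0 : 0 ≤ 1 - t ^ 2 := by nlinarith [ht.1, ht.2]
  have h1 : (1 - t ^ 2) ^ p ≤ 1 := Real.rpow_le_one h0 (by nlinarith [sq_nonneg t]) hp
  rw [norm_mul, norm_exp, norm_of_nonneg (by positivity)]
  have h2 : (I * w * t).re = -(w.im * t) := by simp
  rw [h2]
  have h3 : -(w.im * t) ≤ |w.im| := by
    refine (neg_le_abs _).trans ?_
    rw [abs_mul]
    exact mul_le_of_le_one_right (abs_nonneg _) (abs_le.2 ht)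
  calc _ ≤ rexp |w.im| * 1 := by gcongr
    _ = _ := mul_one _

lemma norm_poissonG_le {p : ℝ} (hp : 0 ≤ p) (w : ℂ) : ‖poissonG p w‖ ≤ 2 * rexp |w.im| := by
  have h := intervalIntegral.norm_integral_le_of_norm_le_const (a := (-1 : ℝ)) (b := 1)
    (f := fun t => cexp (I * w * t) * ((1 - t ^ 2) ^ p : ℝ))
    (C := rexp |w.im|) fun t ht => by
      rw [uIoc_of_le (by norm_num)] at ht
      exact norm_poissonG_integrand_le hp w ⟨ht.1.le, ht.2⟩
  refine h.trans (le_of_eq ?_); norm_num; ring_nf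

lemma continuous_poissonG_integrand {p : ℝ} (hp : 0 ≤ p) (w : ℂ) :
    Continuous fun t : ℝ => cexp (I * w * t) * ((1 - t ^ 2) ^ p : ℝ) := by fun_prop

lemma differentiable_poissonG {p : ℝ} (hp : 0 ≤ p) : Differentiable ℂ (poissonG p) := by
  rw [← differentiableOn_univ]
  have : poissonG p = fun w => ∫ t in Ioc (-1 : ℝ) 1, cexp (I * w * t) * ((1 - t ^ 2) ^ p : ℝ) := by
    ext w; rw [poissonG, intervalIntegral.integral_of_le (by norm_num)]
  rw [this]
  refine differentiableOn_integral_of_dominated isOpen_univ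
    (fun w _ => (continuous_poissonG_integrand hp w).aestronglyMeasurable) ?_ ?_
  · filter_upwards with t
    fun_prop
  · intro w _
    refine ⟨1, one_pos, fun _ => rexp (‖w‖ + 1), integrable_const _, ?_⟩
    filter_upwards [ae_restrict_mem measurableSet_Ioc] with t ht w' hw' _
    refine (norm_poissonG_integrand_le hp w' ⟨ht.1.le, ht.2⟩).trans ?_; gcongr
    rw [Metric.mem_ball, dist_eq_norm] at hw'
    linarith [norm_le_norm_add_norm_sub' w' w, Complex.abs_im_le_norm w']

lemma one_sub_sq_mem_slitPlane {z : ℂ} (h : |z.re| < 1 ∨ (|z.re| ≤ 1 ∧ z.im ≠ 0)) :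
    1 - z ^ 2 ∈ slitPlane := by
  rw [mem_slitPlane_iff]
  left
  have h1 : (1 - z ^ 2).re = 1 - z.re ^ 2 + z.im ^ 2 := by simp [sq]; ring
  rw [h1]
  rcases h with h | ⟨h, h'⟩
  · have : z.re ^ 2 < 1 := by rw [← sq_abs]; nlinarith [abs_nonneg z.re]
    nlinarith [sq_nonneg z.im]
  · have : z.re ^ 2 ≤ 1 := by rw [← sq_abs]; nlinarith [abs_nonneg z.re]
    have : 0 < z.im ^ 2 := by positivity
    linarith

lemma continuousAt_cpow_ofReal {p : ℝ} (hp : 0 ≤ p) {z : ℂ} (hz : z ∈ slitPlane ∨ z = 0) :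
    ContinuousAt (fun z : ℂ => z ^ (p : ℂ)) z := by
  rcases hz with hz | rfl
  · fun_prop
  · rcases hp.eq_or_lt with rfl | hp
    · simp only [ofReal_zero, Complex.cpow_zero]; exact continuousAt_const
    · have h : ContinuousAt (fun x : ℂ × ℂ => x.1 ^ x.2) ((0 : ℂ), (p : ℂ)) :=
        Complex.continuousAt_cpow_zero_of_re_pos (by simpa using hp)
      exact h.comp (f := fun z : ℂ => (z, (p : ℂ))) (by fun_prop)

/-- The contour deformation of the Poisson integral into the two vertical half lines. -/
lemma poissonG_eq_of_pos {p : ℝ} (hp : 0 ≤ p) {w : ℝ} (hw : 0 < w) :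
    mac p (-I * w) - mac p (I * w) = I * (w ^ (2 * p + 1) : ℝ) * poissonG p w := by
  set f : ℂ → ℂ := fun z => cexp (I * w * z) * (1 - z ^ 2) ^ (p : ℂ) with hf
  have hnf : ∀ z : ℂ, ‖f z‖ = rexp (-(w * z.im)) * ‖1 - z ^ 2‖ ^ p := by
    intro z
    rw [hf]
    simp only [norm_mul, norm_exp, norm_cpow_real]; congr 2; simp
  -- the rectangle of height `T`
  have hrect : ∀ T : ℝ, 0 < T → (∫ x in (-1 : ℝ)..1, f x) - (∫ x in (-1 : ℝ)..1, f (x + T * I)) +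
      I * (∫ y in (0 : ℝ)..T, f (1 + y * I)) -
      I * (∫ y in (0 : ℝ)..T, f (-1 + y * I)) = 0 := by
    intro T hT
    have h := Complex.integral_boundary_rect_eq_zero_of_continuousOn_of_differentiableOn f
      (-1) (1 + T * I) ?_ ?_
    · simpa using h
    · intro z hz
      simp only [Complex.mem_reProdIm, neg_re, one_re, Complex.neg_im,
        one_im, add_re, add_im, Complex.mul_re, mul_im,
        ofReal_re, ofReal_im, I_re, I_im] at hz
      norm_num at hz
      rw [uIcc_of_le hT.le] at hz
      refine ContinuousAt.continuousWithinAt (ContinuousAt.mul (by fun_prop) ?_)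
      refine ContinuousAt.comp (f := fun z : ℂ => 1 - z ^ 2) (g := fun z : ℂ => z ^ (p : ℂ))
        (continuousAt_cpow_ofReal hp ?_) (by fun_prop)
      by_cases hz1 : z.im = 0
      · rcases (abs_le.2 hz.1).lt_or_eq with h1 | h1
        · exact Or.inl (one_sub_sq_mem_slitPlane (Or.inl h1))
        · right
          have : z = (z.re : ℂ) := Complex.ext (by simp) (by simpa using hz1)
          rw [this]
          have h2 : z.re ^ 2 = 1 := by grind
          rw [← ofReal_pow, h2]; simp
      · exact Or.inl (one_sub_sq_mem_slitPlane (Or.inr ⟨abs_le.2 hz.1, hz1⟩))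
    · intro z hz
      simp only [Complex.mem_reProdIm, neg_re, one_re, Complex.neg_im,
        one_im, add_re, add_im, Complex.mul_re, mul_im,
        ofReal_re, ofReal_im, I_re, I_im] at hz
      norm_num at hz
      refine DifferentiableAt.differentiableWithinAt (DifferentiableAt.mul (by fun_prop) ?_)
      exact DifferentiableAt.cpow_const (by fun_prop)
        (one_sub_sq_mem_slitPlane (Or.inl (abs_lt.2 hz.1)))
  have hbase : (∫ x in (-1 : ℝ)..1, f x) = poissonG p w := by
    rw [poissonG]
    refine intervalIntegral.integral_congr fun t ht => ?_
    rw [uIcc_of_le (by norm_num)] at ht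
    have h0 : 0 ≤ 1 - t ^ 2 := by nlinarith [ht.1, ht.2]
    simp only [hf]
    rw [ofReal_cpow h0]
    push_cast; ring_nf
  have hside : ∀ (s : ℝ), s ^ 2 = 1 → ∀ y ∈ Ioi (0 : ℝ), f (s + y * I) = cexp (I * w * s) *
        ((rexp (-(w * y)) : ℂ) * ((y : ℂ) * (y + 2 * (-I * s))) ^ (p : ℂ)) := by
    intro s hs y hy
    have h1 : 1 - ((s : ℂ) + y * I) ^ 2 = (y : ℂ) * (y + 2 * (-I * s)) := by
      have : (s : ℂ) ^ 2 = 1 := mod_cast hs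
      linear_combination -this - (y : ℂ) ^ 2 * I_sq
    simp only [hf]
    rw [h1, ← mul_assoc (cexp (I * w * s))]; congr 1
    rw [ofReal_exp, ← exp_add]; congr 1; push_cast
    linear_combination (w : ℂ) * y * I_sq
  have hslit : ∀ s : ℝ, s ^ 2 = 1 → -I * s ∈ slitPlane := by
    intro s hs
    rw [mem_slitPlane_iff]
    right
    have : s ≠ 0 := by grind
    simpa using this
  have hmaclim : ∀ s : ℝ, s ^ 2 = 1 → Tendsto (fun T => ∫ y in (0 : ℝ)..T, f (s + y * I)) atTop
        (𝓝 ((w ^ (-(2 * p + 1)) : ℝ) * mac p (-I * s * w))) := by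
    intro s hs
    have hval : ∫ y in Ioi (0 : ℝ), f (s + y * I) =
        (w ^ (-(2 * p + 1)) : ℝ) * mac p (-I * s * w) := by
      rw [setIntegral_congr_fun measurableSet_Ioi (hside s hs), integral_const_mul,
        integral_exp_mul_cpow hw (hslit s hs), mac]
      have : (w : ℂ) * (-I * s) = -I * s * w := by ring
      rw [this]
      have : I * w * s = -(-I * s * w) := by ring
      rw [this]; ring
    rw [← hval]
    refine intervalIntegral_tendsto_integral_Ioi 0 ?_ tendsto_id
    refine Integrable.congr (Integrable.const_mul (f := fun y => (rexp (-(w * y)) : ℂ) *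
      ((y : ℂ) * (y + 2 * (-I * s))) ^ (p : ℂ)) ?_ (cexp (I * w * s)))
      (ae_mem_Ioi.mono fun y hy => (hside s hs y hy).symm)
    have h1 : ContinuousOn (fun y => (rexp (-(w * y)) : ℂ) *
        ((y : ℂ) * (y + 2 * (-I * s))) ^ (p : ℂ)) (Ioi 0) :=
      ContinuousOn.mul (by fun_prop) (ContinuousOn.cpow_const (by fun_prop) fun y hy =>
        ofReal_mul_add_mem_slitPlane hy (hslit s hs))
    refine Integrable.mono' ((integrableOn_rpow_mul_exp (2 * p) hw).const_mul (2 ^ p))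
      (h1.aestronglyMeasurable measurableSet_Ioi) ?_
    filter_upwards [ae_mem_Ioi] with y hy
    have hy0 : 0 < y := hy
    rw [norm_mul, norm_cpow_real, norm_mul, norm_of_nonneg (exp_pos _).le, norm_of_nonneg hy0.le]
    have h2 : ‖(y : ℂ) + 2 * (-I * s)‖ ≤ y + 2 := by
      refine (norm_add_le _ _).trans ?_
      have : |s| = 1 := by grind
      simp [this, abs_of_pos hy0]
    calc _ ≤ rexp (-(w * y)) * (2 * ((1 + y) * (1 + y))) ^ p := by
          have h3 : y * ‖(y : ℂ) + 2 * (-I * s)‖ ≤ 2 * ((1 + y) * (1 + y)) := by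
            calc _ ≤ y * (y + 2) := by gcongr
              _ ≤ _ := by nlinarith
          gcongr
      _ = _ := by
        rw [mul_rpow (by positivity) (by positivity), mul_rpow (by positivity)
          (by positivity), ← rpow_add (by positivity), ← two_mul p, neg_mul]
        ring
  have htop : Tendsto (fun T : ℝ => ∫ x in (-1 : ℝ)..1, f (x + T * I)) atTop (𝓝 0) := by
    obtain ⟨C, hC, hexp⟩ := exists_rpow_le_exp (2 * p) (half_pos hw)
    have hlim : Tendsto (fun T => 2 * (2 ^ p * (C * rexp (-(w / 2) * T)))) atTop (𝓝 0) := by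
      have h1 : Tendsto (fun T => rexp (-(w / 2) * T)) atTop (𝓝 0) := by
        refine Real.tendsto_exp_atBot.comp ?_
        exact tendsto_id.const_mul_atTop_of_neg (by linarith)
      simpa using ((h1.const_mul C).const_mul (2 ^ p)).const_mul 2
    refine squeeze_zero_norm' ?_ hlim
    filter_upwards [eventually_gt_atTop 0] with T hT
    have h := intervalIntegral.norm_integral_le_of_norm_le_const (a := (-1 : ℝ)) (b := 1)
      (f := fun x => f (x + T * I))
      (C := 2 ^ p * (C * rexp (-(w / 2) * T))) fun x hx => by
        rw [uIoc_of_le (by norm_num)] at hx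
        rw [hnf]
        have h1 : ‖1 - ((x : ℂ) + T * I) ^ 2‖ ≤ 2 * ((1 + T) * (1 + T)) := by
          refine (norm_sub_le _ _).trans ?_
          rw [norm_pow]
          have h2 : ‖(x : ℂ) + T * I‖ ≤ 1 + T := by
            refine (norm_add_le _ _).trans ?_
            have : |x| ≤ 1 := abs_le.2 ⟨hx.1.le, hx.2⟩
            simpa [abs_of_pos hT] using this
          have h3 := pow_le_pow_left₀ (norm_nonneg _) h2 2
          simp only [norm_one]; nlinarith
        have h2 : (((x : ℂ) + T * I)).im = T := by simp
        rw [h2]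
        have h4 := hexp T hT.le
        calc _ ≤ rexp (-(w * T)) * (2 * ((1 + T) * (1 + T))) ^ p := by gcongr
          _ = rexp (-(w * T)) * (2 ^ p * (1 + T) ^ (2 * p)) := by
            rw [mul_rpow (by positivity) (by positivity), mul_rpow (by positivity)
              (by positivity), ← rpow_add (by positivity), ← two_mul p]
          _ ≤ rexp (-(w * T)) * (2 ^ p * (C * rexp (w / 2 * T))) := by gcongr
          _ = 2 ^ p * (C * (rexp (-(w * T)) * rexp (w / 2 * T))) := by ring
          _ = _ := by rw [← Real.exp_add]; ring_nf
    refine h.trans (le_of_eq ?_)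
    norm_num; ring
  have hlim := ((tendsto_const_nhds (x := poissonG p w)).sub htop).add
    ((hmaclim 1 (by norm_num)).const_mul I) |>.sub
    ((hmaclim (-1) (by norm_num)).const_mul I)
  have hzero := tendsto_nhds_unique hlim ((tendsto_const_nhds (x := (0 : ℂ))).congr' (by
    filter_upwards [eventually_gt_atTop 0] with T hT
    have := hrect T hT
    rw [hbase] at this; push_cast
    exact this.symm))
  simp only [ofReal_one, mul_one, ofReal_neg, sub_zero, mul_neg, neg_mul, neg_neg] at hzero
  have hne : w ^ (2 * p + 1) * w ^ (-(2 * p + 1)) = 1 := by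
    rw [← rpow_add hw, add_neg_cancel, rpow_zero]
  have hne' : (w ^ (2 * p + 1) : ℝ) * ((w ^ (-(2 * p + 1)) : ℝ) : ℂ) = 1 := by exact_mod_cast hne
  rw [neg_mul]
  linear_combination (-I * (w ^ (2 * p + 1) : ℝ)) * hzero + (mac p (-(I * w)) - mac p (I * w)) *
      ((w ^ (2 * p + 1) : ℝ) * ((w ^ (-(2 * p + 1)) : ℝ) : ℂ) * I_sq - hne')

lemma I_mul_mem_slitPlane {w : ℂ} (hw : 0 < w.re) : I * w ∈ slitPlane := by
  rw [mem_slitPlane_iff]; right; simpa using hw.ne'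

lemma neg_I_mul_mem_slitPlane {w : ℂ} (hw : 0 < w.re) : -I * w ∈ slitPlane := by
  rw [mem_slitPlane_iff]; right; simpa using hw.ne'

lemma mac_sub_mac {p : ℝ} (hp : 0 ≤ p) {w : ℂ} (hw : 0 < w.re) : mac p (-I * w) - mac p (I * w) =
      I * w ^ᵣ (2 * p + 1) * poissonG p w := by
  have hU : IsOpen {w : ℂ | 0 < w.re} := isOpen_lt continuous_const continuous_re
  have hc : IsPreconnected {w : ℂ | 0 < w.re} := (convex_halfSpace_re_gt 0).isPreconnected
  refine eqOn_of_eq_on_pos (f := fun w => mac p (-I * w) - mac p (I * w))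
    (g := fun w => I * w ^ᵣ (2 * p + 1) * poissonG p w) hU hc (by simp) ?_ ?_ ?_ hw
  · refine DifferentiableOn.sub ?_ ?_
    · exact (differentiableOn_mac hp).comp (by fun_prop) fun w hw => neg_I_mul_mem_slitPlane hw
    · exact (differentiableOn_mac hp).comp (by fun_prop) fun w hw => I_mul_mem_slitPlane hw
  · intro w hw
    refine DifferentiableAt.differentiableWithinAt (DifferentiableAt.mul (DifferentiableAt.const_mul
      (DifferentiableAt.cpow_const differentiableAt_id (Or.inl hw)) _) (differentiable_poissonG hp w))
  · intro t ht
    rw [poissonG_eq_of_pos hp ht, ofReal_cpow ht.le]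

/-! ### Localised symbols -/

lemma exists_symBound_one_sub_cutoff_mul (N : ℕ) : ∃ C > 0, ∀ (β : ℝ → ℝ) (b : ℝ → ℂ),
    SymBound (Ioi (1 / 2)) N β b →
    SymBound (Ioi 0) N (fun t => C * (Ici 1).indicator β t) (fun t => (1 - cutoff t) * b t) := by
  obtain ⟨c, hc, -, hcut⟩ := exists_symBound_cutoff N
  refine ⟨2 ^ N * c, by positivity, fun β b h => ?_⟩
  have hsub : Ioi (1 / 2 : ℝ) ⊆ Ioi 0 := Ioi_subset_Ioi (by norm_num)
  have h1 := (hcut.mono (β' := fun t => c * (Ici 1).indicator 1 t) hsub hsub fun _ _ => le_rfl).mul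
    isOpen_Ioi hsub h
  have h2 : SymBound (Ioo 0 1) N (fun t => 2 ^ N * c * (Ici 1).indicator β t)
      (fun t => (1 - cutoff t) * b t) := by
    refine (SymBound.zero (β := fun t => 2 ^ N * c * (Ici 1).indicator β t)
      Ioo_subset_Ioi_self fun t ht => ?_).congr isOpen_Ioo fun t ht => ?_
    · simp_all
    · simp [cutoff_one ht.2.le]
  refine ((h1.mono (β' := fun t => 2 ^ N * c * (Ici 1).indicator β t) Subset.rfl hsub
    fun t _ => le_of_eq ?_).union h2).mono (fun t ht => ?_) Subset.rfl fun _ _ => le_rfl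
  · by_cases ht : t ∈ Ici (1 : ℝ)
    · simp only [indicator_of_mem ht, Pi.one_apply]; ring
    · simp_all
  · rcases lt_or_ge t 1 with h | h
    · grind
    · grind

lemma exists_symBound_cutoff_mul (N : ℕ) : ∃ C > 0, ∀ (β : ℝ → ℝ) (b : ℝ → ℂ),
    SymBound (Ioo 0 3) N β b →
    SymBound (Ioi 0) N (fun t => C * (Iic 2).indicator β t) (fun t => cutoff t * b t) := by
  obtain ⟨c, hc, hcut, -⟩ := exists_symBound_cutoff N
  refine ⟨2 ^ N * c, by positivity, fun β b h => ?_⟩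
  have hsub : Ioo (0 : ℝ) 3 ⊆ Ioi 0 := Ioo_subset_Ioi_self
  have hsub2 : Ioi (2 : ℝ) ⊆ Ioi 0 := Ioi_subset_Ioi (by norm_num)
  have h1 := (hcut.mono (β' := fun t => c * (Iic 2).indicator 1 t) hsub hsub fun _ _ => le_rfl).mul
    isOpen_Ioo hsub h
  have h2 : SymBound (Ioi 2) N (fun t => 2 ^ N * c * (Iic 2).indicator β t)
      (fun t => cutoff t * b t) := by
    refine (SymBound.zero (β := fun t => 2 ^ N * c * (Iic 2).indicator β t)
      hsub2 fun t ht => ?_).congr isOpen_Ioi fun t ht => ?_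
    · simp_all
    · simp [cutoff_zero (le_of_lt ht)]
  refine ((h1.mono (β' := fun t => 2 ^ N * c * (Iic 2).indicator β t) Subset.rfl hsub
    fun t _ => le_of_eq ?_).union h2).mono (fun t ht => ?_) Subset.rfl fun _ _ => le_rfl
  · by_cases ht : t ∈ Iic (2 : ℝ)
    · simp only [indicator_of_mem ht, Pi.one_apply]; ring
    · simp_all
  · rcases lt_or_ge 2 t with h | h
    · exact Or.inr h
    · grind

/-! ### Asymptotics of the Poisson integral -/

lemma closedBall_half_facts {t : ℝ} (ht : 0 < t) {w : ℂ}
    (hw : w ∈ Metric.closedBall (t : ℂ) (1 / 2 * t)) :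
    0 < w.re ∧ t / 2 ≤ ‖w‖ ∧ ‖w‖ ≤ 2 * t ∧ |w.im| ≤ t / 2 := by
  rw [Metric.mem_closedBall, dist_eq_norm] at hw
  have h1 := (abs_re_le_norm (w - t)).trans hw
  have h2 := (Complex.abs_im_le_norm (w - t)).trans hw
  simp only [sub_re, ofReal_re, Complex.sub_im, ofReal_im, sub_zero] at h1 h2
  have h3 := abs_le.1 h1
  have h4 : w.re ≤ ‖w‖ := (le_abs_self _).trans (abs_re_le_norm w)
  have h5 := norm_le_norm_add_norm_sub' w (t : ℂ)
  rw [norm_of_nonneg ht.le] at h5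
  exact ⟨by linarith, by linarith, by linarith, by linarith⟩

lemma exists_poissonG_eq {p : ℝ} (hp : 0 ≤ p) (N : ℕ) : ∃ (C : ℝ) (g g' : ℝ → ℂ), 0 < C ∧
      (∀ t : ℝ, 0 < t → poissonG p t = cexp (I * t) * g t + cexp (-(I * t)) * g' t) ∧
      SymBound (Ioi 0) N (fun t => C * (1 + t) ^ (-(p + 1))) g ∧
      SymBound (Ioi 0) N (fun t => C * (1 + t) ^ (-(p + 1))) g' := by
  have hU : IsOpen {w : ℂ | 0 < w.re} := isOpen_lt continuous_const continuous_re
  -- the two large-argument amplitudes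
  have hlarge : ∀ s : ℂ, ‖s‖ = 1 → (∀ w : ℂ, 0 < w.re → s * w ∈ slitPlane) →
      ∃ C > 0, SymBound (Ioi (1 / 2)) N (fun t => C * (1 + t) ^ (-(p + 1)))
        (fun t => (t : ℂ) ^ ((-(2 * p + 1) : ℝ) : ℂ) * macF p (s * t)) := by
    intro s hs hslit
    have hsub : Ioi (1 / 2 : ℝ) ⊆ Ioi 0 := Ioi_subset_Ioi (by norm_num)
    set F : ℂ → ℂ := fun w => w ^ ((-(2 * p + 1) : ℝ) : ℂ) * macF p (s * w) with hFdef
    have hF : DifferentiableOn ℂ F {w : ℂ | 0 < w.re} := by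
      refine DifferentiableOn.mul (fun w hw => ?_)
        ((differentiableOn_macF hp).comp (by fun_prop) fun w hw => hslit w hw)
      exact (DifferentiableAt.cpow_const differentiableAt_id (Or.inl hw)).differentiableWithinAt
    have hM := macConst_nonneg p
    have hkey := SymBound.of_differentiableOn (β := fun t => (6 ^ (2 * p + 1) * 4 ^ p * (macConst p + 1)) *
      (1 + t) ^ (-(p + 1))) hU hF hsub (σ := 1 / 2) (by norm_num) (by norm_num)
      (fun t ht w hw => (closedBall_half_facts (hsub ht) hw).1) (fun t ht w hw => ?_) N
    · exact ⟨N.factorial / (1 / 2) ^ N * (6 ^ (2 * p + 1) * 4 ^ p * (macConst p + 1)),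
        by positivity, hkey.mono Subset.rfl hsub fun t ht => le_of_eq (by ring)⟩
    · obtain ⟨h1, h2, h3, -⟩ := closedBall_half_facts (hsub ht) hw
      have ht0 : (1 / 2 : ℝ) < t := ht
      have hb := norm_macF_le hp (s * w)
      rw [norm_mul, hs, one_mul] at hb
      rw [hFdef]
      simp only [norm_mul, norm_cpow_real]
      have e1 : ‖w‖ ^ (-(2 * p + 1)) ≤ 6 ^ (2 * p + 1) * (1 + t) ^ (-(2 * p + 1)) := by
        rw [rpow_neg (norm_nonneg _), rpow_neg (by linarith), ← div_eq_mul_inv,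
          ← div_rpow (by norm_num) (by linarith), ← Real.inv_rpow (norm_nonneg _)]
        refine rpow_le_rpow (by positivity) ?_ (by linarith)
        rw [inv_eq_one_div, div_le_div_iff₀ (by linarith) (by linarith)]; linarith
      have e2 : (1 + 2 * ‖w‖) ^ p ≤ 4 ^ p * (1 + t) ^ p := by
        rw [← mul_rpow (by norm_num) (by linarith)]
        exact rpow_le_rpow (by positivity) (by linarith) hp
      calc _ ≤ (6 ^ (2 * p + 1) * (1 + t) ^ (-(2 * p + 1))) *
            ((macConst p + 1) * (4 ^ p * (1 + t) ^ p)) := by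
            have : 0 < t := by linarith
            refine mul_le_mul e1 (hb.trans ?_) (norm_nonneg _) (by positivity); gcongr; linarith
        _ = 6 ^ (2 * p + 1) * 4 ^ p * (macConst p + 1) *
            ((1 + t) ^ (-(2 * p + 1)) * (1 + t) ^ p) := by ring
        _ = _ := by rw [← rpow_add (by linarith)]; congr 2; ring
  -- the small-argument amplitude
  have hsmall : ∃ C > 0, SymBound (Ioo 0 3) N (fun t => C * (1 + t) ^ (-(p + 1)))
      (fun t : ℝ => cexp (-(I * t)) * poissonG p t) := by
    have hF : DifferentiableOn ℂ (fun w : ℂ => cexp (-(I * w)) * poissonG p w) {w : ℂ | 0 < w.re} :=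
      DifferentiableOn.mul (by fun_prop) (differentiable_poissonG hp).differentiableOn
    have hkey := SymBound.of_differentiableOn (s := Ioo 0 3)
      (β := fun t => rexp 3 * (2 * rexp 3)) hU hF
      Ioo_subset_Ioi_self (σ := 1 / 2) (by norm_num) (by norm_num)
      (fun t ht w hw => (closedBall_half_facts ht.1 hw).1) (fun t ht w hw => ?_) N
    · refine ⟨N.factorial / (1 / 2) ^ N * (rexp 3 * (2 * rexp 3)) * 4 ^ (p + 1),
        by positivity, hkey.mono Subset.rfl Ioo_subset_Ioi_self fun t ht => ?_⟩
      have e1 : 1 ≤ 4 ^ (p + 1) * (1 + t) ^ (-(p + 1)) := by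
        have := ht.1
        rw [rpow_neg (by linarith), ← div_eq_mul_inv, ← div_rpow (by norm_num) (by linarith)]
        refine one_le_rpow ?_ (by linarith)
        rw [one_le_div (by linarith)]
        linarith [ht.2]
      rw [mul_assoc _ (4 ^ (p + 1))]
      exact le_mul_of_one_le_right (by positivity) e1
    · obtain ⟨-, h2, h3, h4⟩ := closedBall_half_facts ht.1 hw
      rw [norm_mul, norm_exp]
      have e1 : (-(I * w)).re = w.im := by simp
      rw [e1]
      have e2 := norm_poissonG_le hp w
      have e3 : |w.im| ≤ 3 := h4.trans (by linarith [ht.1, ht.2])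
      have e4 : w.im ≤ 3 := (le_abs_self _).trans e3
      calc _ ≤ rexp 3 * (2 * rexp |w.im|) := by gcongr
        _ ≤ _ := by gcongr
  obtain ⟨C₁, hC₁, h₁⟩ := hlarge (-I) (by simp) fun w hw => neg_I_mul_mem_slitPlane hw
  obtain ⟨C₂, hC₂, h₂⟩ := hlarge I (by simp) fun w hw => I_mul_mem_slitPlane hw
  obtain ⟨C₃, hC₃, h₃⟩ := hsmall
  obtain ⟨c, hc, hcut⟩ := exists_symBound_one_sub_cutoff_mul N
  obtain ⟨c', hc', hcut'⟩ := exists_symBound_cutoff_mul N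
  have k₁ := (hcut _ _ h₁).const_mul isOpen_Ioi Subset.rfl (-I)
  have k₂ := (hcut _ _ h₂).const_mul isOpen_Ioi Subset.rfl I
  have k₃ := hcut' _ _ h₃
  have hpos : ∀ t ∈ Ioi (0 : ℝ), 0 < (1 + t) ^ (-(p + 1)) := fun t ht => by
    have : (0 : ℝ) < t := ht; positivity
  have hind : ∀ (A : Set ℝ) (D : ℝ), 0 < D → ∀ t ∈ Ioi (0 : ℝ),
      A.indicator (fun t => D * (1 + t) ^ (-(p + 1))) t ≤ D * (1 + t) ^ (-(p + 1)) := by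
    intro A D hD t ht
    have := hpos t ht
    by_cases h : t ∈ A
    · rw [indicator_of_mem h]
    · rw [indicator_of_notMem h]; positivity
  refine ⟨c * C₁ + c' * C₃ + c * C₂, _, _, by positivity, fun t ht => ?_,
    (k₁.add isOpen_Ioi k₃).mono Subset.rfl Subset.rfl fun t ht => ?_,
    k₂.mono Subset.rfl Subset.rfl fun t ht => ?_⟩
  · have h := mac_sub_mac hp (w := (t : ℂ)) (by simpa using ht)
    rw [mac, mac] at h
    have hne : (t : ℂ) ^ ((-(2 * p + 1) : ℝ) : ℂ) * (t : ℂ) ^ᵣ (2 * p + 1) = 1 := by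
      rw [← Complex.cpow_add _ _ (mod_cast ht.ne'), ← Complex.ofReal_add, neg_add_cancel]; simp
    have hee : cexp (I * t) * cexp (-(I * t)) = 1 := by rw [← exp_add, add_neg_cancel, exp_zero]
    rw [neg_mul, neg_neg] at h
    simp only [neg_mul]
    linear_combination (-(1 - cutoff t) * poissonG p t) * hne +
      (1 - cutoff t) * (t : ℂ) ^ ((-(2 * p + 1) : ℝ) : ℂ) * (I * h +
        (t : ℂ) ^ᵣ (2 * p + 1) * poissonG p t * I_sq) -
      cutoff t * poissonG p t * hee
  · have e1 := hind (Ici 1) C₁ hC₁ t ht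
    have e3 := hind (Iic 2) C₃ hC₃ t ht
    have := hpos t ht
    simp only [norm_neg, norm_I, one_mul]
    calc _ ≤ c * (C₁ * (1 + t) ^ (-(p + 1))) + c' * (C₃ * (1 + t) ^ (-(p + 1))) := by gcongr
      _ ≤ _ := by
        have : 0 ≤ c * C₂ * (1 + t) ^ (-(p + 1)) := by positivity
        linarith
  · have e1 := hind (Ici 1) C₂ hC₂ t ht
    have := hpos t ht
    simp only [norm_I, one_mul]
    calc _ ≤ c * (C₂ * (1 + t) ^ (-(p + 1))) := by gcongr
      _ ≤ _ := by
        have h1 : 0 ≤ c * C₁ * (1 + t) ^ (-(p + 1)) := by positivity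
        have h2 : 0 ≤ c' * C₃ * (1 + t) ^ (-(p + 1)) := by positivity
        linarith

/-! ### The antiderivative of the Poisson integral -/

lemma hasDerivAt_poissonG_ofReal {p : ℝ} (hp : 0 ≤ p) (x : ℝ) :
    HasDerivAt (fun x : ℝ => poissonG p x) (∫ t in (-1 : ℝ)..1, I * t * (cexp (I * x * t) *
        ((1 - t ^ 2) ^ p : ℝ))) x := by
  have hcont : ∀ x : ℝ, Continuous fun t : ℝ => cexp (I * (x : ℂ) * t) *
      (((1 - t ^ 2) ^ p : ℝ) : ℂ) := fun x => continuous_poissonG_integrand hp x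
  refine (intervalIntegral.hasDerivAt_integral_of_dominated_loc_of_deriv_le (μ := volume)
    (F := fun (x : ℝ) (t : ℝ) => cexp (I * (x : ℂ) * t) * ((1 - t ^ 2) ^ p : ℝ))
    (F' := fun (x : ℝ) (t : ℝ) => I * t * (cexp (I * x * t) * ((1 - t ^ 2) ^ p : ℝ)))
    (bound := fun _ => 1) (s := univ) univ_mem
    (Eventually.of_forall fun x => (hcont x).aestronglyMeasurable)
    ((hcont x).intervalIntegrable _ _) ?_ ?_ (by simp) ?_).2
  · fun_prop
  · refine Eventually.of_forall fun t ht x _ => ?_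
    rw [uIoc_of_le (by norm_num)] at ht
    have h := norm_poissonG_integrand_le hp (x : ℂ) (t := t) ⟨ht.1.le, ht.2⟩
    simp only [ofReal_im, abs_zero, Real.exp_zero] at h
    rw [norm_mul, norm_mul, norm_I, one_mul, norm_real, norm_eq_abs]
    have : |t| ≤ 1 := abs_le.2 ⟨ht.1.le, ht.2⟩
    exact mul_le_one₀ this (norm_nonneg _) h
  · refine Eventually.of_forall fun t ht x _ => ?_
    have h1 : HasDerivAt (fun x : ℝ => I * (x : ℂ) * t) (I * t) x := by
      have := ((hasDerivAt_id x).ofReal_comp.const_mul I).mul_const (t : ℂ)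
      simpa using this
    have h2 := h1.cexp.mul_const (((1 - t ^ 2) ^ p : ℝ) : ℂ)
    exact h2.congr_deriv (by ring)

lemma poissonG_recurrence {p : ℝ} (hp : 0 ≤ p) (x : ℝ) :
    (2 * p + 3) * poissonG (p + 1) x + x * (∫ t in (-1 : ℝ)..1, I * t *
      (cexp (I * x * t) * ((1 - t ^ 2) ^ (p + 1) : ℝ))) =
      (2 * p + 2) * poissonG p x := by
  have hp1 : 0 ≤ p + 1 := by linarith
  have hc0 := continuous_poissonG_integrand hp (x : ℂ)
  have hc1 := continuous_poissonG_integrand hp1 (x : ℂ)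
  have hd : ∀ t ∈ uIcc (-1 : ℝ) 1, HasDerivAt
      (fun t => (t * (1 - t ^ 2) ^ (p + 1) : ℝ) * cexp (I * x * t))
      ((2 * p + 3) * (cexp (I * x * t) * ((1 - t ^ 2) ^ (p + 1) : ℝ)) +
        x * (I * t * (cexp (I * x * t) * ((1 - t ^ 2) ^ (p + 1) : ℝ))) -
        (2 * p + 2) * (cexp (I * x * t) * ((1 - t ^ 2) ^ p : ℝ))) t := by
    intro t ht
    rw [uIcc_of_le (by norm_num)] at ht
    have h0 : 0 ≤ 1 - t ^ 2 := by nlinarith [ht.1, ht.2]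
    have h1 : HasDerivAt (fun t => 1 - t ^ 2) (-(2 * t)) t := by
      simpa using ((hasDerivAt_id t).pow 2).const_sub 1
    have h2 := h1.rpow_const (p := p + 1) (Or.inr (by linarith))
    have h3 := ((hasDerivAt_id t).mul h2).ofReal_comp
    have h4 : HasDerivAt (fun t : ℝ => I * (x : ℂ) * t) (I * x) t := by
      simpa using (hasDerivAt_id t).ofReal_comp.const_mul (I * x)
    have h5 := h3.mul h4.cexp
    have h6 : (((1 - t ^ 2) ^ (p + 1) : ℝ) : ℂ) = (1 - t ^ 2) * ((1 - t ^ 2) ^ p : ℝ) := by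
      rw [Real.rpow_add_one' h0 (by linarith)]; push_cast; ring
    refine h5.congr_deriv ?_
    simp only [Pi.mul_apply, id, add_sub_cancel_right]; push_cast
    rw [h6]; ring
  have hint := intervalIntegral.integral_eq_sub_of_hasDerivAt hd
    (Continuous.intervalIntegrable (by fun_prop) _ _)
  rw [intervalIntegral.integral_sub (Continuous.intervalIntegrable (by fun_prop) _ _)
      (Continuous.intervalIntegrable (by fun_prop) _ _),
    intervalIntegral.integral_add (Continuous.intervalIntegrable (by fun_prop) _ _)
      (Continuous.intervalIntegrable (by fun_prop) _ _), intervalIntegral.integral_const_mul,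
    intervalIntegral.integral_const_mul, intervalIntegral.integral_const_mul] at hint
  have hz : ∀ s : ℝ, s ^ 2 = 1 → (1 - s ^ 2 : ℝ) ^ (p + 1) = 0 := fun s hs => by
    rw [hs, sub_self, Real.zero_rpow (by linarith)]
  rw [hz 1 (by norm_num), hz (-1) (by norm_num)] at hint
  simp only [mul_zero, ofReal_zero, zero_mul, sub_zero] at hint
  rw [poissonG, poissonG]
  linear_combination hint

/-- `λ ↦ λ^{2p+3} G_{p+1}(λ r)` is an antiderivative of `(2p+2) λ^{2p+2} G_p(λ r)`. -/
lemma hasDerivAt_rpow_mul_poissonG {p : ℝ} (hp : 0 ≤ p) (r : ℝ) {t : ℝ} (ht : 0 < t) :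
    HasDerivAt (fun t : ℝ => (t ^ (2 * p + 3) : ℝ) * poissonG (p + 1) (t * r : ℝ))
      ((2 * p + 2) * (t ^ (2 * p + 2) : ℝ) * poissonG p (t * r : ℝ)) t := by
  have h1 := (Real.hasDerivAt_rpow_const (x := t) (p := 2 * p + 3) (Or.inl ht.ne')).ofReal_comp
  have h2 : HasDerivAt (fun t : ℝ => t * r) r t := by simpa using (hasDerivAt_id t).mul_const r
  have h3 := (hasDerivAt_poissonG_ofReal (p := p + 1) (by linarith) (t * r)).scomp t h2
  have h4 := h1.mul h3
  have h5 := poissonG_recurrence hp (t * r)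
  have h6 : (2 * p + 3 - 1) = 2 * p + 2 := by ring
  have h7 : ((t ^ (2 * p + 3) : ℝ) : ℂ) = (t ^ (2 * p + 2) : ℝ) * t := by
    rw [← Complex.ofReal_mul, ← Real.rpow_add_one ht.ne']; congr 2; ring
  refine h4.congr_deriv ?_
  rw [h6, h7, real_smul]
  simp only [Function.comp]
  rw [mul_comm (2 * (p : ℂ) + 2), mul_assoc (((t ^ (2 * p + 2) : ℝ)) : ℂ) (2 * (p : ℂ) + 2), ← h5]
  push_cast; ring

/-! ### Superpositions and their Fourier transforms -/

lemma fourier_integral_of_integrable_prod {n : ℕ} {T : Type*} [MeasurableSpace T] {μ : Measure T}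
    [SFinite μ] {k : T → Rn n → ℂ}
    (hk : Integrable (fun q : T × Rn n => k q.1 q.2) (μ.prod volume)) :
    Integrable (fun x => ∫ t, k t x ∂μ) ∧
      ∀ ξ, 𝓕 (fun x => ∫ t, k t x ∂μ) ξ = ∫ t, 𝓕 (k t) ξ ∂μ := by
  refine ⟨hk.integral_prod_right, fun ξ => ?_⟩
  simp only [fourier_eq]
  have h1 : ∀ v : Rn n, (fourierChar (-(inner ℝ v ξ)) • ∫ t, k t v ∂μ) =
      ∫ t, fourierChar (-(inner ℝ v ξ)) • k t v ∂μ := fun v => by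
    simp only [Circle.smul_def]
    exact (integral_smul _ _).symm
  simp only [h1]
  refine integral_integral_swap (f := fun v t => fourierChar (-(inner ℝ v ξ)) • k t v) ?_
  have h2 : Integrable (fun q : Rn n × T => k q.2 q.1) (volume.prod μ) := hk.swap
  refine h2.mono ?_ (Eventually.of_forall fun q => (Circle.norm_smul _ _).le)
  have h3 : Continuous fun v : Rn n => ((fourierChar (-(inner ℝ v ξ)) : Circle) : ℂ) :=
    continuous_subtype_val.comp (Real.continuous_fourierChar.comp (by fun_prop))
  have h4 : AEStronglyMeasurable (fun q : Rn n × T =>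
      ((fourierChar (-(inner ℝ q.1 ξ)) : Circle) : ℂ)) (volume.prod μ) :=
    (h3.measurable.comp measurable_fst).aestronglyMeasurable
  exact h4.smul h2.1

/-! ### Superpositions of heat kernels -/

/-- `∫₀^∞ t^{a-1} e^{-tu} (4πt)^{-n/2} e^{-r²/4t} dt`. -/
def heatPot (n : ℕ) (a : ℝ) (u : ℂ) (r : ℝ) : ℂ :=
  ∫ t in Ioi 0, (t ^ (a - 1) * (4 * π * t) ^ (-((n : ℝ) / 2)) *
    rexp (-r ^ 2 / (4 * t)) : ℝ) * cexp (-t * u)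

lemma exists_rpow_mul_exp_neg_div_le (b : ℝ) {c : ℝ} (hc : 0 < c) :
    ∃ C > 0, ∀ t > 0, t ^ b * rexp (-c / t) ≤ C * (1 + t) ^ |b| := by
  obtain ⟨C, hC, h⟩ := exists_rpow_le_exp |b| hc
  refine ⟨1 + C, by positivity, fun t ht => ?_⟩
  have h1 : (1 : ℝ) ≤ (1 + t) ^ |b| := one_le_rpow (by linarith) (abs_nonneg _)
  have he : rexp (-c / t) ≤ 1 := by
    rw [exp_le_one_iff, neg_div]
    exact neg_nonpos.2 (by positivity)
  rcases le_or_gt 1 t with ht1 | ht1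
  · have h2 : t ^ b ≤ (1 + t) ^ |b| := (Real.rpow_le_rpow_of_exponent_le ht1 (le_abs_self b)).trans
        (rpow_le_rpow ht.le (by linarith) (abs_nonneg _))
    calc _ ≤ (1 + t) ^ |b| * 1 := by gcongr
      _ ≤ _ := by nlinarith
  · have h2 : t ^ b ≤ (1 + t⁻¹) ^ |b| := by
      have h3 : t ^ b ≤ t ^ (-|b|) := Real.rpow_le_rpow_of_exponent_ge ht ht1.le (neg_abs_le b)
      rw [rpow_neg ht.le, ← Real.inv_rpow ht.le] at h3
      exact h3.trans (rpow_le_rpow (by positivity) (by linarith) (abs_nonneg _))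
    have h3 := h t⁻¹ (by positivity)
    calc _ ≤ (C * rexp (c * t⁻¹)) * rexp (-c / t) := by bound
      _ = C := by
        rw [mul_assoc, ← Real.exp_add, neg_div, div_eq_mul_inv, add_neg_cancel, Real.exp_zero,
          mul_one]
      _ ≤ _ := by nlinarith

lemma integrableOn_rpow_mul_exp_heat (b : ℝ) {c u : ℝ} (hc : 0 < c) (hu : 0 < u) :
    IntegrableOn (fun t => t ^ b * rexp (-c / t) * rexp (-u * t)) (Ioi 0) := by
  obtain ⟨C, hC, h⟩ := exists_rpow_mul_exp_neg_div_le b hc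
  refine Integrable.mono' ((integrableOn_rpow_mul_exp |b| hu).const_mul C)
    (Measurable.aestronglyMeasurable (by fun_prop)) ?_
  filter_upwards [ae_mem_Ioi] with t ht
  have ht0 : 0 < t := ht
  rw [Real.norm_of_nonneg (by positivity), ← mul_assoc]
  have := h t ht0; gcongr

lemma integral_gaussian_Rn {n : ℕ} {t : ℝ} (ht : 0 < t) :
    ∫ x : Rn n, (4 * π * t) ^ (-((n : ℝ) / 2)) * rexp (-‖x‖ ^ 2 / (4 * t)) = 1 := by
  rw [integral_const_mul]
  have h := GaussianFourier.integral_rexp_neg_mul_sq_norm (V := Rn n) (b := 1 / (4 * t))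
    (by positivity)
  have h2 : ∀ x : Rn n, rexp (-‖x‖ ^ 2 / (4 * t)) = rexp (-(1 / (4 * t)) * ‖x‖ ^ 2) :=
    fun x => by congr 1; ring
  simp only [h2, h, finrank_euclideanSpace, Fintype.card_fin]
  have h3 : π / (1 / (4 * t)) = 4 * π * t := by field_simp
  rw [h3, ← rpow_add (by positivity), neg_add_cancel, rpow_zero]

lemma integrable_gaussian_Rn {n : ℕ} {t : ℝ} (ht : 0 < t) :
    Integrable fun x : Rn n => (4 * π * t) ^ (-((n : ℝ) / 2)) * rexp (-‖x‖ ^ 2 / (4 * t)) := by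
  by_contra h
  have := integral_gaussian_Rn (n := n) ht
  rw [integral_undef h] at this
  exact zero_ne_one this

lemma fourier_gaussian_Rn {n : ℕ} {t : ℝ} (ht : 0 < t) (ξ : Rn n) :
    𝓕 (fun x : Rn n => (((4 * π * t) ^ (-((n : ℝ) / 2)) * rexp (-‖x‖ ^ 2 / (4 * t)) : ℝ) : ℂ)) ξ =
      cexp (-t * ((2 * π * ‖ξ‖) ^ 2 : ℝ)) := by
  have h := fourier_gaussian_innerProductSpace (V := Rn n) (b := ((1 / (4 * t) : ℝ) : ℂ))
    (by rw [ofReal_re]; positivity) ξ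
  have h2 : (fun x : Rn n => (((4 * π * t) ^ (-((n : ℝ) / 2)) *
      rexp (-‖x‖ ^ 2 / (4 * t)) : ℝ) : ℂ)) =
      (((4 * π * t) ^ (-((n : ℝ) / 2)) : ℝ) : ℂ) •
        fun x : Rn n => cexp (-(1 / (4 * t) : ℝ) * (‖x‖ : ℂ) ^ 2) := by
    ext x
    simp only [Pi.smul_apply, smul_eq_mul]; push_cast; congr 2; ring
  rw [h2, fourier_eq]
  simp only [Pi.smul_apply, smul_comm _ (((4 * π * t) ^ (-((n : ℝ) / 2)) : ℝ) : ℂ)]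
  rw [integral_smul]
  rw [fourier_eq] at h
  rw [h, smul_eq_mul, finrank_euclideanSpace, Fintype.card_fin]
  have h3 : (π : ℂ) / ((1 / (4 * t) : ℝ) : ℂ) = ((4 * π * t : ℝ) : ℂ) := by
    push_cast
    have : (t : ℂ) ≠ 0 := mod_cast ht.ne'; field_simp
  have h4 : ((n : ℂ) / 2) = (((n : ℝ) / 2 : ℝ) : ℂ) := by push_cast; ring
  rw [h3, h4, ← ofReal_cpow (by positivity), ← mul_assoc, ← Complex.ofReal_mul,
    ← rpow_add (by positivity), neg_add_cancel, rpow_zero, ofReal_one, one_mul]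
  congr 1
  have : (t : ℂ) ≠ 0 := mod_cast ht.ne'; push_cast; field_simp; ring

lemma integrableOn_rpow_mul_exp_neg {a u : ℝ} (ha : 0 < a) (hu : 0 < u) :
    IntegrableOn (fun t => t ^ (a - 1) * rexp (-(u * t))) (Ioi 0) := by
  have := integrableOn_Ioi_comp_mul_left_iff (fun x => rexp (-x) * x ^ (a - 1)) 0 hu
  rw [mul_zero] at this
  have h3 := this.2 (Real.GammaIntegral_convergent ha)
  refine (h3.const_mul (u ^ (-(a - 1)))).congr ?_
  filter_upwards [ae_mem_Ioi] with t ht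
  have ht0 : 0 < t := ht
  rw [mul_rpow hu.le ht0.le, rpow_neg hu.le]
  have : u ^ (a - 1) ≠ 0 := (rpow_pos_of_pos hu _).ne'; field_simp

lemma integral_rpow_mul_cexp_neg {a : ℝ} (ha : 0 < a) {u : ℂ} (hu : 0 < u.re) :
    ∫ t in Ioi 0, (t ^ (a - 1) : ℝ) * cexp (-t * u) = u ^ (-(a : ℂ)) * Complex.Gamma a := by
  have hUo : IsOpen {z : ℂ | 0 < z.re} := isOpen_lt continuous_const continuous_re
  have hnorm : ∀ t > 0, ∀ z : ℂ, ‖(t ^ (a - 1) : ℝ) * cexp (-t * z)‖ =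
      t ^ (a - 1) * rexp (-(z.re * t)) := by
    intro t ht z
    rw [norm_mul, norm_of_nonneg (by positivity), norm_exp]; congr 2
    simp; ring
  refine eqOn_of_eq_on_pos (U := {z : ℂ | 0 < z.re}) hUo
    (convex_halfSpace_re_gt 0).isPreconnected (by simp)
    (f := fun u => ∫ t in Ioi 0, (t ^ (a - 1) : ℝ) * cexp (-t * u))
    (g := fun u => u ^ (-(a : ℂ)) * Complex.Gamma a) ?_ ?_ ?_ hu
  · refine differentiableOn_integral_of_dominated hUo (fun w hw => ?_)
      (Eventually.of_forall fun t => by fun_prop) (fun w hw => ?_)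
    · fun_prop
    · have hw0 : 0 < w.re := hw
      refine ⟨w.re / 2, by linarith, _, integrableOn_rpow_mul_exp_neg ha (half_pos hw0), ?_⟩
      filter_upwards [ae_mem_Ioi] with t ht w' hw' _
      rw [hnorm t ht]
      have ht0 : 0 < t := ht
      have h1 := (abs_re_le_norm (w' - w)).trans_lt (mem_ball_iff_norm.1 hw')
      rw [sub_re, abs_lt] at h1; gcongr; linarith
  · intro z hz
    refine DifferentiableAt.differentiableWithinAt ?_
    refine DifferentiableAt.mul_const ?_ _
    exact differentiableAt_id.cpow_const (Or.inl hz)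
  · intro r hr
    have := Complex.integral_cpow_mul_exp_neg_mul_Ioi (a := a) (by simpa using ha) hr
    rw [Complex.cpow_neg, ← Complex.inv_cpow _ _ (by rw [Complex.arg_ofReal_of_nonneg hr.le]; exact pi_pos.ne),
      ← one_div, ← this]
    refine setIntegral_congr_fun measurableSet_Ioi fun t ht => ?_
    have ht0 : 0 < t := ht
    rw [ofReal_cpow ht0.le]; push_cast; congr 2; ring

lemma integrable_heatPot_integrand {n : ℕ} {a : ℝ} (ha : 0 < a) {u : ℂ} (hu : 0 < u.re) :
    Integrable (fun q : ℝ × Rn n => (q.1 ^ (a - 1) * (4 * π * q.1) ^ (-((n : ℝ) / 2)) *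
      rexp (-‖q.2‖ ^ 2 / (4 * q.1)) : ℝ) * cexp (-q.1 * u))
      ((volume.restrict (Ioi 0)).prod volume) := by
  have hm : Measurable (fun q : ℝ × Rn n => (q.1 ^ (a - 1) * (4 * π * q.1) ^ (-((n : ℝ) / 2)) *
      rexp (-‖q.2‖ ^ 2 / (4 * q.1)) : ℝ) * cexp (-q.1 * u)) := by fun_prop
  have hnorm : ∀ t > 0, ∀ x : Rn n, ‖(t ^ (a - 1) * (4 * π * t) ^ (-((n : ℝ) / 2)) *
      rexp (-‖x‖ ^ 2 / (4 * t)) : ℝ) * cexp (-t * u)‖ =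
      (t ^ (a - 1) * rexp (-(u.re * t))) * ((4 * π * t) ^ (-((n : ℝ) / 2)) *
        rexp (-‖x‖ ^ 2 / (4 * t))) := by
    intro t ht x
    rw [norm_mul, norm_of_nonneg (by positivity), norm_exp]
    have : (-(t : ℂ) * u).re = -(u.re * t) := by simp; ring
    rw [this]; ring
  rw [integrable_prod_iff hm.aestronglyMeasurable]
  refine ⟨?_, ?_⟩
  · filter_upwards [ae_mem_Ioi] with t ht
    have hm' : Measurable fun x : Rn n => (t ^ (a - 1) * (4 * π * t) ^ (-((n : ℝ) / 2)) *
      rexp (-‖x‖ ^ 2 / (4 * t)) : ℝ) * cexp (-t * u) := by fun_prop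
    rw [← integrable_norm_iff hm'.aestronglyMeasurable]
    simp only [hnorm t ht]
    exact (integrable_gaussian_Rn ht).const_mul _
  · have h2 := integrableOn_rpow_mul_exp_neg ha hu
    refine h2.congr ?_
    filter_upwards [ae_mem_Ioi] with t ht
    simp only [hnorm t ht]
    rw [integral_const_mul, integral_gaussian_Rn ht, mul_one]

/-- The superposition of heat kernels is the kernel of a (Bessel) potential. -/
lemma fourier_heatPot {n : ℕ} {a : ℝ} (ha : 0 < a) {u : ℂ} (hu : 0 < u.re) :
    Integrable (fun x : Rn n => heatPot n a u ‖x‖) ∧ ∀ ξ : Rn n,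
      𝓕 (fun x : Rn n => heatPot n a u ‖x‖) ξ =
        (u + ((2 * π * ‖ξ‖) ^ 2 : ℝ)) ^ (-(a : ℂ)) * Complex.Gamma a := by
  have h := fourier_integral_of_integrable_prod
    (k := fun (t : ℝ) (x : Rn n) => (t ^ (a - 1) * (4 * π * t) ^ (-((n : ℝ) / 2)) *
      rexp (-‖x‖ ^ 2 / (4 * t)) : ℝ) * cexp (-t * u))
    (integrable_heatPot_integrand (n := n) ha hu)
  refine ⟨h.1, fun ξ => (h.2 ξ).trans ?_⟩
  have hv : 0 < (u + ((2 * π * ‖ξ‖) ^ 2 : ℝ)).re := by rw [add_re, ofReal_re]; positivity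
  rw [← integral_rpow_mul_cexp_neg ha hv]
  refine setIntegral_congr_fun measurableSet_Ioi fun t ht => ?_
  have ht0 : 0 < t := ht
  have h3 := fourier_gaussian_Rn (n := n) ht0 ξ
  have h2 : (fun x : Rn n => (t ^ (a - 1) * (4 * π * t) ^ (-((n : ℝ) / 2)) *
      rexp (-‖x‖ ^ 2 / (4 * t)) : ℝ) * cexp (-t * u)) =
      fun x : Rn n => ((t ^ (a - 1) : ℝ) * cexp (-t * u)) •
        (((4 * π * t) ^ (-((n : ℝ) / 2)) * rexp (-‖x‖ ^ 2 / (4 * t)) : ℝ) : ℂ) := by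
    ext x
    rw [smul_eq_mul]; push_cast; ring
  rw [h2, fourier_eq]
  simp only [smul_comm _ (((t ^ (a - 1) : ℝ) : ℂ) * cexp (-t * u))]
  rw [integral_smul]
  rw [fourier_eq] at h3
  rw [h3, smul_eq_mul, mul_assoc, ← exp_add]; congr 2; ring

/-! ### The Helmholtz kernel in dimension `n` -/

lemma integral_rpow_neg_half_mul_exp {σ r : ℝ} (hσ : 0 < σ) (hr : 0 < r) :
    ∫ t in Ioi 0, t ^ (-(1 / 2) : ℝ) * rexp (-r ^ 2 / (4 * t)) * rexp (-σ ^ 2 * t) =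
      sqrt π * rexp (-r * σ) / σ := by
  set S : ℝ → ℝ := fun x => sqrt (x ^ 2 + 2 * r * σ) with hS
  have hSsq : ∀ x, S x ^ 2 = x ^ 2 + 2 * r * σ := fun x => sq_sqrt (by positivity)
  have hSpos : ∀ x, 0 < S x := fun x => Real.sqrt_pos.2 (by positivity)
  have hSx : ∀ x, |x| < S x := fun x => Real.lt_sqrt_of_sq_lt (by rw [sq_abs]; nlinarith [mul_pos hr hσ])
  set u : ℝ → ℝ := fun x => (x + S x) / (2 * σ) with hu
  have hupos : ∀ x, 0 < u x := fun x => by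
    have := neg_abs_le x
    have := hSx x
    exact div_pos (by linarith) (by linarith)
  have hux : ∀ x, σ * u x - r / (2 * u x) = x := by
    intro x
    have h1 : x + S x ≠ 0 := by grind
    simp only [hu]; field_simp
    have := hSsq x; nlinarith
  have hSd : ∀ x, HasDerivAt S (x / S x) x := by
    intro x
    have h1 : HasDerivAt (fun x => x ^ 2 + 2 * r * σ) (2 * x) x := by
      simpa using (hasDerivAt_pow 2 x).add_const (2 * r * σ)
    have := h1.sqrt (by positivity)
    convert this using 1
    simp only [hS]; ring
  have hud : ∀ x, HasDerivAt u ((1 + x / S x) / (2 * σ)) x := fun x =>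
    ((hasDerivAt_id x).add (hSd x)).div_const (2 * σ)
  have hφd : ∀ x ∈ (univ : Set ℝ), HasDerivWithinAt (fun x => u x ^ 2)
      (2 * u x * ((1 + x / S x) / (2 * σ))) univ x := fun x _ => by
    have := ((hud x).pow 2).hasDerivWithinAt (s := univ)
    simp only [Nat.cast_ofNat, Nat.add_one_sub_one, pow_one] at this
    exact this
  have hinj : InjOn (fun x => u x ^ 2) univ := by
    intro x _ y _ hxy
    have h1 : u x = u y := by
      have : u x ^ 2 = u y ^ 2 := hxy
      exact (pow_left_inj₀ (hupos x).le (hupos y).le two_ne_zero).1 this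
    rw [← hux x, ← hux y, h1]
  have himg : (fun x => u x ^ 2) '' univ = Ioi 0 := by
    ext t
    constructor
    · aesop
    · intro ht
      have ht0 : 0 < t := ht
      have hst : 0 < sqrt t := Real.sqrt_pos.2 ht0
      refine ⟨σ * sqrt t - r / (2 * sqrt t), mem_univ _, ?_⟩
      have h1 : S (σ * sqrt t - r / (2 * sqrt t)) = σ * sqrt t + r / (2 * sqrt t) := by
        simp only [hS]
        rw [Real.sqrt_eq_iff_mul_self_eq (by positivity) (by positivity)]; field_simp; ring
      simp only [hu, h1]
      have h2 : (σ * sqrt t - r / (2 * sqrt t) +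
          (σ * sqrt t + r / (2 * sqrt t))) / (2 * σ) = sqrt t := by
        field_simp; ring
      rw [h2, sq_sqrt ht0.le]
  rw [← himg, integral_image_eq_integral_abs_deriv_smul MeasurableSet.univ hφd hinj,
    setIntegral_univ]
  have hcongr : ∀ x, |2 * u x * ((1 + x / S x) / (2 * σ))| • ((u x ^ 2) ^ (-(1 / 2) : ℝ) *
      rexp (-r ^ 2 / (4 * u x ^ 2)) * rexp (-σ ^ 2 * u x ^ 2)) =
      rexp (-r * σ) / σ * (rexp (-1 * x ^ 2) + rexp (-1 * x ^ 2) * (x / S x)) := by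
    intro x
    have h1 : 0 < 1 + x / S x := by
      have : |x / S x| < 1 := by
        rw [abs_div, abs_of_pos (hSpos x), div_lt_one (hSpos x)]
        exact hSx x
      linarith [(abs_lt.1 this).1]
    have h2 : (u x ^ 2) ^ (-(1 / 2) : ℝ) = (u x)⁻¹ := by
      rw [rpow_neg (by positivity), ← Real.sqrt_eq_rpow, Real.sqrt_sq (hupos x).le]
    have h3 : rexp (-r ^ 2 / (4 * u x ^ 2)) * rexp (-σ ^ 2 * u x ^ 2) =
        rexp (-r * σ) * rexp (-1 * x ^ 2) := by
      rw [← Real.exp_add, ← Real.exp_add]; congr 1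
      conv_rhs => rw [← hux x]
      have := (hupos x).ne'; field_simp; ring
    rw [abs_of_pos (mul_pos (mul_pos two_pos (hupos x)) (div_pos h1 (by positivity))), smul_eq_mul,
      h2, mul_assoc (u x)⁻¹, h3]
    have := (hupos x).ne'; field_simp
  simp only [hcongr]
  have hi1 : Integrable fun x => rexp (-1 * x ^ 2) := integrable_exp_neg_mul_sq one_pos
  have hmS : Measurable S := by simp only [hS]; fun_prop
  have hi2 : Integrable fun x => rexp (-1 * x ^ 2) * (x / S x) := by
    refine hi1.mono (Measurable.aestronglyMeasurable (by fun_prop)) (Eventually.of_forall fun x => ?_)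
    rw [norm_mul, norm_div, norm_eq_abs x, Real.norm_of_nonneg (hSpos x).le]
    refine mul_le_of_le_one_right (norm_nonneg _) ?_
    exact (div_le_one (hSpos x)).2 (hSx x).le
  have hodd : ∫ x : ℝ, rexp (-1 * x ^ 2) * (x / S x) = 0 := by
    have h1 := integral_neg_eq_self (fun x => rexp (-1 * x ^ 2) * (x / S x)) volume
    have h2 : ∀ x : ℝ, rexp (-1 * (-x) ^ 2) * (-x / S (-x)) =
        -(rexp (-1 * x ^ 2) * (x / S x)) := fun x => by
      simp only [hS, neg_sq]; ring
    simp only [h2, integral_neg] at h1; linarith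
  rw [integral_const_mul, integral_add hi1 hi2, hodd, integral_gaussian, div_one, add_zero]; ring

/-- The normalising constant of the Helmholtz kernel in dimension `n`. -/
def helmC (n : ℕ) : ℝ :=
  (4 * π) ^ (-((n : ℝ) / 2)) * (2 * sqrt π) / Gamma (ord(n) + 1)

lemma heatPot_one_eq {n : ℕ} (hn : 3 ≤ n) {κ r : ℝ} (hκ : 0 < κ) (hr : 0 < r) :
    heatPot n 1 ((κ : ℂ) ^ 2) r = (helmC n * r ^ (2 - (n : ℝ)) : ℝ) * mac ord(n) (κ * r) := by
  set p : ℝ := ord(n) with hp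
  have hn' : (3 : ℝ) ≤ n := mod_cast hn
  have hp0 : 0 ≤ p := by rw [hp]; linarith
  have hG : 0 < Gamma (p + 1) := Real.Gamma_pos_of_pos (by linarith)
  set f : ℝ → ℝ → ℝ := fun t y => y ^ p * rexp (-(t * y)) *
    (t ^ (-(1 / 2) : ℝ) * rexp (-r ^ 2 / (4 * t)) * rexp (-κ ^ 2 * t)) with hf
  have hty : ∀ t > 0, ∫ y in Ioi 0, y ^ p * rexp (-(t * y)) = t ^ (-(p + 1)) * Gamma (p + 1) := by
    intro t ht
    have := Real.integral_rpow_mul_exp_neg_mul_Ioi (a := p + 1) (r := t) (by linarith) ht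
    rw [add_sub_cancel_right] at this
    rw [this, rpow_neg ht.le, one_div, Real.inv_rpow ht.le]
  have hmeas : Measurable (fun q : ℝ × ℝ => f q.1 q.2) := by fun_prop
  have hint : Integrable (fun q : ℝ × ℝ => f q.1 q.2)
      ((volume.restrict (Ioi 0)).prod (volume.restrict (Ioi 0))) := by
    rw [integrable_prod_iff hmeas.aestronglyMeasurable]
    constructor
    · filter_upwards [ae_mem_Ioi] with t ht
      have := integrableOn_rpow_mul_exp_neg (a := p + 1) (by linarith) (show 0 < t from ht)
      rw [add_sub_cancel_right] at this
      exact this.mul_const _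
    · have h1 := integrableOn_rpow_mul_exp_heat (-(p + 1) + -(1 / 2)) (c := r ^ 2 / 4)
        (u := κ ^ 2) (by positivity) (by positivity)
      refine (h1.mul_const (Gamma (p + 1))).congr ?_
      filter_upwards [ae_mem_Ioi] with t ht
      have ht0 : 0 < t := ht
      have h2 : ∫ y in Ioi 0, ‖f t y‖ = ∫ y in Ioi 0, f t y :=
        setIntegral_congr_fun measurableSet_Ioi fun y hy => by
          have hy0 : 0 < y := hy
          exact Real.norm_of_nonneg (by simp only [hf]; positivity)
      rw [h2]
      simp only [hf]
      rw [integral_mul_const, hty t ht0, rpow_add ht0]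
      have : -(r ^ 2 / 4) / t = -r ^ 2 / (4 * t) := by field_simp
      rw [this]; ring
  have hswap := integral_integral_swap (f := f) hint
  have hL : ∫ t in Ioi 0, ∫ y in Ioi 0, f t y =
      Gamma (p + 1) * (4 * π) ^ ((n : ℝ) / 2) * ∫ t in Ioi 0,
        (t ^ ((1 : ℝ) - 1) * (4 * π * t) ^ (-((n : ℝ) / 2)) * rexp (-r ^ 2 / (4 * t))) *
        rexp (-t * κ ^ 2) := by
    rw [← integral_const_mul]
    refine setIntegral_congr_fun measurableSet_Ioi fun t ht => ?_
    have ht0 : 0 < t := ht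
    simp only [hf]
    rw [integral_mul_const, hty t ht0, sub_self, rpow_zero,
      mul_rpow (by positivity) ht0.le, rpow_neg (by positivity : (0 : ℝ) ≤ 4 * π)]
    have h1 : (4 * π) ^ ((n : ℝ) / 2) ≠ 0 := (rpow_pos_of_pos (by positivity) _).ne'
    have h2 : t ^ (-((n : ℝ) / 2)) = t ^ (-(p + 1)) * t ^ (-(1 / 2) : ℝ) := by
      rw [← rpow_add ht0]; congr 1
      rw [hp]; ring
    rw [h2]
    have h3 : -κ ^ 2 * t = -t * κ ^ 2 := by ring
    rw [h3]; field_simp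
  have hR1 : ∫ y in Ioi 0, ∫ t in Ioi 0, f t y = ∫ y in Ioi 0, y ^ p * (sqrt π *
        rexp (-r * sqrt (κ ^ 2 + y)) / sqrt (κ ^ 2 + y)) := by
    refine setIntegral_congr_fun measurableSet_Ioi fun y hy => ?_
    have hy0 : 0 < y := hy
    rw [← integral_rpow_neg_half_mul_exp (Real.sqrt_pos.2 (by positivity : 0 < κ ^ 2 + y)) hr,
      ← integral_const_mul]
    refine setIntegral_congr_fun measurableSet_Ioi fun t ht => ?_
    simp only [hf]
    rw [sq_sqrt (by positivity)]
    have : rexp (-(κ ^ 2 + y) * t) = rexp (-(t * y)) * rexp (-κ ^ 2 * t) := by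
      rw [← Real.exp_add]; congr 1; ring
    rw [this]; ring
  have hR2 : ∫ y in Ioi 0, y ^ p * (sqrt π * rexp (-r * sqrt (κ ^ 2 + y)) / sqrt (κ ^ 2 + y)) =
      2 * sqrt π * rexp (-(r * κ)) * ∫ s in Ioi 0, rexp (-(r * s)) * (s * (s + 2 * κ)) ^ p := by
    have himg : (fun s => s * (s + 2 * κ)) '' Ioi 0 = Ioi 0 := by
      ext y
      constructor
      · rintro ⟨s, hs, rfl⟩
        have hs0 : 0 < s := hs
        exact mul_pos hs0 (by positivity)
      · intro hy
        have hy0 : 0 < y := hy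
        refine ⟨sqrt (κ ^ 2 + y) - κ, ?_, ?_⟩
        · exact sub_pos.2 (Real.lt_sqrt_of_sq_lt (by linarith))
        · have := sq_sqrt (by positivity : 0 ≤ κ ^ 2 + y)
          simp only; nlinarith
    have hinj : InjOn (fun s => s * (s + 2 * κ)) (Ioi 0) := by
      intro s hs s' hs' h
      have hs0 : 0 < s := hs
      have hs0' : 0 < s' := hs'
      have h1 : (s - s') * (s + s' + 2 * κ) = 0 := by linarith
      rcases mul_eq_zero.1 h1 with h2 | h2
      · linarith
      · linarith
    conv_lhs => rw [← himg]
    rw [integral_image_eq_integral_abs_deriv_smul (f' := fun s => 2 * (s + κ)) measurableSet_Ioi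
      (fun s _ => ?_) hinj, ← integral_const_mul]
    · refine setIntegral_congr_fun measurableSet_Ioi fun s hs => ?_
      have hs0 : 0 < s := hs
      have h1 : sqrt (κ ^ 2 + s * (s + 2 * κ)) = s + κ := by
        rw [show κ ^ 2 + s * (s + 2 * κ) = (s + κ) ^ 2 by ring, Real.sqrt_sq (by positivity)]
      rw [h1, abs_of_pos (by positivity), smul_eq_mul,
        show -r * (s + κ) = -(r * κ) + -(r * s) by ring, Real.exp_add]
      field_simp
    · refine HasDerivAt.hasDerivWithinAt ?_
      have h1 := (hasDerivAt_id' s).fun_mul ((hasDerivAt_id' s).add_const (2 * κ))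
      rwa [show 1 * (s + 2 * κ) + s * 1 = 2 * (s + κ) by ring] at h1
  have hR3 : ((∫ s in Ioi 0, rexp (-(r * s)) * (s * (s + 2 * κ)) ^ p : ℝ) : ℂ) =
      (r ^ (-(2 * p + 1)) : ℝ) * macF p (κ * r) := by
    have := integral_exp_mul_cpow (p := p) hr (z := (κ : ℂ)) (Or.inl (by simpa using hκ))
    rw [mul_comm (κ : ℂ), ← this, ← integral_complex_ofReal]
    refine setIntegral_congr_fun measurableSet_Ioi fun s hs => ?_
    have hs0 : 0 < s := hs
    rw [Complex.ofReal_mul, ofReal_cpow (by positivity)]; push_cast; rfl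
  rw [hL, hR1, hR2] at hswap
  have hheat : heatPot n 1 ((κ : ℂ) ^ 2) r = ((∫ t in Ioi 0,
      (t ^ ((1 : ℝ) - 1) * (4 * π * t) ^ (-((n : ℝ) / 2)) * rexp (-r ^ 2 / (4 * t))) *
        rexp (-t * κ ^ 2) : ℝ) : ℂ) := by
    rw [heatPot, ← integral_complex_ofReal]
    refine setIntegral_congr_fun measurableSet_Ioi fun t _ => ?_; push_cast; rfl
  have h4 : (4 * π) ^ ((n : ℝ) / 2) ≠ 0 := (rpow_pos_of_pos (by positivity) _).ne'
  have hfin : (∫ t in Ioi 0,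
      (t ^ ((1 : ℝ) - 1) * (4 * π * t) ^ (-((n : ℝ) / 2)) * rexp (-r ^ 2 / (4 * t))) *
        rexp (-t * κ ^ 2)) = helmC n * rexp (-(r * κ)) *
      ∫ s in Ioi 0, rexp (-(r * s)) * (s * (s + 2 * κ)) ^ p := by
    rw [helmC, ← hp, rpow_neg (by positivity)]
    have aux : ∀ G P E T J₁ J₂ : ℝ, G ≠ 0 → P ≠ 0 → G * P * J₁ = T * E * J₂ →
        J₁ = P⁻¹ * T / G * E * J₂ := by
      intro G P E T J₁ J₂ hG hP h; field_simp; linarith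
    exact aux _ _ _ _ _ _ hG.ne' h4 hswap
  rw [hheat, hfin, Complex.ofReal_mul, hR3, mac]
  have h5 : -(2 * p + 1) = 2 - (n : ℝ) := by rw [hp]; ring
  rw [h5]; push_cast
  rw [mul_comm (r : ℂ) κ]; ring

/-- The kernel of `(-Δ + κ²)⁻¹` on `ℝⁿ`, `n ≥ 3`. -/
def helm (n : ℕ) (κ : ℂ) (r : ℝ) : ℂ :=
  (helmC n * r ^ (2 - (n : ℝ)) : ℝ) * mac ord(n) (κ * r)

lemma helmC_pos {n : ℕ} (hn : 3 ≤ n) : 0 < helmC n := by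
  have hn' : (3 : ℝ) ≤ n := mod_cast hn
  have := Real.Gamma_pos_of_pos (by linarith : 0 < ord(n) + 1)
  have := pi_pos
  rw [helmC]; positivity

lemma norm_helm_le {n : ℕ} (hn : 3 ≤ n) (κ : ℂ) {r : ℝ} (hr : 0 ≤ r) :
    ‖helm n κ r‖ ≤ helmC n * macConst ord(n) *
      (r ^ (2 - (n : ℝ)) * (1 + 2 * ‖κ‖ * r) ^ ord(n) * rexp (-κ.re * r)) := by
  have hn' : (3 : ℝ) ≤ n := mod_cast hn
  have h := norm_mac_le (p := ord(n)) (by linarith) (κ * r)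
  have h0 : 0 ≤ helmC n * r ^ (2 - (n : ℝ)) := mul_nonneg (helmC_pos hn).le (rpow_nonneg hr _)
  rw [helm, norm_mul, norm_of_nonneg h0]
  refine (mul_le_mul_of_nonneg_left h h0).trans (le_of_eq ?_)
  rw [norm_mul, norm_of_nonneg hr]
  have : -(κ * r).re = -κ.re * r := by simp
  rw [this, ← mul_assoc 2 ‖κ‖ r]; ring

lemma integrable_helm_bound {n : ℕ} (hn : 3 ≤ n) {R δ : ℝ} (hR : 0 ≤ R) (hδ : 0 < δ) :
    Integrable fun x : Rn n => ‖x‖ ^ (2 - (n : ℝ)) * (1 + 2 * R * ‖x‖) ^ ord(n) *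
      rexp (-δ * ‖x‖) := by
  have hn' : (3 : ℝ) ≤ n := mod_cast hn
  have : Nontrivial (Rn n) := by
    have : Nonempty (Fin n) := ⟨⟨0, by omega⟩⟩
    infer_instance
  rw [integrable_fun_norm_addHaar (volume : Measure (Rn n)) (f := fun r => r ^ (2 - (n : ℝ)) *
    (1 + 2 * R * r) ^ ord(n) * rexp (-δ * r))]
  rw [finrank_euclideanSpace, Fintype.card_fin]
  refine Integrable.mono' ((integrableOn_rpow_mul_exp (1 + ord(n)) hδ).const_mul
    ((1 + 2 * R) ^ ord(n))) (Measurable.aestronglyMeasurable (by fun_prop)) ?_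
  filter_upwards [ae_mem_Ioi] with r hr
  have hr0 : 0 < r := hr
  have h1 : r ^ (n - 1) * r ^ (2 - (n : ℝ)) = r := by
    rw [← rpow_natCast, ← rpow_add hr0, Nat.cast_sub (by omega)]; norm_num
  have h2 : (1 + 2 * R * r) ^ ord(n) ≤ (1 + 2 * R) ^ ord(n) * (1 + r) ^ ord(n) := by
    rw [← mul_rpow (by positivity) (by positivity)]
    exact rpow_le_rpow (by positivity) (by nlinarith) (by linarith)
  rw [Real.norm_of_nonneg (by simp only [smul_eq_mul]; positivity), smul_eq_mul, ← mul_assoc, ← mul_assoc, h1,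
    rpow_add (by positivity), Real.rpow_one]
  have h3 : r ≤ 1 + r := by linarith
  calc _ ≤ (1 + r) * ((1 + 2 * R) ^ ord(n) * (1 + r) ^ ord(n)) * rexp (-δ * r) := by gcongr
    _ = _ := by ring

lemma mul_ofReal_mem_slitPlane {κ : ℂ} (hκ : 0 < κ.re) {r : ℝ} (hr : 0 < r) :
    κ * r ∈ slitPlane := Or.inl (by simpa using mul_pos hκ hr)

lemma continuousOn_helm {n : ℕ} (hn : 3 ≤ n) {κ : ℂ} (hκ : 0 < κ.re) :
    ContinuousOn (helm n κ) (Ioi 0) := by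
  have hn' : (3 : ℝ) ≤ n := mod_cast hn
  have h1 : ContinuousOn (fun r => ((helmC n * r ^ (2 - (n : ℝ)) : ℝ) : ℂ)) (Ioi 0) :=
    continuous_ofReal.comp_continuousOn
      (continuousOn_const.mul (continuousOn_id.rpow_const fun r hr => Or.inl (ne_of_gt hr)))
  refine h1.mul ((differentiableOn_mac (p := ord(n)) (by linarith)).continuousOn.comp
    (by fun_prop) fun r hr => mul_ofReal_mem_slitPlane hκ hr)

lemma aestronglyMeasurable_radial {n : ℕ} (hn : 0 < n) {f : ℝ → ℂ} (hf : ContinuousOn f (Ioi 0)) :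
    AEStronglyMeasurable (fun x : Rn n => f ‖x‖) volume := by
  have : Nonempty (Fin n) := ⟨⟨0, hn⟩⟩
  have h0 : (volume.restrict ({0}ᶜ : Set (Rn n))) = volume :=
    Measure.restrict_eq_self_of_ae_mem (compl_mem_ae_iff.2 (measure_singleton 0))
  rw [← h0]
  refine ContinuousOn.aestronglyMeasurable ?_ (measurableSet_singleton 0).compl
  exact hf.comp continuous_norm.continuousOn fun x hx => norm_pos_iff.2 hx

lemma integrable_helm {n : ℕ} (hn : 3 ≤ n) {κ : ℂ} (hκ : 0 < κ.re) :
    Integrable fun x : Rn n => helm n κ ‖x‖ := by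
  refine Integrable.mono' ((integrable_helm_bound hn (norm_nonneg κ) hκ).const_mul
    (helmC n * macConst ord(n)))
    (aestronglyMeasurable_radial (by omega) (continuousOn_helm hn hκ))
    (Eventually.of_forall fun x => norm_helm_le hn κ (norm_nonneg x))

lemma sq_add_ne_zero {κ : ℂ} (hκ : 0 < κ.re) (s : ℝ) : ((s ^ 2 : ℝ) : ℂ) + κ ^ 2 ≠ 0 := by
  intro h
  have h1 : ((s : ℂ) + I * κ) * (s - I * κ) = 0 := by
    rw [← h]; push_cast; ring_nf
    rw [I_sq]; ring
  rcases mul_eq_zero.1 h1 with h2 | h2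
  · have := congrArg Complex.im h2
    simp at this; linarith
  · have := congrArg Complex.im h2
    simp at this; linarith

lemma fourier_helm {n : ℕ} (hn : 3 ≤ n) {κ : ℂ} (hκ : 0 < κ.re) (ξ : Rn n) :
    𝓕 (fun x : Rn n => helm n κ ‖x‖) ξ = (((2 * π * ‖ξ‖) ^ 2 : ℝ) + κ ^ 2)⁻¹ := by
  have hn' : (3 : ℝ) ≤ n := mod_cast hn
  have hUo : IsOpen {z : ℂ | 0 < z.re} := isOpen_lt continuous_const continuous_re
  have hne : ∀ᵐ x : Rn n, x ≠ 0 := by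
    have : Nonempty (Fin n) := ⟨⟨0, by omega⟩⟩
    exact compl_mem_ae_iff.2 (measure_singleton 0)
  refine eqOn_of_eq_on_pos (U := {z : ℂ | 0 < z.re}) hUo
    (convex_halfSpace_re_gt 0).isPreconnected (by simp)
    (f := fun κ => 𝓕 (fun x : Rn n => helm n κ ‖x‖) ξ)
    (g := fun κ => (((2 * π * ‖ξ‖) ^ 2 : ℝ) + κ ^ 2)⁻¹) ?_ ?_ ?_ hκ
  · simp only [fourier_eq, Circle.smul_def]
    refine differentiableOn_integral_of_dominated hUo (fun w hw => ?_) ?_ (fun w hw => ?_)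
    · have h3 : Continuous fun v : Rn n => ((fourierChar (-(inner ℝ v ξ)) : Circle) : ℂ) :=
        continuous_subtype_val.comp (Real.continuous_fourierChar.comp (by fun_prop))
      exact h3.aestronglyMeasurable.smul (integrable_helm hn hw).1
    · filter_upwards [hne] with x hx
      simp only [helm, smul_eq_mul]
      refine DifferentiableOn.const_mul ?_ _
      refine DifferentiableOn.const_mul ?_ _
      exact (differentiableOn_mac (p := ord(n)) (by linarith)).comp
        (by fun_prop) fun κ hκ => mul_ofReal_mem_slitPlane hκ (norm_pos_iff.2 hx)
    · have hw0 : 0 < w.re := hw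
      refine ⟨w.re / 2, by linarith, _, (integrable_helm_bound hn
        (R := ‖w‖ + w.re / 2) (by positivity) (half_pos hw0)).const_mul
        (helmC n * macConst ord(n)), ?_⟩
      refine Eventually.of_forall fun x w' hw' _ => ?_
      rw [norm_smul, Circle.norm_coe, one_mul]
      refine (norm_helm_le hn w' (norm_nonneg x)).trans ?_
      have h0 := mem_ball_iff_norm.1 hw'
      have h1 := (abs_re_le_norm (w' - w)).trans_lt h0
      rw [sub_re, abs_lt] at h1
      have h2 : ‖w'‖ ≤ ‖w‖ + w.re / 2 := by
        have := norm_add_le w (w' - w)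
        rw [add_sub_cancel] at this; linarith
      have h3 := macConst_nonneg ord(n)
      have h4 := (helmC_pos hn).le
      have h5 : 0 ≤ ord(n) := by linarith
      gcongr; linarith
  · intro z hz
    refine DifferentiableAt.differentiableWithinAt (DifferentiableAt.inv (by fun_prop) ?_)
    exact sq_add_ne_zero hz _
  · intro t ht
    have h1 : 0 < ((t : ℂ) ^ 2).re := by rw [← ofReal_pow, ofReal_re]; positivity
    have h2 := (fourier_heatPot (n := n) one_pos h1).2 ξ
    have h3 : 𝓕 (fun x : Rn n => helm n t ‖x‖) ξ =
        𝓕 (fun x : Rn n => heatPot n 1 ((t : ℂ) ^ 2) ‖x‖) ξ := by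
      rw [fourier_eq, fourier_eq]
      refine integral_congr_ae ?_
      filter_upwards [hne] with x hx
      rw [heatPot_one_eq hn ht (norm_pos_iff.2 hx), helm]
    rw [h3, h2, ofReal_one, Complex.cpow_neg_one, Complex.Gamma_one, mul_one, add_comm]

/-! ### Contour integrals along the boundary of a sector -/

lemma integral_line_eq_of_strip {h : ℂ → ℂ} {θ : ℝ} (hθ : 0 < θ)
    (hd : DifferentiableOn ℂ h {z | |z.im| ≤ θ}) {C c R : ℝ} (hc : 0 < c)
    (hb : ∀ z : ℂ, |z.im| ≤ θ → R ≤ |z.re| → ‖h z‖ ≤ C * rexp (-c * |z.re|)) :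
    ∫ x : ℝ, h (x - θ * I) = ∫ x : ℝ, h (x + θ * I) := by
  have hline : ∀ y : ℝ, |y| ≤ θ → Integrable fun x : ℝ => h (x + y * I) := by
    intro y hy
    have hcont : Continuous fun x : ℝ => h (x + y * I) := by
      refine continuousOn_univ.1 (hd.continuousOn.comp (by fun_prop) fun x _ => ?_)
      simpa using hy
    have hO : ∀ l : Filter ℝ, Tendsto (fun x : ℝ => |x|) l atTop →
        (fun x => h (x + y * I)) =O[l] fun x : ℝ => rexp (-c * |x|) := by
      intro l hl
      refine Asymptotics.IsBigO.of_bound C ?_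
      filter_upwards [hl.eventually_ge_atTop R] with x hx
      rw [Real.norm_of_nonneg (exp_pos _).le]
      simpa using hb (x + y * I) (by simpa using hy) (by simpa using hx)
    have h1 := exp_neg_integrableOn_Ioi 0 hc
    have h2 := IntegrableOn.comp_neg_Iio (c := 0) (f := fun x : ℝ => rexp (-c * x))
      (by rw [neg_zero]; exact h1)
    refine hcont.locallyIntegrable.integrable_of_isBigO_atBot_atTop
      (g := fun x => rexp (-c * -x)) (g' := fun x => rexp (-c * x)) ?_
      ⟨_, Iio_mem_atBot 0, h2⟩ ?_ ⟨_, Ioi_mem_atTop 0, h1⟩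
    · refine (hO atBot tendsto_abs_atBot_atTop).trans (Asymptotics.IsBigO.of_bound 1 ?_)
      filter_upwards [eventually_le_atBot 0] with x hx
      rw [abs_of_nonpos hx, one_mul]
    · refine (hO atTop tendsto_abs_atTop_atTop).trans (Asymptotics.IsBigO.of_bound 1 ?_)
      filter_upwards [eventually_ge_atTop 0] with x hx
      rw [abs_of_nonneg hx, one_mul]
  have hlim : ∀ y : ℝ, |y| ≤ θ → Tendsto (fun T : ℝ => ∫ x in (-T)..T, h (x + y * I)) atTop
      (𝓝 (∫ x : ℝ, h (x + y * I))) := fun y hy =>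
    intervalIntegral_tendsto_integral (hline y hy) tendsto_neg_atTop_atBot tendsto_id
  have hside : ∀ s : ℝ, |s| = 1 → Tendsto (fun T : ℝ => ∫ y in (-θ)..θ, h ((s * T : ℝ) + y * I))
      atTop (𝓝 0) := by
    intro s hs
    have h0 : Tendsto (fun T : ℝ => C * rexp (-c * T) * |θ - -θ|) atTop (𝓝 0) := by
      have : Tendsto (fun T : ℝ => rexp (-c * T)) atTop (𝓝 0) := by
        refine Real.tendsto_exp_atBot.comp ?_
        exact tendsto_id.const_mul_atTop_of_neg (by linarith)
      simpa using (this.const_mul C).mul_const |θ - -θ|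
    refine squeeze_zero_norm' ?_ h0
    filter_upwards [eventually_ge_atTop (max R 0)] with T hT
    have hT0 : 0 ≤ T := (le_max_right _ _).trans hT
    refine intervalIntegral.norm_integral_le_of_norm_le_const fun y hy => ?_
    rw [uIoc_of_le (by linarith)] at hy
    have := hb ((s * T : ℝ) + y * I) (by simpa [abs_le] using ⟨hy.1.le, hy.2⟩)
      (by simpa [abs_mul, hs, abs_of_nonneg hT0] using (le_max_left _ _).trans hT)
    simpa [abs_mul, hs, abs_of_nonneg hT0] using this
  have hrect : ∀ T : ℝ, (∫ x in (-T)..T, h (x + (-θ : ℝ) * I)) -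
      (∫ x in (-T)..T, h (x + (θ : ℂ) * I)) +
      I * (∫ y in (-θ)..θ, h (((1 * T : ℝ) : ℂ) + y * I)) -
      I * (∫ y in (-θ)..θ, h (((-1 * T : ℝ) : ℂ) + y * I)) = 0 := by
    intro T
    have := Complex.integral_boundary_rect_eq_zero_of_differentiableOn h
      (((-T : ℝ) : ℂ) + (-θ : ℝ) * I) ((T : ℂ) + (θ : ℂ) * I) ?_
    · simpa using this
    · refine hd.mono fun z hz => ?_
      have := hz.2
      simp only [add_im, ofReal_im, mul_im, ofReal_re,
        I_im, I_re, mul_zero, mul_one, add_zero, zero_add, mem_preimage] at this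
      rw [uIcc_of_le (by linarith)] at this
      exact abs_le.2 this
  have hfin := (((hlim (-θ) (by simp [abs_of_pos hθ])).sub (hlim θ (by simp [abs_of_pos hθ]))).add
    ((hside 1 (by simp)).const_mul I)).sub ((hside (-1) (by simp)).const_mul I)
  simp only [hrect, mul_zero, add_zero, sub_zero] at hfin
  have := tendsto_nhds_unique hfin tendsto_const_nhds
  rw [sub_eq_zero] at this
  simpa [sub_eq_add_neg] using this

/-- The closed sector of half-opening `θ`, without its vertex. -/
def closedSector (θ : ℝ) : Set ℂ := {w | w ≠ 0 ∧ |w.arg| ≤ θ}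

/-- The point at distance `τ` on the ray of argument `θ`. -/
def ray (θ τ : ℝ) : ℂ := τ * cexp (θ * I)

lemma norm_ray (θ : ℝ) {τ : ℝ} (hτ : 0 ≤ τ) : ‖ray θ τ‖ = τ := by
  rw [ray, norm_mul, norm_exp_ofReal_mul_I, mul_one, norm_of_nonneg hτ]

lemma arg_ray {θ : ℝ} (hθ : |θ| < π) {τ : ℝ} (hτ : 0 < τ) : (ray θ τ).arg = θ := by
  rw [ray, Complex.arg_real_mul _ hτ, Complex.arg_exp_mul_I, toIocMod_eq_self Real.two_pi_pos]
  have := abs_lt.1 hθ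
  constructor <;> linarith [this.1, this.2]

lemma ray_mem_closedSector {θ θ' : ℝ} (hθ : |θ| < π) (h : |θ| ≤ θ') {τ : ℝ} (hτ : 0 < τ) :
    ray θ τ ∈ closedSector θ' := by
  refine ⟨?_, by rwa [arg_ray hθ hτ]⟩
  rw [← norm_pos_iff, norm_ray θ hτ.le]
  exact hτ

lemma exp_mem_closedSector {θ : ℝ} (hθ : θ < π) {z : ℂ} (hz : |z.im| ≤ θ) :
    cexp z ∈ closedSector θ := by
  refine ⟨Complex.exp_ne_zero _, ?_⟩
  rw [Complex.arg_exp, (toIocMod_eq_self Real.two_pi_pos).2]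
  · exact hz
  · grind

lemma integral_Ioi_eq_integral_exp (G : ℝ → ℂ) :
    ∫ τ in Ioi 0, G τ = ∫ x : ℝ, rexp x • G (rexp x) := by
  have himg : rexp '' univ = Ioi 0 := by simp
  rw [← himg, integral_image_eq_integral_abs_deriv_smul MeasurableSet.univ
    (fun x _ => (Real.hasDerivAt_exp x).hasDerivWithinAt) Real.exp_injective.injOn, setIntegral_univ]
  simp only [abs_of_pos (exp_pos _)]

/-- `(2πi)⁻¹ (∫_{arg ζ = -θ} - ∫_{arg ζ = θ}) q(ζ) 2ζ dζ`. -/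
def rayDiff (θ : ℝ) (q : ℂ → ℂ) : ℂ :=
  (2 * π * I)⁻¹ * ((∫ τ in Ioi 0, q (ray (-θ) τ) * (2 * τ * cexp (-θ * I) ^ 2)) -
      ∫ τ in Ioi 0, q (ray θ τ) * (2 * τ * cexp (θ * I) ^ 2))

/-- The integrals that define `rayDiff` converge absolutely. -/
def RayIntegrable (θ : ℝ) (q : ℂ → ℂ) : Prop :=
  IntegrableOn (fun τ => q (ray (-θ) τ) * (2 * τ * cexp (-θ * I) ^ 2)) (Ioi 0) ∧
    IntegrableOn (fun τ => q (ray θ τ) * (2 * τ * cexp (θ * I) ^ 2)) (Ioi 0)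

lemma RayIntegrable.add {θ : ℝ} {q q' : ℂ → ℂ} (h : RayIntegrable θ q) (h' : RayIntegrable θ q') :
    RayIntegrable θ (fun ζ => q ζ + q' ζ) := by
  refine ⟨(h.1.add h'.1).congr ?_, (h.2.add h'.2).congr ?_⟩ <;>
  · refine Eventually.of_forall fun τ => ?_
    simp only [Pi.add_apply]; ring

lemma RayIntegrable.const_mul {θ : ℝ} {q : ℂ → ℂ} (h : RayIntegrable θ q) (c : ℂ) :
    RayIntegrable θ (fun ζ => c * q ζ) := by
  refine ⟨(h.1.const_mul c).congr ?_, (h.2.const_mul c).congr ?_⟩ <;>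
  · refine Eventually.of_forall fun τ => ?_
    simp only; ring

lemma rayDiff_add {θ : ℝ} {q q' : ℂ → ℂ} (h : RayIntegrable θ q) (h' : RayIntegrable θ q') :
    rayDiff θ (fun ζ => q ζ + q' ζ) = rayDiff θ q + rayDiff θ q' := by
  simp only [rayDiff, add_mul]
  rw [integral_add h.1 h'.1, integral_add h.2 h'.2]; ring

lemma rayDiff_const_mul {θ : ℝ} (q : ℂ → ℂ) (c : ℂ) :
    rayDiff θ (fun ζ => c * q ζ) = c * rayDiff θ q := by
  simp only [rayDiff, mul_assoc]
  rw [integral_const_mul, integral_const_mul]; ring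

lemma RayIntegrable.sub {θ : ℝ} {q q' : ℂ → ℂ} (h : RayIntegrable θ q) (h' : RayIntegrable θ q') :
    RayIntegrable θ (fun ζ => q ζ - q' ζ) := by
  simpa [sub_eq_add_neg] using h.add (h'.const_mul (-1))

lemma rayDiff_sub {θ : ℝ} {q q' : ℂ → ℂ} (h : RayIntegrable θ q) (h' : RayIntegrable θ q') :
    rayDiff θ (fun ζ => q ζ - q' ζ) = rayDiff θ q - rayDiff θ q' := by
  have := rayDiff_add h (h'.const_mul (-1))
  rw [rayDiff_const_mul] at this
  simpa [sub_eq_add_neg] using this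

/-- The two rays, as a set. -/
def rays (θ : ℝ) : Set ℂ := {w | ∃ τ > 0, (w = ray (-θ) τ ∨ w = ray θ τ)}

lemma rayDiff_congr {θ : ℝ} {q q' : ℂ → ℂ} (h : ∀ ζ ∈ rays θ, q ζ = q' ζ) :
    rayDiff θ q = rayDiff θ q' := by
  have h1 : ∀ τ ∈ Ioi 0, q (ray (-θ) τ) = q' (ray (-θ) τ) := fun τ hτ => h _ ⟨τ, hτ, Or.inl rfl⟩
  have h2 : ∀ τ ∈ Ioi 0, q (ray θ τ) = q' (ray θ τ) := fun τ hτ => h _ ⟨τ, hτ, Or.inr rfl⟩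
  rw [rayDiff, rayDiff]
  congr 2 <;> refine setIntegral_congr_fun measurableSet_Ioi fun τ hτ => ?_
  · simp only [h1 τ hτ]
  · simp only [h2 τ hτ]

lemma RayIntegrable.congr {θ : ℝ} {q q' : ℂ → ℂ} (hq : RayIntegrable θ q)
    (h : ∀ ζ ∈ rays θ, q ζ = q' ζ) : RayIntegrable θ q' := by
  refine ⟨hq.1.congr ?_, hq.2.congr ?_⟩
  · filter_upwards [ae_mem_Ioi] with τ hτ
    rw [h _ ⟨τ, hτ, Or.inl rfl⟩]
  · filter_upwards [ae_mem_Ioi] with τ hτ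
    rw [h _ ⟨τ, hτ, Or.inr rfl⟩]

/-- Holomorphic functions on a closed sector which are bounded near the vertex and `O(|ζ|^{-c})`
at infinity. -/
def SectorDecay (θ c : ℝ) (q : ℂ → ℂ) : Prop := DifferentiableOn ℂ q (closedSector θ) ∧
    (∃ C ρ : ℝ, 0 < ρ ∧ ∀ ζ ∈ closedSector θ, ‖ζ‖ ≤ ρ → ‖q ζ‖ ≤ C) ∧
    ∃ C R : ℝ, ∀ ζ ∈ closedSector θ, R ≤ ‖ζ‖ → ‖q ζ‖ ≤ C * ‖ζ‖ ^ (-c)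

lemma integrableOn_Ioi_of_bounds {f : ℝ → ℂ} (hf : ContinuousOn f (Ioi 0)) {C C' ρ R c : ℝ}
    (hρ : 0 < ρ) (hc : 1 < c) (h0 : ∀ τ, 0 < τ → τ ≤ ρ → ‖f τ‖ ≤ C)
    (h1 : ∀ τ, 0 < τ → R ≤ τ → ‖f τ‖ ≤ C' * τ ^ (-c)) : IntegrableOn f (Ioi 0) := by
  set R' := max R ρ
  have hR' : 0 < R' := hρ.trans_le (le_max_right _ _)
  have i1 : IntegrableOn f (Ioc 0 ρ) := by
    refine Integrable.mono' (integrable_const C)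
      ((hf.mono Ioc_subset_Ioi_self).aestronglyMeasurable measurableSet_Ioc) ?_
    filter_upwards [ae_restrict_mem measurableSet_Ioc] with τ hτ using h0 τ hτ.1 hτ.2
  have i2 : IntegrableOn f (Icc ρ R') := (hf.mono fun τ hτ => hρ.trans_le hτ.1).integrableOn_Icc
  have i3 : IntegrableOn f (Ioi R') := by
    refine Integrable.mono' ((integrableOn_Ioi_rpow_of_lt (by linarith : -c < -1) hR').const_mul C')
      ((hf.mono (Ioi_subset_Ioi hR'.le)).aestronglyMeasurable measurableSet_Ioi) ?_
    filter_upwards [ae_mem_Ioi] with τ hτ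
    exact h1 τ (hR'.trans hτ) ((le_max_left _ _).trans (le_of_lt hτ))
  refine ((i1.union i2).union i3).mono_set fun τ hτ => ?_
  rcases le_or_gt τ ρ with h | h
  · grind
  · rcases le_or_gt τ R' with h' | h'
    · grind
    · exact Or.inr h'

lemma continuous_ray (θ : ℝ) : Continuous (ray θ) := by unfold ray; fun_prop

lemma SectorDecay.integrableOn_ray {θ c : ℝ} {q : ℂ → ℂ} (h : SectorDecay θ c q) (hc : 2 < c)
    {φ : ℝ} (hφ : |φ| ≤ θ) (hθ : θ < π) :
    IntegrableOn (fun τ => q (ray φ τ) * (2 * τ * cexp (φ * I) ^ 2)) (Ioi 0) := by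
  obtain ⟨hd, ⟨C, ρ, hρ, h0⟩, ⟨C', R, h1⟩⟩ := h
  have hmem : ∀ τ > 0, ray φ τ ∈ closedSector θ := fun τ hτ =>
    ray_mem_closedSector (hφ.trans_lt hθ) hφ hτ
  have hn : ∀ τ > 0, ‖q (ray φ τ) * (2 * τ * cexp (φ * I) ^ 2)‖ = ‖q (ray φ τ)‖ * (2 * τ) := by
    intro τ hτ
    rw [norm_mul, norm_mul, norm_pow, norm_exp_ofReal_mul_I, norm_mul, norm_of_nonneg hτ.le]; simp
  refine integrableOn_Ioi_of_bounds (C := C * (2 * ρ)) (C' := C' * 2) (R := R) (c := c - 1) ?_ hρ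
    (by linarith) (fun τ hτ hτρ => ?_) (fun τ hτ hτR => ?_)
  · exact (hd.continuousOn.comp (continuous_ray φ).continuousOn fun τ hτ => hmem τ hτ).mul
      (by fun_prop)
  · rw [hn τ hτ]
    have := h0 _ (hmem τ hτ) (by rwa [norm_ray _ hτ.le])
    have h2 : 0 ≤ C := (norm_nonneg _).trans this; gcongr
  · rw [hn τ hτ]
    have := h1 _ (hmem τ hτ) (by rwa [norm_ray _ hτ.le])
    rw [norm_ray _ hτ.le] at this
    calc _ ≤ C' * τ ^ (-c) * (2 * τ) := by gcongr
      _ = C' * 2 * (τ ^ (-c) * τ ^ (1 : ℝ)) := by rw [Real.rpow_one]; ring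
      _ = _ := by rw [← rpow_add hτ]; congr 2; ring

lemma SectorDecay.rayIntegrable {θ c : ℝ} {q : ℂ → ℂ} (h : SectorDecay θ c q) (hc : 2 < c)
    (hθ0 : 0 < θ) (hθ : θ < π) : RayIntegrable θ q := by
  have h1 := h.integrableOn_ray hc (φ := -θ) (by rw [abs_neg, abs_of_pos hθ0]) hθ
  rw [ofReal_neg] at h1
  exact ⟨h1, h.integrableOn_ray hc (φ := θ) (by rw [abs_of_pos hθ0]) hθ⟩

lemma SectorDecay.rayDiff_eq_zero {θ c : ℝ} {q : ℂ → ℂ} (h : SectorDecay θ c q) (hc : 2 < c)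
    (hθ0 : 0 < θ) (hθ : θ < π) : rayDiff θ q = 0 := by
  obtain ⟨hd, ⟨C, ρ, hρ, h0⟩, ⟨C', R, h1⟩⟩ := h
  have hline : ∀ φ : ℝ, ∫ τ in Ioi 0, q (ray φ τ) * (2 * τ * cexp (φ * I) ^ 2) =
      ∫ x : ℝ, (fun z : ℂ => q (cexp z) * (2 * cexp (2 * z))) (x + φ * I) := by
    intro φ
    rw [integral_Ioi_eq_integral_exp]
    refine integral_congr_ae (Eventually.of_forall fun x => ?_)
    simp only [ray, real_smul]
    rw [exp_add, ofReal_exp, ← exp_nat_mul (φ * I) 2, mul_add,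
      exp_add, show (2 : ℂ) * x = x + x by ring, exp_add]
    push_cast; ring
  have hnorm : ∀ z : ℂ, ‖q (cexp z) * (2 * cexp (2 * z))‖ =
      ‖q (cexp z)‖ * (2 * rexp (2 * z.re)) := by
    intro z
    rw [norm_mul, norm_mul, norm_exp]; simp
  have key := integral_line_eq_of_strip (h := fun z => q (cexp z) * (2 * cexp (2 * z)))
    hθ0 ?_ (C := 2 * (|C| + |C'|)) (c := min 2 (c - 2))
    (R := max |log ρ| (log (max R 1) + 1)) (by simpa using hc) ?_
  · rw [rayDiff, hline θ]
    have := hline (-θ)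
    rw [ofReal_neg] at this
    rw [this, ← key]
    simp [sub_eq_add_neg]
  · refine DifferentiableOn.mul (hd.comp (by fun_prop) fun z hz => exp_mem_closedSector hθ hz)
      (by fun_prop)
  · intro z hz hR
    have hmem := exp_mem_closedSector hθ hz
    have hz1 : |log ρ| ≤ |z.re| := (le_max_left _ _).trans hR
    have hz2 : log (max R 1) + 1 ≤ |z.re| := (le_max_right _ _).trans hR
    rw [hnorm]
    rcases le_or_gt 0 z.re with hre | hre
    · rw [abs_of_nonneg hre] at hz2 ⊢
      have h3 : R ≤ ‖cexp z‖ := by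
        rw [norm_exp]
        refine (le_max_left R 1).trans ?_
        rw [← Real.exp_log (lt_of_lt_of_le one_pos (le_max_right R 1))]
        exact exp_le_exp.2 (by linarith)
      have h4 := h1 _ hmem h3
      rw [norm_exp, ← Real.exp_mul] at h4
      calc _ ≤ (C' * rexp (z.re * -c)) * (2 * rexp (2 * z.re)) := by gcongr
        _ ≤ (|C'| * rexp (z.re * -c)) * (2 * rexp (2 * z.re)) := by bound
        _ = 2 * |C'| * rexp (-(c - 2) * z.re) := by
            rw [show -(c - 2) * z.re = z.re * -c + 2 * z.re by ring, Real.exp_add]; ring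
        _ ≤ _ := by bound
    · rw [abs_of_neg hre] at hz1 ⊢
      have h3 : ‖cexp z‖ ≤ ρ := by
        rw [norm_exp, ← Real.exp_log hρ]
        exact exp_le_exp.2 (by linarith [neg_abs_le (log ρ)])
      have h4 := h0 _ hmem h3
      calc _ ≤ |C| * (2 * rexp (2 * z.re)) := by gcongr; exact h4.trans (le_abs_self _)
        _ = 2 * |C| * rexp (-2 * -z.re) := by ring_nf
        _ ≤ _ := by bound

lemma exists_le_norm_one_add_mul {z : ℂ} (hz : z ∈ slitPlane) :
    ∃ c > 0, ∀ x : ℝ, 0 ≤ x → c * (1 + x) ≤ ‖1 + x * z‖ := by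
  have hcont : ContinuousOn (fun s => ‖((1 - s : ℝ) : ℂ) + s * z‖) (Icc 0 1) := by fun_prop
  obtain ⟨s, hs, hmin⟩ := isCompact_Icc.exists_isMinOn ⟨0, by simp⟩ hcont
  refine ⟨‖((1 - s : ℝ) : ℂ) + s * z‖, norm_pos_iff.2 fun h => ?_, fun x hx => ?_⟩
  · rcases eq_or_lt_of_le hs.1 with h0 | h0
    · simp [← h0] at h
    · have h1 := congrArg Complex.re h
      have h2 := congrArg Complex.im h
      simp at h1 h2
      have hzi : z.im = 0 := by aesop
      rcases hz with hz | hz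
      · have := mul_pos h0 hz
        linarith [hs.2]
      · exact hz hzi
  · have hx1 : (0 : ℝ) < 1 + x := by linarith
    have hmem : x / (1 + x) ∈ Icc (0 : ℝ) 1 := ⟨by positivity, (div_le_one hx1).2 (by linarith)⟩
    have h1 := hmin hmem
    simp only [mem_ofPred_eq] at h1
    calc _ ≤ ‖((1 - x / (1 + x) : ℝ) : ℂ) + (x / (1 + x) : ℝ) * z‖ * (1 + x) := by gcongr
      _ = ‖(((1 - x / (1 + x) : ℝ) : ℂ) + (x / (1 + x) : ℝ) * z) * (1 + x : ℝ)‖ := by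
        rw [norm_mul, norm_of_nonneg hx1.le]
      _ = _ := by
        congr 1
        have : (1 : ℂ) + x ≠ 0 := mod_cast hx1.ne'; push_cast; field_simp; ring

lemma neg_sq_mem_slitPlane {k : ℂ} (hk : k.im ≠ 0) : -k ^ 2 ∈ slitPlane := by
  by_cases h : k.re = 0
  · left
    rw [sq]
    simp [h]
    exact hk
  · right
    rw [sq]; simp
    intro h'
    exact mul_ne_zero h hk (by linarith)

lemma integral_ray_log {k : ℂ} (hk : k.im ≠ 0) :
    IntegrableOn (fun τ : ℝ => 4 * τ * k / (τ ^ 4 * k ^ 2 - 1)) (Ioi 0) ∧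
    (0 < k.im → ∫ τ in Ioi (0 : ℝ), 4 * τ * k / (τ ^ 4 * k ^ 2 - 1) = -(I * π)) := by
  obtain ⟨c, hc, hlow⟩ := exists_le_norm_one_add_mul (neg_sq_mem_slitPlane hk)
  have hlow' : ∀ τ : ℝ, c * (1 + τ ^ 4) ≤ ‖(τ : ℂ) ^ 4 * k ^ 2 - 1‖ := by
    intro τ
    refine (hlow (τ ^ 4) (by positivity)).trans (le_of_eq ?_)
    rw [← norm_neg]; congr 1; push_cast; ring
  have hne : ∀ τ : ℝ, (τ : ℂ) ^ 4 * k ^ 2 - 1 ≠ 0 := fun τ => by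
    rw [← norm_pos_iff]
    exact lt_of_lt_of_le (by positivity) (hlow' τ)
  have hnorm : ∀ τ : ℝ, 0 < τ → ‖4 * τ * k / (τ ^ 4 * k ^ 2 - 1)‖ ≤
      4 * τ * ‖k‖ / (c * (1 + τ ^ 4)) := by
    intro τ hτ
    rw [norm_div, norm_mul, norm_mul, norm_of_nonneg hτ.le]
    have := hlow' τ
    simp only [norm_ofNat]; gcongr
  have hint : IntegrableOn (fun τ : ℝ => 4 * τ * k / (τ ^ 4 * k ^ 2 - 1)) (Ioi 0) := by
    refine integrableOn_Ioi_of_bounds (C := 4 * ‖k‖ / c) (C' := 4 * ‖k‖ / c) (ρ := 1) (R := 1)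
      (c := 3) ?_ one_pos (by norm_num) (fun τ hτ hτ1 => ?_) (fun τ hτ _ => ?_)
    · exact ContinuousOn.div (by fun_prop) (by fun_prop) fun τ _ => hne τ
    · refine (hnorm τ hτ).trans ?_
      rw [div_le_div_iff₀ (by positivity) hc]
      have : τ ≤ 1 + τ ^ 4 := by nlinarith [pow_pos hτ 4]
      calc _ = 4 * ‖k‖ * c * τ := by ring
        _ ≤ 4 * ‖k‖ * c * (1 + τ ^ 4) := by gcongr
        _ = _ := by ring
    · refine (hnorm τ hτ).trans ?_
      have h3 : τ ^ (-3 : ℝ) = (τ ^ 3)⁻¹ := by simp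
      rw [h3, div_le_iff₀ (by positivity)]
      have : 4 * τ * ‖k‖ = 4 * ‖k‖ / c * (τ ^ 3)⁻¹ * (c * τ ^ 4) := by field_simp
      rw [this]; gcongr; linarith
  refine ⟨hint, fun hk0 => ?_⟩
  have hu : ∀ τ : ℝ, (τ : ℂ) ^ 2 * k + 1 ≠ 0 ∧ (τ : ℂ) ^ 2 * k - 1 ≠ 0 := by grind
  set v : ℝ → ℂ := fun τ => -I * (((τ : ℂ) ^ 2 * k - 1) / ((τ : ℂ) ^ 2 * k + 1)) with hv
  have hvre : ∀ τ : ℝ, 0 < τ → 0 < (v τ).re := by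
    intro τ hτ
    have h1 : 0 < Complex.normSq ((τ : ℂ) ^ 2 * k + 1) := Complex.normSq_pos.2 (hu τ).1
    have h2 : (v τ).re = 2 * (τ ^ 2 * k.im) / Complex.normSq ((τ : ℂ) ^ 2 * k + 1) := by
      simp only [hv]
      have h3 : ∀ z : ℂ, (-I * z).re = z.im := fun z => by simp
      rw [h3, Complex.div_im, show (τ : ℂ) ^ 2 = ((τ ^ 2 : ℝ) : ℂ) by push_cast; rfl]
      simp only [add_re, sub_re, add_im, Complex.sub_im, re_ofReal_mul,
        im_ofReal_mul, one_re, one_im]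
      ring
    rw [h2]; positivity
  have hderiv : ∀ τ ∈ Ioi (0 : ℝ), HasDerivAt (fun τ => Complex.log (v τ))
      (4 * τ * k / (τ ^ 4 * k ^ 2 - 1)) τ := by
    intro τ hτ
    have h0 : HasDerivAt (fun τ : ℝ => (τ : ℂ) ^ 2 * k) (2 * τ * k) τ := by
      have := ((ofRealCLM.hasDerivAt (x := τ)).pow 2).mul_const k
      simpa using this
    have h1 : HasDerivAt v (-I * ((2 * τ * k * (τ ^ 2 * k + 1) -
        (τ ^ 2 * k - 1) * (2 * τ * k)) / (τ ^ 2 * k + 1) ^ 2)) τ :=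
      ((h0.sub_const 1).fun_div (h0.add_const 1) (hu τ).1).const_mul (-I)
    have h5 := h1.clog_real (Or.inl (hvre τ hτ))
    have h2 := (hu τ).1
    have h3 := (hu τ).2
    have h4 := hne τ
    have h6 : -I * ((2 * τ * k * (τ ^ 2 * k + 1) -
        (τ ^ 2 * k - 1) * (2 * τ * k)) / (τ ^ 2 * k + 1) ^ 2) / v τ =
        4 * τ * k / (τ ^ 4 * k ^ 2 - 1) := by
      simp only [hv]
      rw [show (τ : ℂ) ^ 4 * k ^ 2 - 1 = (τ ^ 2 * k - 1) * (τ ^ 2 * k + 1) by ring]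
      have := Complex.I_ne_zero; field_simp; ring
    rwa [h6] at h5
  have hI : v 0 = I := by simp [hv]
  have hcont : ContinuousWithinAt (fun τ => Complex.log (v τ)) (Ici 0) 0 := by
    have : ContinuousAt v 0 := by
      refine ContinuousAt.mul continuousAt_const (ContinuousAt.div ?_ ?_ (hu 0).1)
      · fun_prop
      · fun_prop
    exact (this.clog (by rw [hI]; right; simp)).continuousWithinAt
  have hlim : Tendsto (fun τ => Complex.log (v τ)) atTop (𝓝 (Complex.log (-I))) := by
    have h1 : Tendsto v atTop (𝓝 (-I)) := by
      have h2 : Tendsto (fun τ : ℝ => ((τ : ℂ) ^ 2)⁻¹) atTop (𝓝 0) := by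
        refine tendsto_inv₀_cobounded.comp (tendsto_norm_atTop_iff_cobounded.1 ?_)
        simp only [norm_pow, norm_real, norm_eq_abs, sq_abs]
        exact tendsto_pow_atTop two_ne_zero
      have hk' : k - 0 ≠ 0 := fun h => hk (by rw [sub_zero] at h; simp [h])
      have h3 := (((tendsto_const_nhds (x := k)).sub h2).div ((tendsto_const_nhds (x := k)).add h2)
        (by simpa using hk')).const_mul (-I)
      rw [sub_zero, add_zero, div_self (by simpa using hk'), mul_one] at h3
      refine h3.congr' ?_
      filter_upwards [eventually_gt_atTop 0] with τ hτ
      have hτ' : (τ : ℂ) ≠ 0 := mod_cast hτ.ne'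
      have h4 := (hu τ).1
      have h5 : k + ((τ : ℂ) ^ 2)⁻¹ ≠ 0 := by
        intro h
        apply h4
        field_simp at h
        linear_combination h
      simp only [hv, Pi.div_apply]; field_simp
    exact h1.clog (by right; simp)
  have := integral_Ioi_of_hasDerivAt_of_tendsto hcont hderiv hint hlim
  rw [this, hI, Complex.log_neg_I, Complex.log_I]; ring

lemma integral_ray_log_of_neg {k : ℂ} (hk : k.im < 0) :
    ∫ τ in Ioi (0 : ℝ), 4 * τ * k / (τ ^ 4 * k ^ 2 - 1) = I * π := by
  have h := (integral_ray_log (k := (starRingEnd ℂ) k) (by simpa using hk.ne)).2 (by simpa using hk)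
  have h2 := congrArg (starRingEnd ℂ) h
  rw [← integral_conj] at h2
  simpa [conj_ofNat] using h2

lemma div_eq_of_norm_arg {ζ b : ℂ} (hb : b ≠ 0) :
    ζ / b = (‖ζ‖ / ‖b‖ : ℝ) * cexp ((ζ.arg - b.arg : ℝ) * I) := by
  conv_lhs => rw [← Complex.norm_mul_exp_arg_mul_I ζ, ← Complex.norm_mul_exp_arg_mul_I b]
  have hb' : (‖b‖ : ℂ) ≠ 0 := by simp_all
  have h1 : cexp ((ζ.arg - b.arg : ℝ) * I) = cexp (ζ.arg * I) / cexp (b.arg * I) := by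
    rw [← Complex.exp_sub]; congr 1; push_cast; ring
  rw [h1]
  have := Complex.exp_ne_zero (b.arg * I); push_cast; field_simp

lemma div_re_pos {ζ b : ℂ} (hζ : ζ ≠ 0) (hb : b ≠ 0) (h : |ζ.arg| + |b.arg| < π / 2) :
    0 < (ζ / b).re := by
  rw [div_eq_of_norm_arg hb, re_ofReal_mul, exp_ofReal_mul_I_re]
  refine mul_pos (div_pos (norm_pos_iff.2 hζ) (norm_pos_iff.2 hb)) (Real.cos_pos_of_mem_Ioo ?_)
  have := abs_sub ζ.arg b.arg
  have h2 := abs_lt.1 (lt_of_le_of_lt this h)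
  exact ⟨by linarith [h2.1], h2.2⟩

lemma sq_add_sq_ne_zero {ζ b : ℂ} (hb : b ≠ 0) (h : 0 < (ζ / b).re) : ζ ^ 2 + b ^ 2 ≠ 0 := by
  intro h0
  have h1 : (ζ / b - I) * (ζ / b + I) = 0 := by
    have : (ζ / b - I) * (ζ / b + I) = (ζ / b) ^ 2 - I ^ 2 := by ring
    rw [this, I_sq]; field_simp
    linear_combination h0
  rcases mul_eq_zero.1 h1 with h2 | h2
  · rw [sub_eq_zero.1 h2] at h; simp at h
  · rw [eq_neg_of_add_eq_zero_left h2] at h; simp at h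

lemma add_ne_zero_of_div_re_pos {ζ b : ℂ} (hb : b ≠ 0) (h : 0 < (ζ / b).re) : ζ + b ≠ 0 := by
  intro h0
  rw [eq_neg_of_add_eq_zero_left h0, neg_div, div_self hb] at h
  simp at h; linarith

lemma closedSector_mem_nhds {θ : ℝ} (hθ : θ < π) {b : ℂ} (hb : b ≠ 0) (h : |b.arg| < θ) :
    closedSector θ ∈ 𝓝 b := by
  have hs : b ∈ slitPlane := by
    rw [Complex.mem_slitPlane_iff_arg]
    exact ⟨fun h' => by rw [h', abs_of_pos pi_pos] at h; linarith, hb⟩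
  have h1 : ContinuousAt (fun w : ℂ => |w.arg|) b := (Complex.continuousAt_arg hs).abs
  filter_upwards [h1.eventually_lt_const h, isOpen_compl_singleton.mem_nhds hb] with w hw hw0
  exact ⟨hw0, hw.le⟩

lemma SectorDecay.cauchy {θ c : ℝ} {q : ℂ → ℂ} (h : SectorDecay θ c q) (hc : 0 < c)
    (hθ0 : 0 < θ) (hθ : θ < π / 4) {b : ℂ} (hb : b ≠ 0) (hbθ : |b.arg| < θ) :
    RayIntegrable θ (fun ζ => q ζ / (ζ ^ 2 - b ^ 2)) ∧
      rayDiff θ (fun ζ => q ζ / (ζ ^ 2 - b ^ 2)) = q b := by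
  obtain ⟨hd, ⟨C, ρ, hρ, h0⟩, ⟨C', R, h1⟩⟩ := h
  have hπ := pi_pos
  have hre : ∀ ζ ∈ closedSector θ, 0 < (ζ / b).re := fun ζ hζ =>
    div_re_pos hζ.1 hb (by linarith [hζ.2])
  have hne1 : ∀ ζ ∈ closedSector θ, ζ ^ 2 + b ^ 2 ≠ 0 := fun ζ hζ => sq_add_sq_ne_zero hb (hre ζ hζ)
  have hne2 : ∀ ζ ∈ closedSector θ, ζ + b ≠ 0 := fun ζ hζ => add_ne_zero_of_div_re_pos hb (hre ζ hζ)
  have hb0 : 0 < ‖b‖ := norm_pos_iff.2 hb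
  set F : ℂ → ℂ := fun ζ => q ζ - q b * (2 * b ^ 2 / (ζ ^ 2 + b ^ 2)) with hF
  have hFb : F b = 0 := by
    have : b ^ 2 + b ^ 2 ≠ 0 := by grind
    simp only [hF]
    rw [← two_mul, div_self (by rwa [two_mul]), mul_one, sub_self]
  have hFd : DifferentiableOn ℂ F (closedSector θ) := by fun_prop
  have hgd : DifferentiableOn ℂ (fun ζ => dslope F b ζ / (ζ + b)) (closedSector θ) :=
    ((Complex.differentiableOn_dslope (closedSector_mem_nhds (by linarith) hb hbθ)).2 hFd).div
      (by fun_prop) hne2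
  have hg : ∀ ζ, ζ ≠ b → dslope F b ζ / (ζ + b) = F ζ / (ζ ^ 2 - b ^ 2) := by
    intro ζ hζ
    rw [dslope_of_ne _ hζ, slope_def_field, hFb, sub_zero, div_div]; congr 1; ring
  have hsq : ∀ ζ : ℂ, |‖ζ‖ ^ 2 - ‖b‖ ^ 2| ≤ ‖ζ ^ 2 - b ^ 2‖ ∧ |‖ζ‖ ^ 2 - ‖b‖ ^ 2| ≤ ‖ζ ^ 2 + b ^ 2‖ := by
    intro ζ
    rw [← norm_pow, ← norm_pow]
    refine ⟨abs_norm_sub_norm_le _ _, ?_⟩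
    have := abs_norm_sub_norm_le (ζ ^ 2) (-b ^ 2)
    rwa [norm_neg, sub_neg_eq_add] at this
  have hFnorm : ∀ ζ, ‖F ζ‖ ≤ ‖q ζ‖ + ‖q b‖ * (2 * ‖b‖ ^ 2 / ‖ζ ^ 2 + b ^ 2‖) := by
    intro ζ
    refine (norm_sub_le _ _).trans (le_of_eq ?_)
    rw [norm_mul, norm_div, norm_mul, norm_pow]; simp
  have hgdec : SectorDecay θ (2 + min c 2) (fun ζ => dslope F b ζ / (ζ + b)) := by
    refine ⟨hgd, ⟨(C + ‖q b‖ * (2 * ‖b‖ ^ 2 / (‖b‖ ^ 2 / 2))) / (‖b‖ ^ 2 / 2), min ρ (‖b‖ / 2),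
      lt_min hρ (by positivity), fun ζ hζ hζρ => ?_⟩,
      ⟨(C' + ‖q b‖ * (4 * ‖b‖ ^ 2)) * 2, max (max R 1) (2 * ‖b‖), fun ζ hζ hζR => ?_⟩⟩
    · have hζ1 := hζρ.trans (min_le_left _ _)
      have hζ2 := hζρ.trans (min_le_right _ _)
      have hz : ζ ≠ b := by rintro rfl; linarith
      have hlow : ‖b‖ ^ 2 / 2 ≤ |‖ζ‖ ^ 2 - ‖b‖ ^ 2| := by
        rw [abs_sub_comm]
        refine le_trans ?_ (le_abs_self _)
        nlinarith [norm_nonneg ζ]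
      simp only [hg ζ hz, norm_div]
      have h3 := h0 ζ hζ hζ1
      have h4 := hFnorm ζ
      have h5 := hlow.trans (hsq ζ).1
      have h6 := hlow.trans (hsq ζ).2
      have h7 : 0 < ‖b‖ ^ 2 / 2 := by positivity
      calc _ ≤ (‖q ζ‖ + ‖q b‖ * (2 * ‖b‖ ^ 2 / ‖ζ ^ 2 + b ^ 2‖)) / ‖ζ ^ 2 - b ^ 2‖ := by gcongr
        _ ≤ _ := by
          have : 0 ≤ C := (norm_nonneg _).trans h3; gcongr
    · have hζ1 : R ≤ ‖ζ‖ := ((le_max_left _ _).trans (le_max_left _ _)).trans hζR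
      have hζ3 : 1 ≤ ‖ζ‖ := ((le_max_right _ _).trans (le_max_left _ _)).trans hζR
      have hζ2 : 2 * ‖b‖ ≤ ‖ζ‖ := (le_max_right _ _).trans hζR
      have hz : ζ ≠ b := by rintro rfl; linarith
      have hζ0 : 0 < ‖ζ‖ := by linarith
      have hlow : ‖ζ‖ ^ 2 / 2 ≤ |‖ζ‖ ^ 2 - ‖b‖ ^ 2| := by
        refine le_trans ?_ (le_abs_self _); nlinarith
      simp only [hg ζ hz, norm_div]
      have h3 := h1 ζ hζ hζ1
      have h4 := hFnorm ζ
      have h5 := hlow.trans (hsq ζ).1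
      have h6 := hlow.trans (hsq ζ).2
      have h7 : 0 < ‖ζ‖ ^ 2 / 2 := by positivity
      have hC' : 0 ≤ C' := by
        have := (norm_nonneg _).trans h3
        exact nonneg_of_mul_nonneg_left this (by positivity)
      have e1 : ‖ζ‖ ^ (-c) ≤ ‖ζ‖ ^ (-min c 2) :=
        Real.rpow_le_rpow_of_exponent_le hζ3 (neg_le_neg (min_le_left _ _))
      have e2 : (‖ζ‖ ^ 2)⁻¹ ≤ ‖ζ‖ ^ (-min c 2) := by
        have : (‖ζ‖ ^ 2)⁻¹ = ‖ζ‖ ^ (-2 : ℝ) := by rw [rpow_neg hζ0.le]; norm_cast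
        rw [this]
        exact Real.rpow_le_rpow_of_exponent_le hζ3 (neg_le_neg (min_le_right _ _))
      calc _ ≤ (‖q ζ‖ + ‖q b‖ * (2 * ‖b‖ ^ 2 / ‖ζ ^ 2 + b ^ 2‖)) / ‖ζ ^ 2 - b ^ 2‖ := by gcongr
        _ ≤ (C' * ‖ζ‖ ^ (-c) + ‖q b‖ * (2 * ‖b‖ ^ 2 / (‖ζ‖ ^ 2 / 2))) / (‖ζ‖ ^ 2 / 2) := by gcongr
        _ = (C' * ‖ζ‖ ^ (-c) + ‖q b‖ * (4 * ‖b‖ ^ 2) * (‖ζ‖ ^ 2)⁻¹) * 2 * (‖ζ‖ ^ 2)⁻¹ := by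
            field_simp; ring
        _ ≤ (C' * ‖ζ‖ ^ (-min c 2) + ‖q b‖ * (4 * ‖b‖ ^ 2) * ‖ζ‖ ^ (-min c 2)) * 2 *
            (‖ζ‖ ^ 2)⁻¹ := by gcongr
        _ = _ := by
            rw [neg_add, rpow_add hζ0, rpow_neg hζ0.le 2]
            norm_cast; ring
  have hrays : ∀ ζ ∈ rays θ, ζ ≠ b ∧ ζ ∈ closedSector θ := by
    rintro ζ ⟨τ, hτ, hζ⟩
    have ha1 : |(-θ)| < π := by rw [abs_neg, abs_of_pos hθ0]; linarith
    have ha2 : |θ| < π := by rw [abs_of_pos hθ0]; linarith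
    rcases hζ with rfl | rfl
    · refine ⟨fun h' => ?_, ray_mem_closedSector ha1 (by rw [abs_neg, abs_of_pos hθ0]) hτ⟩
      rw [← h', arg_ray ha1 hτ, abs_neg, abs_of_pos hθ0] at hbθ
      exact lt_irrefl _ hbθ
    · refine ⟨fun h' => ?_, ray_mem_closedSector ha2 (by rw [abs_of_pos hθ0]) hτ⟩
      rw [← h', arg_ray ha2 hτ, abs_of_pos hθ0] at hbθ
      exact lt_irrefl _ hbθ
  have hc2 : 2 < 2 + min c 2 := by simpa using hc
  have hint1 := hgdec.rayIntegrable hc2 hθ0 (by linarith)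
  have hzero := hgdec.rayDiff_eq_zero hc2 hθ0 (by linarith)
  set N : ℂ → ℂ := fun ζ => 2 * b ^ 2 / (ζ ^ 4 - b ^ 4) with hN
  have hdecomp : ∀ ζ ∈ rays θ, dslope F b ζ / (ζ + b) + q b * N ζ = q ζ / (ζ ^ 2 - b ^ 2) := by
    intro ζ hζ
    have h2 := hne1 ζ (hrays ζ hζ).2
    have h3 : ζ ^ 2 - b ^ 2 ≠ 0 := by
      rw [sq_sub_sq]
      exact mul_ne_zero (hne2 ζ (hrays ζ hζ).2) (sub_ne_zero.2 (hrays ζ hζ).1)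
    rw [hg ζ (hrays ζ hζ).1]
    simp only [hF, hN]
    rw [show ζ ^ 4 - b ^ 4 = (ζ ^ 2 - b ^ 2) * (ζ ^ 2 + b ^ 2) by ring]; field_simp; ring
  have hNeq : ∀ φ : ℝ, ∀ τ : ℝ, N (ray φ τ) * (2 * τ * cexp (φ * I) ^ 2) =
      4 * τ * ((cexp (φ * I) / b) ^ 2) / (τ ^ 4 * ((cexp (φ * I) / b) ^ 2) ^ 2 - 1) := by
    intro φ τ
    simp only [hN, ray]
    have : (↑τ ^ 4 * ((cexp (φ * I) / b) ^ 2) ^ 2 - 1) =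
      ((↑τ * cexp (φ * I)) ^ 4 - b ^ 4) / b ^ 4 := by
      field_simp
    rw [this]; field_simp; ring
  have him : ∀ φ : ℝ, |φ| < π → ((cexp (φ * I) / b) ^ 2).im =
      (1 / ‖b‖) ^ 2 * Real.sin (2 * (φ - b.arg)) := by
    intro φ hφ
    rw [div_eq_of_norm_arg hb, norm_exp_ofReal_mul_I]
    have := arg_ray hφ one_pos
    rw [ray, ofReal_one, one_mul] at this
    rw [this, mul_pow, ← ofReal_pow, im_ofReal_mul, ← exp_nat_mul,
      show ((2 : ℕ) : ℂ) * ((φ - b.arg : ℝ) * I) =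
        (2 * (φ - b.arg) : ℝ) * I by push_cast; ring, Complex.exp_ofReal_mul_I_im]
  have hbθ' := abs_lt.1 hbθ
  have him1 : ((cexp ((-θ : ℝ) * I) / b) ^ 2).im < 0 := by
    rw [him (-θ) (by rw [abs_neg, abs_of_pos hθ0]; linarith)]
    refine mul_neg_of_pos_of_neg (by positivity) (Real.sin_neg_of_neg_of_neg_pi_lt ?_ ?_) <;> linarith
  have him2 : 0 < ((cexp ((θ : ℂ) * I) / b) ^ 2).im := by
    rw [him θ (by rw [abs_of_pos hθ0]; linarith)]
    refine mul_pos (by positivity) (Real.sin_pos_of_pos_of_lt_pi ?_ ?_) <;> linarith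
  have hNint : RayIntegrable θ N := by
    constructor
    · have := (integral_ray_log him1.ne).1
      simp only [← hNeq] at this
      simpa using this
    · have := (integral_ray_log him2.ne').1
      simp only [← hNeq] at this
      exact this
  have hNval : rayDiff θ N = 1 := by
    have e1 := integral_ray_log_of_neg him1
    simp only [← hNeq] at e1
    have e2 := (integral_ray_log him2.ne').2 him2
    simp only [← hNeq] at e2
    rw [ofReal_neg] at e1
    rw [rayDiff, e1, e2]
    have : (π : ℂ) ≠ 0 := mod_cast hπ.ne'; field_simp; ring
  refine ⟨(hint1.add (hNint.const_mul (q b))).congr hdecomp, ?_⟩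
  rw [← rayDiff_congr hdecomp, rayDiff_add hint1 (hNint.const_mul (q b)), rayDiff_const_mul, hzero,
    hNval, zero_add, mul_one]

/-! ### The symbol of the fractional resolvent on the sector -/

/-- The opening of the contour for the symbol `ζ ↦ (ζ^{2a} - w^{2a})⁻¹`. -/
def theta (a : ℝ) : ℝ := π / (4 * a)

/-- The closed sector bounded by the contour. -/
notation:max "sec(" a ")" => closedSector (theta a)

/-- The open sector of half-opening `π/(8a)`. -/
def domU (a : ℝ) : Set ℂ := {w | w ≠ 0 ∧ |w.arg| < π / (8 * a)}

section

variable {a : ℝ} {w ζ : ℂ}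

lemma theta_pos (ha : 1 < a) : 0 < theta a := by
  have := pi_pos
  rw [theta]; positivity

lemma theta_lt (ha : 1 < a) : theta a < π / 4 := by
  have := pi_pos
  rw [theta]
  exact div_lt_div_of_pos_left this (by norm_num) (by linarith)

lemma abs_arg_lt_of_mem_domU {w : ℂ} (hw : w ∈ domU a) (ha : 1 < a) : |w.arg| < theta a := by
  refine hw.2.trans ?_
  have := pi_pos
  rw [theta]
  exact div_lt_div_of_pos_left this (by linarith) (by linarith)

lemma domU_subset (ha : 1 < a) : domU a ⊆ sec(a) := fun _ hw =>
  ⟨hw.1, (abs_arg_lt_of_mem_domU hw ha).le⟩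

lemma mem_slitPlane_of_sec (ha : 1 < a) (hζ : ζ ∈ sec(a)) :
    ζ ∈ slitPlane := by
  rw [Complex.mem_slitPlane_iff_arg]
  refine ⟨fun h => ?_, hζ.1⟩
  have h1 := hζ.2
  have := theta_lt ha
  rw [h, abs_of_pos pi_pos] at h1
  linarith [pi_pos]

lemma sq_re_pos (ha : 1 < a) (hζ : ζ ∈ sec(a)) : 0 < (ζ ^ 2).re := by
  have h0 := norm_pos_iff.2 hζ.1
  have h1 : ζ ^ 2 = (‖ζ‖ ^ 2 : ℝ) * cexp ((2 * ζ.arg : ℝ) * I) := by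
    conv_lhs => rw [← Complex.norm_mul_exp_arg_mul_I ζ]
    rw [mul_pow, ← exp_nat_mul]; push_cast; congr 2; ring
  rw [h1, re_ofReal_mul, exp_ofReal_mul_I_re]
  refine mul_pos (by positivity) (Real.cos_pos_of_mem_Ioo ?_)
  have := abs_le.1 hζ.2
  have := theta_lt ha
  constructor <;> linarith

lemma sq_add_sq_mem_slitPlane (ha : 1 < a) (hζ : ζ ∈ sec(a)) (hw : w ∈ domU a) :
    ζ ^ 2 + w ^ 2 ∈ slitPlane := by
  left
  have h1 := sq_re_pos ha hζ
  have h2 := sq_re_pos ha (domU_subset ha hw)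
  rw [add_re]
  exact add_pos h1 h2

lemma div_re_pos_of_mem (ha : 1 < a) (hζ : ζ ∈ sec(a)) (hw : w ∈ domU a) :
    0 < (ζ / w).re := by
  have := theta_lt ha
  have := abs_arg_lt_of_mem_domU hw ha
  exact div_re_pos hζ.1 hw.1 (by linarith [hζ.2, pi_pos])

lemma sq_sub_sq_ne_zero (ha : 1 < a) (hζ : ζ ∈ sec(a)) (hw : w ∈ domU a)
    (h : ζ ≠ w) : ζ ^ 2 - w ^ 2 ≠ 0 := by
  rw [sq_sub_sq]
  exact mul_ne_zero (add_ne_zero_of_div_re_pos hw.1 (div_re_pos_of_mem ha hζ hw)) (sub_ne_zero.2 h)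

lemma cpow_inj_of_closedSector (ha : 1 < a) (hζ : ζ ∈ sec(a))
    (hw : w ∈ sec(a)) (h : ζ ^ᵣ (2 * a) = w ^ᵣ (2 * a)) :
    ζ = w := by
  have hb : ∀ z ∈ sec(a), -π < (Complex.log z * (2 * a : ℝ)).im ∧
      (Complex.log z * (2 * a : ℝ)).im ≤ π := by
    intro z hz
    have h2 : |z.arg * (2 * a)| ≤ π / 2 := by
      rw [abs_mul, abs_of_pos (by linarith : 0 < 2 * a)]
      calc _ ≤ theta a * (2 * a) := by gcongr; exact hz.2
        _ = _ := by rw [theta]; field_simp; norm_num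
    rw [Complex.im_mul_ofReal, log_im]
    have := abs_le.1 h2
    constructor <;> linarith [pi_pos]
  rw [cpow_def_of_ne_zero hζ.1, cpow_def_of_ne_zero hw.1] at h
  have h1 := Complex.exp_inj_of_neg_pi_lt_of_le_pi (hb ζ hζ).1 (hb ζ hζ).2 (hb w hw).1 (hb w hw).2 h
  have h2 : Complex.log ζ = Complex.log w := by
    refine mul_right_cancel₀ ?_ h1
    exact_mod_cast (by linarith : (2 * a : ℝ) ≠ 0)
  rw [← exp_log hζ.1, h2, exp_log hw.1]

/-- The symbol `(ζ^{2a} - w^{2a})⁻¹`, corrected to vanish at `ζ = 0`. -/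
def ft (a : ℝ) (w ζ : ℂ) : ℂ :=
  (ζ ^ᵣ (2 * a) - w ^ᵣ (2 * a))⁻¹ + (ζ ^ 2 + w ^ 2) ^ᵣ (-a)

/-- The product of `ft` with `(ζ² - w²)/(ζ² + w²)`, which has no pole at `w`. -/
def ftReg (a : ℝ) (w ζ : ℂ) : ℂ :=
  (dslope (fun z : ℂ => z ^ᵣ (2 * a)) w ζ)⁻¹ * ((ζ + w) / (ζ ^ 2 + w ^ 2)) +
    (ζ ^ 2 + w ^ 2) ^ᵣ (-a) * ((ζ ^ 2 - w ^ 2) / (ζ ^ 2 + w ^ 2))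

lemma ftReg_eq (hne : ζ ≠ w) : ftReg a w ζ = ft a w ζ * ((ζ ^ 2 - w ^ 2) / (ζ ^ 2 + w ^ 2)) := by
  rw [ftReg, ft, dslope_of_ne _ hne, slope_def_field, inv_div]; ring

lemma ft_eq (ha : 1 < a) (hζ : ζ ∈ sec(a)) (hw : w ∈ domU a) (hne : ζ ≠ w) :
    ft a w ζ = ftReg a w ζ + 2 * w ^ 2 * (ftReg a w ζ / (ζ ^ 2 - w ^ 2)) := by
  have h1 := sq_sub_sq_ne_zero ha hζ hw hne
  have h2 := sq_add_sq_ne_zero hw.1 (div_re_pos_of_mem ha hζ hw)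
  rw [ftReg_eq hne]; field_simp; ring

lemma two_mul_sq_mul_ftReg (ha : 1 < a) (hw : w ∈ domU a) :
    2 * w ^ 2 * ftReg a w w = w ^ᵣ (2 - 2 * a) / a := by
  have hs := mem_slitPlane_of_sec ha (domU_subset ha hw)
  have h1 : deriv (fun z : ℂ => z ^ᵣ (2 * a)) w =
      (2 * a : ℝ) * w ^ (((2 * a : ℝ) : ℂ) - 1) :=
    (hasStrictDerivAt_cpow_const hs).hasDerivAt.deriv
  have hw0 := hw.1
  rw [ftReg, dslope_same, h1, sub_self, zero_div, mul_zero, add_zero, Complex.cpow_sub _ _ hw0,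
    Complex.cpow_one]
  have h2 : w ^ᵣ (2 - 2 * a) = w ^ 2 / w ^ᵣ (2 * a) := by
    rw [Complex.ofReal_sub, Complex.cpow_sub _ _ hw0]; congr 1; norm_num
  have h3 : w ^ᵣ (2 * a) ≠ 0 := by simp_all
  have h4 : (a : ℂ) ≠ 0 := by exact_mod_cast (by linarith : a ≠ 0)
  rw [h2]
  push_cast at h3 ⊢; field_simp

lemma differentiableOn_ftReg (ha : 1 < a) (hw : w ∈ domU a) :
    DifferentiableOn ℂ (ftReg a w) (sec(a)) := by
  have hd : DifferentiableOn ℂ (fun z : ℂ => z ^ᵣ (2 * a)) (sec(a)) :=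
    fun z hz => ((hasStrictDerivAt_cpow_const
      (mem_slitPlane_of_sec ha hz)).hasDerivAt.differentiableAt).differentiableWithinAt
  have hwS := domU_subset ha hw
  have h1 := (Complex.differentiableOn_dslope (closedSector_mem_nhds
    (by linarith [theta_lt ha, pi_pos]) hw.1 (abs_arg_lt_of_mem_domU hw ha))).2 hd
  have hne : ∀ ζ ∈ sec(a), ζ ^ 2 + w ^ 2 ≠ 0 := fun ζ hζ =>
    sq_add_sq_ne_zero hw.1 (div_re_pos_of_mem ha hζ hw)
  have h0 : ∀ ζ ∈ sec(a), dslope (fun z : ℂ => z ^ᵣ (2 * a)) w ζ ≠ 0 := by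
    intro ζ hζ
    rcases eq_or_ne ζ w with rfl | h
    · rw [dslope_same, (hasStrictDerivAt_cpow_const
        (mem_slitPlane_of_sec ha hζ)).hasDerivAt.deriv]
      refine mul_ne_zero (by exact_mod_cast (by linarith : (2 * a : ℝ) ≠ 0)) ?_
      simp [Complex.cpow_eq_zero_iff, hw.1]
    · rw [dslope_of_ne _ h, slope_def_field]
      exact div_ne_zero (sub_ne_zero.2 fun h' => h (cpow_inj_of_closedSector ha hζ hwS h'))
        (sub_ne_zero.2 h)
  refine DifferentiableOn.add ((h1.inv h0).mul (DifferentiableOn.div (by fun_prop) (by fun_prop) hne))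
    (DifferentiableOn.mul ?_ (DifferentiableOn.div (by fun_prop) (by fun_prop) hne))
  intro ζ hζ
  exact (DifferentiableAt.cpow_const (f := fun ζ : ℂ => ζ ^ 2 + w ^ 2) (by fun_prop)
    (sq_add_sq_mem_slitPlane ha hζ hw)).differentiableWithinAt

lemma norm_sq_add_sq_ge {z z' : ℂ} (h : ‖z‖ ≤ ‖z'‖ / 2) :
    ‖z'‖ ^ 2 / 2 ≤ ‖z ^ 2 + z' ^ 2‖ ∧ ‖z'‖ ^ 2 / 2 ≤ ‖z ^ 2 - z' ^ 2‖ ∧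
      ‖z ^ 2 - z' ^ 2‖ ≤ 2 * ‖z'‖ ^ 2 := by
  have h1 := norm_sub_norm_le (z' ^ 2) (-z ^ 2)
  have h2 := norm_sub_norm_le (z' ^ 2) (z ^ 2)
  have h3 := norm_sub_le (z ^ 2) (z' ^ 2)
  rw [norm_sub_rev (z' ^ 2) (z ^ 2)] at h2
  have e : z' ^ 2 - -z ^ 2 = z ^ 2 + z' ^ 2 := by ring
  rw [e] at h1
  simp only [norm_pow, norm_neg] at h1 h2 h3
  have h0 := norm_nonneg z
  refine ⟨?_, ?_, ?_⟩ <;> nlinarith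

lemma norm_cpow_sub_cpow_ge (ha : 1 < a) {z z' : ℂ} (h : ‖z‖ ≤ ‖z'‖ / 2) :
    ‖z'‖ ^ (2 * a) / 2 ≤ ‖z ^ᵣ (2 * a) - z' ^ᵣ (2 * a)‖ := by
  have h1 := norm_sub_norm_le (z' ^ᵣ (2 * a)) (z ^ᵣ (2 * a))
  rw [norm_sub_rev, norm_cpow_real, norm_cpow_real] at h1
  have h2 : ‖z‖ ^ (2 * a) ≤ ‖z'‖ ^ (2 * a) / 2 := by
    calc _ ≤ (‖z'‖ * (1 / 2)) ^ (2 * a) := by gcongr; linarith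
      _ = ‖z'‖ ^ (2 * a) * (1 / 2) ^ (2 * a) := mul_rpow (norm_nonneg _) (by norm_num)
      _ ≤ ‖z'‖ ^ (2 * a) * (1 / 2) ^ (1 : ℝ) := by bound
      _ = _ := by linarith
  linarith

lemma norm_ft_le_of_ge (ha : 1 < a) {X : ℝ} (hX : 0 < X)
    (h1 : X ^ (2 * a) / 2 ≤ ‖ζ ^ᵣ (2 * a) - w ^ᵣ (2 * a)‖)
    (h2 : X ^ 2 / 2 ≤ ‖ζ ^ 2 + w ^ 2‖) :
    ‖ft a w ζ‖ ≤ (2 + 2 ^ a) * X ^ (-(2 * a)) := by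
  refine (norm_add_le _ _).trans ?_
  rw [add_mul]
  refine add_le_add ?_ ?_
  · rw [norm_inv, rpow_neg hX.le]
    calc _ ≤ (X ^ (2 * a) / 2)⁻¹ := inv_anti₀ (by positivity) h1
      _ = _ := by ring
  · rw [norm_cpow_real]
    calc _ ≤ (X ^ 2 / 2) ^ (-a) := Real.rpow_le_rpow_of_nonpos (by positivity) h2 (by linarith)
      _ = _ := by
        rw [div_rpow (by positivity) (by norm_num), rpow_neg (by norm_num : (0 : ℝ) ≤ 2),
          div_inv_eq_mul, mul_comm, ← rpow_natCast, ← rpow_mul hX.le]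
        congr 2; push_cast; ring

lemma norm_ft_le_of_le (ha : 1 < a) (hw : w ≠ 0) (h : ‖ζ‖ ≤ ‖w‖ / 2) :
    ‖ft a w ζ‖ ≤ (2 + 2 ^ a) * ‖w‖ ^ (-(2 * a)) :=
  norm_ft_le_of_ge ha (norm_pos_iff.2 hw) (norm_cpow_sub_cpow_ge ha h) (norm_sq_add_sq_ge h).1

lemma norm_ft_le_of_ge_two_mul (ha : 1 < a) (hζ : ζ ≠ 0) (h : ‖w‖ ≤ ‖ζ‖ / 2) :
    ‖ft a w ζ‖ ≤ (2 + 2 ^ a) * ‖ζ‖ ^ (-(2 * a)) := by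
  refine norm_ft_le_of_ge ha (norm_pos_iff.2 hζ) ?_ ?_
  · rw [norm_sub_rev]; exact norm_cpow_sub_cpow_ge ha h
  · rw [add_comm]; exact (norm_sq_add_sq_ge h).1

lemma sectorDecay_ftReg (ha : 1 < a) (hw : w ∈ domU a) :
    SectorDecay (theta a) (2 * a) (ftReg a w) := by
  have hw0 := norm_pos_iff.2 hw.1
  refine ⟨differentiableOn_ftReg ha hw, ⟨(2 + 2 ^ a) * ‖w‖ ^ (-(2 * a)) * 4, ‖w‖ / 2, by positivity,
    fun ζ hζ h => ?_⟩, ⟨(2 + 2 ^ a) * 4, 2 * ‖w‖, fun ζ hζ h => ?_⟩⟩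
  · have hne : ζ ≠ w := by rintro rfl; linarith
    rw [ftReg_eq hne, norm_mul, norm_div]
    obtain ⟨h1, _, h3⟩ := norm_sq_add_sq_ge h
    have h4 : ‖ζ ^ 2 - w ^ 2‖ / ‖ζ ^ 2 + w ^ 2‖ ≤ 4 :=
      (div_le_iff₀ (lt_of_lt_of_le (by positivity) h1)).2 (by linarith)
    have := norm_ft_le_of_le ha hw.1 h; gcongr
  · have hne : ζ ≠ w := by rintro rfl; linarith
    rw [ftReg_eq hne, norm_mul, norm_div]
    have h' : ‖w‖ ≤ ‖ζ‖ / 2 := by linarith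
    have hζ0 := norm_pos_iff.2 hζ.1
    obtain ⟨h1, _, h3⟩ := norm_sq_add_sq_ge h'
    rw [norm_sub_rev, add_comm (ζ ^ 2)]
    have h4 : ‖w ^ 2 - ζ ^ 2‖ / ‖w ^ 2 + ζ ^ 2‖ ≤ 4 :=
      (div_le_iff₀ (lt_of_lt_of_le (by positivity) h1)).2 (by linarith)
    have := norm_ft_le_of_ge_two_mul ha hζ.1 h'
    calc _ ≤ (2 + 2 ^ a) * ‖ζ‖ ^ (-(2 * a)) * 4 := by gcongr
      _ = _ := by ring

lemma SectorDecay.mul_bounded {θ c : ℝ} {q Q : ℂ → ℂ} (h : SectorDecay θ c q)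
    (hQ : DifferentiableOn ℂ Q (closedSector θ)) {M : ℝ} (hM : ∀ ζ ∈ closedSector θ, ‖Q ζ‖ ≤ M) :
    SectorDecay θ c (fun ζ => q ζ * Q ζ) := by
  obtain ⟨hd, ⟨C, ρ, hρ, h0⟩, ⟨C', R, h1⟩⟩ := h
  refine ⟨hd.mul hQ, ⟨C * M, ρ, hρ, fun ζ hζ h => ?_⟩, ⟨C' * M, R, fun ζ hζ h => ?_⟩⟩
  · rw [norm_mul]
    have h2 := h0 ζ hζ h
    exact mul_le_mul h2 (hM ζ hζ) (norm_nonneg _) ((norm_nonneg _).trans h2)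
  · rw [norm_mul]
    have h2 := h1 ζ hζ h
    calc _ ≤ C' * ‖ζ‖ ^ (-c) * M :=
          mul_le_mul h2 (hM ζ hζ) (norm_nonneg _) ((norm_nonneg _).trans h2)
      _ = _ := by ring

lemma mem_of_mem_rays (ha : 1 < a) (hζ : ζ ∈ rays (theta a)) :
    ζ ∈ sec(a) ∧ |ζ.arg| = theta a := by
  have h1 := theta_pos ha
  have h2 := theta_lt ha
  have hπ := pi_pos
  have h3 : |(-theta a)| < π := by grind
  have h4 : |theta a| < π := by grind
  obtain ⟨τ, hτ, rfl | rfl⟩ := hζ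
  · exact ⟨ray_mem_closedSector h3 (by rw [abs_neg, abs_of_pos h1]) hτ, by
      rw [arg_ray h3 hτ, abs_neg, abs_of_pos h1]⟩
  · exact ⟨ray_mem_closedSector h4 (by rw [abs_of_pos h1]) hτ, by rw [arg_ray h4 hτ, abs_of_pos h1]⟩

lemma ne_of_mem_rays (ha : 1 < a) (hζ : ζ ∈ rays (theta a)) (hw : w ∈ domU a) : ζ ≠ w := by
  rintro rfl
  have := abs_arg_lt_of_mem_domU hw ha
  rw [(mem_of_mem_rays ha hζ).2] at this
  exact lt_irrefl _ this

lemma rayDiff_ft_mul (ha : 1 < a) (hw : w ∈ domU a) {Q : ℂ → ℂ}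
    (hQ : DifferentiableOn ℂ Q (sec(a))) {M : ℝ}
    (hM : ∀ ζ ∈ sec(a), ‖Q ζ‖ ≤ M) :
    RayIntegrable (theta a) (fun ζ => ft a w ζ * Q ζ) ∧
      rayDiff (theta a) (fun ζ => ft a w ζ * Q ζ) = w ^ᵣ (2 - 2 * a) / a * Q w := by
  have hθ := theta_pos ha
  have hθ2 := theta_lt ha
  have hq := (sectorDecay_ftReg ha hw).mul_bounded hQ hM
  have h1 := hq.rayIntegrable (by linarith) hθ (by linarith [pi_pos])
  have h2 := hq.rayDiff_eq_zero (by linarith) hθ (by linarith [pi_pos])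
  obtain ⟨h3, h4⟩ := hq.cauchy (by linarith) hθ hθ2 hw.1 (abs_arg_lt_of_mem_domU hw ha)
  have hdec : ∀ ζ ∈ rays (theta a), ftReg a w ζ * Q ζ +
      2 * w ^ 2 * (ftReg a w ζ * Q ζ / (ζ ^ 2 - w ^ 2)) = ft a w ζ * Q ζ := fun ζ hζ => by
    rw [ft_eq ha (mem_of_mem_rays ha hζ).1 hw (ne_of_mem_rays ha hζ hw)]; ring
  refine ⟨(h1.add (h3.const_mul (2 * w ^ 2))).congr hdec, ?_⟩
  rw [← rayDiff_congr hdec, rayDiff_add h1 (h3.const_mul _), rayDiff_const_mul, h2, h4,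
    ← two_mul_sq_mul_ftReg ha hw]
  ring

lemma rayDiff_ft_div (ha : 1 < a) (hw : w ∈ domU a) {b : ℂ} (hb : b ≠ 0)
    (hbθ : |b.arg| < theta a) (hbw : b ≠ w) :
    RayIntegrable (theta a) (fun ζ => ft a w ζ / (ζ ^ 2 - b ^ 2)) ∧
      ft a w b = w ^ᵣ (2 - 2 * a) / a / (b ^ 2 - w ^ 2) +
        rayDiff (theta a) (fun ζ => ft a w ζ / (ζ ^ 2 - b ^ 2)) := by
  have hθ := theta_pos ha
  have hθ2 := theta_lt ha
  have hq := sectorDecay_ftReg ha hw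
  have hbS : b ∈ sec(a) := ⟨hb, hbθ.le⟩
  obtain ⟨h1, h2⟩ := hq.cauchy (by linarith) hθ hθ2 hb hbθ
  obtain ⟨h3, h4⟩ := hq.cauchy (by linarith) hθ hθ2 hw.1 (abs_arg_lt_of_mem_domU hw ha)
  have hbw2 := sq_sub_sq_ne_zero ha hbS hw hbw
  have hdec : ∀ ζ ∈ rays (theta a),
      (b ^ 2 + w ^ 2) / (b ^ 2 - w ^ 2) * (ftReg a w ζ / (ζ ^ 2 - b ^ 2)) -
      2 * w ^ 2 / (b ^ 2 - w ^ 2) * (ftReg a w ζ / (ζ ^ 2 - w ^ 2)) =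
      ft a w ζ / (ζ ^ 2 - b ^ 2) := fun ζ hζ => by
    have hζS := (mem_of_mem_rays ha hζ).1
    have hne := ne_of_mem_rays ha hζ hw
    have e1 := sq_sub_sq_ne_zero ha hζS hw hne
    have hζb : ζ ≠ b := by
      rintro rfl
      rw [(mem_of_mem_rays ha hζ).2] at hbθ
      exact lt_irrefl _ hbθ
    have e2 : ζ ^ 2 - b ^ 2 ≠ 0 := by
      rw [sq_sub_sq]
      refine mul_ne_zero (add_ne_zero_of_div_re_pos hb (div_re_pos hζS.1 hb ?_)) (sub_ne_zero.2 hζb)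
      linarith [hζS.2, pi_pos]
    rw [ft_eq ha hζS hw hne]; field_simp; ring
  have i1 := h1.const_mul ((b ^ 2 + w ^ 2) / (b ^ 2 - w ^ 2))
  have i2 := h3.const_mul (2 * w ^ 2 / (b ^ 2 - w ^ 2))
  refine ⟨(i1.sub i2).congr hdec, ?_⟩
  rw [← rayDiff_congr hdec, rayDiff_sub i1 i2, rayDiff_const_mul, rayDiff_const_mul, h2, h4,
    ft_eq ha hbS hw hbw, ← two_mul_sq_mul_ftReg ha hw]
  field_simp; ring

end

/-! ### Gaussian summation of Fourier integrals -/

lemma fourierInv_gaussian_mul {n : ℕ} {f g : Rn n → ℂ} (hf : Integrable f) (hg : g =ᵐ[volume] 𝓕 f)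
    (x : Rn n) {c : ℝ} (hc : 0 < c) :
    𝓕⁻ (fun ξ : Rn n => cexp (-(c : ℂ)⁻¹ * (‖ξ‖ : ℂ) ^ 2) * g ξ) x =
      ∫ w : Rn n, ((π * c : ℂ) ^ (Module.finrank ℝ (Rn n) / 2 : ℂ) *
        cexp (-π ^ 2 * c * ‖x - w‖ ^ 2)) • f w := by
  have J : Integrable (fun w : Rn n => cexp (-(c : ℂ)⁻¹ * (‖w‖ : ℂ) ^ 2 +
      2 * π * I * (inner ℝ x w : ℝ))) :=
    GaussianFourier.integrable_cexp_neg_mul_sq_norm_add (by simpa using hc) _ _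
  have h1 : ∫ w : Rn n, 𝓕 (fun w : Rn n => cexp (-(c : ℂ)⁻¹ * (‖w‖ : ℂ) ^ 2 +
      2 * π * I * (inner ℝ x w : ℝ))) w • f w =
      ∫ w : Rn n, cexp (-(c : ℂ)⁻¹ * (‖w‖ : ℂ) ^ 2 +
      2 * π * I * (inner ℝ x w : ℝ)) • 𝓕 f w := by
    simpa using! (VectorFourier.integral_fourierIntegral_smul_eq_flip (L := innerₗ (Rn n))
      Real.continuous_fourierChar continuous_inner J hf)
  have h2 : ∀ w : Rn n, 𝓕 (fun w : Rn n => cexp (-(c : ℂ)⁻¹ * (‖w‖ : ℂ) ^ 2 +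
      2 * π * I * (inner ℝ x w : ℝ))) w =
      (π * c : ℂ) ^ (Module.finrank ℝ (Rn n) / 2 : ℂ) * cexp (-π ^ 2 * c * ‖x - w‖ ^ 2) := by
    intro w
    rw [fourier_gaussian_innerProductSpace' (by simpa using hc)]
    congr
    · simp
    · simp; ring
  simp only [h2] at h1
  rw [h1, Real.fourierInv_eq']
  refine integral_congr_ae ?_
  filter_upwards [hg] with w hw
  rw [hw, smul_eq_mul, smul_eq_mul, ← mul_assoc, ← exp_add, real_inner_comm]; congr 2; push_cast
  ring

lemma tendsto_fourierInv_gaussian_mul {n : ℕ} {f g : Rn n → ℂ} (hf : Integrable f)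
    (hg : g =ᵐ[volume] 𝓕 f) {x : Rn n} (hx : ContinuousAt f x) :
    Tendsto (fun δ => 𝓕⁻ (fun ξ : Rn n =>
      (rexp (-δ * (2 * π * ‖ξ‖) ^ 2) : ℂ) * g ξ) x) (𝓝[>] 0) (𝓝 (f x)) := by
  have hlim : Tendsto (fun δ => (4 * π ^ 2 * δ)⁻¹) (𝓝[>] 0) atTop := by
    refine tendsto_inv_nhdsGT_zero.comp ?_
    refine tendsto_nhdsWithin_iff.2 ⟨?_, ?_⟩
    · have : Tendsto (fun δ => 4 * π ^ 2 * δ) (𝓝 0) (𝓝 (4 * π ^ 2 * 0)) :=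
        Continuous.tendsto (by fun_prop) 0
      rw [mul_zero] at this
      exact this.mono_left nhdsWithin_le_nhds
    · filter_upwards [self_mem_nhdsWithin] with δ hδ
      have : (0 : ℝ) < δ := hδ
      have := pi_pos
      exact mem_Ioi.2 (by positivity)
  refine ((Real.tendsto_integral_gaussian_smul' hf hx).comp hlim).congr' ?_
  filter_upwards [self_mem_nhdsWithin] with δ hδ
  have hδ0 : (0 : ℝ) < δ := hδ
  have := pi_pos
  simp only [Function.comp_apply]
  rw [← fourierInv_gaussian_mul hf hg x (by positivity)]
  refine congrFun (congrArg _ (funext fun ξ => ?_)) x; congr 1; push_cast; congr 1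
  rw [inv_inv]; ring

/-! ### Bounds for the symbol on the rays -/

section

variable {a : ℝ} {w ζ : ℂ}

lemma cpow_two_mul_eq {z : ℂ} (hz : z ≠ 0) (a : ℝ) : z ^ᵣ (2 * a) =
    (‖z‖ ^ (2 * a) : ℝ) * cexp ((2 * a * z.arg : ℝ) * I) := by
  rw [cpow_def_of_ne_zero hz, Real.rpow_def_of_pos (norm_pos_iff.2 hz), ofReal_exp,
    ← exp_add, Complex.log]
  congr 1; push_cast; ring

lemma norm_cpow_sub_ge_of_rays (ha : 1 < a) (hζ : ζ ∈ rays (theta a)) (hw : w ∈ domU a) :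
    (‖ζ‖ ^ (2 * a) + ‖w‖ ^ (2 * a)) / 5 ≤ ‖ζ ^ᵣ (2 * a) - w ^ᵣ (2 * a)‖ := by
  have hζ' := mem_of_mem_rays ha hζ
  have h1 : (ζ ^ᵣ (2 * a)).re = 0 := by
    rw [cpow_two_mul_eq hζ'.1.1, re_ofReal_mul, exp_ofReal_mul_I_re,
      ← Real.cos_abs, abs_mul, hζ'.2, abs_of_pos (by linarith : 0 < 2 * a)]
    have : 2 * a * theta a = π / 2 := by rw [theta]; field_simp; norm_num
    rw [this, Real.cos_pi_div_two, mul_zero]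
  have h2 : ‖w‖ ^ (2 * a) / 2 ≤ (w ^ᵣ (2 * a)).re := by
    rw [cpow_two_mul_eq hw.1, re_ofReal_mul, exp_ofReal_mul_I_re,
      ← Real.cos_abs, abs_mul, abs_of_pos (by linarith : 0 < 2 * a), div_eq_mul_inv]
    refine mul_le_mul_of_nonneg_left ?_ (by positivity)
    have h3 : 2 * a * |w.arg| ≤ π / 3 := by
      calc _ ≤ 2 * a * (π / (8 * a)) := by gcongr; exact hw.2.le
        _ = π / 4 := by field_simp; norm_num
        _ ≤ _ := by linarith [pi_pos]
    have := Real.cos_le_cos_of_nonneg_of_le_pi (by positivity) (by linarith [pi_pos]) h3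
    rw [Real.cos_pi_div_three] at this; linarith
  have h3 := abs_re_le_norm (ζ ^ᵣ (2 * a) - w ^ᵣ (2 * a))
  rw [sub_re, h1, zero_sub, abs_neg] at h3
  have h4 := norm_sub_norm_le (ζ ^ᵣ (2 * a)) (w ^ᵣ (2 * a))
  rw [norm_cpow_real, norm_cpow_real] at h4
  have h5 := le_abs_self (w ^ᵣ (2 * a)).re; linarith

lemma cos_two_mul_theta_pos (ha : 1 < a) : 0 < Real.cos (2 * theta a) := by
  have h1 := theta_pos ha
  have h2 := theta_lt ha
  exact Real.cos_pos_of_mem_Ioo ⟨by linarith, by linarith⟩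

lemma le_sq_re (ha : 1 < a) (hζ : ζ ∈ sec(a)) :
    Real.cos (2 * theta a) * ‖ζ‖ ^ 2 ≤ (ζ ^ 2).re := by
  have h1 := cpow_two_mul_eq hζ.1 1
  have h2 : ζ ^ᵣ (2 * 1) = ζ ^ 2 := by norm_num
  rw [h2] at h1
  rw [h1, re_ofReal_mul, exp_ofReal_mul_I_re, mul_comm]
  have h3 : ‖ζ‖ ^ (2 * 1 : ℝ) = ‖ζ‖ ^ 2 := by norm_num
  rw [h3]
  refine mul_le_mul_of_nonneg_left ?_ (by positivity)
  rw [← Real.cos_abs (2 * 1 * ζ.arg), abs_mul]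
  have := theta_lt ha
  refine Real.cos_le_cos_of_nonneg_of_le_pi (by positivity) (by linarith [pi_pos]) ?_
  rw [mul_one, abs_of_pos (by norm_num : (0 : ℝ) < 2)]
  linarith [hζ.2]

lemma le_sq_add_sq_re (ha : 1 < a) (hζ : ζ ∈ sec(a))
    (hw : w ∈ sec(a)) :
    Real.cos (2 * theta a) * (‖ζ‖ ^ 2 + ‖w‖ ^ 2) ≤ (ζ ^ 2 + w ^ 2).re := by
  rw [add_re, mul_add]
  exact add_le_add (le_sq_re ha hζ) (le_sq_re ha hw)

lemma norm_cpow_neg_le {z : ℂ} {m : ℝ} (hm : 0 < m) (hz : m ≤ z.re) {b : ℝ} (hb : 0 ≤ b) :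
    ‖z ^ᵣ (-b)‖ ≤ m ^ (-b) := by
  rw [norm_cpow_real]
  exact Real.rpow_le_rpow_of_nonpos hm (hz.trans (Complex.re_le_norm z)) (by linarith)

lemma norm_cpow_neg_sub_le {z z' : ℂ} {m : ℝ} (hm : 0 < m) (hz : m ≤ z.re) (hz' : m ≤ z'.re)
    {b : ℝ} (hb : 0 ≤ b) :
    ‖z ^ᵣ (-b) - z' ^ᵣ (-b)‖ ≤ b * m ^ (-(b + 1)) * ‖z - z'‖ := by
  refine Convex.norm_image_sub_le_of_norm_hasDerivWithin_le (s := {z : ℂ | m ≤ z.re})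
    (f := fun z : ℂ => z ^ᵣ (-b))
    (f' := fun z => (-b : ℝ) * z ^ (((-b : ℝ) : ℂ) - 1)) (fun x hx => ?_) (fun x hx => ?_)
    (convex_halfSpace_re_ge m) hz' hz
  · have hx0 : 0 < x.re := hm.trans_le hx
    exact (hasStrictDerivAt_cpow_const (Or.inl hx0)).hasDerivAt.hasDerivWithinAt
  · rw [norm_mul, norm_real, norm_eq_abs, abs_neg, abs_of_nonneg hb]
    have : ((-b : ℝ) : ℂ) - 1 = ((-(b + 1) : ℝ) : ℂ) := by push_cast; ring
    rw [this]
    exact mul_le_mul_of_nonneg_left (norm_cpow_neg_le hm hx (by linarith)) hb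

lemma sq_cpow_neg (ha : 1 < a) (hw : w ∈ sec(a)) :
    (w ^ 2) ^ᵣ (-a) = (w ^ᵣ (2 * a))⁻¹ := by
  rw [← Complex.cpow_neg, cpow_def_of_ne_zero (pow_ne_zero 2 hw.1), cpow_def_of_ne_zero hw.1]
  have h1 : Complex.log (w ^ 2) = 2 * Complex.log w := by
    have h3 := abs_le.1 hw.2
    have h4 := theta_lt ha
    have h5 : (2 * Complex.log w).im = 2 * w.arg := by
      rw [show (2 : ℂ) = ((2 : ℝ) : ℂ) by norm_num, im_ofReal_mul, log_im]
    rw [← Complex.log_exp (x := 2 * Complex.log w) (by rw [h5]; linarith [pi_pos])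
      (by rw [h5]; linarith [pi_pos]), two_mul, exp_add, exp_log hw.1, sq]
  rw [h1]; congr 1; push_cast; ring

/-- The value of `ft` at `w = 0`. -/
def ftZero (a : ℝ) (ζ : ℂ) : ℂ := (ζ ^ᵣ (2 * a))⁻¹ + (ζ ^ 2) ^ᵣ (-a)

lemma rpow_neg_mul_sq {m x : ℝ} (hm : 0 < m) (hx : 0 < x) (b : ℝ) :
    (m * x ^ 2) ^ (-b) = m ^ (-b) * x ^ (-(2 * b)) := by
  rw [mul_rpow hm.le (by positivity), ← rpow_natCast, ← rpow_mul hx.le]; congr 2; push_cast; ring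

lemma exists_norm_ft_le (ha : 1 < a) : ∃ C : ℝ, 0 < C ∧ ∀ w ∈ domU a, ∀ ζ ∈ rays (theta a),
    ‖ft a w ζ‖ ≤ C * ‖ζ‖ ^ (-(2 * a)) ∧ ‖ft a w ζ‖ ≤ C * ‖w‖ ^ (-(2 * (a + 1))) * ‖ζ‖ ^ 2 ∧
    ‖ft a w ζ - ftZero a ζ‖ ≤ C * ‖ζ‖ ^ (-(2 * (a + 1))) * ‖w‖ ^ 2 ∧
    ‖ftZero a ζ‖ ≤ C * ‖ζ‖ ^ (-(2 * a)) := by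
  set m := Real.cos (2 * theta a) with hm
  have hm0 : 0 < m := cos_two_mul_theta_pos ha
  refine ⟨5 + m ^ (-a) + a * m ^ (-(a + 1)), by positivity, fun w hw ζ hζ => ?_⟩
  have hζS := (mem_of_mem_rays ha hζ).1
  have hwS := domU_subset ha hw
  have hζ0 := norm_pos_iff.2 hζS.1
  have hw0 := norm_pos_iff.2 hw.1
  have hX : 0 < ‖ζ‖ ^ (2 * a) := by positivity
  have hW : 0 < ‖w‖ ^ (2 * a) := by positivity
  have h1 := norm_cpow_sub_ge_of_rays ha hζ hw
  have h2 := le_sq_add_sq_re ha hζS hwS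
  have h2ζ := le_sq_re ha hζS
  have h2w := le_sq_re ha hwS
  have hp : ‖ζ ^ᵣ (2 * a)‖ = ‖ζ‖ ^ (2 * a) := norm_cpow_real _ _
  have hq : ‖w ^ᵣ (2 * a)‖ = ‖w‖ ^ (2 * a) := norm_cpow_real _ _
  have hp0 : ζ ^ᵣ (2 * a) ≠ 0 := norm_pos_iff.1 (by rwa [hp])
  have hq0 : w ^ᵣ (2 * a) ≠ 0 := norm_pos_iff.1 (by rwa [hq])
  have hd0 : ζ ^ᵣ (2 * a) - w ^ᵣ (2 * a) ≠ 0 :=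
    norm_pos_iff.1 (lt_of_lt_of_le (by positivity) h1)
  have hpos1 : 0 < m ^ (-a) := by positivity
  have hpos2 : 0 < a * m ^ (-(a + 1)) := by positivity
  have e2 : -(2 * (a + 1)) = -(2 * a) + -2 := by ring
  have e3 : ∀ x : ℝ, 0 < x → x ^ (-2 : ℝ) = (x ^ 2)⁻¹ := fun x hx => by simp
  have key : ∀ x y : ℝ, 0 < x → 0 < y → ∀ d : ℝ, (x ^ (2 * a) + y ^ (2 * a)) / 5 ≤ d →
      x ^ (2 * a) / (y ^ (2 * a) * d) ≤ 5 * y ^ (-(2 * (a + 1))) * x ^ 2 := by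
    intro x y hx hy d hd
    have hx' : 0 < x ^ (2 * a) := by positivity
    have hy' : 0 < y ^ (2 * a) := by positivity
    have hd' : 0 < d := lt_of_lt_of_le (by positivity) hd
    have h3 : x ^ (2 * a) / d ≤ 5 * (x ^ 2 / y ^ 2) := by
      rcases le_total x y with h | h
      · have h4 : (x / y) ^ (2 * a) ≤ (x / y) ^ (2 : ℝ) :=
          Real.rpow_le_rpow_of_exponent_ge (by positivity) ((div_le_one hy).2 h) (by linarith)
        rw [div_rpow hx.le hy.le] at h4
        have h5 : (x / y) ^ (2 : ℝ) = x ^ 2 / y ^ 2 := by norm_cast; rw [div_pow]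
        rw [h5] at h4
        calc _ ≤ x ^ (2 * a) / (y ^ (2 * a) / 5) := by gcongr; linarith
          _ = 5 * (x ^ (2 * a) / y ^ (2 * a)) := by field_simp
          _ ≤ _ := by gcongr
      · calc _ ≤ x ^ (2 * a) / (x ^ (2 * a) / 5) := by gcongr; linarith
          _ = 5 * 1 := by field_simp
          _ ≤ _ := by
            gcongr
            rw [one_le_div (by positivity)]; gcongr
    calc x ^ (2 * a) / (y ^ (2 * a) * d) = x ^ (2 * a) / d * (y ^ (2 * a))⁻¹ := by field_simp
      _ ≤ 5 * (x ^ 2 / y ^ 2) * (y ^ (2 * a))⁻¹ := by gcongr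
      _ = _ := by
        rw [e2, rpow_add hy, e3 y hy, rpow_neg hy.le]; field_simp
  have hbound1 : ‖(ζ ^ᵣ (2 * a) - w ^ᵣ (2 * a))⁻¹‖ ≤ 5 * ‖ζ‖ ^ (-(2 * a)) := by
    rw [norm_inv, rpow_neg hζ0.le]
    calc _ ≤ (‖ζ‖ ^ (2 * a) / 5)⁻¹ := inv_anti₀ (by positivity) (by linarith)
      _ = _ := by ring
  have hbound2 : ‖(ζ ^ 2) ^ᵣ (-a)‖ ≤ m ^ (-a) * ‖ζ‖ ^ (-(2 * a)) := by
    rw [← rpow_neg_mul_sq hm0 hζ0]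
    exact norm_cpow_neg_le (by positivity) h2ζ (by linarith)
  have hbound3 : ‖(ζ ^ 2 + w ^ 2) ^ᵣ (-a)‖ ≤ m ^ (-a) * ‖ζ‖ ^ (-(2 * a)) := by
    rw [← rpow_neg_mul_sq hm0 hζ0]
    refine norm_cpow_neg_le (by positivity) (le_trans ?_ h2) (by linarith); gcongr
    linarith [sq_nonneg ‖w‖]
  have hY : 0 < ‖ζ‖ ^ (-(2 * a)) := by positivity
  refine ⟨?_, ?_, ?_, ?_⟩
  · refine (norm_add_le _ _).trans ?_
    nlinarith
  · have e1 : ft a w ζ = ζ ^ᵣ (2 * a) / (w ^ᵣ (2 * a) *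
        (ζ ^ᵣ (2 * a) - w ^ᵣ (2 * a))) +
        ((ζ ^ 2 + w ^ 2) ^ᵣ (-a) - (w ^ 2) ^ᵣ (-a)) := by
      rw [ft, sq_cpow_neg ha hwS]; field_simp; ring
    have b1 := key ‖ζ‖ ‖w‖ hζ0 hw0 _ h1
    have b2 := norm_cpow_neg_sub_le (z := ζ ^ 2 + w ^ 2) (z' := w ^ 2) (m := m * ‖w‖ ^ 2)
      (by positivity) (le_trans (by gcongr; linarith [sq_nonneg ‖ζ‖]) h2) h2w (b := a) (by linarith)
    rw [rpow_neg_mul_sq hm0 hw0, add_sub_cancel_right, norm_pow] at b2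
    rw [e1]
    refine (norm_add_le _ _).trans ?_
    rw [norm_div, norm_mul, hp, hq]
    have : 0 < ‖w‖ ^ (-(2 * (a + 1))) * ‖ζ‖ ^ 2 := by positivity
    nlinarith
  · have e1 : ft a w ζ - ftZero a ζ = w ^ᵣ (2 * a) / (ζ ^ᵣ (2 * a) *
        (ζ ^ᵣ (2 * a) - w ^ᵣ (2 * a))) +
        ((ζ ^ 2 + w ^ 2) ^ᵣ (-a) - (ζ ^ 2) ^ᵣ (-a)) := by
      rw [ft, ftZero]; field_simp; ring
    have b1 := key ‖w‖ ‖ζ‖ hw0 hζ0 ‖ζ ^ᵣ (2 * a) - w ^ᵣ (2 * a)‖ (by rw [add_comm]; exact h1)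
    have b2 := norm_cpow_neg_sub_le (z := ζ ^ 2 + w ^ 2) (z' := ζ ^ 2) (m := m * ‖ζ‖ ^ 2)
      (by positivity) (le_trans (by gcongr; linarith [sq_nonneg ‖w‖]) h2) h2ζ (b := a) (by linarith)
    rw [rpow_neg_mul_sq hm0 hζ0, add_sub_cancel_left, norm_pow] at b2
    rw [e1]
    refine (norm_add_le _ _).trans ?_
    rw [norm_div, norm_mul, hp, hq]
    have : 0 < ‖ζ‖ ^ (-(2 * (a + 1))) * ‖w‖ ^ 2 := by positivity
    nlinarith
  · refine (norm_add_le _ _).trans ?_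
    have : ‖(ζ ^ᵣ (2 * a))⁻¹‖ = ‖ζ‖ ^ (-(2 * a)) := by rw [norm_inv, hp, rpow_neg hζ0.le]
    rw [this]; nlinarith

end

lemma integrable_fourierChar_smul {n : ℕ} {f : Rn n → ℂ} (hf : Integrable f) (ξ : Rn n) :
    Integrable (fun v : Rn n => fourierChar (-(inner ℝ v ξ)) • f v) := by simp_all

lemma fourier_sub_apply {n : ℕ} {f g : Rn n → ℂ} (hf : Integrable f) (hg : Integrable g) (ξ : Rn n) :
    𝓕 (fun x => f x - g x) ξ = 𝓕 f ξ - 𝓕 g ξ := by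
  simp only [fourier_eq, smul_sub]
  exact integral_sub (integrable_fourierChar_smul hf ξ) (integrable_fourierChar_smul hg ξ)

lemma fourier_const_mul_apply {n : ℕ} (f : Rn n → ℂ) (c : ℂ) (ξ : Rn n) :
    𝓕 (fun x => c * f x) ξ = c * 𝓕 f ξ := by
  simp only [fourier_eq, ← smul_eq_mul (a := c), smul_comm _ c]
  exact integral_smul _ _

/-! ### The kernel of the fractional resolvent -/

/-- The square root of `-ζ²` with positive real part, for `ζ` off the real axis. -/
def decayRoot (ζ : ℂ) : ℂ := if 0 < ζ.im then -I * ζ else I * ζ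

lemma decayRoot_sq (ζ : ℂ) : decayRoot ζ ^ 2 = -ζ ^ 2 := by
  rw [decayRoot]
  split_ifs <;> (rw [mul_pow]; simp)

lemma norm_decayRoot (ζ : ℂ) : ‖decayRoot ζ‖ = ‖ζ‖ := by
  rw [decayRoot]
  split_ifs <;> simp

lemma decayRoot_re (ζ : ℂ) : (decayRoot ζ).re = |ζ.im| := by
  rw [decayRoot]
  split_ifs with h
  · simp [abs_of_pos h]
  · simp [abs_of_nonpos (not_lt.1 h)]

lemma decayRoot_mul_ofReal {r : ℝ} (hr : 0 < r) (ζ : ℂ) : decayRoot (ζ * r) = decayRoot ζ * r := by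
  have h : (0 < (ζ * r).im) = (0 < ζ.im) := by simp_all
  simp only [decayRoot, h]
  split_ifs <;> ring

lemma ray_mul (θ τ r : ℝ) : ray θ τ * r = ray θ (r * τ) := by rw [ray, ray]; push_cast; ring

lemma abs_im_ray {θ φ : ℝ} (hθ : 0 < θ) (hθ' : θ < π) (hφ : φ = -θ ∨ φ = θ) {τ : ℝ}
    (hτ : 0 < τ) : |(ray φ τ).im| = Real.sin θ * τ := by
  have hs := Real.sin_pos_of_pos_of_lt_pi hθ hθ'
  rw [ray, im_ofReal_mul, Complex.exp_ofReal_mul_I_im, abs_mul, abs_of_pos hτ, mul_comm]; congr 1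
  rcases hφ with rfl | rfl
  · rw [Real.sin_neg, abs_neg, abs_of_pos hs]
  · exact abs_of_pos hs

/-- The kernel of `((-Δ)^a - w^{2a})⁻¹` on `ℝⁿ` as a function of the distance. -/
def kern (n : ℕ) (a : ℝ) (w : ℂ) (r : ℝ) : ℂ :=
  w ^ᵣ (2 - 2 * a) / a * helm n (-I * w) r - (Complex.Gamma a)⁻¹ * heatPot n a (w ^ 2) r -
    rayDiff (theta a) (fun ζ => ft a w ζ * helm n (decayRoot ζ) r)

/-- The profile of `kern`. -/
def Phi (n : ℕ) (a : ℝ) (w : ℂ) : ℂ := kern n a w 1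

section

variable {n : ℕ} {a : ℝ} {w ζ : ℂ}

lemma helm_eq_rpow_mul (n : ℕ) (κ : ℂ) (r : ℝ) :
    helm n κ r = (r ^ (2 - (n : ℝ)) : ℝ) * helm n (κ * r) 1 := by
  simp only [helm, Real.one_rpow, ofReal_one, mul_one]; push_cast; ring

lemma heatPot_eq_rpow_mul (n : ℕ) (a : ℝ) (u : ℂ) {r : ℝ} (hr : 0 < r) :
    heatPot n a u r = (r ^ (2 * a - n) : ℝ) * heatPot n a (u * r ^ 2) 1 := by
  have h := integral_comp_mul_left_Ioi (fun t => ((t ^ (a - 1) *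
    (4 * π * t) ^ (-((n : ℝ) / 2)) * rexp (-r ^ 2 / (4 * t)) : ℝ) : ℂ) *
    cexp (-t * u)) 0 (b := r ^ 2) (by positivity)
  rw [mul_zero, eq_inv_smul_iff₀ (by positivity)] at h
  rw [heatPot, heatPot, ← h, real_smul, ← integral_const_mul, ← integral_const_mul]
  refine setIntegral_congr_fun measurableSet_Ioi fun t ht => ?_
  have ht0 : 0 < t := ht
  have h1 : (r ^ 2 * t) ^ (a - 1) = r ^ (2 * a - 2) * t ^ (a - 1) := by
    rw [mul_rpow (by positivity) ht0.le, ← rpow_natCast, ← rpow_mul hr.le]; congr 2; push_cast; ring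
  have h2 : (4 * π * (r ^ 2 * t)) ^ (-((n : ℝ) / 2)) =
      r ^ (-(n : ℝ)) * (4 * π * t) ^ (-((n : ℝ) / 2)) := by
    have := pi_pos
    rw [show 4 * π * (r ^ 2 * t) = r ^ 2 * (4 * π * t) by ring,
      mul_rpow (by positivity) (by positivity), ← rpow_natCast, ← rpow_mul hr.le]
    congr 2; push_cast; ring
  have h3 : -r ^ 2 / (4 * (r ^ 2 * t)) = -1 ^ 2 / (4 * t) := by field_simp
  have h4 : r ^ 2 * r ^ (2 * a - 2) * r ^ (-(n : ℝ)) = r ^ (2 * a - n) := by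
    rw [← rpow_natCast, ← rpow_add hr, ← rpow_add hr]; congr 1; push_cast; ring
  have h5 : -(r ^ 2 * t : ℝ) * u = -t * (u * r ^ 2) := by push_cast; ring
  rw [h1, h2, h3, h5, ← h4]; push_cast; ring

lemma rayDiff_comp_mul {θ : ℝ} (q : ℂ → ℂ) {r : ℝ} (hr : 0 < r) :
    rayDiff θ (fun ζ => q (ζ * r)) = (r ^ (-2 : ℝ) : ℝ) * rayDiff θ q := by
  have h : ∀ φ : ℝ, ∀ c : ℂ, ∫ τ in Ioi 0, q (ray φ τ * r) * (2 * τ * c) =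
      (r ^ (-2 : ℝ) : ℝ) * ∫ τ in Ioi 0, q (ray φ τ) * (2 * τ * c) := by
    intro φ c
    have h := integral_comp_mul_left_Ioi (fun τ => q (ray φ τ) * (2 * τ * c)) 0 hr
    rw [mul_zero, eq_inv_smul_iff₀ hr.ne', real_smul] at h
    rw [← h, ← integral_const_mul, ← integral_const_mul]
    refine setIntegral_congr_fun measurableSet_Ioi fun t _ => ?_
    simp only [ray_mul]
    have h2 : r ^ (-2 : ℝ) = (r ^ 2)⁻¹ := by simp
    have hr' : (r : ℂ) ≠ 0 := mod_cast hr.ne'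
    rw [h2]; push_cast; field_simp
  simp only [rayDiff]
  rw [h, h]; ring

lemma ft_mul_ofReal (ha : 1 < a) (hw : w ∈ domU a) (hζ : ζ ∈ sec(a)) {r : ℝ}
    (hr : 0 < r) : ft a (w * r) (ζ * r) = (r ^ (-(2 * a)) : ℝ) * ft a w ζ := by
  have h0 : ζ ^ 2 + w ^ 2 ≠ 0 := Complex.slitPlane_ne_zero (sq_add_sq_mem_slitPlane ha hζ hw)
  have h1 : (ζ * r) ^ 2 + (w * r) ^ 2 = (r ^ 2 : ℝ) * (ζ ^ 2 + w ^ 2) := by push_cast; ring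
  have h2 : (r ^ 2) ^ (-a) = r ^ (-(2 * a)) := by
    rw [← rpow_natCast, ← rpow_mul hr.le]; congr 1; push_cast; ring
  rw [ft, ft, h1, mul_comm ζ, mul_comm w, ofReal_mul_cpow_ofReal hr hζ.1,
    ofReal_mul_cpow_ofReal hr hw.1, ofReal_mul_cpow_ofReal (by positivity) h0, h2, ← mul_sub, mul_inv,
    mul_add, rpow_neg hr.le]
  push_cast; ring

lemma kern_eq_rpow_mul_Phi (ha : 1 < a) (hw : w ∈ domU a) {r : ℝ} (hr : 0 < r) :
    kern n a w r = (r ^ (2 * a - n) : ℝ) * Phi n a (w * r) := by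
  have h1 : (w * r) ^ᵣ (2 - 2 * a) = (r ^ (2 - 2 * a) : ℝ) * w ^ᵣ (2 - 2 * a) := by
    rw [mul_comm w, ofReal_mul_cpow_ofReal hr hw.1]
  have h2 : r ^ (2 * a - n) * r ^ (2 - 2 * a) = r ^ (2 - (n : ℝ)) := by
    rw [← rpow_add hr]; congr 1; ring
  have h3 := rayDiff_comp_mul (θ := theta a) (fun ζ => ft a (w * r) ζ * helm n (decayRoot ζ) 1) hr
  have h4 : rayDiff (theta a) (fun ζ => ft a w ζ * helm n (decayRoot ζ) r) =
      ((r ^ (2 * a) * r ^ (2 - (n : ℝ)) : ℝ) : ℂ) *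
        rayDiff (theta a) (fun ζ => ft a (w * r) (ζ * r) * helm n (decayRoot (ζ * r)) 1) := by
    rw [← rayDiff_const_mul]
    refine rayDiff_congr fun ζ hζ => ?_
    rw [ft_mul_ofReal ha hw (mem_of_mem_rays ha hζ).1 hr, helm_eq_rpow_mul n (decayRoot ζ),
      decayRoot_mul_ofReal hr]
    have : r ^ (2 * a) * r ^ (-(2 * a)) = 1 := by rw [← rpow_add hr, add_neg_cancel, rpow_zero]
    have h5 : (r ^ (2 * a) : ℝ) * ((r ^ (-(2 * a)) : ℝ) : ℂ) = 1 := mod_cast this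
    push_cast at h5 ⊢
    linear_combination (-ft a w ζ * (r ^ (2 - (n : ℝ)) : ℝ) * helm n (decayRoot ζ * r) 1) * h5
  have h6 : r ^ (2 * a) * r ^ (2 - (n : ℝ)) * r ^ (-2 : ℝ) = r ^ (2 * a - n) := by
    rw [← rpow_add hr, ← rpow_add hr]; congr 1; ring
  rw [Phi, kern, kern, h4, h3, ← mul_assoc _ ((r ^ (-2 : ℝ) : ℝ) : ℂ), ← Complex.ofReal_mul, h6,
    helm_eq_rpow_mul n (-I * w), heatPot_eq_rpow_mul n a _ hr, h1, ← h2, mul_pow,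
    mul_assoc (-I)]
  push_cast; ring

lemma continuousAt_ft (ha : 1 < a) (hw : w ∈ domU a) (hζ : ζ ∈ rays (theta a)) :
    ContinuousAt (ft a w) ζ := by
  have hζS := (mem_of_mem_rays ha hζ).1
  have hwS := domU_subset ha hw
  have hne := ne_of_mem_rays ha hζ hw
  refine ContinuousAt.add (ContinuousAt.inv₀ (ContinuousAt.sub ?_ continuousAt_const) ?_) ?_
  · exact (hasStrictDerivAt_cpow_const (mem_slitPlane_of_sec ha
      hζS)).hasDerivAt.continuousAt
  · exact sub_ne_zero.2 fun h => hne (cpow_inj_of_closedSector ha hζS hwS h)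
  · exact ContinuousAt.cpow (f := fun ζ : ℂ => ζ ^ 2 + w ^ 2) (by fun_prop) continuousAt_const
      (sq_add_sq_mem_slitPlane ha hζS hw)

lemma mem_rays {θ φ τ : ℝ} (hφ : φ = -θ ∨ φ = θ) (hτ : 0 < τ) : ray φ τ ∈ rays θ := by
  rcases hφ with rfl | rfl
  · exact ⟨τ, hτ, Or.inl rfl⟩
  · exact ⟨τ, hτ, Or.inr rfl⟩

lemma continuousOn_ft_ray (ha : 1 < a) (hw : w ∈ domU a) {φ : ℝ} (hφ : φ = -theta a ∨ φ = theta a) :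
    ContinuousOn (fun τ => ft a w (ray φ τ)) (Ioi 0) := fun _ hτ =>
  ((continuousAt_ft ha hw (mem_rays hφ hτ)).comp (f := ray φ)
    (continuous_ray φ).continuousAt).continuousWithinAt

lemma decayRoot_ray (φ : ℝ) {τ : ℝ} (hτ : 0 < τ) : decayRoot (ray φ τ) = decayRoot (ray φ 1) * τ := by
  rw [← decayRoot_mul_ofReal hτ, ray_mul, mul_one]

lemma decayRoot_ray_re_pos (ha : 1 < a) {φ : ℝ} (hφ : φ = -theta a ∨ φ = theta a) {τ : ℝ}
    (hτ : 0 < τ) : 0 < (decayRoot (ray φ τ)).re := by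
  have h1 := theta_pos ha
  have h2 : theta a < π := by linarith [theta_lt ha, pi_pos]
  rw [decayRoot_re, abs_im_ray h1 h2 hφ hτ]
  exact mul_pos (Real.sin_pos_of_pos_of_lt_pi h1 h2) hτ

lemma integral_norm_helm_mul (n : ℕ) (κ : ℂ) {τ : ℝ} (hτ : 0 < τ) :
    ∫ x : Rn n, ‖helm n (κ * τ) ‖x‖‖ = (τ ^ 2)⁻¹ * ∫ x : Rn n, ‖helm n κ ‖x‖‖ := by
  have h := Measure.integral_comp_smul_of_nonneg (volume : Measure (Rn n))
    (fun x : Rn n => ‖helm n κ ‖x‖‖) τ (hR := hτ.le)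
  rw [finrank_euclideanSpace, Fintype.card_fin, smul_eq_mul] at h
  have h2 : ∀ x : Rn n, ‖helm n (κ * τ) ‖x‖‖ = τ ^ ((n : ℝ) - 2) * ‖helm n κ ‖τ • x‖‖ := by
    intro x
    have h3 : helm n (κ * τ) ‖x‖ = (τ ^ ((n : ℝ) - 2) : ℝ) * helm n κ ‖τ • x‖ := by
      have h4 : τ ^ ((n : ℝ) - 2) * τ ^ (2 - (n : ℝ)) = 1 := by rw [← rpow_add hτ]; norm_num
      have h5 : (τ ^ ((n : ℝ) - 2) : ℝ) * ((τ ^ (2 - (n : ℝ)) : ℝ) : ℂ) = 1 := by exact_mod_cast h4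
      rw [norm_smul, Real.norm_of_nonneg hτ.le, helm, helm, mul_rpow hτ.le (norm_nonneg _),
        mul_assoc κ]
      push_cast at h5 ⊢
      linear_combination (-(helmC n * (((‖x‖ ^ (2 - (n : ℝ)) : ℝ)) : ℂ) *
        mac ord(n) (κ * (τ * ‖x‖)))) * h5
    rw [h3, norm_mul, norm_of_nonneg (by positivity)]
  simp only [h2]
  rw [integral_const_mul, h, ← mul_assoc]; congr 1
  rw [← rpow_natCast τ n, ← rpow_neg hτ.le, ← rpow_add hτ, ← rpow_natCast τ 2, ← rpow_neg hτ.le]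
  congr 1; push_cast; ring

lemma integrable_ray_helm (hn : 3 ≤ n) (ha : 1 < a) (hw : w ∈ domU a) {φ : ℝ}
    (hφ : φ = -theta a ∨ φ = theta a) (c : ℂ) :
    Integrable (fun q : ℝ × Rn n => ft a w (ray φ q.1) * helm n (decayRoot (ray φ q.1)) ‖q.2‖ *
      (2 * q.1 * c)) ((volume.restrict (Ioi 0)).prod volume) := by
  have : Nonempty (Fin n) := ⟨⟨0, by omega⟩⟩
  have hn' : (3 : ℝ) ≤ n := mod_cast hn
  have hκ := decayRoot_ray_re_pos ha hφ one_pos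
  set κ := decayRoot (ray φ 1)
  have h0 : (volume.restrict ({0}ᶜ : Set (Rn n))) = volume :=
    Measure.restrict_eq_self_of_ae_mem (compl_mem_ae_iff.2 (measure_singleton 0))
  have hmeas : AEStronglyMeasurable (fun q : ℝ × Rn n => ft a w (ray φ q.1) *
      helm n (decayRoot (ray φ q.1)) ‖q.2‖ * (2 * q.1 * c))
      ((volume.restrict (Ioi 0)).prod volume) := by
    rw [← h0, Measure.prod_restrict]
    refine ContinuousOn.aestronglyMeasurable ?_
      (measurableSet_Ioi.prod (measurableSet_singleton _).compl)
    refine (ContinuousOn.mul ?_ ?_).mul (by fun_prop)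
    · exact (continuousOn_ft_ray ha hw hφ).comp continuousOn_fst fun q hq => hq.1
    · have h1 : ContinuousOn (fun q : ℝ × Rn n => helm n (κ * q.1) ‖q.2‖) (Ioi 0 ×ˢ {0}ᶜ) := by
        simp only [helm]
        refine ContinuousOn.mul ?_ ?_
        · refine continuous_ofReal.comp_continuousOn (continuousOn_const.mul
            (ContinuousOn.rpow_const (by fun_prop) fun q hq => Or.inl ?_))
          exact norm_ne_zero_iff.2 hq.2
        · refine (differentiableOn_mac (p := ord(n)) (by linarith)).continuousOn.comp
            (by fun_prop) fun q hq => ?_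
          have h2 : 0 < q.1 := hq.1
          have h3 : 0 < ‖q.2‖ := norm_pos_iff.2 hq.2
          rw [mul_assoc, ← Complex.ofReal_mul]
          exact mul_ofReal_mem_slitPlane hκ (mul_pos h2 h3)
      refine h1.congr fun q hq => ?_
      rw [decayRoot_ray φ hq.1]
  rw [integrable_prod_iff hmeas]
  refine ⟨?_, ?_⟩
  · filter_upwards [ae_mem_Ioi] with τ hτ
    exact ((integrable_helm hn (decayRoot_ray_re_pos ha hφ hτ)).const_mul _).mul_const _
  · obtain ⟨C, hC, hft⟩ := exists_norm_ft_le ha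
    have h1 : IntegrableOn (fun τ => ft a w (ray φ τ) * (τ : ℂ)⁻¹) (Ioi 0) := by
      refine integrableOn_Ioi_of_bounds (C := C * ‖w‖ ^ (-(2 * (a + 1)))) (C' := C) (ρ := 1) (R := 1)
        (c := 2 * a + 1) ?_ one_pos (by linarith) (fun τ hτ hτ1 => ?_) (fun τ hτ _ => ?_)
      · exact (continuousOn_ft_ray ha hw hφ).mul (ContinuousOn.inv₀ (by fun_prop) fun τ hτ => by
          exact_mod_cast (ne_of_gt hτ))
      · have h2 := (hft w hw _ (mem_rays hφ hτ)).2.1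
        rw [norm_ray _ hτ.le] at h2
        rw [norm_mul, norm_inv, norm_of_nonneg hτ.le]
        have h3 : 0 ≤ C * ‖w‖ ^ (-(2 * (a + 1))) := by positivity
        calc _ ≤ C * ‖w‖ ^ (-(2 * (a + 1))) * τ ^ 2 * τ⁻¹ := by gcongr
          _ = C * ‖w‖ ^ (-(2 * (a + 1))) * τ := by field_simp
          _ ≤ _ := mul_le_of_le_one_right h3 hτ1
      · have h2 := (hft w hw _ (mem_rays hφ hτ)).1
        rw [norm_ray _ hτ.le] at h2
        rw [norm_mul, norm_inv, norm_of_nonneg hτ.le]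
        calc _ ≤ C * τ ^ (-(2 * a)) * τ⁻¹ := by gcongr
          _ = _ := by rw [mul_assoc, ← Real.rpow_neg_one, ← rpow_add hτ]; congr 2; ring
    refine (h1.norm.mul_const (2 * ‖c‖ * ∫ x : Rn n, ‖helm n κ ‖x‖‖)).congr ?_
    filter_upwards [ae_mem_Ioi] with τ hτ
    have hτ0 : 0 < τ := hτ
    simp only [norm_mul]
    rw [integral_mul_const, integral_const_mul, decayRoot_ray φ hτ0, integral_norm_helm_mul n κ hτ0,
      norm_inv, norm_of_nonneg hτ0.le]
    simp only [norm_ofNat]; field_simp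

lemma fourier_rayDiff (hn : 3 ≤ n) (ha : 1 < a) (hw : w ∈ domU a) :
    Integrable (fun x : Rn n => rayDiff (theta a) (fun ζ => ft a w ζ * helm n (decayRoot ζ) ‖x‖)) ∧
    ∀ ξ : Rn n,
      𝓕 (fun x : Rn n => rayDiff (theta a) (fun ζ => ft a w ζ * helm n (decayRoot ζ) ‖x‖)) ξ =
        rayDiff (theta a) (fun ζ => -(ft a w ζ / (ζ ^ 2 - ((2 * π * ‖ξ‖ : ℝ) : ℂ) ^ 2))) := by
  have h := fun (φ : ℝ) (hφ : φ = -theta a ∨ φ = theta a) (c : ℂ) =>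
    fourier_integral_of_integrable_prod (k := fun (τ : ℝ) (x : Rn n) => ft a w (ray φ τ) *
      helm n (decayRoot (ray φ τ)) ‖x‖ * (2 * τ * c)) (integrable_ray_helm hn ha hw hφ c)
  obtain ⟨h1, h1'⟩ := h (-theta a) (Or.inl rfl) (cexp (-(theta a) * I) ^ 2)
  obtain ⟨h2, h2'⟩ := h (theta a) (Or.inr rfl) (cexp ((theta a) * I) ^ 2)
  refine ⟨(h1.sub h2).const_mul _, fun ξ => ?_⟩
  have hF : ∀ φ : ℝ, (φ = -theta a ∨ φ = theta a) → ∀ c : ℂ, ∀ τ ∈ Ioi 0,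
      𝓕 (fun x : Rn n => ft a w (ray φ τ) * helm n (decayRoot (ray φ τ)) ‖x‖ * (2 * τ * c)) ξ =
      -(ft a w (ray φ τ) / ((ray φ τ) ^ 2 - ((2 * π * ‖ξ‖ : ℝ) : ℂ) ^ 2)) * (2 * τ * c) := by
    intro φ hφ c τ hτ
    have e1 : (fun x : Rn n => ft a w (ray φ τ) * helm n (decayRoot (ray φ τ)) ‖x‖ * (2 * τ * c)) =
        fun x : Rn n => (ft a w (ray φ τ) * (2 * τ * c)) * helm n (decayRoot (ray φ τ)) ‖x‖ := by
      ext x; ring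
    rw [e1, fourier_const_mul_apply, fourier_helm hn (decayRoot_ray_re_pos ha hφ hτ), decayRoot_sq,
      ← neg_sub (_ ^ 2), div_neg, neg_neg, div_eq_mul_inv]
    push_cast; ring
  have hlhs : (fun x : Rn n => rayDiff (theta a)
      (fun ζ => ft a w ζ * helm n (decayRoot ζ) ‖x‖)) = fun x => (2 * π * I)⁻¹ *
      ((fun x : Rn n => ∫ τ in Ioi 0, ft a w (ray (-theta a) τ) *
        helm n (decayRoot (ray (-theta a) τ)) ‖x‖ *
        (2 * τ * cexp (-(theta a) * I) ^ 2)) x -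
      (fun x : Rn n => ∫ τ in Ioi 0, ft a w (ray (theta a) τ) *
        helm n (decayRoot (ray (theta a) τ)) ‖x‖ *
        (2 * τ * cexp ((theta a) * I) ^ 2)) x) := rfl
  rw [hlhs, fourier_const_mul_apply, fourier_sub_apply h1 h2, h1', h2', rayDiff]
  rw [setIntegral_congr_fun measurableSet_Ioi (hF (-theta a) (Or.inl rfl) _),
    setIntegral_congr_fun measurableSet_Ioi (hF (theta a) (Or.inr rfl) _)]

lemma fourier_kern (hn : 3 ≤ n) (ha : 1 < a) (hw : w ∈ domU a) (hwi : 0 < w.im) :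
    Integrable (fun x : Rn n => kern n a w ‖x‖) ∧ ∀ ξ : Rn n, ξ ≠ 0 →
      𝓕 (fun x : Rn n => kern n a w ‖x‖) ξ =
        ((((2 * π * ‖ξ‖) ^ (2 * a) : ℝ) : ℂ) - w ^ᵣ (2 * a))⁻¹ := by
  have hκ : 0 < (-I * w).re := by simpa using hwi
  have hw2 : 0 < (w ^ 2).re := sq_re_pos ha (domU_subset ha hw)
  have i1 := (integrable_helm hn hκ).const_mul (w ^ᵣ (2 - 2 * a) / a)
  obtain ⟨i2, f2⟩ := fourier_heatPot (n := n) (a := a) (by linarith) hw2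
  obtain ⟨i3, f3⟩ := fourier_rayDiff hn ha hw
  have i2' := i2.const_mul (Complex.Gamma a)⁻¹
  have i12 : Integrable (fun x : Rn n => w ^ᵣ (2 - 2 * a) / a *
      helm n (-I * w) ‖x‖ - (Complex.Gamma a)⁻¹ * heatPot n a (w ^ 2) ‖x‖) := i1.sub i2'
  refine ⟨i12.sub i3, fun ξ hξ => ?_⟩
  have hπ := pi_pos
  have hξ0 := norm_pos_iff.2 hξ
  set b : ℝ := 2 * π * ‖ξ‖ with hb
  have hb0 : 0 < b := by positivity
  have hbc : (b : ℂ) ≠ 0 := mod_cast hb0.ne'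
  have hba : |(b : ℂ).arg| < theta a := by
    rw [Complex.arg_ofReal_of_nonneg hb0.le, abs_zero]; exact theta_pos ha
  have hbw : (b : ℂ) ≠ w := by aesop
  have hG : Complex.Gamma a ≠ 0 := by
    rw [Complex.Gamma_ofReal]
    exact_mod_cast (Real.Gamma_pos_of_pos (by linarith : 0 < a)).ne'
  have hC := (rayDiff_ft_div ha hw hbc hba hbw).2
  have e : 𝓕 (fun x : Rn n => kern n a w ‖x‖) ξ = w ^ᵣ (2 - 2 * a) / a *
      (((b ^ 2 : ℝ) : ℂ) + (-I * w) ^ 2)⁻¹ -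
      (Complex.Gamma a)⁻¹ * ((w ^ 2 + ((b ^ 2 : ℝ) : ℂ)) ^ (-(a : ℂ)) * Complex.Gamma a) -
      rayDiff (theta a) (fun ζ => -(ft a w ζ / (ζ ^ 2 - (b : ℂ) ^ 2))) := by
    simp only [kern]
    rw [fourier_sub_apply i12 i3, f3, fourier_sub_apply i1 i2', fourier_const_mul_apply,
      fourier_const_mul_apply, fourier_helm hn hκ, f2]
  have e2 : rayDiff (theta a) (fun ζ => -(ft a w ζ / (ζ ^ 2 - (b : ℂ) ^ 2))) =
      -rayDiff (theta a) (fun ζ => ft a w ζ / (ζ ^ 2 - (b : ℂ) ^ 2)) := by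
    have := rayDiff_const_mul (θ := theta a) (fun ζ => ft a w ζ / (ζ ^ 2 - (b : ℂ) ^ 2)) (-1)
    simpa using this
  rw [e, e2]
  have e3 : (-I * w) ^ 2 = -w ^ 2 := by rw [mul_pow]; simp
  have e4 : (Complex.Gamma a)⁻¹ * ((w ^ 2 + ((b ^ 2 : ℝ) : ℂ)) ^ (-(a : ℂ)) * Complex.Gamma a) =
      ((b : ℂ) ^ 2 + w ^ 2) ^ᵣ (-a) := by
    rw [mul_comm, mul_assoc, mul_inv_cancel₀ hG, mul_one, add_comm]; push_cast; rfl
  rw [e3, e4]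
  rw [ft] at hC
  have e5 : (b : ℂ) ^ᵣ (2 * a) = ((b ^ (2 * a) : ℝ) : ℂ) := (ofReal_cpow hb0.le _).symm
  rw [e5] at hC
  push_cast at hC ⊢
  rw [← sub_eq_add_neg]
  linear_combination -hC

end

/-! ### Analyticity of the profile -/

lemma integrableOn_rpow_mul_exp_neg_div {b c : ℝ} (hb : b < -1) (hc : 0 < c) :
    IntegrableOn (fun t => t ^ b * rexp (-c / t)) (Ioi 0) := by
  obtain ⟨C, hC, h⟩ := exists_rpow_mul_exp_neg_div_le b hc
  have h1 : IntegrableOn (fun t => ((t ^ b * rexp (-c / t) : ℝ) : ℂ)) (Ioi 0) := by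
    refine integrableOn_Ioi_of_bounds (C := C * (1 + 1) ^ |b|) (C' := 1) (ρ := 1) (R := 1) (c := -b)
      ?_ one_pos (by linarith) (fun t ht ht1 => ?_) (fun t ht _ => ?_)
    · refine continuous_ofReal.comp_continuousOn (ContinuousOn.mul ?_ ?_)
      · exact continuousOn_id.rpow_const fun t ht => Or.inl (ne_of_gt ht)
      · exact Real.continuous_exp.comp_continuousOn
          (continuousOn_const.div continuousOn_id fun t ht => ne_of_gt ht)
    · rw [norm_of_nonneg (by positivity)]
      exact (h t ht).trans (by gcongr)
    · rw [norm_of_nonneg (by positivity), neg_neg, one_mul]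
      refine mul_le_of_le_one_right (by positivity) ?_
      rw [exp_le_one_iff, neg_div]
      exact neg_nonpos.2 (by positivity)
  exact h1.re.congr (Eventually.of_forall fun t => ofReal_re _)

section

variable {n : ℕ} {a : ℝ} {w ζ : ℂ}

lemma norm_heatPot_integrand (n : ℕ) (a : ℝ) (u : ℂ) {t : ℝ} (ht : 0 < t) :
    ‖((t ^ (a - 1) * (4 * π * t) ^ (-((n : ℝ) / 2)) * rexp (-1 ^ 2 / (4 * t)) : ℝ) : ℂ) *
      cexp (-t * u)‖ = (4 * π) ^ (-((n : ℝ) / 2)) *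
      (t ^ (a - 1 - n / 2) * rexp (-(1 / 4) / t)) * rexp (-(t * u.re)) := by
  have hπ := pi_pos
  rw [norm_mul, norm_of_nonneg (by positivity), norm_exp,
    mul_rpow (by positivity) ht.le, sub_eq_add_neg (a - 1), rpow_add ht]
  have h1 : (-(t : ℂ) * u).re = -(t * u.re) := by simp
  have h2 : -1 ^ 2 / (4 * t) = -(1 / 4) / t := by field_simp
  rw [h1, h2]; ring

lemma measurable_heatPot_integrand (n : ℕ) (a : ℝ) (u : ℂ) :
    Measurable fun t => (t ^ (a - 1) * (4 * π * t) ^ (-((n : ℝ) / 2)) *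
      rexp (-1 ^ 2 / (4 * t)) : ℝ) * cexp (-t * u) := by fun_prop

lemma differentiableOn_heatPot (han : 2 * a < n) :
    DifferentiableOn ℂ (fun u => heatPot n a u 1) {u | 0 < u.re} := by
  have hUo : IsOpen {z : ℂ | 0 < z.re} := isOpen_lt continuous_const continuous_re
  refine differentiableOn_integral_of_dominated hUo
    (fun u _ => (measurable_heatPot_integrand n a u).aestronglyMeasurable)
    (Eventually.of_forall fun t => by fun_prop) (fun u _ => ⟨1, one_pos, _,
      (integrableOn_rpow_mul_exp_neg_div (b := a - 1 - n / 2) (c := 1 / 4) (by linarith)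
        (by norm_num)).const_mul ((4 * π) ^ (-((n : ℝ) / 2))), ?_⟩)
  filter_upwards [ae_mem_Ioi] with t ht u' _ hu'
  have ht0 : 0 < t := ht
  have hu0 : 0 < u'.re := hu'
  rw [norm_heatPot_integrand n a u' ht0]
  have hπ := pi_pos
  refine mul_le_of_le_one_right (by positivity) ?_
  rw [exp_le_one_iff]
  exact neg_nonpos.2 (by positivity)

lemma helm_one (n : ℕ) (κ : ℂ) : helm n κ 1 = helmC n * mac ord(n) κ := by simp [helm]

lemma norm_mac_decayRoot_le {p : ℝ} (hp : 0 ≤ p) (ha : 1 < a) (hζ : ζ ∈ rays (theta a)) :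
    ‖mac p (decayRoot ζ)‖ ≤ macConst p * 2 ^ p *
      ((1 + ‖ζ‖) ^ p * rexp (-Real.sin (theta a) * ‖ζ‖)) := by
  have h := norm_mac_le hp (decayRoot ζ)
  have h2 : |ζ.im| = Real.sin (theta a) * ‖ζ‖ := by
    have h1 := theta_pos ha
    have h2 : theta a < π := by linarith [theta_lt ha, pi_pos]
    obtain ⟨τ, hτ, rfl | rfl⟩ := hζ
    · rw [abs_im_ray h1 h2 (Or.inl rfl) hτ, norm_ray _ hτ.le]
    · rw [abs_im_ray h1 h2 (Or.inr rfl) hτ, norm_ray _ hτ.le]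
  rw [norm_decayRoot, decayRoot_re, h2, ← neg_mul] at h
  have h3 : (1 + 2 * ‖ζ‖) ^ p ≤ 2 ^ p * (1 + ‖ζ‖) ^ p := by
    rw [← mul_rpow (by norm_num) (by positivity)]
    exact rpow_le_rpow (by positivity) (by linarith) hp
  have h4 := macConst_nonneg p
  calc _ ≤ _ := h
    _ ≤ macConst p * (2 ^ p * (1 + ‖ζ‖) ^ p) * rexp (-Real.sin (theta a) * ‖ζ‖) := by gcongr
    _ = _ := by ring

lemma sin_theta_pos (ha : 1 < a) : 0 < Real.sin (theta a) :=
  Real.sin_pos_of_pos_of_lt_pi (theta_pos ha) (by linarith [theta_lt ha, pi_pos])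

lemma norm_rayDiff_le {θ : ℝ} {q : ℂ → ℂ} {g : ℝ → ℝ} (hg : IntegrableOn (fun τ => g τ * τ) (Ioi 0))
    (h : ∀ ζ ∈ rays θ, ‖q ζ‖ ≤ g ‖ζ‖) : ‖rayDiff θ q‖ ≤ ∫ τ in Ioi 0, g τ * τ := by
  have h1 : ∀ φ : ℝ, (φ = -θ ∨ φ = θ) → ‖∫ τ in Ioi 0, q (ray φ τ) * (2 * τ * cexp (φ * I) ^ 2)‖ ≤
      2 * ∫ τ in Ioi 0, g τ * τ := by
    intro φ hφ
    rw [← integral_const_mul]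
    refine norm_integral_le_of_norm_le (hg.const_mul 2) ?_
    filter_upwards [ae_mem_Ioi] with τ hτ
    have hτ0 : 0 < τ := hτ
    have h2 := h _ (mem_rays hφ hτ0)
    rw [norm_ray _ hτ0.le] at h2
    rw [norm_mul, norm_mul, norm_pow, norm_exp_ofReal_mul_I, norm_mul,
      norm_of_nonneg hτ0.le, norm_ofNat]
    nlinarith
  have h2 := h1 (-θ) (Or.inl rfl)
  have h3 := h1 θ (Or.inr rfl)
  rw [ofReal_neg] at h2
  set J := ∫ τ in Ioi 0, g τ * τ
  have hJ : 0 ≤ J := by linarith [norm_nonneg (∫ τ in Ioi 0,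
    q (ray θ τ) * (2 * τ * cexp (θ * I) ^ 2))]
  have hπ := Real.pi_gt_three
  rw [rayDiff, norm_mul, norm_inv]
  have h4 : ‖(2 * π * I : ℂ)‖ = 2 * π := by simp [abs_of_pos pi_pos]
  rw [h4, inv_mul_le_iff₀ (by positivity)]
  refine (norm_sub_le _ _).trans ?_; nlinarith

lemma isOpen_domU (ha : 1 < a) : IsOpen (domU a) := by
  refine isOpen_iff_mem_nhds.2 fun w hw => ?_
  have hs := mem_slitPlane_of_sec ha (domU_subset ha hw)
  have h1 : ContinuousAt (fun w : ℂ => |w.arg|) w := (Complex.continuousAt_arg hs).abs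
  filter_upwards [h1.eventually_lt_const hw.2, isOpen_compl_singleton.mem_nhds hw.1] with z hz hz0
  exact ⟨hz0, hz⟩

lemma re_pos_of_mem_domU (ha : 1 < a) (hw : w ∈ domU a) : 0 < w.re := by
  have h1 := abs_arg_lt_of_mem_domU hw ha
  have h2 := theta_lt ha
  have h3 := abs_lt.1 h1
  rw [← Complex.norm_mul_cos_arg]
  exact mul_pos (norm_pos_iff.2 hw.1)
    (Real.cos_pos_of_mem_Ioo ⟨by linarith [pi_pos], by linarith [pi_pos]⟩)

lemma differentiableOn_ft (ha : 1 < a) (hζ : ζ ∈ rays (theta a)) :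
    DifferentiableOn ℂ (fun w => ft a w ζ) (domU a) := by
  intro w hw
  have hζS := (mem_of_mem_rays ha hζ).1
  have hwS := domU_subset ha hw
  have hne := ne_of_mem_rays ha hζ hw
  refine DifferentiableAt.differentiableWithinAt (DifferentiableAt.add (DifferentiableAt.inv
    (DifferentiableAt.const_sub ?_ _) ?_) ?_)
  · exact (hasStrictDerivAt_cpow_const
      (mem_slitPlane_of_sec ha hwS)).hasDerivAt.differentiableAt
  · exact sub_ne_zero.2 fun h => hne (cpow_inj_of_closedSector ha hζS hwS h)
  · exact DifferentiableAt.cpow_const (f := fun w : ℂ => ζ ^ 2 + w ^ 2) (by fun_prop)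
      (sq_add_sq_mem_slitPlane ha hζS hw)

/-- The part of the profile given by an integral over the two rays. -/
def rayPart (n : ℕ) (a : ℝ) (w : ℂ) : ℂ :=
  rayDiff (theta a) (fun ζ => ft a w ζ * helm n (decayRoot ζ) 1)

lemma continuousOn_mac_decayRoot_ray {p : ℝ} (hp : 0 ≤ p) (ha : 1 < a) {φ : ℝ}
    (hφ : φ = -theta a ∨ φ = theta a) :
    ContinuousOn (fun τ => mac p (decayRoot (ray φ τ))) (Ioi 0) := by
  have h1 : ContinuousOn (fun τ : ℝ => mac p (decayRoot (ray φ 1) * τ)) (Ioi 0) :=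
    (differentiableOn_mac hp).continuousOn.comp (by fun_prop) fun τ hτ =>
      mul_ofReal_mem_slitPlane (decayRoot_ray_re_pos ha hφ one_pos) hτ
  refine h1.congr fun τ hτ => ?_
  rw [decayRoot_ray φ hτ]

lemma integrableOn_rpow_mul_exp' {b s : ℝ} (hb : -1 < b) (p : ℝ) (hs : 0 < s) :
    IntegrableOn (fun τ => τ ^ b * ((1 + τ) ^ p * rexp (-s * τ))) (Ioi 0) := by
  obtain ⟨C, hC, h⟩ := exists_rpow_le_exp p (half_pos hs)
  have h1 := integrableOn_rpow_mul_exp_neg (a := b + 1) (u := s / 2) (by linarith) (half_pos hs)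
  rw [add_sub_cancel_right] at h1
  refine Integrable.mono' (h1.const_mul C) (Measurable.aestronglyMeasurable (by fun_prop)) ?_
  filter_upwards [ae_mem_Ioi] with τ hτ
  have hτ0 : 0 < τ := hτ
  rw [Real.norm_of_nonneg (by positivity)]
  calc _ ≤ τ ^ b * ((C * rexp (s / 2 * τ)) * rexp (-s * τ)) := by gcongr; exact h τ hτ0.le
    _ = C * (τ ^ b * (rexp (s / 2 * τ) * rexp (-s * τ))) := by ring
    _ = _ := by rw [← Real.exp_add]; congr 3; ring

lemma differentiableOn_rayPart (hn : 3 ≤ n) (ha : 1 < a) :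
    DifferentiableOn ℂ (rayPart n a) (domU a) := by
  have hn' : (3 : ℝ) ≤ n := mod_cast hn
  have hp : 0 ≤ ord(n) := by linarith
  obtain ⟨C, hC, hft⟩ := exists_norm_ft_le ha
  have hs := sin_theta_pos ha
  have hU := isOpen_domU ha
  have key : ∀ φ : ℝ, (φ = -theta a ∨ φ = theta a) → ∀ c : ℂ, DifferentiableOn ℂ
      (fun w => ∫ τ in Ioi 0, ft a w (ray φ τ) * helm n (decayRoot (ray φ τ)) 1 *
        (2 * τ * c)) (domU a) := by
    intro φ hφ c
    refine differentiableOn_integral_of_dominated hU (fun w hw => ?_) ?_ (fun w hw => ?_)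
    · refine ContinuousOn.aestronglyMeasurable ?_ measurableSet_Ioi
      simp only [helm_one]
      exact ((continuousOn_ft_ray ha hw hφ).mul (continuousOn_const.mul
        (continuousOn_mac_decayRoot_ray hp ha hφ))).mul (by fun_prop)
    · filter_upwards [ae_mem_Ioi] with τ hτ
      exact ((differentiableOn_ft ha (mem_rays hφ hτ)).mul_const _).mul_const _
    · have hw0 := norm_pos_iff.2 hw.1
      refine ⟨‖w‖ / 2, by positivity, _, (integrableOn_rpow_mul_exp' (b := 3) (by norm_num) ord(n) hs).const_mul (C * (‖w‖ / 2) ^ (-(2 * (a + 1))) * (helmC n * (macConst ord(n) *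
          2 ^ ord(n))) * (2 * ‖c‖)), ?_⟩
      filter_upwards [ae_mem_Ioi] with τ hτ w' hw' hwU'
      have hτ0 : 0 < τ := hτ
      have h1 := (hft w' hwU' _ (mem_rays hφ hτ)).2.1
      have h2 := norm_mac_decayRoot_le hp ha (mem_rays hφ hτ)
      rw [norm_ray _ hτ0.le] at h1 h2
      have h3 : ‖w‖ / 2 ≤ ‖w'‖ := by
        have h4 := norm_sub_norm_le w w'
        rw [mem_ball_iff_norm, norm_sub_rev] at hw'; linarith
      have h5 : ‖w'‖ ^ (-(2 * (a + 1))) ≤ (‖w‖ / 2) ^ (-(2 * (a + 1))) :=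
        Real.rpow_le_rpow_of_nonpos (by positivity) h3 (by linarith)
      have h6 : τ ^ (3 : ℝ) = τ ^ 2 * τ := by norm_cast
      have h7 := macConst_nonneg ord(n)
      have h8 := (helmC_pos hn).le
      rw [helm_one, norm_mul, norm_mul, norm_mul, norm_mul, norm_mul, norm_of_nonneg h8,
        norm_of_nonneg hτ0.le, norm_ofNat, h6]
      calc _ ≤ C * (‖w‖ / 2) ^ (-(2 * (a + 1))) * τ ^ 2 * (helmC n * (macConst ord(n) *
            2 ^ ord(n) * ((1 + τ) ^ ord(n) *
            rexp (-Real.sin (theta a) * τ)))) * (2 * τ * ‖c‖) := by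
            gcongr
            exact h1.trans (by gcongr)
        _ = _ := by ring
  exact ((key (-theta a) (Or.inl rfl) _).sub (key (theta a) (Or.inr rfl) _)).const_mul _

lemma Phi_eq (n : ℕ) (a : ℝ) (w : ℂ) : Phi n a w = w ^ᵣ (2 - 2 * a) / a *
    (helmC n * mac ord(n) (-I * w)) -
    (Complex.Gamma a)⁻¹ * heatPot n a (w ^ 2) 1 - rayPart n a w := by
  rw [Phi, kern, helm_one, rayPart]

lemma differentiableOn_heatPot_sq (ha : 1 < a) (han : 2 * a < n) :
    DifferentiableOn ℂ (fun w => heatPot n a (w ^ 2) 1) (domU a) :=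
  (differentiableOn_heatPot han).comp (f := fun w : ℂ => w ^ 2) (by fun_prop) fun w hw =>
    sq_re_pos ha (domU_subset ha hw)

lemma differentiableOn_Phi (hn : 3 ≤ n) (ha : 1 < a) (han : 2 * a < n) :
    DifferentiableOn ℂ (Phi n a) (domU a) := by
  have hn' : (3 : ℝ) ≤ n := mod_cast hn
  have h1 : DifferentiableOn ℂ (fun w : ℂ => w ^ᵣ (2 - 2 * a)) (domU a) := fun w hw =>
    ((hasStrictDerivAt_cpow_const (mem_slitPlane_of_sec ha
      (domU_subset ha hw))).hasDerivAt.differentiableAt).differentiableWithinAt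
  have h2 : DifferentiableOn ℂ (fun w : ℂ => mac ord(n) (-I * w)) (domU a) :=
    (differentiableOn_mac (by linarith)).comp (f := fun w : ℂ => -I * w) (by fun_prop)
      fun w hw => neg_I_mul_mem_slitPlane (re_pos_of_mem_domU ha hw)
  have h3 := differentiableOn_heatPot_sq ha han
  refine DifferentiableOn.congr ?_ fun w _ => Phi_eq n a w
  exact (((h1.div_const _).mul (h2.const_mul _)).sub (h3.const_mul _)).sub
    (differentiableOn_rayPart hn ha)

end

/-! ### The limiting kernels of the resolvent -/

section

variable {n : ℕ} {a : ℝ} {w : ℂ}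

lemma mul_ofReal_mem_domU {r : ℝ} (hr : 0 < r) (hw : w ∈ domU a) : w * r ∈ domU a := by
  refine ⟨mul_ne_zero hw.1 (mod_cast hr.ne'), ?_⟩
  rw [mul_comm, Complex.arg_real_mul _ hr]
  exact hw.2

lemma ofReal_mem_domU (ha : 1 < a) {r : ℝ} (hr : 0 < r) : (r : ℂ) ∈ domU a := by
  refine ⟨by exact_mod_cast hr.ne', ?_⟩
  rw [Complex.arg_ofReal_of_nonneg hr.le, abs_zero]
  have := pi_pos; positivity

lemma continuousAt_kern (hn : 3 ≤ n) (ha : 1 < a) (han : 2 * a < n) (hw : w ∈ domU a) {x : Rn n}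
    (hx : x ≠ 0) : ContinuousAt (fun x : Rn n => kern n a w ‖x‖) x := by
  have hx0 := norm_pos_iff.2 hx
  have h1 : ContinuousAt (fun x : Rn n => (‖x‖ ^ (2 * a - n) : ℝ) * Phi n a (w * ‖x‖)) x := by
    refine ContinuousAt.mul ?_ ?_
    · exact continuous_ofReal.continuousAt.comp
        (ContinuousAt.rpow_const continuous_norm.continuousAt (Or.inl hx0.ne'))
    · have h2 := ((differentiableOn_Phi hn ha han).continuousOn).continuousAt
        ((isOpen_domU ha).mem_nhds (mul_ofReal_mem_domU hx0 hw))
      exact ContinuousAt.comp (f := fun x : Rn n => w * ‖x‖) h2 (by fun_prop)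
  refine h1.congr ?_
  filter_upwards [isOpen_compl_singleton.mem_nhds hx] with y hy
  exact (kern_eq_rpow_mul_Phi ha hw (norm_pos_iff.2 hy)).symm

lemma tendsto_regResolventKernel (hn : 3 ≤ n) (ha : 1 < a) (han : 2 * a < n) (hw : w ∈ domU a)
    (hwi : 0 < w.im) {x : Rn n} (hx : x ≠ 0) :
    Tendsto (fun δ => regResolventKernel a δ (w ^ᵣ (2 * a)) x) (𝓝[>] 0)
      (𝓝 (kern n a w ‖x‖)) := by
  obtain ⟨h1, h2⟩ := fourier_kern hn ha hw hwi
  have : Nonempty (Fin n) := ⟨⟨0, by omega⟩⟩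
  have hne : ∀ᵐ ξ : Rn n, ξ ≠ 0 := compl_mem_ae_iff.2 (measure_singleton 0)
  have h3 := tendsto_fourierInv_gaussian_mul (g := fun ξ : Rn n =>
    ((((2 * π * ‖ξ‖) ^ (2 * a) : ℝ) : ℂ) - w ^ᵣ (2 * a))⁻¹) h1
    (by filter_upwards [hne] with ξ hξ using (h2 ξ hξ).symm) (continuousAt_kern hn ha han hw hx)
  exact h3

/-- The root `z^{1/(2a)}` of a point `z` of the upper half plane. -/
lemma cpow_root {z : ℂ} (ha : 1 < a) (hz : 0 < z.im) :
    (z ^ ((1 / (2 * a) : ℝ) : ℂ)) ^ᵣ (2 * a) = z ∧ 0 < (z ^ ((1 / (2 * a) : ℝ) : ℂ)).im := by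
  have hz0 : z ≠ 0 := by rintro rfl; simp at hz
  have h1 : 0 < z.arg := by
    rcases (Complex.arg_nonneg_iff.2 hz.le).eq_or_lt with h | h
    · have := (Complex.arg_eq_zero_iff.1 h.symm).2
      linarith
    · exact h
  have h2 := Complex.arg_le_pi z
  have hs : (1 / (2 * a) : ℝ) < 1 := by bound
  have hs0 : (0 : ℝ) < 1 / (2 * a) := by positivity
  have h3 : (Complex.log z * (1 / (2 * a) : ℝ)).im = z.arg * (1 / (2 * a)) := by
    rw [Complex.im_mul_ofReal, log_im]
  have h4 : z.arg * (1 / (2 * a)) < π := by nlinarith [pi_pos]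
  have h5 : 0 < z.arg * (1 / (2 * a)) := by positivity
  constructor
  · rw [← Complex.cpow_mul]
    · rw [← Complex.ofReal_mul, show 1 / (2 * a) * (2 * a) = 1 by field_simp, ofReal_one,
        Complex.cpow_one]
    · linarith
    · rw [h3]; exact h4.le
  · rw [cpow_def_of_ne_zero hz0, Complex.exp_im, h3]
    exact mul_pos (exp_pos _) (Real.sin_pos_of_pos_of_lt_pi h5 h4)

lemma tendsto_resolventKernel (hn : 3 ≤ n) (ha : 1 < a) (han : 2 * a < n) {lam : ℝ} (hl : 0 < lam)
    {x : Rn n} (hx : x ≠ 0) :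
    Tendsto (fun ε : ℝ => resolventKernel a (((lam ^ (2 * a) : ℝ) : ℂ) + (ε : ℂ) * I) x)
      (𝓝[>] 0) (𝓝 (kern n a lam ‖x‖)) ∧
    ∀ᶠ ε : ℝ in 𝓝[>] (0 : ℝ), ∃ L, Tendsto (fun δ => regResolventKernel a δ
      (((lam ^ (2 * a) : ℝ) : ℂ) + (ε : ℂ) * I) x) (𝓝[>] 0) (𝓝 L) ∧
      resolventKernel a (((lam ^ (2 * a) : ℝ) : ℂ) + (ε : ℂ) * I) x = L := by
  have hx0 := norm_pos_iff.2 hx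
  have hla : 0 < lam ^ (2 * a) := by positivity
  set z : ℝ → ℂ := fun ε => ((lam ^ (2 * a) : ℝ) : ℂ) + (ε : ℂ) * I with hz
  set W : ℝ → ℂ := fun ε => (z ε) ^ ((1 / (2 * a) : ℝ) : ℂ) with hW
  have hz0 : z 0 = ((lam ^ (2 * a) : ℝ) : ℂ) := by simp [hz]
  have hW0 : W 0 = lam := by
    simp only [hW, hz0]
    rw [← ofReal_cpow hla.le, ← rpow_mul hl.le, show 2 * a * (1 / (2 * a)) = 1 by
      field_simp, Real.rpow_one]
  have hWc : Tendsto W (𝓝[>] 0) (𝓝 lam) := by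
    rw [← hW0]
    have : ContinuousAt W 0 := by
      refine ContinuousAt.cpow (f := z) (by fun_prop) continuousAt_const ?_
      rw [hz0]
      left
      simpa using hla
    exact this.tendsto.mono_left nhdsWithin_le_nhds
  have hU := (isOpen_domU ha).mem_nhds (ofReal_mem_domU ha hl)
  have hev : ∀ᶠ ε in 𝓝[>] (0 : ℝ), 0 < ε ∧ W ε ∈ domU a :=
    (eventually_mem_nhdsWithin (s := Ioi 0)).and (hWc.eventually hU)
  have hroot : ∀ ε > 0, (W ε) ^ᵣ (2 * a) = z ε ∧ 0 < (W ε).im := by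
    intro ε hε
    exact cpow_root ha (by simpa [hz] using hε)
  have hlim : ∀ᶠ ε in 𝓝[>] (0 : ℝ), Tendsto (fun δ => regResolventKernel a δ (z ε) x) (𝓝[>] 0)
      (𝓝 (kern n a (W ε) ‖x‖)) := by
    filter_upwards [hev] with ε hε
    obtain ⟨h1, h2⟩ := hroot ε hε.1
    rw [← h1]
    exact tendsto_regResolventKernel hn ha han hε.2 h2 hx
  refine ⟨?_, ?_⟩
  · have h1 : Tendsto (fun ε => kern n a (W ε) ‖x‖) (𝓝[>] 0) (𝓝 (kern n a lam ‖x‖)) := by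
      have h2 := ((differentiableOn_Phi hn ha han).continuousOn).continuousAt
        ((isOpen_domU ha).mem_nhds (mul_ofReal_mem_domU hx0 (ofReal_mem_domU ha hl)))
      rw [kern_eq_rpow_mul_Phi ha (ofReal_mem_domU ha hl) hx0]
      refine Tendsto.congr' (f₁ := fun ε => (‖x‖ ^ (2 * a - n) : ℝ) * Phi n a (W ε * ‖x‖)) ?_
        ((h2.tendsto.comp (hWc.mul_const _)).const_mul _)
      filter_upwards [hev] with ε hε
      exact (kern_eq_rpow_mul_Phi ha hε.2 hx0).symm
    refine h1.congr' ?_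
    filter_upwards [hlim] with ε hε
    exact hε.limUnder_eq.symm
  · filter_upwards [hlim] with ε hε
    exact ⟨_, hε, hε.limUnder_eq⟩

lemma resolventPlus_eq (hn : 3 ≤ n) (ha : 1 < a) (han : 2 * a < n) {lam : ℝ} (hl : 0 < lam)
    {x : Rn n} (hx : x ≠ 0) :
    resolventPlus a lam x = (‖x‖ ^ (2 * a - n) : ℝ) * Phi n a ((lam * ‖x‖ : ℝ) : ℂ) := by
  rw [resolventPlus, (tendsto_resolventKernel hn ha han hl hx).1.limUnder_eq,
    kern_eq_rpow_mul_Phi ha (ofReal_mem_domU ha hl) (norm_pos_iff.2 hx), Complex.ofReal_mul]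

lemma regResolventKernel_conj (δ : ℝ) (z : ℂ) (x : Rn n) :
    regResolventKernel a δ ((starRingEnd ℂ) z) x = (starRingEnd ℂ) (regResolventKernel a δ z x) := by
  simp only [regResolventKernel, Real.fourierInv_eq']
  rw [← integral_conj]
  have h := integral_neg_eq_self (fun v : Rn n => cexp (↑(2 * π * inner ℝ v x) * I) •
    ((rexp (-δ * (2 * π * ‖v‖) ^ 2) : ℂ) /
      (((2 * π * ‖v‖) ^ (2 * a) : ℝ) - (starRingEnd ℂ) z))) volume
  rw [← h]
  refine integral_congr_ae (Eventually.of_forall fun v => ?_)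
  simp only [norm_neg, inner_neg_left, smul_eq_mul, map_mul, map_div₀, map_sub, conj_ofReal,
    ← exp_conj, conj_I]
  congr 2; push_cast; ring

lemma resolventMinus_eq (hn : 3 ≤ n) (ha : 1 < a) (han : 2 * a < n) {lam : ℝ} (hl : 0 < lam)
    {x : Rn n} (hx : x ≠ 0) :
    resolventMinus a lam x = (starRingEnd ℂ) (resolventPlus a lam x) := by
  obtain ⟨h1, h2⟩ := tendsto_resolventKernel hn ha han hl hx
  rw [resolventPlus, h1.limUnder_eq, resolventMinus]
  refine Tendsto.limUnder_eq ?_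
  refine ((Complex.continuous_conj.tendsto _).comp h1).congr' ?_
  filter_upwards [h2] with ε hε
  obtain ⟨L, hL, hL'⟩ := hε
  simp only [Function.comp_apply]
  rw [hL']
  refine (Tendsto.limUnder_eq ?_).symm
  refine ((Complex.continuous_conj.tendsto _).comp hL).congr fun δ => ?_
  simp only [Function.comp_apply]
  rw [← regResolventKernel_conj]; congr 1
  simp [sub_eq_add_neg]

/-! ### The jump of the resolvent -/

lemma conj_cpow_ofReal {z : ℂ} (hz : z ∈ slitPlane) (s : ℝ) :
    (starRingEnd ℂ) (z ^ (s : ℂ)) = ((starRingEnd ℂ) z) ^ (s : ℂ) := by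
  rw [Complex.conj_cpow _ _ (Complex.mem_slitPlane_iff_arg.1 hz).1, conj_ofReal]

lemma mac_conj {κ : ℂ} (hκ : κ ∈ slitPlane) (p : ℝ) :
    mac p ((starRingEnd ℂ) κ) = (starRingEnd ℂ) (mac p κ) := by
  rw [mac, mac, map_mul, ← exp_conj, map_neg, macF, macF, ← integral_conj]; congr 1
  refine setIntegral_congr_fun measurableSet_Ioi fun u hu => ?_
  simp only [map_mul, conj_ofReal, conj_cpow_ofReal (ofReal_mul_add_mem_slitPlane hu hκ) p,
    map_add, conj_ofNat]

lemma heatPot_conj (n : ℕ) (a : ℝ) (u : ℂ) (r : ℝ) :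
    heatPot n a ((starRingEnd ℂ) u) r = (starRingEnd ℂ) (heatPot n a u r) := by
  rw [heatPot, heatPot, ← integral_conj]
  refine setIntegral_congr_fun measurableSet_Ioi fun t ht => ?_
  simp only [map_mul, conj_ofReal, ← exp_conj, map_neg]

lemma ray_conj (φ τ : ℝ) : (starRingEnd ℂ) (ray φ τ) = ray (-φ) τ := by
  rw [ray, ray, map_mul, conj_ofReal, ← exp_conj, map_mul, conj_ofReal, conj_I]; push_cast; ring_nf

lemma rayDiff_conj {θ : ℝ} {q : ℂ → ℂ}
    (hq : ∀ ζ ∈ rays θ, q ((starRingEnd ℂ) ζ) = (starRingEnd ℂ) (q ζ)) :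
    (starRingEnd ℂ) (rayDiff θ q) = rayDiff θ q := by
  have h : ∀ φ : ℝ, (φ = -θ ∨ φ = θ) →
      (starRingEnd ℂ) (∫ τ in Ioi 0, q (ray φ τ) * (2 * τ * cexp (φ * I) ^ 2)) =
      ∫ τ in Ioi 0, q (ray (-φ) τ) * (2 * τ * cexp ((-φ : ℝ) * I) ^ 2) := by
    intro φ hφ
    rw [← integral_conj]
    refine setIntegral_congr_fun measurableSet_Ioi fun τ hτ => ?_
    simp only [map_mul, ← hq _ (mem_rays hφ hτ), ray_conj, map_pow, ← exp_conj,
      conj_ofReal, conj_I, conj_ofNat]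
    push_cast; ring_nf
  have h1 := h θ (Or.inr rfl)
  have h2 := h (-θ) (Or.inl rfl)
  rw [neg_neg] at h2
  push_cast at h1 h2
  rw [rayDiff, map_mul, map_sub, h1, h2, map_inv₀, map_mul, map_mul, conj_I,
    conj_ofReal, conj_ofNat, mul_neg, inv_neg]
  ring

lemma decayRoot_conj {ζ : ℂ} (hζ : ζ.im ≠ 0) :
    decayRoot ((starRingEnd ℂ) ζ) = (starRingEnd ℂ) (decayRoot ζ) := by
  rw [decayRoot, decayRoot, Complex.conj_im]
  rcases lt_or_gt_of_ne hζ with h | h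
  · bound
  · bound

lemma ft_conj (ha : 1 < a) (hw : w ∈ domU a) {ζ : ℂ} (hζ : ζ ∈ sec(a)) :
    ft a ((starRingEnd ℂ) w) ((starRingEnd ℂ) ζ) = (starRingEnd ℂ) (ft a w ζ) := by
  rw [ft, ft, map_add, map_inv₀, map_sub, conj_cpow_ofReal (mem_slitPlane_of_sec ha hζ),
    conj_cpow_ofReal (mem_slitPlane_of_sec ha (domU_subset ha hw)),
    conj_cpow_ofReal (sq_add_sq_mem_slitPlane ha hζ hw), map_add, map_pow, map_pow]

lemma im_ne_zero_of_mem_rays (ha : 1 < a) {ζ : ℂ} (hζ : ζ ∈ rays (theta a)) : ζ.im ≠ 0 := by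
  obtain ⟨τ, hτ, h⟩ := hζ
  have h1 := theta_pos ha
  have h2 : theta a < π := by linarith [theta_lt ha, pi_pos]
  have key : ∀ φ : ℝ, (φ = -theta a ∨ φ = theta a) → (ray φ τ).im ≠ 0 := by
    intro φ hφ h3
    have := abs_im_ray h1 h2 hφ hτ
    rw [h3, abs_zero] at this
    exact (mul_pos (Real.sin_pos_of_pos_of_lt_pi h1 h2) hτ).ne this
  rcases h with rfl | rfl
  · grind
  · grind

lemma decayRoot_mem_slitPlane (ha : 1 < a) {ζ : ℂ} (hζ : ζ ∈ rays (theta a)) :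
    decayRoot ζ ∈ slitPlane := by
  left
  rw [decayRoot_re]
  exact abs_pos.2 (im_ne_zero_of_mem_rays ha hζ)

lemma rayPart_conj (ha : 1 < a) {t : ℝ} (ht : 0 < t) :
    (starRingEnd ℂ) (rayPart n a t) = rayPart n a t := by
  refine rayDiff_conj fun ζ hζ => ?_
  have h := ft_conj ha (ofReal_mem_domU ha ht) (mem_of_mem_rays ha hζ).1
  rw [conj_ofReal] at h
  rw [h, helm_one, helm_one, decayRoot_conj (im_ne_zero_of_mem_rays ha hζ),
    mac_conj (decayRoot_mem_slitPlane ha hζ), map_mul, map_mul, conj_ofReal]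

/-- The jump of the profile of the resolvent kernels across the spectrum. -/
lemma Phi_sub_conj (hn : 3 ≤ n) (ha : 1 < a) {t : ℝ} (ht : 0 < t) :
    Phi n a t - (starRingEnd ℂ) (Phi n a t) =
      I * (helmC n / a * t ^ (n - 2 * a) : ℝ) * poissonG ord(n) t := by
  have hn' : (3 : ℝ) ≤ n := mod_cast hn
  have h1 : (starRingEnd ℂ) ((t : ℂ) ^ᵣ (2 - 2 * a)) = ((t ^ (2 - 2 * a) : ℝ) : ℂ) := by
    rw [← ofReal_cpow ht.le, conj_ofReal]
  have h2 : (starRingEnd ℂ) (heatPot n a ((t : ℂ) ^ 2) 1) = heatPot n a ((t : ℂ) ^ 2) 1 := by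
    rw [← heatPot_conj, map_pow, conj_ofReal]
  have h3 : (starRingEnd ℂ) (mac ord(n) (-I * t)) = mac ord(n) (I * t) := by
    rw [← mac_conj (neg_I_mul_mem_slitPlane (by simpa using ht)), map_mul, map_neg, conj_I,
      neg_neg, conj_ofReal]
  have h4 : (starRingEnd ℂ) (Complex.Gamma a)⁻¹ = (Complex.Gamma a)⁻¹ := by
    rw [Complex.Gamma_ofReal, map_inv₀, conj_ofReal]
  have h5 := mac_sub_mac (p := ord(n)) (by linarith) (w := t) (by simpa using ht)
  rw [← ofReal_cpow ht.le] at h5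
  have h6 : t ^ (n - 2 * a) = t ^ (2 - 2 * a) * t ^ (2 * ord(n) + 1) := by
    rw [← rpow_add ht]; congr 1; ring
  rw [Phi_eq, map_sub, map_sub, map_mul, map_mul, map_mul, map_div₀, h1, h2, h3, h4,
    rayPart_conj ha ht, conj_ofReal, conj_ofReal, ← ofReal_cpow ht.le, h6]
  push_cast at h5 ⊢
  linear_combination ((t ^ (2 - 2 * a) : ℝ) : ℂ) / a * helmC n * h5

end

/-! ### Bounds of the profile of the resolvent kernels -/

lemma rayIntegrable_of_bound {θ : ℝ} {q : ℂ → ℂ} {K b p s : ℝ} (hb : -2 < b) (hs : 0 < s)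
    (hc : ∀ φ : ℝ, (φ = -θ ∨ φ = θ) → ContinuousOn (fun τ => q (ray φ τ)) (Ioi 0))
    (h : ∀ ζ ∈ rays θ, ‖q ζ‖ ≤ K * (‖ζ‖ ^ b * ((1 + ‖ζ‖) ^ p * rexp (-s * ‖ζ‖)))) :
    RayIntegrable θ q := by
  have hint := (integrableOn_rpow_mul_exp' (b := b + 1) (by linarith) p hs).const_mul (2 * K)
  have key : ∀ φ : ℝ, (φ = -θ ∨ φ = θ) →
      IntegrableOn (fun τ => q (ray φ τ) * (2 * τ * cexp (φ * I) ^ 2)) (Ioi 0) := by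
    intro φ hφ
    refine Integrable.mono' hint ?_ ?_
    · exact ((hc φ hφ).mul (by fun_prop)).aestronglyMeasurable measurableSet_Ioi
    · filter_upwards [ae_mem_Ioi] with τ hτ
      have hτ' : 0 < τ := hτ
      have h1 := h _ (mem_rays hφ hτ')
      rw [norm_ray _ hτ'.le] at h1
      rw [norm_mul, norm_mul, norm_mul, norm_pow, norm_exp_ofReal_mul_I, one_pow, mul_one,
        norm_of_nonneg hτ'.le, norm_ofNat, Real.rpow_add_one hτ'.ne']
      calc _ ≤ K * (τ ^ b * ((1 + τ) ^ p * rexp (-s * τ))) * (2 * τ) := by gcongr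
        _ = _ := by ring
  have h1 := key (-θ) (Or.inl rfl)
  rw [ofReal_neg] at h1
  exact ⟨h1, key θ (Or.inr rfl)⟩

lemma norm_rayDiff_le_of_bound {θ : ℝ} {q : ℂ → ℂ} {K b p s : ℝ} (hb : -2 < b) (hs : 0 < s)
    (h : ∀ ζ ∈ rays θ, ‖q ζ‖ ≤ K * (‖ζ‖ ^ b * ((1 + ‖ζ‖) ^ p * rexp (-s * ‖ζ‖)))) :
    ‖rayDiff θ q‖ ≤ K * ∫ τ in Ioi 0, τ ^ (b + 1) * ((1 + τ) ^ p * rexp (-s * τ)) := by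
  have hint := (integrableOn_rpow_mul_exp' (b := b + 1) (by linarith) p hs).const_mul K
  have he : ∀ τ ∈ Ioi 0, K * (τ ^ (b + 1) * ((1 + τ) ^ p * rexp (-s * τ))) =
      K * (τ ^ b * ((1 + τ) ^ p * rexp (-s * τ))) * τ := fun τ hτ => by
    rw [Real.rpow_add_one (ne_of_gt hτ)]; ring
  rw [← integral_const_mul, setIntegral_congr_fun measurableSet_Ioi he]
  exact norm_rayDiff_le (IntegrableOn.congr_fun hint he measurableSet_Ioi) h

lemma exists_exp_neg_le_rpow {b : ℝ} (hb : 0 ≤ b) : ∃ C > 0, ∀ x > 0, rexp (-x) ≤ C * x ^ (-b) := by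
  obtain ⟨C, hC, h⟩ := exists_rpow_le_exp b one_pos
  refine ⟨C, hC, fun x hx => ?_⟩
  have h1 : x ^ b ≤ C * rexp x := (rpow_le_rpow hx.le (by linarith : x ≤ 1 + x) hb).trans
    (by simpa using h x hx.le)
  rw [Real.exp_neg, rpow_neg hx.le, ← div_eq_mul_inv, le_div_iff₀ (by positivity),
    inv_mul_le_iff₀ (exp_pos _), mul_comm]
  exact h1

section

variable {n : ℕ} {a : ℝ} {w ζ : ℂ}

/-- What remains of the profile `Phi` without its oscillating part. -/
def phiRem (n : ℕ) (a : ℝ) (w : ℂ) : ℂ :=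
  -((Complex.Gamma a)⁻¹ * heatPot n a (w ^ 2) 1) - rayPart n a w

lemma Phi_eq_add_phiRem (n : ℕ) (a : ℝ) (w : ℂ) : Phi n a w = w ^ᵣ (2 - 2 * a) / a *
      (helmC n * mac ord(n) (-I * w)) + phiRem n a w := by
  rw [Phi_eq, phiRem]; ring

lemma continuousOn_mac_decayRoot_helm (hn : 3 ≤ n) (ha : 1 < a) {φ : ℝ}
    (hφ : φ = -theta a ∨ φ = theta a) :
    ContinuousOn (fun τ => helm n (decayRoot (ray φ τ)) 1) (Ioi 0) := by
  have hn' : (3 : ℝ) ≤ n := mod_cast hn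
  simp only [helm_one]
  exact continuousOn_const.mul (continuousOn_mac_decayRoot_ray (by linarith) ha hφ)

/-- Bounds for the part of the resolvent profile carried by the rays. -/
lemma exists_norm_rayPart_le (hn : 3 ≤ n) (ha : 1 < a) : ∃ C > 0, ∀ w ∈ domU a,
    RayIntegrable (theta a) (fun ζ => ft a w ζ * helm n (decayRoot ζ) 1) ∧
    ‖rayPart n a w‖ ≤ C * ‖w‖ ^ (-(2 * (a + 1))) := by
  have hn' : (3 : ℝ) ≤ n := mod_cast hn
  obtain ⟨C, hC, hft⟩ := exists_norm_ft_le ha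
  have hp : 0 ≤ ord(n) := by linarith
  set p := ord(n)
  set s := Real.sin (theta a)
  have hs : 0 < s := sin_theta_pos ha
  have hM := macConst_nonneg p
  have hc := helmC_pos hn
  set J := ∫ τ in Ioi 0, τ ^ ((2 : ℝ) + 1) * ((1 + τ) ^ p * rexp (-s * τ)) with hJ
  have hJ0 : 0 ≤ J := setIntegral_nonneg measurableSet_Ioi fun τ hτ => by
    have : 0 < τ := hτ; positivity
  have hb : ∀ w ∈ domU a, ∀ ζ ∈ rays (theta a), ‖ft a w ζ * helm n (decayRoot ζ) 1‖ ≤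
      C * helmC n * (macConst p * 2 ^ p) * ‖w‖ ^ (-(2 * (a + 1))) *
        (‖ζ‖ ^ (2 : ℝ) * ((1 + ‖ζ‖) ^ p * rexp (-s * ‖ζ‖))) := by
    intro w hw ζ hζ
    have h1 := (hft w hw ζ hζ).2.1
    have h2 := norm_mac_decayRoot_le hp ha hζ
    rw [norm_mul, helm_one, norm_mul, norm_of_nonneg hc.le, Real.rpow_two]
    calc _ ≤ (C * ‖w‖ ^ (-(2 * (a + 1))) * ‖ζ‖ ^ 2) * (helmC n * (macConst p * 2 ^ p *
        ((1 + ‖ζ‖) ^ p * rexp (-s * ‖ζ‖)))) := by gcongr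
      _ = _ := by ring
  refine ⟨C * helmC n * (macConst p * 2 ^ p) * J + 1, by positivity, fun w hw => ⟨?_, ?_⟩⟩
  · exact rayIntegrable_of_bound (by norm_num) hs (fun φ hφ =>
      (continuousOn_ft_ray ha hw hφ).mul (continuousOn_mac_decayRoot_helm hn ha hφ)) (hb w hw)
  · refine (norm_rayDiff_le_of_bound (by norm_num) hs (hb w hw)).trans ?_
    rw [← hJ]
    have : 0 ≤ ‖w‖ ^ (-(2 * (a + 1))) := by positivity
    nlinarith

lemma exists_norm_heatPot_le (ha : 1 < a) (n : ℕ) :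
    ∃ C > 0, ∀ w ∈ domU a, ‖heatPot n a (w ^ 2) 1‖ ≤ C * ‖w‖ ^ (-(2 * (a + 1))) := by
  obtain ⟨C, hC, hexp⟩ := exists_exp_neg_le_rpow (b := a + 1) (by linarith)
  set m := Real.cos (2 * theta a)
  have hm : 0 < m := cos_two_mul_theta_pos ha
  have hint := integrableOn_rpow_mul_exp_neg_div (b := -2 - (n : ℝ) / 2) (c := 1 / 4)
    (by have : (0 : ℝ) ≤ n := Nat.cast_nonneg n
        linarith) (by norm_num)
  set J := ∫ t in Ioi 0, t ^ (-2 - (n : ℝ) / 2) * rexp (-(1 / 4) / t) with hJ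
  have hJ0 : 0 ≤ J := setIntegral_nonneg measurableSet_Ioi fun τ hτ => by
    have : 0 < τ := hτ; positivity
  have hpi := pi_pos
  refine ⟨(4 * π) ^ (-((n : ℝ) / 2)) * C * m ^ (-(a + 1)) * J + 1, by positivity, fun w hw => ?_⟩
  have hw0 : 0 < ‖w‖ := norm_pos_iff.2 hw.1
  have hre := le_sq_re ha (domU_subset ha hw)
  have h1 : ‖heatPot n a (w ^ 2) 1‖ ≤ ∫ t in Ioi 0,
      (4 * π) ^ (-((n : ℝ) / 2)) * C * m ^ (-(a + 1)) * ‖w‖ ^ (-(2 * (a + 1))) *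
        (t ^ (-2 - (n : ℝ) / 2) * rexp (-(1 / 4) / t)) := by
    refine norm_integral_le_of_norm_le (hint.const_mul _) ?_
    filter_upwards [ae_mem_Ioi] with t ht
    have ht' : 0 < t := ht
    rw [norm_heatPot_integrand n a _ ht']
    have h2 : rexp (-(t * (w ^ 2).re)) ≤ C * (t * (m * ‖w‖ ^ 2)) ^ (-(a + 1)) := by
      refine (exp_le_exp.2 (neg_le_neg (mul_le_mul_of_nonneg_left hre ht'.le))).trans ?_
      exact hexp _ (by positivity)
    rw [mul_rpow ht'.le (by positivity), rpow_neg_mul_sq hm hw0] at h2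
    have h3 : t ^ (-2 - (n : ℝ) / 2) = t ^ (a - 1 - (n : ℝ) / 2) * t ^ (-(a + 1)) := by
      rw [← rpow_add ht']; congr 1; ring
    rw [h3]
    calc _ ≤ (4 * π) ^ (-((n : ℝ) / 2)) * (t ^ (a - 1 - n / 2) * rexp (-(1 / 4) / t)) *
          (C * (t ^ (-(a + 1)) * (m ^ (-(a + 1)) * ‖w‖ ^ (-(2 * (a + 1)))))) := by gcongr
      _ = _ := by ring
  rw [integral_const_mul, ← hJ] at h1
  have : 0 ≤ ‖w‖ ^ (-(2 * (a + 1))) := by positivity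
  nlinarith

lemma exists_norm_phiRem_le (hn : 3 ≤ n) (ha : 1 < a) :
    ∃ C > 0, ∀ w ∈ domU a, ‖phiRem n a w‖ ≤ C * ‖w‖ ^ (-(2 * (a + 1))) := by
  obtain ⟨C, hC, h1⟩ := exists_norm_rayPart_le hn ha
  obtain ⟨C', hC', h2⟩ := exists_norm_heatPot_le ha n
  refine ⟨‖(Complex.Gamma a)⁻¹‖ * C' + C, by positivity, fun w hw => ?_⟩
  calc _ ≤ ‖-((Complex.Gamma a)⁻¹ * heatPot n a (w ^ 2) 1)‖ + ‖rayPart n a w‖ := norm_sub_le _ _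
    _ ≤ ‖(Complex.Gamma a)⁻¹‖ * (C' * ‖w‖ ^ (-(2 * (a + 1)))) + C * ‖w‖ ^ (-(2 * (a + 1))) := by
      rw [norm_neg, norm_mul]; gcongr
      · exact h2 w hw
      · exact (h1 w hw).2
    _ = _ := by ring

lemma differentiableOn_phiRem (hn : 3 ≤ n) (ha : 1 < a) (han : 2 * a < n) :
    DifferentiableOn ℂ (phiRem n a) (domU a) :=
  (((differentiableOn_heatPot_sq ha han).const_mul _).neg).sub (differentiableOn_rayPart hn ha)

/-! ### Small arguments -/

/-- A cut-off that is `1` at the origin to the order `2 n` and decays like a gaussian. -/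
def gaussCut (n : ℕ) (ζ : ℂ) : ℂ := 1 - (1 - cexp (-ζ ^ 2)) ^ n

lemma differentiable_gaussCut (n : ℕ) : Differentiable ℂ (gaussCut n) := by
  unfold gaussCut; fun_prop

lemma norm_one_sub_exp_neg_le {z : ℂ} (hz : 0 ≤ z.re) :
    ‖1 - cexp (-z)‖ ≤ 2 ∧ ‖1 - cexp (-z)‖ ≤ ‖z‖ := by
  constructor
  · refine (norm_sub_le _ _).trans ?_
    rw [norm_one, norm_exp]
    have : rexp (-z).re ≤ 1 := exp_le_one_iff.2 (by simpa using hz); linarith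
  · have h := (convex_halfSpace_re_ge 0).norm_image_sub_le_of_norm_deriv_le (𝕜 := ℂ)
      (f := fun z : ℂ => cexp (-z)) (C := 1) (x := 0) (y := z)
      (fun x _ => by fun_prop) (fun x hx => ?_) (by simp) hz
    · simpa [norm_sub_rev] using h
    · have hd : HasDerivAt (fun z : ℂ => cexp (-z)) (cexp (-x) * (-1)) x :=
        (Complex.hasDerivAt_exp (-x)).comp x (hasDerivAt_neg x)
      rw [hd.deriv, norm_mul, norm_neg, norm_one, mul_one, norm_exp]
      exact exp_le_one_iff.2 (by simpa using hx)

lemma norm_one_sub_gaussCut_le (ha : 1 < a) (hn : 3 ≤ n) (hζ : ζ ∈ sec(a)) :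
    ‖1 - gaussCut n ζ‖ ≤ 2 ^ n * ‖ζ‖ ^ ((n : ℝ) - 2) := by
  obtain ⟨h1, h2⟩ := norm_one_sub_exp_neg_le (sq_re_pos ha hζ).le
  have hζ0 : 0 < ‖ζ‖ := norm_pos_iff.2 hζ.1
  have hn' : (3 : ℝ) ≤ n := mod_cast hn
  rw [gaussCut, sub_sub_cancel, norm_pow]
  rcases le_total ‖ζ‖ 1 with h | h
  · calc _ ≤ (‖ζ ^ 2‖) ^ n := by gcongr
      _ = ‖ζ‖ ^ (2 * (n : ℝ)) := by rw [norm_pow, ← pow_mul, ← rpow_natCast]; push_cast; rfl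
      _ ≤ ‖ζ‖ ^ ((n : ℝ) - 2) := Real.rpow_le_rpow_of_exponent_ge hζ0 h (by linarith)
      _ ≤ _ := le_mul_of_one_le_left (by positivity) (one_le_pow₀ (by norm_num))
  · calc _ ≤ (2 : ℝ) ^ n := by gcongr
      _ ≤ _ := le_mul_of_one_le_right (by positivity) (one_le_rpow h (by linarith))

lemma norm_gaussCut_le (ha : 1 < a) (n : ℕ) (hζ : ζ ∈ sec(a)) :
    ‖gaussCut n ζ‖ ≤ n * 2 ^ n * rexp (-(Real.cos (2 * theta a) * ‖ζ‖ ^ 2)) := by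
  obtain ⟨h1, -⟩ := norm_one_sub_exp_neg_le (sq_re_pos ha hζ).le
  have h3 : gaussCut n ζ = cexp (-ζ ^ 2) * ∑ k ∈ Finset.range n, (1 - cexp (-ζ ^ 2)) ^ k := by
    have := mul_neg_geom_sum (1 - cexp (-ζ ^ 2)) n
    rw [sub_sub_cancel] at this
    rw [gaussCut, this]
  rw [h3, norm_mul, mul_comm]
  refine mul_le_mul ?_ ?_ (norm_nonneg _) (by positivity)
  · calc _ ≤ ∑ k ∈ Finset.range n, ‖(1 - cexp (-ζ ^ 2)) ^ k‖ := norm_sum_le _ _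
      _ ≤ ∑ k ∈ Finset.range n, (2 : ℝ) ^ n := by
        refine Finset.sum_le_sum fun k hk => ?_
        rw [norm_pow]
        calc _ ≤ (2 : ℝ) ^ k := by gcongr
          _ ≤ 2 ^ n := pow_le_pow_right₀ (by norm_num) (Finset.mem_range.1 hk).le
      _ = _ := by simp
  · rw [norm_exp, exp_le_exp, neg_re]
    exact neg_le_neg (le_sq_re ha hζ)

lemma exists_exp_mul_norm_gaussCut_le (ha : 1 < a) (n : ℕ) {p : ℝ} :
    ∃ C > 0, ∀ ζ ∈ sec(a),
      (1 + 2 * ‖ζ‖) ^ p * rexp ‖ζ‖ * ‖gaussCut n ζ‖ ≤ C * rexp (-‖ζ‖) := by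
  set m := Real.cos (2 * theta a)
  have hm : 0 < m := cos_two_mul_theta_pos ha
  obtain ⟨C, hC, h⟩ := exists_rpow_le_exp p one_half_pos
  refine ⟨C * (n * 2 ^ n + 1) * rexp (4 / m), by positivity, fun ζ hζ => ?_⟩
  have h1 := norm_gaussCut_le ha n hζ
  have h2 := h (2 * ‖ζ‖) (by positivity)
  have h4 : 3 * ‖ζ‖ - m * ‖ζ‖ ^ 2 ≤ 4 / m := by
    rw [le_div_iff₀ hm]
    nlinarith [sq_nonneg (m * ‖ζ‖ - 3 / 2)]
  calc _ ≤ (C * rexp (1 / 2 * (2 * ‖ζ‖))) * rexp ‖ζ‖ *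
        ((n * 2 ^ n + 1) * rexp (-(m * ‖ζ‖ ^ 2))) := by
        gcongr
        refine h1.trans ?_; gcongr; linarith
    _ = C * (n * 2 ^ n + 1) * (rexp (3 * ‖ζ‖ - m * ‖ζ‖ ^ 2) * rexp (-‖ζ‖)) := by
      rw [← Real.exp_add, show 3 * ‖ζ‖ - m * ‖ζ‖ ^ 2 + -‖ζ‖ =
        1 / 2 * (2 * ‖ζ‖) + ‖ζ‖ + -(m * ‖ζ‖ ^ 2) by ring, Real.exp_add, Real.exp_add]
      ring
    _ ≤ C * (n * 2 ^ n + 1) * (rexp (4 / m) * rexp (-‖ζ‖)) := by gcongr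
    _ = _ := by ring

lemma re_pos_of_mem_closedSector (ha : 1 < a) (hζ : ζ ∈ sec(a)) : 0 < ζ.re := by
  have h := theta_lt ha
  have := pi_pos
  rw [← Complex.norm_mul_cos_arg]
  exact mul_pos (norm_pos_iff.2 hζ.1) (Real.cos_pos_of_mem_Ioo
    ⟨by linarith [(abs_le.1 hζ.2).1], by linarith [(abs_le.1 hζ.2).2]⟩)

/-- The density on the rays that remains after the subtraction of a holomorphic function. -/
def rayDensity (n : ℕ) (ζ : ℂ) : ℂ :=
  mac ord(n) (-I * ζ) * gaussCut n ζ - mac ord(n) (decayRoot ζ)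

lemma exists_norm_rayDensity_le (hn : 3 ≤ n) (ha : 1 < a) :
    ∃ C > 0, ∀ ζ ∈ rays (theta a), ‖rayDensity n ζ‖ ≤ C * (‖ζ‖ ^ ((n : ℝ) - 2) *
      ((1 + ‖ζ‖) ^ ord(n) * rexp (-Real.sin (theta a) * ‖ζ‖))) := by
  have hn' : (3 : ℝ) ≤ n := mod_cast hn
  have hp : 0 ≤ ord(n) := by linarith
  have hp1 : 2 * ord(n) + 1 = (n : ℝ) - 2 := by ring
  rw [show ((n : ℝ) - 2) = 2 * ord(n) + 1 from hp1.symm]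
  unfold rayDensity
  obtain ⟨C, hC, hcut⟩ := exists_exp_mul_norm_gaussCut_le ha n (p := 0)
  set p := ord(n)
  set s := Real.sin (theta a)
  have hs : 0 < s := sin_theta_pos ha
  have hM := macConst_nonneg p
  refine ⟨2 * C + macConst p * 2 ^ p * 2 ^ n, by positivity, fun ζ hζ => ?_⟩
  have hζS := (mem_of_mem_rays ha hζ).1
  have hζ0 : 0 < ‖ζ‖ := norm_pos_iff.2 hζS.1
  have hre := re_pos_of_mem_closedSector ha hζS
  have h1 := norm_mac_decayRoot_le hp ha hζ
  have h2 := norm_one_sub_gaussCut_le ha hn hζS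
  rw [show (n : ℝ) - 2 = 2 * p + 1 from hp1.symm] at h2
  set E := (1 + ‖ζ‖) ^ p * rexp (-s * ‖ζ‖)
  have hE : rexp (-‖ζ‖) ≤ E := by
    have h5 : s ≤ 1 := Real.sin_le_one _
    calc _ ≤ rexp (-s * ‖ζ‖) := exp_le_exp.2 (by nlinarith)
      _ ≤ _ := le_mul_of_one_le_left (exp_pos _).le (one_le_rpow (by linarith) hp)
  have h3 : ‖mac p (decayRoot ζ) * (1 - gaussCut n ζ)‖ ≤
      macConst p * 2 ^ p * 2 ^ n * (‖ζ‖ ^ (2 * p + 1) * E) := by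
    rw [norm_mul]
    calc _ ≤ (macConst p * 2 ^ p * E) * (2 ^ n * ‖ζ‖ ^ (2 * p + 1)) := by gcongr
      _ = _ := by ring
  have hE0 : 0 ≤ E := by positivity
  have hz0 : 0 ≤ ‖ζ‖ ^ (2 * p + 1) := by positivity
  by_cases him : 0 < ζ.im
  · have h4 : mac p (-I * ζ) * gaussCut n ζ - mac p (decayRoot ζ) =
        -(mac p (decayRoot ζ) * (1 - gaussCut n ζ)) := by
      rw [decayRoot, if_pos him]; ring
    rw [h4, norm_neg]
    refine h3.trans ?_
    nlinarith [mul_nonneg hC.le (mul_nonneg hz0 hE0)]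
  · have h4 : mac p (-I * ζ) * gaussCut n ζ - mac p (decayRoot ζ) =
        I * ζ ^ᵣ (2 * p + 1) * poissonG p ζ * gaussCut n ζ -
        mac p (decayRoot ζ) * (1 - gaussCut n ζ) := by
      rw [← mac_sub_mac hp hre, decayRoot, if_neg him]; ring
    rw [h4]
    refine (norm_sub_le _ _).trans ?_
    have h5 : ‖I * ζ ^ᵣ (2 * p + 1) * poissonG p ζ * gaussCut n ζ‖ ≤
        2 * C * (‖ζ‖ ^ (2 * p + 1) * E) := by
      have h6 := hcut ζ hζS
      rw [rpow_zero, one_mul] at h6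
      have h7 : ‖poissonG p ζ‖ ≤ 2 * rexp ‖ζ‖ := (norm_poissonG_le hp ζ).trans (by
        gcongr; exact Complex.abs_im_le_norm ζ)
      rw [norm_mul, norm_mul, norm_mul, norm_I, one_mul, norm_cpow_real]
      calc _ ≤ ‖ζ‖ ^ (2 * p + 1) * (2 * rexp ‖ζ‖) * ‖gaussCut n ζ‖ := by gcongr
        _ = 2 * ‖ζ‖ ^ (2 * p + 1) * (rexp ‖ζ‖ * ‖gaussCut n ζ‖) := by ring
        _ ≤ 2 * ‖ζ‖ ^ (2 * p + 1) * (C * E) :=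
          mul_le_mul_of_nonneg_left (h6.trans (by gcongr)) (by positivity)
        _ = _ := by ring
    linarith

lemma le_mul_rpow_of_le {X A y c : ℝ} (hA : 0 ≤ A) (hy : 0 ≤ y) (hc : 0 ≤ c) (hc2 : c ≤ 2)
    (h1 : X ≤ A) (h2 : X ≤ A * y ^ 2) : X ≤ A * y ^ c := by
  rcases le_total y 1 with h | h
  · refine h2.trans (mul_le_mul_of_nonneg_left ?_ hA)
    rcases hy.eq_or_lt with rfl | h0
    · rw [zero_pow two_ne_zero]; positivity
    · rw [← Real.rpow_two]
      exact Real.rpow_le_rpow_of_exponent_ge h0 h hc2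
  · exact h1.trans (le_mul_of_one_le_right hA (one_le_rpow h hc))

end

/-! ### Small arguments of the profile -/

section

variable {n : ℕ} {a : ℝ} {w ζ : ℂ}

lemma ray_subset_closedSector (ha : 1 < a) {φ : ℝ} (hφ : φ = -theta a ∨ φ = theta a) {τ : ℝ}
    (hτ : 0 < τ) : ray φ τ ∈ sec(a) := (mem_of_mem_rays ha (mem_rays hφ hτ)).1

lemma continuousOn_ftZero_ray (ha : 1 < a) {φ : ℝ} (hφ : φ = -theta a ∨ φ = theta a) :
    ContinuousOn (fun τ => ftZero a (ray φ τ)) (Ioi 0) := by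
  intro τ hτ
  have hS := ray_subset_closedSector ha hφ hτ
  have h1 := mem_slitPlane_of_sec ha hS
  have hc := (continuous_ray φ).continuousAt (x := τ)
  refine (ContinuousAt.add (ContinuousAt.inv₀ (hc.cpow continuousAt_const h1) ?_)
    (ContinuousAt.cpow (hc.pow 2) continuousAt_const (Or.inl (sq_re_pos ha hS)))).continuousWithinAt
  rw [Complex.cpow_ne_zero_iff]
  exact Or.inl hS.1

lemma continuousOn_rayDensity_ray (hn : 3 ≤ n) (ha : 1 < a) {φ : ℝ}
    (hφ : φ = -theta a ∨ φ = theta a) :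
    ContinuousOn (fun τ => rayDensity n (ray φ τ)) (Ioi 0) := by
  have hn' : (3 : ℝ) ≤ n := mod_cast hn
  have hp : 0 ≤ ord(n) := by linarith
  refine ContinuousOn.sub (ContinuousOn.mul ?_ ?_) (continuousOn_mac_decayRoot_ray hp ha hφ)
  · refine (differentiableOn_mac hp).continuousOn.comp
      ((continuous_const.mul (continuous_ray φ)).continuousOn) fun τ hτ => ?_
    exact neg_I_mul_mem_slitPlane (re_pos_of_mem_closedSector ha (ray_subset_closedSector ha hφ hτ))
  · exact ((differentiable_gaussCut n).continuous.comp (continuous_ray φ)).continuousOn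

lemma exists_norm_mac_mul_gaussCut_le (hn : 3 ≤ n) (ha : 1 < a) :
    ∃ M : ℝ, ∀ ζ ∈ sec(a), ‖mac ord(n) (-I * ζ) * gaussCut n ζ‖ ≤ M := by
  have hn' : (3 : ℝ) ≤ n := mod_cast hn
  have hp : 0 ≤ ord(n) := by linarith
  set p := ord(n)
  obtain ⟨C, hC, h⟩ := exists_exp_mul_norm_gaussCut_le ha n (p := p)
  have hM := macConst_nonneg p
  refine ⟨macConst p * C, fun ζ hζ => ?_⟩
  have h1 := norm_mac_le hp (-I * ζ)
  have h2 : (-(-I * ζ).re) ≤ ‖ζ‖ := by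
    refine (neg_le_abs _).trans ((abs_re_le_norm _).trans ?_); simp
  rw [norm_mul]
  have h3 : ‖-I * ζ‖ = ‖ζ‖ := by simp
  rw [h3] at h1
  calc _ ≤ macConst p * (1 + 2 * ‖ζ‖) ^ p * rexp ‖ζ‖ * ‖gaussCut n ζ‖ := by
        gcongr
        refine h1.trans ?_; gcongr
    _ = macConst p * ((1 + 2 * ‖ζ‖) ^ p * rexp ‖ζ‖ * ‖gaussCut n ζ‖) := by ring
    _ ≤ macConst p * (C * rexp (-‖ζ‖)) := mul_le_mul_of_nonneg_left (h ζ hζ) hM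
    _ ≤ macConst p * (C * 1) := by bound
    _ = _ := by ring

/-- The profile, with the contribution of the pole made small at the origin. -/
lemma Phi_eq_of_rayDensity (hn : 3 ≤ n) (ha : 1 < a) (hw : w ∈ domU a) :
    RayIntegrable (theta a) (fun ζ => ft a w ζ * rayDensity n ζ) ∧
    Phi n a w = w ^ᵣ (2 - 2 * a) / a * (helmC n * mac ord(n) (-I * w) *
      (1 - gaussCut n w)) - (Complex.Gamma a)⁻¹ * heatPot n a (w ^ 2) 1 +
      helmC n * rayDiff (theta a) (fun ζ => ft a w ζ * rayDensity n ζ) := by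
  have hn' : (3 : ℝ) ≤ n := mod_cast hn
  have hp : 0 ≤ ord(n) := by linarith
  obtain ⟨M, hM⟩ := exists_norm_mac_mul_gaussCut_le hn ha
  have hc := helmC_pos hn
  obtain ⟨C', hC', hR⟩ := exists_norm_rayPart_le hn ha
  have hQ : DifferentiableOn ℂ (fun ζ => mac ord(n) (-I * ζ) * gaussCut n ζ)
      (sec(a)) := by
    refine DifferentiableOn.mul ?_ (differentiable_gaussCut n).differentiableOn
    refine (differentiableOn_mac hp).comp (by fun_prop) fun ζ hζ => ?_
    exact neg_I_mul_mem_slitPlane (re_pos_of_mem_closedSector ha hζ)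
  obtain ⟨h1, h2⟩ := rayDiff_ft_mul ha hw hQ hM
  have h3 := (hR w hw).1
  have hc' : (helmC n : ℂ) ≠ 0 := mod_cast hc.ne'
  have h4 : RayIntegrable (theta a) (fun ζ => ft a w ζ * mac ord(n) (decayRoot ζ)) := by
    refine (h3.const_mul (helmC n : ℂ)⁻¹).congr fun ζ hζ => ?_
    rw [helm_one]; field_simp
  have h5 : rayPart n a w =
      helmC n * rayDiff (theta a) (fun ζ => ft a w ζ * mac ord(n) (decayRoot ζ)) := by
    rw [rayPart, ← rayDiff_const_mul]
    refine rayDiff_congr fun ζ hζ => ?_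
    rw [helm_one]; ring
  have h6 : ∀ ζ, ft a w ζ * rayDensity n ζ = ft a w ζ * (mac ord(n) (-I * ζ) * gaussCut n ζ) -
      ft a w ζ * mac ord(n) (decayRoot ζ) := fun ζ => by rw [rayDensity]; ring
  simp only [h6]
  refine ⟨h1.sub h4, ?_⟩
  rw [rayDiff_sub h1 h4, h2, Phi_eq, h5]; ring

lemma exists_norm_heatPot_sub_le (ha : 1 < a) {c : ℝ} (hc : 0 < c) (hc2 : c ≤ 2)
    (hcn : c < n - 2 * a) :
    ∃ C > 0, ∀ w ∈ domU a, ‖heatPot n a (w ^ 2) 1 - heatPot n a 0 1‖ ≤ C * ‖w‖ ^ c := by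
  have hi0 := integrableOn_rpow_mul_exp_neg_div (b := a - 1 - (n : ℝ) / 2) (c := 1 / 4)
    (by linarith) (by norm_num)
  have hint := integrableOn_rpow_mul_exp_neg_div (b := a - 1 - (n : ℝ) / 2 + c / 2) (c := 1 / 4)
    (by linarith) (by norm_num)
  set J := ∫ t in Ioi 0, t ^ (a - 1 - (n : ℝ) / 2 + c / 2) * rexp (-(1 / 4) / t) with hJ
  have hJ0 : 0 ≤ J := setIntegral_nonneg measurableSet_Ioi fun τ hτ => by
    have : 0 < τ := hτ; positivity
  have hpi := pi_pos
  refine ⟨(4 * π) ^ (-((n : ℝ) / 2)) * 2 * J + 1, by positivity, fun w hw => ?_⟩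
  have hw0 : 0 < ‖w‖ := norm_pos_iff.2 hw.1
  have hre := sq_re_pos ha (domU_subset ha hw)
  have hI : ∀ u : ℂ, 0 ≤ u.re → Integrable (fun t => ((t ^ (a - 1) *
      (4 * π * t) ^ (-((n : ℝ) / 2)) * rexp (-1 ^ 2 / (4 * t)) : ℝ) : ℂ) *
      cexp (-t * u)) (volume.restrict (Ioi 0)) := by
    intro u hu
    refine Integrable.mono' (hi0.const_mul ((4 * π) ^ (-((n : ℝ) / 2))))
      (measurable_heatPot_integrand n a u).aestronglyMeasurable ?_
    filter_upwards [ae_mem_Ioi] with t ht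
    have ht' : 0 < t := ht
    rw [norm_heatPot_integrand n a u ht']
    refine mul_le_of_le_one_right (by positivity) (exp_le_one_iff.2 ?_)
    have := mul_nonneg ht'.le hu; linarith
  have h1 : ‖heatPot n a (w ^ 2) 1 - heatPot n a 0 1‖ ≤ ∫ t in Ioi 0,
      (4 * π) ^ (-((n : ℝ) / 2)) * 2 * ‖w‖ ^ c *
        (t ^ (a - 1 - (n : ℝ) / 2 + c / 2) * rexp (-(1 / 4) / t)) := by
    rw [heatPot, heatPot, ← integral_sub (hI _ hre.le) (hI 0 le_rfl)]
    refine norm_integral_le_of_norm_le (hint.const_mul _) ?_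
    filter_upwards [ae_mem_Ioi] with t ht
    have ht' : 0 < t := ht
    have h0 := norm_heatPot_integrand n a 0 ht'
    simp only [Complex.zero_re, mul_zero, neg_zero, Real.exp_zero, mul_one, exp_zero] at h0
    rw [mul_zero, exp_zero, ← mul_sub, norm_mul, h0]
    have hz : 0 ≤ ((t : ℂ) * w ^ 2).re := by rw [re_ofReal_mul]; exact mul_nonneg ht'.le hre.le
    obtain ⟨e1, e2⟩ := norm_one_sub_exp_neg_le hz
    have e3 : ‖cexp (-t * w ^ 2) - 1‖ ≤ 2 * (t ^ (1 / 2 : ℝ) * ‖w‖) ^ c := by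
      rw [norm_sub_rev, neg_mul]
      refine le_mul_rpow_of_le (by norm_num) (by positivity) hc.le hc2 e1 (e2.trans ?_)
      rw [mul_pow, ← rpow_natCast (t ^ (1 / 2 : ℝ)), ← rpow_mul ht'.le, norm_mul, norm_pow,
        norm_of_nonneg ht'.le]
      norm_num
      nlinarith [mul_nonneg ht'.le (sq_nonneg ‖w‖)]
    rw [mul_rpow (by positivity) hw0.le, ← rpow_mul ht'.le, show 1 / 2 * c = c / 2 by ring] at e3
    rw [rpow_add ht']
    calc _ ≤ (4 * π) ^ (-((n : ℝ) / 2)) * (t ^ (a - 1 - n / 2) * rexp (-(1 / 4) / t)) *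
          (2 * (t ^ (c / 2) * ‖w‖ ^ c)) := by gcongr
      _ = _ := by ring
  rw [integral_const_mul, ← hJ] at h1
  have : 0 ≤ ‖w‖ ^ c := by positivity
  nlinarith

/-- The profile is Hölder continuous at the origin. -/
lemma exists_norm_Phi_sub_le (hn : 3 ≤ n) (ha : 1 < a) (han : 2 * a < n) :
    ∃ (C c : ℝ) (P : ℂ), 0 < C ∧ 0 < c ∧ ∀ w ∈ domU a, ‖w‖ ≤ 8 → ‖Phi n a w - P‖ ≤ C * ‖w‖ ^ c := by
  have hn' : (3 : ℝ) ≤ n := mod_cast hn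
  have hp : 0 ≤ ord(n) := by linarith
  obtain ⟨c, hc, hc2, hcn⟩ : ∃ c > 0, c ≤ 2 ∧ c < n - 2 * a :=
    ⟨min 2 ((n - 2 * a) / 2), lt_min (by norm_num) (by linarith), min_le_left _ _,
      (min_le_right _ _).trans_lt (by linarith)⟩
  obtain ⟨C1, hC1, hB⟩ := exists_norm_rayDensity_le hn ha
  obtain ⟨C2, hC2, hft⟩ := exists_norm_ft_le ha
  obtain ⟨C3, hC3, hH⟩ := exists_norm_heatPot_sub_le ha hc hc2 hcn
  have hs := sin_theta_pos ha
  have hhc := helmC_pos hn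
  have hM := macConst_nonneg ord(n)
  set p := ord(n) with hpdef
  set s := Real.sin (theta a)
  have hb : -2 < (n : ℝ) - 2 - 2 * a - c := by linarith
  set J := ∫ τ in Ioi 0, τ ^ (((n : ℝ) - 2 - 2 * a - c) + 1) * ((1 + τ) ^ p * rexp (-s * τ))
  have hJ0 : 0 ≤ J := setIntegral_nonneg measurableSet_Ioi fun τ hτ => by
    have : 0 < τ := hτ; positivity
  have hZ : RayIntegrable (theta a) (fun ζ => ftZero a ζ * rayDensity n ζ) := by
    refine rayIntegrable_of_bound (K := C2 * C1) (b := (n : ℝ) - 2 - 2 * a) (p := p) (s := s)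
      (by linarith) hs (fun φ hφ => (continuousOn_ftZero_ray ha hφ).mul
        (continuousOn_rayDensity_ray hn ha hφ)) fun ζ hζ => ?_
    have hζ0 : 0 < ‖ζ‖ := norm_pos_iff.2 (mem_of_mem_rays ha hζ).1.1
    have h1 := (hft 1 (mod_cast ofReal_mem_domU ha one_pos) ζ hζ).2.2.2
    have h2 := hB ζ hζ
    rw [norm_mul, show (n : ℝ) - 2 - 2 * a = -(2 * a) + ((n : ℝ) - 2) by ring, rpow_add hζ0]
    calc _ ≤ (C2 * ‖ζ‖ ^ (-(2 * a))) * (C1 * (‖ζ‖ ^ ((n : ℝ) - 2) *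
          ((1 + ‖ζ‖) ^ p * rexp (-s * ‖ζ‖)))) := by gcongr
      _ = _ := by ring
  set C4 := 1 / a * (helmC n * (macConst p * (1 + 2 * 8) ^ p * rexp 8) * 2 ^ n) *
    8 ^ (n - 2 * a - c) with hC4
  have hC40 : 0 ≤ C4 := by positivity
  refine ⟨C4 + ‖(Complex.Gamma a)⁻¹‖ * C3 + helmC n * (2 * C2 * C1 * J) + 1, c,
    -((Complex.Gamma a)⁻¹ * heatPot n a 0 1) +
      helmC n * rayDiff (theta a) (fun ζ => ftZero a ζ * rayDensity n ζ), by positivity, hc,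
    fun w hw hw8 => ?_⟩
  have hw0 : 0 < ‖w‖ := norm_pos_iff.2 hw.1
  have hwS := domU_subset ha hw
  obtain ⟨hI, heq⟩ := Phi_eq_of_rayDensity hn ha hw
  have hdiff : Phi n a w - (-((Complex.Gamma a)⁻¹ * heatPot n a 0 1) +
      helmC n * rayDiff (theta a) (fun ζ => ftZero a ζ * rayDensity n ζ)) =
      w ^ᵣ (2 - 2 * a) / a * (helmC n * mac p (-I * w) * (1 - gaussCut n w)) -
      (Complex.Gamma a)⁻¹ * (heatPot n a (w ^ 2) 1 - heatPot n a 0 1) +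
      helmC n * rayDiff (theta a) (fun ζ => ft a w ζ * rayDensity n ζ -
        ftZero a ζ * rayDensity n ζ) := by
    rw [rayDiff_sub hI hZ, heq]; ring
  have hT1 : ‖w ^ᵣ (2 - 2 * a) / a * (helmC n * mac p (-I * w) *
      (1 - gaussCut n w))‖ ≤ C4 * ‖w‖ ^ c := by
    have h1 := norm_mac_le hp (-I * w)
    have h2 : (-(-I * w).re) ≤ ‖w‖ := by
      refine (neg_le_abs _).trans ((abs_re_le_norm _).trans ?_); simp
    have h3 : ‖-I * w‖ = ‖w‖ := by simp
    rw [h3] at h1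
    have h4 : ‖mac p (-I * w)‖ ≤ macConst p * (1 + 2 * 8) ^ p * rexp 8 := by
      refine h1.trans ?_; gcongr; linarith
    have h5 := norm_one_sub_gaussCut_le ha hn hwS
    have h6 : ‖w‖ ^ (2 - 2 * a) * ‖w‖ ^ ((n : ℝ) - 2) = ‖w‖ ^ (n - 2 * a - c) * ‖w‖ ^ c := by
      rw [← rpow_add hw0, ← rpow_add hw0]; congr 1; ring
    have h7 : ‖w‖ ^ (n - 2 * a - c) ≤ 8 ^ (n - 2 * a - c) := rpow_le_rpow hw0.le hw8 (by linarith)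
    rw [norm_mul, norm_div, norm_cpow_real, norm_mul, norm_mul,
      norm_of_nonneg hhc.le, norm_of_nonneg (by linarith : 0 ≤ a)]
    calc _ ≤ ‖w‖ ^ (2 - 2 * a) / a * (helmC n * (macConst p * (1 + 2 * 8) ^ p * rexp 8) *
          (2 ^ n * ‖w‖ ^ ((n : ℝ) - 2))) := by gcongr
      _ = 1 / a * (helmC n * (macConst p * (1 + 2 * 8) ^ p * rexp 8) * 2 ^ n) *
          (‖w‖ ^ (2 - 2 * a) * ‖w‖ ^ ((n : ℝ) - 2)) := by ring
      _ = 1 / a * (helmC n * (macConst p * (1 + 2 * 8) ^ p * rexp 8) * 2 ^ n) *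
          (‖w‖ ^ (n - 2 * a - c) * ‖w‖ ^ c) := by rw [h6]
      _ ≤ 1 / a * (helmC n * (macConst p * (1 + 2 * 8) ^ p * rexp 8) * 2 ^ n) *
          (8 ^ (n - 2 * a - c) * ‖w‖ ^ c) := by gcongr
      _ = _ := by rw [hC4]; ring
  have hT2 : ‖rayDiff (theta a) (fun ζ => ft a w ζ * rayDensity n ζ -
        ftZero a ζ * rayDensity n ζ)‖ ≤ 2 * C2 * C1 * ‖w‖ ^ c * J := by
    refine norm_rayDiff_le_of_bound (p := p) (s := s) hb hs fun ζ hζ => ?_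
    have hζ0 : 0 < ‖ζ‖ := norm_pos_iff.2 (mem_of_mem_rays ha hζ).1.1
    obtain ⟨f1, -, f3, f4⟩ := hft w hw ζ hζ
    have f5 : ‖ft a w ζ - ftZero a ζ‖ ≤ 2 * C2 * ‖ζ‖ ^ (-(2 * a)) * (‖w‖ / ‖ζ‖) ^ c := by
      refine le_mul_rpow_of_le (by positivity) (by positivity) hc.le hc2 ?_ ?_
      · refine (norm_sub_le _ _).trans ?_
        linarith
      · refine f3.trans ?_
        rw [show -(2 * (a + 1)) = -(2 * a) + (-2 : ℝ) by ring, rpow_add hζ0, rpow_neg hζ0.le 2,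
          Real.rpow_two, div_pow]
        have : 0 ≤ C2 * (‖ζ‖ ^ (-(2 * a)) * (‖ζ‖ ^ 2)⁻¹) * ‖w‖ ^ 2 := by positivity
        calc _ ≤ 2 * (C2 * (‖ζ‖ ^ (-(2 * a)) * (‖ζ‖ ^ 2)⁻¹) * ‖w‖ ^ 2) := by linarith
          _ = _ := by field_simp
    have h2 := hB ζ hζ
    rw [div_rpow hw0.le hζ0.le] at f5
    rw [← sub_mul, norm_mul, show (n : ℝ) - 2 - 2 * a - c = -(2 * a) + ((n : ℝ) - 2) + -c by ring,
      rpow_add hζ0, rpow_add hζ0, rpow_neg hζ0.le c]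
    calc _ ≤ (2 * C2 * ‖ζ‖ ^ (-(2 * a)) * (‖w‖ ^ c / ‖ζ‖ ^ c)) * (C1 * (‖ζ‖ ^ ((n : ℝ) - 2) *
          ((1 + ‖ζ‖) ^ p * rexp (-s * ‖ζ‖)))) := by gcongr
      _ = _ := by ring
  rw [hdiff]
  have hwc : 0 ≤ ‖w‖ ^ c := by positivity
  calc _ ≤ ‖w ^ᵣ (2 - 2 * a) / a * (helmC n * mac p (-I * w) *
        (1 - gaussCut n w))‖ + ‖(Complex.Gamma a)⁻¹ * (heatPot n a (w ^ 2) 1 - heatPot n a 0 1)‖ +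
        ‖helmC n * rayDiff (theta a) (fun ζ => ft a w ζ * rayDensity n ζ -
        ftZero a ζ * rayDensity n ζ)‖ := (norm_add_le _ _).trans (by gcongr; exact norm_sub_le _ _)
    _ ≤ C4 * ‖w‖ ^ c + ‖(Complex.Gamma a)⁻¹‖ * (C3 * ‖w‖ ^ c) +
        helmC n * (2 * C2 * C1 * ‖w‖ ^ c * J) := by
      rw [norm_mul (Complex.Gamma a)⁻¹, norm_mul (helmC n : ℂ), norm_of_nonneg hhc.le]; gcongr
      exact hH w hw
    _ ≤ _ := by nlinarith

end

/-! ### The profile as a sum of an oscillating symbol and a compactly supported one -/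

lemma exists_symBound_exp (N : ℕ) :
    SymBound (Ioi 0) N (fun t => (1 + t) ^ N) (fun t => cexp (-(I * t))) := by
  have h := iteratedDeriv_comp_ofReal (F := fun w => cexp (-I * w)) isOpen_univ (by fun_prop)
  have he : (fun t : ℝ => cexp (-(I * t))) = fun t : ℝ => (fun w : ℂ => cexp (-I * w)) t := by
    funext t; simp
  rw [he]
  refine SymBound.of_iteratedDeriv Subset.rfl (fun k _ t _ => (h k t (mem_univ _)).2)
    fun k hk t ht => ?_
  have ht0 : 0 < t := ht
  rw [(h k t (mem_univ _)).1, iteratedDeriv_cexp_const_mul, norm_mul, norm_pow, norm_exp]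
  have h1 : (-I * (t : ℂ)).re = 0 := by simp
  rw [h1, Real.exp_zero, norm_neg, norm_I, one_pow, one_mul, one_mul]
  calc t ^ k ≤ (1 + t) ^ k := by gcongr; linarith
    _ ≤ _ := pow_le_pow_right₀ (by linarith) hk

section

variable {n : ℕ} {a : ℝ}

lemma exists_closedBall_subset_domU (ha : 1 < a) : ∃ σ : ℝ, 0 < σ ∧ σ ≤ 1 / 2 ∧
    ∀ t : ℝ, 0 < t → Metric.closedBall (t : ℂ) (σ * t) ⊆ domU a := by
  obtain ⟨ε, hε, hsub⟩ := Metric.isOpen_iff.1 (isOpen_domU ha) 1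
    (mod_cast ofReal_mem_domU ha one_pos)
  refine ⟨min (ε / 2) (1 / 2), by positivity, min_le_right _ _, fun t ht w hw => ?_⟩
  have hw' : w / t ∈ Metric.ball (1 : ℂ) ε := by
    rw [Metric.mem_closedBall, dist_eq_norm] at hw
    have ht' : (t : ℂ) ≠ 0 := mod_cast ht.ne'
    rw [Metric.mem_ball, dist_eq_norm, show w / t - 1 = (w - t) / t by field_simp, norm_div,
      norm_of_nonneg ht.le, div_lt_iff₀ ht]
    refine hw.trans_lt ?_
    have := min_le_left (ε / 2) (1 / 2); nlinarith
  have := mul_ofReal_mem_domU ht (hsub hw')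
  rwa [div_mul_cancel₀ _ (mod_cast ht.ne')] at this

lemma rpow_le_of_le_two_mul {x t s : ℝ} (ht : 0 < t) (h1 : t / 2 ≤ x) (h2 : x ≤ 2 * t) :
    x ^ s ≤ 2 ^ |s| * t ^ s := by
  have hx : 0 < x := by linarith
  rcases le_total 0 s with h | h
  · rw [abs_of_nonneg h, ← mul_rpow (by norm_num) ht.le]
    exact rpow_le_rpow hx.le h2 h
  · rw [abs_of_nonpos h, rpow_neg (by norm_num), ← Real.inv_rpow (by norm_num),
      ← mul_rpow (by norm_num) ht.le]
    exact Real.rpow_le_rpow_of_nonpos (by positivity) (by linarith) h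

lemma exists_high_part (hn : 3 ≤ n) (ha : 1 < a) (han : 2 * a < n) {N : ℕ}
    (hN : (N : ℝ) ≤ ((n : ℝ) + 5) / 2) : ∃ (C : ℝ) (S : ℝ → ℂ), 0 < C ∧
      (∀ t : ℝ, (1 - cutoff t) * Phi n a t = cexp (I * t) * S t) ∧
      SymBound (Ioi 0) N
        (fun t => C * (Ici 1).indicator (fun t => t ^ (((n : ℝ) + 1) / 2 - 2 * a)) t) S := by
  have hn' : (3 : ℝ) ≤ n := mod_cast hn
  have hp : (0 : ℝ) ≤ ord(n) := by linarith
  obtain ⟨C1, hC1, hrem⟩ := exists_norm_phiRem_le hn ha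
  obtain ⟨σ, hσ, hσ2, hball⟩ := exists_closedBall_subset_domU ha
  obtain ⟨c, hc, hcut⟩ := exists_symBound_one_sub_cutoff_mul N
  have hhc := helmC_pos hn
  have hq : ((n : ℝ) + 1) / 2 - 2 * a = 2 - 2 * a + ord(n) := by ring
  set q := ((n : ℝ) + 1) / 2 - 2 * a
  set p := ord(n)
  have hM := macConst_nonneg p
  have hsub : Ioi (1 / 2 : ℝ) ⊆ Ioi 0 := Ioi_subset_Ioi (by norm_num)
  have hfacts : ∀ t ∈ Ioi (1 / 2 : ℝ), ∀ w ∈ Metric.closedBall (t : ℂ) (σ * t),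
      w ∈ domU a ∧ t / 2 ≤ ‖w‖ ∧ ‖w‖ ≤ 2 * t := by
    intro t ht w hw
    have ht0 : 0 < t := hsub ht
    obtain ⟨-, h2, h3, -⟩ := closedBall_half_facts ht0
      (Metric.closedBall_subset_closedBall (by gcongr) hw)
    exact ⟨hball t ht0 hw, h2, h3⟩
  set C2 := 2 ^ |2 - 2 * a| / a * (helmC n * (macConst p * 6 ^ p)) with hC2
  have h1 := SymBound.of_differentiableOn (β := fun t => C2 * t ^ q)
    (F := fun w : ℂ => w ^ᵣ (2 - 2 * a) / a * (helmC n * macF p (-I * w)))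
    (isOpen_domU ha) ?_ hsub hσ (by linarith) (fun t ht => hball t (hsub ht)) ?_ N
  rotate_left
  · refine DifferentiableOn.mul (DifferentiableOn.div_const (fun w hw => ?_) _)
      (DifferentiableOn.const_mul ((differentiableOn_macF hp).comp (by fun_prop) fun w hw =>
        neg_I_mul_mem_slitPlane (re_pos_of_mem_domU ha hw)) _)
    exact (DifferentiableAt.cpow_const differentiableAt_id
      (mem_slitPlane_of_sec ha (domU_subset ha hw))).differentiableWithinAt
  · intro t ht w hw
    obtain ⟨-, h2, h3⟩ := hfacts t ht w hw
    have ht0 : 0 < t := hsub ht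
    have ht1 : 1 / 2 < t := ht
    have e1 := rpow_le_of_le_two_mul (s := 2 - 2 * a) ht0 h2 h3
    have e2 := norm_macF_le hp (-I * w)
    have e3 : ‖-I * w‖ = ‖w‖ := by simp
    rw [e3] at e2
    have e4 : (1 + 2 * ‖w‖) ^ p ≤ 6 ^ p * t ^ p := by
      rw [← mul_rpow (by norm_num) ht0.le]
      exact rpow_le_rpow (by positivity) (by linarith) hp
    rw [norm_mul, norm_div, norm_cpow_real, norm_mul,
      norm_of_nonneg hhc.le, norm_of_nonneg (by linarith : 0 ≤ a), hq,
      rpow_add ht0]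
    calc _ ≤ 2 ^ |2 - 2 * a| * t ^ (2 - 2 * a) / a * (helmC n * (macConst p * (6 ^ p * t ^ p))) := by
          gcongr
          exact e2.trans (by gcongr)
      _ = _ := by rw [hC2]; ring
  have h2 := SymBound.of_differentiableOn (β := fun t => C1 * 2 ^ |-(2 * (a + 1))| * t ^ (-(2 * (a + 1))))
    (isOpen_domU ha) (differentiableOn_phiRem hn ha han) hsub hσ (by linarith)
    (fun t ht => hball t (hsub ht)) (fun t ht w hw => by
      obtain ⟨h0, h2, h3⟩ := hfacts t ht w hw
      have e1 := rpow_le_of_le_two_mul (s := -(2 * (a + 1))) (hsub ht) h2 h3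
      rw [mul_assoc]
      exact (hrem w h0).trans (by gcongr)) N
  have h3 := ((exists_symBound_exp N).mono hsub hsub fun t _ => le_rfl).mul isOpen_Ioi hsub h2
  have h4 := hcut _ _ (h1.add isOpen_Ioi h3)
  set K := (N.factorial : ℝ) / σ ^ N
  have hK : 0 < K := by positivity
  set C3 := C1 * 2 ^ |-(2 * (a + 1))|
  refine ⟨c * (K * C2 + 2 ^ N * (2 ^ N * K * C3)), _, by positivity, fun t => ?_,
    h4.mono Subset.rfl Subset.rfl fun t ht => ?_⟩
  · rw [Phi_eq_add_phiRem, mac]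
    have h5 : cexp (I * t) * cexp (-(I * t)) = 1 := by rw [← exp_add, add_neg_cancel, exp_zero]
    rw [show -(-I * (t : ℂ)) = I * t by ring]
    linear_combination (-(1 - cutoff t) * phiRem n a t) * h5
  · by_cases h : t ∈ Ici (1 : ℝ)
    · rw [indicator_of_mem h, indicator_of_mem h]
      have ht1 : (1 : ℝ) ≤ t := h
      have e1 : (1 + t) ^ N * t ^ (-(2 * (a + 1))) ≤ 2 ^ N * t ^ q := by
        calc _ ≤ (2 * t) ^ N * t ^ (-(2 * (a + 1))) := by gcongr; linarith
          _ = 2 ^ N * t ^ ((N : ℝ) + -(2 * (a + 1))) := by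
            rw [rpow_add (by linarith), rpow_natCast, mul_pow]; ring
          _ ≤ _ := by
            gcongr
            simp only [q]; linarith
      calc _ = c * (K * C2 * t ^ q) + c * (2 ^ N * (K * C3 * ((1 + t) ^ N * t ^ (-(2 * (a + 1)))))) := by
            ring
        _ ≤ c * (K * C2 * t ^ q) + c * (2 ^ N * (K * C3 * (2 ^ N * t ^ q))) := by gcongr
        _ = _ := by ring
    · rw [indicator_of_notMem h, indicator_of_notMem h]; simp

lemma exists_symBound_id_mul_deriv_cutoff (N : ℕ) (c : ℝ) (hc : 0 ≤ c) : ∃ C > 0,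
    SymBound (Ioi 0) N (fun t => C * (Iic 2).indicator (fun t => t ^ c) t)
      (fun t => (t : ℂ) * deriv cutoff t) := by
  obtain ⟨C, hC, h1, -⟩ := exists_symBound_cutoff (N + 1)
  refine ⟨2 ^ N * C, by positivity, ?_⟩
  have h2 : SymBound (Ioo 0 1) N (fun t => (2 ^ N * C) * (Iic 2).indicator (fun t => t ^ c) t)
      (fun t => (t : ℂ) * deriv cutoff t) := by
    refine (SymBound.zero (N := N) Ioo_subset_Ioi_self (β := fun _ => 0) (fun _ _ => le_rfl)).congr
      isOpen_Ioo (fun t ht => ?_) |>.mono Subset.rfl Ioo_subset_Ioi_self fun t ht => ?_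
    · have : cutoff =ᶠ[𝓝 t] fun _ => 1 := by
        filter_upwards [isOpen_Iio.mem_nhds ht.2] with s hs using cutoff_one (le_of_lt hs)
      rw [this.deriv_eq, deriv_const, mul_zero]
    · have : 0 < t := ht.1
      exact mul_nonneg (by positivity) (indicator_apply_nonneg fun _ => by positivity)
  have h3 := (h1.id_mul_deriv isOpen_Ioi Subset.rfl).mono (s' := Ici 1)
    (β' := fun t => (2 ^ N * C) * (Iic 2).indicator (fun t => t ^ c) t)
    (Ici_subset_Ioi.2 one_pos) (Ici_subset_Ioi.2 one_pos) fun t ht => by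
      by_cases h : t ∈ Iic (2 : ℝ)
      · rw [indicator_of_mem h, indicator_of_mem h, ← mul_assoc]
        exact mul_le_mul_of_nonneg_left (one_le_rpow ht hc) (by positivity)
      · simp_all
  refine (h2.union h3).mono (fun t ht => ?_) Subset.rfl fun t _ => le_rfl
  rcases lt_or_ge t 1 with h | h
  · grind
  · exact Or.inr h

lemma exists_low_part (hn : 3 ≤ n) (ha : 1 < a) (han : 2 * a < n) (N : ℕ) :
    ∃ C c : ℝ, 0 < C ∧ 0 < c ∧
      SymBound (Ioi 0) (N + 1) (fun t => C * (Iic 2).indicator 1 t) (fun t => cutoff t * Phi n a t) ∧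
      SymBound (Ioi 0) N (fun t => C * (Iic 2).indicator (fun t => t ^ c) t)
        (fun t => (t : ℂ) * deriv (fun t : ℝ => cutoff t * Phi n a t) t) := by
  obtain ⟨C1, c, P, hC1, hc, hP⟩ := exists_norm_Phi_sub_le hn ha han
  obtain ⟨σ, hσ, hσ2, hball⟩ := exists_closedBall_subset_domU ha
  obtain ⟨k, hk, hcut⟩ := exists_symBound_cutoff_mul (N + 1)
  obtain ⟨C2, hC2, hd⟩ := exists_symBound_id_mul_deriv_cutoff N c hc.le
  obtain ⟨C3, hC3, h3, -⟩ := exists_symBound_cutoff (N + 1)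
  have h1 := SymBound.of_differentiableOn (β := fun t => C1 * 2 ^ |c| * t ^ c) (s := Ioo 0 3)
    (F := fun w : ℂ => Phi n a w - P) (isOpen_domU ha)
    ((differentiableOn_Phi hn ha han).sub_const P) Ioo_subset_Ioi_self hσ (by linarith)
    (fun t ht => hball t ht.1) (fun t ht w hw => by
      obtain ⟨-, h2, h3, -⟩ := closedBall_half_facts ht.1
        (Metric.closedBall_subset_closedBall (mul_le_mul_of_nonneg_right hσ2 ht.1.le) hw)
      have e1 := rpow_le_of_le_two_mul (s := c) ht.1 h2 h3
      rw [mul_assoc]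
      exact (hP w (hball t ht.1 hw) (by linarith [ht.2])).trans (by gcongr)) (N + 1)
  have h2 := hcut _ _ h1
  set K := ((N + 1).factorial : ℝ) / σ ^ (N + 1)
  have hK : 0 < K := by positivity
  have hL : (fun t => cutoff t * Phi n a t) =
      fun t => P * cutoff t + cutoff t * (Phi n a t - P) := by funext t; ring
  have h4 := (h3.const_mul isOpen_Ioi Subset.rfl P).add isOpen_Ioi h2
  have h5 := (hd.const_mul isOpen_Ioi Subset.rfl P).add isOpen_Ioi
    (h2.id_mul_deriv isOpen_Ioi Subset.rfl)
  set K1 := k * (K * (C1 * 2 ^ |c|))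
  have hK1 : 0 < K1 := by positivity
  set B := ‖P‖ * C3 + K1 * 2 ^ c + ‖P‖ * C2 + 2 ^ N * K1 with hB
  have hB1 : ‖P‖ * C3 + K1 * 2 ^ c ≤ B := by
    have : 0 ≤ ‖P‖ * C2 + 2 ^ N * K1 := by positivity
    linarith
  have hB2 : ‖P‖ * C2 + 2 ^ N * K1 ≤ B := by bound
  refine ⟨B, c, by positivity, hc, ?_, ?_⟩
  · rw [hL]
    refine h4.mono Subset.rfl Subset.rfl fun t ht => ?_
    have ht0 : 0 < t := ht
    by_cases h : t ∈ Iic (2 : ℝ)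
    · rw [indicator_of_mem h, indicator_of_mem h, Pi.one_apply]
      have e1 : t ^ c ≤ 2 ^ c := rpow_le_rpow ht0.le h hc.le
      calc _ = ‖P‖ * C3 + K1 * t ^ c := by simp only [K1]; ring
        _ ≤ ‖P‖ * C3 + K1 * 2 ^ c := by gcongr
        _ ≤ _ := by linarith
    · simp_all
  · refine (h5.congr isOpen_Ioi fun t ht => ?_).mono Subset.rfl Subset.rfl fun t ht => ?_
    · have d1 : DifferentiableAt ℝ cutoff t := h3.2.1 t ht
      have d2 := h2.2.1 t ht
      rw [hL, deriv_fun_add (d1.const_mul P) d2, deriv_const_mul _ d1]; ring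
    · have ht0 : 0 < t := ht
      by_cases h : t ∈ Iic (2 : ℝ)
      · simp only [indicator_of_mem h]
        calc _ = (‖P‖ * C2 + 2 ^ N * K1) * t ^ c := by simp only [K1]; ring
          _ ≤ _ := by gcongr
      · simp_all

end

/-! ### The oscillatory integral in the spectral variable -/

lemma exists_symBound_rpow (N : ℕ) (s : ℝ) : ∃ C > 0,
    SymBound (Ioi 0) N (fun t => C * t ^ s) (fun t => ((t ^ s : ℝ) : ℂ)) := by
  have h := SymBound.of_differentiableOn (β := fun t => 2 ^ |s| * t ^ s) (s := Ioi 0)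
    (F := fun w : ℂ => w ^ (s : ℂ)) (isOpen_lt continuous_const continuous_re)
    (fun w hw => (DifferentiableAt.cpow_const differentiableAt_id
      (Or.inl hw)).differentiableWithinAt) Subset.rfl (σ := 1 / 2)
    (by norm_num) (by norm_num) (fun t ht w hw => (closedBall_half_facts ht hw).1)
    (fun t ht w hw => by
      obtain ⟨-, h2, h3, -⟩ := closedBall_half_facts ht hw
      rw [norm_cpow_real]
      exact rpow_le_of_le_two_mul ht h2 h3) N
  refine ⟨N.factorial / (1 / 2) ^ N * 2 ^ |s|, by positivity,
    (h.congr isOpen_Ioi fun t ht => ?_).mono Subset.rfl Subset.rfl fun t _ => by rw [mul_assoc]⟩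
  rw [ofReal_cpow (le_of_lt ht)]

lemma exists_norm_integral_exp_mul_le' (N : ℕ) {Λ : ℝ} (hΛ : 0 < Λ) : ∃ C > 0,
    ∀ (D : ℝ) (γ : ℝ → ℝ) (b : ℝ → ℂ) (M : ℝ), (∀ t ∈ Ioo 0 Λ, 0 ≤ γ t ∧ γ t ≤ M) →
      SymBound (Ioo 0 Λ) N (fun t => (Λ - t) * γ t) b →
      ‖∫ t in Ioo 0 Λ, cexp (I * (t * D : ℝ)) * b t‖ₑ ≤
        ofReal C * ∫⁻ t in Ioo 0 Λ, ofReal (γ t * ((1 + t * |D|) ^ N)⁻¹) := by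
  obtain ⟨C, hC, h⟩ := exists_norm_integral_exp_mul_le N
  refine ⟨C * Λ, by positivity, fun D γ b M hγ hb => ?_⟩
  refine (h Λ hΛ D _ b hb ?_ ⟨Λ * M, fun t ht => ?_⟩).trans ?_
  · have h1 : Tendsto (fun t => (Λ - t) * M) (𝓝[<] Λ) (𝓝 0) := by
      have : ContinuousAt (fun t => (Λ - t) * M) Λ := by fun_prop
      have h2 := this.tendsto
      simp only [sub_self, zero_mul] at h2
      exact h2.mono_left nhdsWithin_le_nhds
    refine squeeze_zero' ?_ ?_ h1
    · filter_upwards [Ioo_mem_nhdsLT hΛ] with t ht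
      exact mul_nonneg (by linarith [ht.2]) (hγ t ht).1
    · filter_upwards [Ioo_mem_nhdsLT hΛ] with t ht
      exact mul_le_mul_of_nonneg_left (hγ t ht).2 (by linarith [ht.2])
  · exact mul_le_mul (by linarith [ht.1]) (hγ t ht).2 (hγ t ht).1 hΛ.le
  · rw [ofReal_mul hC.le, mul_assoc]
    gcongr
    rw [← lintegral_const_mul' _ _ ofReal_ne_top]
    refine setLIntegral_mono' measurableSet_Ioo fun t ht => ?_
    rw [← ofReal_mul hΛ.le, ← mul_assoc]
    refine ofReal_le_ofReal ?_
    have h1 := (hγ t ht).1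
    have h2 : 0 ≤ ((1 + t * |D|) ^ N)⁻¹ := by
      have := ht.1; positivity
    gcongr
    linarith [ht.1]

lemma SymBound.integrableOn_exp_mul {Λ : ℝ} {N : ℕ} {γ : ℝ → ℝ} {b : ℝ → ℂ} {M : ℝ}
    (hb : SymBound (Ioo 0 Λ) (N + 1) (fun t => (Λ - t) * γ t) b)
    (hγ : ∀ t ∈ Ioo 0 Λ, 0 ≤ γ t ∧ γ t ≤ M) (D : ℝ) :
    IntegrableOn (fun t => cexp (I * (t * D : ℝ)) * b t) (Ioo 0 Λ) := by
  refine integrableOn_Ioo_of_bounded (M := Λ * M) ?_ ?_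
  · refine ContinuousOn.aestronglyMeasurable ?_ measurableSet_Ioo
    exact (Continuous.continuousOn (by fun_prop)).mul hb.continuousOn
  · filter_upwards [ae_mem_Ioo] with t ht
    have h1 := hb.norm_le ht
    rw [norm_mul, mul_comm I, norm_exp_ofReal_mul_I, one_mul]
    refine h1.trans (mul_le_mul (by linarith [ht.1]) (hγ t ht).2 (hγ t ht).1 ?_)
    linarith [ht.1, ht.2]

lemma exists_enorm_integral_add_exp_le (N : ℕ) {Λ : ℝ} (hΛ : 0 < Λ) : ∃ C > 0,
    ∀ (K D D' M : ℝ) (γ ρ : ℝ → ℝ) (b b' F : ℝ → ℂ), 0 ≤ K →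
      (∀ t ∈ Ioo 0 Λ, 0 ≤ γ t ∧ γ t ≤ M) → SymBound (Ioo 0 Λ) (N + 1) (fun t => (Λ - t) * γ t) b →
      SymBound (Ioo 0 Λ) (N + 1) (fun t => (Λ - t) * γ t) b' →
      (∀ d ∈ ({D, D'} : Set ℝ), ∀ t ∈ Ioo 0 Λ, γ t * ((1 + t * |d|) ^ (N + 1))⁻¹ ≤ K * ρ t) →
      (∀ t ∈ Ioo 0 Λ, F t = cexp (I * (t * D : ℝ)) * b t + cexp (I * (t * D' : ℝ)) * b' t) →
      IntegrableOn F (Ioo 0 Λ) ∧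
      ‖∫ t in Ioo 0 Λ, F t‖ₑ ≤ ofReal (C * K) * ∫⁻ t in Ioo 0 Λ, ofReal (ρ t) := by
  obtain ⟨C, hC, h⟩ := exists_norm_integral_exp_mul_le' (N + 1) hΛ
  refine ⟨C + C, by positivity, fun K D D' M γ ρ b b' F hK hγ hb hb' hρ heq => ?_⟩
  have hi := hb.integrableOn_exp_mul hγ D
  have hi' := hb'.integrableOn_exp_mul hγ D'
  refine ⟨(hi.add hi').congr_fun (fun t ht => (heq t ht).symm) measurableSet_Ioo, ?_⟩
  rw [setIntegral_congr_fun measurableSet_Ioo heq, integral_add hi hi', add_mul,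
    ofReal_add (by positivity) (by positivity), add_mul]
  have h1 : ∀ d ∈ ({D, D'} : Set ℝ), ∀ b, SymBound (Ioo 0 Λ) (N + 1) (fun t => (Λ - t) * γ t) b →
      ‖∫ t in Ioo 0 Λ, cexp (I * (t * d : ℝ)) * b t‖ₑ ≤
        ofReal (C * K) * ∫⁻ t in Ioo 0 Λ, ofReal (ρ t) := fun d hd b hb => by
    refine (h d γ b M hγ hb).trans ?_
    rw [ofReal_mul hC.le, mul_assoc]; gcongr
    rw [← lintegral_const_mul' _ _ ofReal_ne_top]
    refine setLIntegral_mono' measurableSet_Ioo fun t ht => ?_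
    rw [← ofReal_mul hK]
    exact ofReal_le_ofReal (hρ d hd t ht)
  exact (enorm_add_le _ _).trans (add_le_add (h1 D (by simp) b hb) (h1 D' (by simp) b' hb'))

/-- The majorant of the part of the spectral integral where `t r₁` is large. -/
def majHigh (n : ℕ) (a : ℝ) (N : ℕ) (t r₁ r₂ : ℝ) : ℝ :=
  t ^ ((n : ℝ) - 1) * (Ici 1).indicator (fun x => x ^ (((n : ℝ) + 1) / 2 - 2 * a)) (t * r₁) *
    (1 + t * r₂) ^ (-(((n : ℝ) - 1) / 2)) * ((1 + |t * r₁ - t * r₂|) ^ N)⁻¹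

/-- The majorant of the part of the spectral integral where `t r₁` is bounded. -/
def majLow (n : ℕ) (N : ℕ) (η c : ℝ) (t r₁ r₂ : ℝ) : ℝ :=
  t ^ ((n : ℝ) - 1) * ((t ^ η + (t * r₁) ^ c) * (Iic 2).indicator 1 (t * r₁)) *
    (1 + t * r₂) ^ (-(((n : ℝ) - 1) / 2 + N))

section

variable {n : ℕ} {a : ℝ}

lemma exists_enorm_integral_high_le (hn : 3 ≤ n) (ha : 1 < a) (han : 2 * a < n) {N : ℕ}
    (hN : ((N + 1 : ℕ) : ℝ) ≤ ((n : ℝ) + 5) / 2) {Λ : ℝ} (hΛ : 0 < Λ) :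
    ∃ C > 0, ∀ (A : ℝ) (m : ℝ → ℂ), 0 ≤ A →
      SymBound (Ioo 0 Λ) (N + 1) (fun t => A * (Λ - t)) m → ∀ r₁ r₂ : ℝ, 0 < r₁ → 0 < r₂ →
      IntegrableOn (fun t => m t * (t ^ ((n : ℝ) - 1) : ℝ) * ((1 - cutoff (t * r₁)) *
        Phi n a (t * r₁ : ℝ)) * poissonG ord(n) (t * r₂ : ℝ)) (Ioo 0 Λ) ∧
      ‖∫ t in Ioo 0 Λ, m t * (t ^ ((n : ℝ) - 1) : ℝ) * ((1 - cutoff (t * r₁)) *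
        Phi n a (t * r₁ : ℝ)) * poissonG ord(n) (t * r₂ : ℝ)‖ₑ ≤
        ofReal (C * A) * ∫⁻ t in Ioo 0 Λ, ofReal (majHigh n a (N + 1) t r₁ r₂) := by
  have hn' : (3 : ℝ) ≤ n := mod_cast hn
  have hp : 0 ≤ ord(n) := by linarith
  obtain ⟨C1, S, hC1, hS, hSb⟩ := exists_high_part hn ha han hN
  obtain ⟨C2, g, g', hC2, hg, hgb, hgb'⟩ := exists_poissonG_eq hp (N + 1)
  obtain ⟨C3, hC3, hr⟩ := exists_symBound_rpow (N + 1) ((n : ℝ) - 1)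
  obtain ⟨C4, hC4, hosc⟩ := exists_enorm_integral_add_exp_le N hΛ
  have hexp : ord(n) + 1 = ((n : ℝ) - 1) / 2 := by ring
  rw [hexp] at hgb hgb'
  set p := ord(n)
  set q := ((n : ℝ) + 1) / 2 - 2 * a with hq
  set K := (2 : ℝ) ^ (N + 1) * (2 ^ (N + 1) * (2 ^ (N + 1) * C3) * C1) * C2 with hK
  have hK0 : 0 < K := by positivity
  refine ⟨C4 * K, by positivity, fun A m hA hm r₁ r₂ hr₁ hr₂ => ?_⟩
  have hsub : Ioo 0 Λ ⊆ Ioi 0 := Ioo_subset_Ioi_self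
  set γ : ℝ → ℝ := fun t => A * K * (t ^ ((n : ℝ) - 1) *
    (Ici 1).indicator (fun x => x ^ q) (t * r₁) * (1 + t * r₂) ^ (-(((n : ℝ) - 1) / 2))) with hγdef
  have hγ : ∀ t ∈ Ioo 0 Λ, 0 ≤ γ t ∧ γ t ≤
      A * K * (Λ ^ ((n : ℝ) - 1) * (1 + Λ * r₁) ^ |q| * 1) := by
    intro t ht
    have ht0 : 0 < t := ht.1
    have h0 : 0 ≤ (Ici 1).indicator (fun x => x ^ q) (t * r₁) :=
      indicator_apply_nonneg fun _ => by positivity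
    have h1 : (Ici 1).indicator (fun x => x ^ q) (t * r₁) ≤ (1 + Λ * r₁) ^ |q| := by
      refine indicator_apply_le' (fun h => ?_) fun _ => by positivity
      calc (t * r₁) ^ q ≤ (t * r₁) ^ |q| := Real.rpow_le_rpow_of_exponent_le h (le_abs_self q)
        _ ≤ _ := rpow_le_rpow (by positivity) (by nlinarith [ht.2]) (abs_nonneg q)
    have h2 : t ^ ((n : ℝ) - 1) ≤ Λ ^ ((n : ℝ) - 1) := rpow_le_rpow ht0.le ht.2.le (by linarith)
    have h3 : (1 + t * r₂) ^ (-(((n : ℝ) - 1) / 2)) ≤ 1 :=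
      Real.rpow_le_one_of_one_le_of_nonpos (by nlinarith [mul_pos ht0 hr₂]) (by linarith)
    simp only [hγdef]
    constructor
    · positivity
    · gcongr
  have hb : ∀ g : ℝ → ℂ, SymBound (Ioi 0) (N + 1) (fun t => C2 * (1 + t) ^ (-(((n : ℝ) - 1) / 2))) g →
      SymBound (Ioo 0 Λ) (N + 1) (fun t => (Λ - t) * γ t)
        (fun t => m t * (t ^ ((n : ℝ) - 1) : ℝ) * S (t * r₁) * g (t * r₂)) := by
    intro g hg
    refine (((hm.mul isOpen_Ioo hsub (hr.mono hsub hsub fun _ _ => le_rfl)).mul isOpen_Ioo hsub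
      ((hSb.comp_mul hr₁).mono hsub hsub fun _ _ => le_rfl)).mul isOpen_Ioo hsub
      ((hg.comp_mul hr₂).mono hsub hsub fun _ _ => le_rfl)).mono Subset.rfl hsub fun t ht => ?_
    refine le_of_eq ?_
    simp only [hγdef, hK]; ring
  rw [mul_assoc, mul_comm K]
  refine hosc (A * K) (r₁ + r₂) (r₁ - r₂) _ γ _ _ _ _ (by positivity) hγ (hb g hgb) (hb g' hgb')
    (fun D hD t ht => ?_) fun t ht => ?_
  · have ht0 : 0 < t := ht.1
    have hD : |r₁ - r₂| ≤ |D| := by rcases hD with rfl | rfl <;> grind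
    have h1 : |t * r₁ - t * r₂| ≤ t * |D| := by rw [← mul_sub, abs_mul, abs_of_pos ht0]; gcongr
    have h2 : ((1 + t * |D|) ^ (N + 1))⁻¹ ≤ ((1 + |t * r₁ - t * r₂|) ^ (N + 1))⁻¹ := by gcongr
    calc _ ≤ γ t * ((1 + |t * r₁ - t * r₂|) ^ (N + 1))⁻¹ := mul_le_mul_of_nonneg_left h2 (hγ t ht).1
      _ = _ := by simp only [hγdef, majHigh, hq]; ring
  · rw [hS, hg _ (mul_pos ht.1 hr₂)]
    have e1 : cexp (I * (t * (r₁ + r₂) : ℝ)) =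
        cexp (I * (t * r₁ : ℝ)) * cexp (I * (t * r₂ : ℝ)) := by
      rw [← exp_add]; congr 1; push_cast; ring
    have e2 : cexp (I * (t * (r₁ - r₂) : ℝ)) =
        cexp (I * (t * r₁ : ℝ)) * cexp (-(I * (t * r₂ : ℝ))) := by
      rw [← exp_add]; congr 1; push_cast; ring
    rw [e1, e2]; ring

end

section

variable {n : ℕ} {a : ℝ}

lemma norm_poissonG_ofReal_le {p : ℝ} (hp : 0 ≤ p) (x : ℝ) : ‖poissonG p x‖ ≤ 2 := by
  simpa using norm_poissonG_le hp (x : ℂ)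

lemma exists_enorm_integral_low_le (hn : 3 ≤ n) (ha : 1 < a) (han : 2 * a < n) (N : ℕ)
    {Λ η : ℝ} (hΛ : 0 < Λ) (hη : 0 < η) :
    ∃ C c : ℝ, 0 < C ∧ 0 < c ∧ ∀ (A : ℝ) (m : ℝ → ℂ), 0 ≤ A →
      SymBound (Ioo 0 Λ) (N + 2) (fun t => A * (Λ - t)) m →
      SymBound (Ioo 0 Λ) (N + 1) (fun t => A * (t ^ η * (Λ - t))) (fun t => (t : ℂ) * deriv m t) →
      ∀ r₁ r₂ : ℝ, 0 < r₁ → 0 < r₂ →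
      IntegrableOn (fun t => m t * (t ^ ((n : ℝ) - 1) : ℝ) * (cutoff (t * r₁) *
        Phi n a (t * r₁ : ℝ)) * poissonG ord(n) (t * r₂ : ℝ)) (Ioo 0 Λ) ∧
      ‖∫ t in Ioo 0 Λ, m t * (t ^ ((n : ℝ) - 1) : ℝ) * (cutoff (t * r₁) *
        Phi n a (t * r₁ : ℝ)) * poissonG ord(n) (t * r₂ : ℝ)‖ₑ ≤
        ofReal (C * A) * ∫⁻ t in Ioo 0 Λ, ofReal (majLow n (N + 2) η c t r₁ r₂) := by
  have hn' : (3 : ℝ) ≤ n := mod_cast hn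
  have hp : 0 ≤ ord(n) := by linarith
  obtain ⟨C1, c, hC1, hc, hL, hL'⟩ := exists_low_part hn ha han (N + 1)
  obtain ⟨C2, g, g', hC2, hg, hgb, hgb'⟩ := exists_poissonG_eq (p := ord(n) + 1)
    (by linarith) (N + 1)
  obtain ⟨C3, hC3, hr⟩ := exists_symBound_rpow (N + 1) ((n : ℝ) - 1)
  obtain ⟨C4, hC4, hosc⟩ := exists_enorm_integral_add_exp_le N hΛ
  set L : ℝ → ℂ := fun t => cutoff t * Phi n a t with hLdef
  have hGd := hasDerivAt_rpow_mul_poissonG hp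
  have e2p3 : 2 * ord(n) + 3 = n := by ring
  have e2p2 : 2 * ord(n) + 2 = (n : ℝ) - 1 := by ring
  have e2p2' : 2 * (ord(n) : ℝ) + 2 = ((n : ℂ) - 1) := by push_cast; ring
  rw [e2p3, e2p2, e2p2'] at hGd
  have hexp : ord(n) + 1 + 1 = ((n : ℝ) - 1) / 2 + 1 := by ring
  rw [hexp] at hgb hgb'
  have hn1 : (1 : ℝ) < n := by linarith
  have hn1' : ((n : ℂ) - 1) ≠ 0 := by
    have : ((n : ℝ) - 1) ≠ 0 := by linarith
    exact_mod_cast this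
  set p := ord(n)
  set K := (2 : ℝ) ^ (N + 1) * (2 ^ (N + 1) * (2 ^ (N + 1) * C1) * C3) * C2 with hK
  have hK0 : 0 < K := by positivity
  refine ⟨C4 * K, c, by positivity, hc, fun A m hA hm hm' r₁ r₂ hr₁ hr₂ => ?_⟩
  have hsub : Ioo 0 Λ ⊆ Ioi 0 := Ioo_subset_Ioi_self
  have hLr := (hL.comp_mul hr₁).mono hsub hsub fun _ _ => le_rfl
  set f : ℝ → ℂ := fun t => m t * L (t * r₁) with hfdef
  -- the derivative of the amplitude
  have hfd : ∀ t ∈ Ioo 0 Λ, DifferentiableAt ℝ f t := fun t ht => (hm.2.1 t ht).mul (hLr.2.1 t ht)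
  have hderiv : ∀ t ∈ Ioo 0 Λ, (t : ℂ) * deriv f t =
      (t : ℂ) * deriv m t * L (t * r₁) + m t * ((t * r₁ : ℝ) * deriv L (t * r₁)) := by
    intro t ht
    have h1 : deriv f t = deriv m t * L (t * r₁) + m t * deriv (fun t => L (t * r₁)) t :=
      deriv_fun_mul (hm.2.1 t ht) (hLr.2.1 t ht)
    have h2 : deriv (fun t => L (t * r₁)) t = r₁ • deriv L (t * r₁) := by
      have h3 := hL.2.1 (t * r₁) (mul_pos ht.1 hr₁)
      have := HasDerivAt.scomp t h3.hasDerivAt ((hasDerivAt_id t).mul_const r₁)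
      rw [one_mul] at this
      exact this.deriv
    rw [h1, h2, real_smul]; push_cast; ring
  have hfb : ∀ t ∈ Ioo 0 Λ, ‖f t‖ ≤ A * C1 * (Λ - t) := by
    intro t ht
    have h1 := hm.norm_le ht
    have h2 : ‖L (t * r₁)‖ ≤ C1 := (hLr.norm_le ht).trans
      (mul_le_of_le_one_right hC1.le (indicator_apply_le' (fun _ => le_rfl) fun _ => zero_le_one))
    simp only [hfdef, norm_mul]
    calc _ ≤ (A * (Λ - t)) * C1 := mul_le_mul h1 h2 (norm_nonneg _)
          (mul_nonneg hA (by linarith [ht.2]))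
      _ = _ := by ring
  have hfc : ContinuousOn f (Ioo 0 Λ) := fun t ht => (hfd t ht).continuousAt.continuousWithinAt
  have hGc : ∀ {p : ℝ}, 0 ≤ p → Continuous fun t => poissonG p (t * r₂ : ℝ) := fun hp =>
    (differentiable_poissonG hp).continuous.comp (by fun_prop)
  have hpow : ∀ s : ℝ, 0 ≤ s → ∀ t ∈ Ioo 0 Λ, t ^ s ≤ Λ ^ s := fun s hs t ht =>
    rpow_le_rpow ht.1.le ht.2.le hs
  have hpc : ∀ s : ℝ, 0 ≤ s → Continuous fun t => ((t ^ s : ℝ) : ℂ) := fun s hs =>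
    continuous_ofReal.comp (Real.continuous_rpow_const hs)
  have hint2 : IntegrableOn (fun t => f t * (((n : ℂ) - 1) * (t ^ ((n : ℝ) - 1) : ℝ) *
      poissonG p (t * r₂ : ℝ))) (Ioo 0 Λ) := by
    refine integrableOn_Ioo_of_bounded (M := A * C1 * Λ * (‖(n : ℂ) - 1‖ * Λ ^ ((n : ℝ) - 1) * 2))
      ?_ ?_
    · refine ContinuousOn.aestronglyMeasurable ?_ measurableSet_Ioo
      exact hfc.mul ((continuous_const.mul (hpc _ (by linarith))).mul (hGc hp)).continuousOn
    · filter_upwards [ae_mem_Ioo] with t ht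
      have h1 := hfb t ht
      have h2 := hpow ((n : ℝ) - 1) (by linarith) t ht
      have h3 := norm_poissonG_ofReal_le hp (t * r₂)
      have h4 : 0 ≤ t ^ ((n : ℝ) - 1) := rpow_nonneg ht.1.le _
      rw [norm_mul (f t), norm_mul (_ * _) (poissonG _ _), norm_mul ((n : ℂ) - 1),
        norm_of_nonneg h4]
      have h5 : A * C1 * (Λ - t) ≤ A * C1 * Λ := by gcongr; linarith [ht.1]
      have h6 : 0 ≤ A * C1 * Λ := by positivity
      refine mul_le_mul (h1.trans h5) ?_ (by positivity) h6; gcongr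
  -- the amplitude after integration by parts
  set γ : ℝ → ℝ := fun t => A * K * (t ^ ((n : ℝ) - 1) *
    ((t ^ η + (t * r₁) ^ c) * (Iic 2).indicator 1 (t * r₁)) *
      (1 + t * r₂) ^ (-(((n : ℝ) - 1) / 2 + 1))) with hγdef
  have hγ : ∀ t ∈ Ioo 0 Λ, 0 ≤ γ t ∧ γ t ≤ A * K * (Λ ^ ((n : ℝ) - 1) * (Λ ^ η + 2 ^ c) * 1) := by
    intro t ht
    have ht0 : 0 < t := ht.1
    have h0 : (0 : ℝ) ≤ (Iic 2).indicator 1 (t * r₁) := indicator_apply_nonneg fun _ => zero_le_one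
    have h1 : (t ^ η + (t * r₁) ^ c) * (Iic 2).indicator 1 (t * r₁) ≤ Λ ^ η + 2 ^ c := by
      by_cases h : t * r₁ ∈ Iic (2 : ℝ)
      · rw [indicator_of_mem h, Pi.one_apply, mul_one]
        exact add_le_add (hpow η hη.le t ht) (rpow_le_rpow (by positivity) h hc.le)
      · rw [indicator_of_notMem h, mul_zero]; positivity
    have h2 := hpow ((n : ℝ) - 1) (by linarith) t ht
    have h3 : (1 + t * r₂) ^ (-(((n : ℝ) - 1) / 2 + 1)) ≤ 1 :=
      Real.rpow_le_one_of_one_le_of_nonpos (by nlinarith [mul_pos ht0 hr₂]) (by linarith)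
    simp only [hγdef]
    constructor
    · positivity
    · gcongr
  have hF : SymBound (Ioo 0 Λ) (N + 1) (fun t => 2 ^ (N + 1) * (A * (Λ - t) *
      (C1 * ((t ^ η + (t * r₁) ^ c) * (Iic 2).indicator 1 (t * r₁))))) (fun t => (t : ℂ) * deriv f t) := by
    refine (((hm'.mul isOpen_Ioo hsub hLr.of_succ).add isOpen_Ioo (hm.of_succ.mul isOpen_Ioo hsub
      ((hL'.comp_mul hr₁).mono hsub hsub fun _ _ => le_rfl))).congr isOpen_Ioo hderiv).mono
      Subset.rfl hsub fun t ht => ?_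
    refine le_of_eq ?_
    by_cases h : t * r₁ ∈ Iic (2 : ℝ)
    · simp only [indicator_of_mem h, Pi.one_apply]; ring
    · simp only [indicator_of_notMem h]; ring
  have hb : ∀ g : ℝ → ℂ, SymBound (Ioi 0) (N + 1)
      (fun t => C2 * (1 + t) ^ (-(((n : ℝ) - 1) / 2 + 1))) g →
      SymBound (Ioo 0 Λ) (N + 1) (fun t => (Λ - t) * γ t)
        (fun t => (t : ℂ) * deriv f t * (t ^ ((n : ℝ) - 1) : ℝ) * g (t * r₂)) := by
    intro g hg
    refine ((hF.mul isOpen_Ioo hsub (hr.mono hsub hsub fun _ _ => le_rfl)).mul isOpen_Ioo hsub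
      ((hg.comp_mul hr₂).mono hsub hsub fun _ _ => le_rfl)).mono Subset.rfl hsub fun t ht => ?_
    refine le_of_eq ?_
    simp only [hγdef, hK]; ring
  set u : ℝ → ℂ := fun t => (t ^ (n : ℝ) : ℝ) * poissonG (p + 1) (t * r₂ : ℝ) with hudef
  have heq : ∀ t ∈ Ioo 0 Λ, deriv f t * u t = cexp (I * (t * r₂ : ℝ)) *
        ((t : ℂ) * deriv f t * (t ^ ((n : ℝ) - 1) : ℝ) * g (t * r₂)) +
      cexp (I * (t * (-r₂) : ℝ)) *
        ((t : ℂ) * deriv f t * (t ^ ((n : ℝ) - 1) : ℝ) * g' (t * r₂)) := by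
    intro t ht
    have e1 : ((t ^ (n : ℝ) : ℝ) : ℂ) = t * (t ^ ((n : ℝ) - 1) : ℝ) := by
      rw [← Complex.ofReal_mul, mul_comm, ← Real.rpow_add_one ht.1.ne', sub_add_cancel]
    have e2 : cexp (I * (t * (-r₂) : ℝ)) = cexp (-(I * (t * r₂ : ℝ))) := by congr 1; push_cast; ring
    simp only [hudef]
    rw [hg _ (mul_pos ht.1 hr₂), e1, e2]; ring
  obtain ⟨hint1, hosc⟩ := hosc (A * K) r₂ (-r₂) _ γ (majLow n (N + 2) η c · r₁ r₂) _ _ _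
    (by positivity) hγ (hb g hgb) (hb g' hgb') (fun D hD t ht => le_of_eq (by
      have hD : |D| = r₂ := by rcases hD with rfl | rfl <;> simp [hr₂.le]
      have ht0 := ht.1
      have h1 : 0 < 1 + t * r₂ := by positivity
      have h2 : (1 + t * r₂) ^ (-(((n : ℝ) - 1) / 2 + (N + 2 : ℕ))) =
          (1 + t * r₂) ^ (-(((n : ℝ) - 1) / 2 + 1)) * ((1 + t * r₂) ^ (N + 1))⁻¹ := by
        rw [← rpow_natCast, ← rpow_neg h1.le, ← rpow_add h1]; congr 1; push_cast; ring
      simp only [hγdef, majLow, hD, h2]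
      ring)) heq
  have hub : ∀ t ∈ Ioo 0 Λ, ‖u t‖ ≤ t ^ (n : ℝ) * 2 := by
    intro t ht
    have h4 : 0 ≤ t ^ (n : ℝ) := rpow_nonneg ht.1.le _
    simp only [hudef, norm_mul, norm_of_nonneg h4]; gcongr
    exact norm_poissonG_ofReal_le (by linarith) _
  have hfu : ∀ t ∈ Ioo 0 Λ, ‖f t * u t‖ ≤ A * C1 * (Λ - t) * (t ^ (n : ℝ) * 2) := by
    intro t ht
    rw [norm_mul]
    exact mul_le_mul (hfb t ht) (hub t ht) (norm_nonneg _)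
      (mul_nonneg (by positivity) (by linarith [ht.2]))
  have hcont : Continuous fun t => A * C1 * (Λ - t) * (t ^ (n : ℝ) * 2) := by
    have := Real.continuous_rpow_const (q := (n : ℝ)) (by linarith); fun_prop
  have hlim : ∀ x, A * C1 * (Λ - x) * (x ^ (n : ℝ) * 2) = 0 → ∀ l ≤ 𝓝 x, Ioo 0 Λ ∈ l →
      Tendsto (fun t => f t * u t) l (𝓝 0) := fun x hx l hl hm =>
    squeeze_zero_norm' (by filter_upwards [hm] using hfu) (hx ▸ (hcont.tendsto x).mono_left hl)
  have hibp := integral_mul_deriv_eq_neg_of_tendsto hΛ (fun t ht => (hfd t ht).hasDerivAt)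
    (fun t ht => hGd r₂ ht.1) hint1 hint2
    (hlim 0 (by simp [show n ≠ 0 by omega]) _ nhdsWithin_le_nhds (Ioo_mem_nhdsGT hΛ))
    (hlim Λ (by simp) _ nhdsWithin_le_nhds (Ioo_mem_nhdsLT hΛ))
  have hre : ∀ t : ℝ, m t * (t ^ ((n : ℝ) - 1) : ℝ) * (cutoff (t * r₁) *
        Phi n a (t * r₁ : ℝ)) * poissonG p (t * r₂ : ℝ) = ((n : ℂ) - 1)⁻¹ *
      (f t * (((n : ℂ) - 1) * (t ^ ((n : ℝ) - 1) : ℝ) * poissonG p (t * r₂ : ℝ))) := by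
    intro t
    simp only [hfdef, hLdef]; field_simp
  simp only [hre]
  refine ⟨hint2.const_mul _, ?_⟩
  rw [integral_const_mul, hibp, enorm_mul, enorm_neg, mul_assoc C4, mul_comm K]
  have hinv : ‖((n : ℂ) - 1)⁻¹‖ₑ ≤ 1 := by
    rw [← ofReal_norm, norm_inv, ENNReal.ofReal_le_one]
    have : ‖(n : ℂ) - 1‖ = n - 1 := by
      have h := norm_of_nonneg (by linarith : 0 ≤ (n : ℝ) - 1)
      push_cast at h
      exact h
    rw [this]
    exact inv_le_one_of_one_le₀ (by linarith)
  exact (mul_le_of_le_one_left' hinv).trans hosc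

/-- The kernel in `(r₁, r₂)` that dominates the spectral integral. -/
def majKernel (n : ℕ) (a : ℝ) (N : ℕ) (η c Λ r₁ r₂ : ℝ) : ℝ≥0∞ :=
  ∫⁻ t in Ioo 0 Λ, (ofReal (majHigh n a N t r₁ r₂) + ofReal (majLow n N η c t r₁ r₂))

@[fun_prop]
lemma measurable_majHigh {X : Type*} [MeasurableSpace X] {N : ℕ} {f g h : X → ℝ}
    (hf : Measurable f) (hg : Measurable g) (hh : Measurable h) :
    Measurable fun x => majHigh n a N (f x) (g x) (h x) := by
  have h1 : Measurable ((Ici (1 : ℝ)).indicator fun x => x ^ (((n : ℝ) + 1) / 2 - 2 * a)) :=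
    (measurable_id.pow_const _).indicator measurableSet_Ici
  unfold majHigh; fun_prop

@[fun_prop]
lemma measurable_majLow {X : Type*} [MeasurableSpace X] {N : ℕ} {η c : ℝ} {f g h : X → ℝ}
    (hf : Measurable f) (hg : Measurable g) (hh : Measurable h) :
    Measurable fun x => majLow n N η c (f x) (g x) (h x) := by
  have h1 : Measurable ((Iic (2 : ℝ)).indicator (1 : ℝ → ℝ)) :=
    measurable_one.indicator measurableSet_Iic
  unfold majLow; fun_prop

end

section

variable {n : ℕ} {a : ℝ}

/-- The main bound of the spectral integral. -/
lemma exists_enorm_integral_Phi_mul_poissonG_le (hn : 3 ≤ n) (ha : 1 < a) (han : 2 * a < n) {N : ℕ}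
    (hN : ((N + 2 : ℕ) : ℝ) ≤ ((n : ℝ) + 5) / 2) {Λ η : ℝ} (hΛ : 0 < Λ) (hη : 0 < η) :
    ∃ C c : ℝ, 0 < C ∧ 0 < c ∧ ∀ (A : ℝ) (m : ℝ → ℂ), 0 ≤ A →
      SymBound (Ioo 0 Λ) (N + 2) (fun t => A * (Λ - t)) m →
      SymBound (Ioo 0 Λ) (N + 1) (fun t => A * (t ^ η * (Λ - t))) (fun t => (t : ℂ) * deriv m t) →
      ∀ r₁ r₂ : ℝ, 0 < r₁ → 0 < r₂ →
      ‖∫ t in Ioo 0 Λ, m t * (t ^ ((n : ℝ) - 1) : ℝ) *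
        Phi n a (t * r₁ : ℝ) * poissonG ord(n) (t * r₂ : ℝ)‖ₑ ≤
        ofReal (C * A) * majKernel n a (N + 2) η c Λ r₁ r₂ := by
  obtain ⟨C1, hC1, h1⟩ := exists_enorm_integral_high_le hn ha han (N := N + 1) hN hΛ
  rw [show N + 1 + 1 = N + 2 from rfl] at h1
  obtain ⟨C2, c, hC2, hc, h2⟩ := exists_enorm_integral_low_le hn ha han N hΛ hη
  refine ⟨C1 + C2, c, by positivity, hc, fun A m hA hm hm' r₁ r₂ hr₁ hr₂ => ?_⟩
  obtain ⟨i1, b1⟩ := h1 A m hA hm r₁ r₂ hr₁ hr₂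
  obtain ⟨i2, b2⟩ := h2 A m hA hm hm' r₁ r₂ hr₁ hr₂
  have heq : ∀ t : ℝ, m t * (t ^ ((n : ℝ) - 1) : ℝ) *
        Phi n a (t * r₁ : ℝ) * poissonG ord(n) (t * r₂ : ℝ) =
      m t * (t ^ ((n : ℝ) - 1) : ℝ) * ((1 - cutoff (t * r₁)) *
        Phi n a (t * r₁ : ℝ)) * poissonG ord(n) (t * r₂ : ℝ) +
      m t * (t ^ ((n : ℝ) - 1) : ℝ) * (cutoff (t * r₁) *
        Phi n a (t * r₁ : ℝ)) * poissonG ord(n) (t * r₂ : ℝ) := fun t => by ring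
  simp only [heq]
  rw [integral_add i1 i2, majKernel]
  rw [lintegral_add_left (by fun_prop), mul_add]
  have h : ∀ C ≤ C1 + C2, ofReal (C * A) ≤ ofReal ((C1 + C2) * A) := fun C hC =>
    ofReal_le_ofReal (mul_le_mul_of_nonneg_right hC hA)
  exact (enorm_add_le _ _).trans (add_le_add (b1.trans (mul_le_mul_left (h C1 (by linarith)) _))
    (b2.trans (mul_le_mul_left (h C2 (by linarith)) _)))

end

/-! ### Integrals of the majorants -/

lemma lintegral_fun_norm {n : ℕ} (hn : 0 < n) {f : ℝ → ℝ≥0∞} (hf : Measurable f) :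
    ∫⁻ x : Rn n, f ‖x‖ = (volume : Measure (Rn n)).toSphere univ *
      ∫⁻ y in Ioi 0, ofReal (y ^ ((n : ℝ) - 1)) * f y := by
  have : Nonempty (Fin n) := ⟨⟨0, hn⟩⟩
  have h1 : ∫⁻ x : Rn n, f ‖x‖ = ∫⁻ x : ({0}ᶜ : Set (Rn n)), f ‖(x : Rn n)‖
      ∂((volume : Measure (Rn n)).comap (↑)) := by
    rw [lintegral_subtype_comap (measurableSet_singleton _).compl fun x : Rn n => f ‖x‖,
      restrict_compl_singleton]
  have h2 := (volume : Measure (Rn n)).measurePreserving_homeomorphUnitSphereProd.lintegral_comp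
    (f := fun x => f x.2) (hf.comp (measurable_subtype_coe.comp measurable_snd))
  simp only [homeomorphUnitSphereProd_apply_snd_coe] at h2
  rw [h1, h2, lintegral_prod _ (by fun_prop)]
  simp only [lintegral_const]
  rw [mul_comm]; congr 1
  rw [Measure.volumeIoiPow, lintegral_withDensity_eq_lintegral_mul _ (by fun_prop) (by fun_prop),
    ← lintegral_subtype_comap measurableSet_Ioi]
  refine lintegral_congr fun x => ?_
  simp only [Pi.mul_apply]; congr 2
  rw [finrank_euclideanSpace, Fintype.card_fin, ← rpow_natCast, Nat.cast_sub hn, Nat.cast_one]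

lemma lintegral_comp_mul_Ioi {t : ℝ} (ht : 0 < t) {h : ℝ → ℝ≥0∞} (hh : Measurable h) :
    ∫⁻ y in Ioi 0, h (t * y) = ofReal t⁻¹ * ∫⁻ y in Ioi 0, h y := by
  have h1 := Real.smul_map_volume_mul_left ht.ne'
  rw [abs_of_pos ht] at h1
  have h2 : ∫⁻ y in Ioi 0, h y = ofReal t * ∫⁻ y in Ioi 0, h (t * y) := by
    rw [← lintegral_indicator measurableSet_Ioi]
    nth_rewrite 1 [← h1]
    rw [lintegral_smul_measure, lintegral_map (hh.indicator measurableSet_Ioi) (by fun_prop),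
      ← lintegral_indicator measurableSet_Ioi, smul_eq_mul]
    congr 2
    funext y
    have : (t * y ∈ Ioi 0) ↔ y ∈ Ioi 0 := mul_pos_iff_of_pos_left ht
    by_cases hy : y ∈ Ioi 0
    · simp_all
    · simp_all
  rw [h2, ← mul_assoc, ← ofReal_mul (by positivity), inv_mul_cancel₀ ht.ne',
    ENNReal.ofReal_one, one_mul]

lemma lintegral_Ioo_rpow {Λ s : ℝ} (hΛ : 0 < Λ) (hs : 0 < s) :
    ∫⁻ t in Ioo 0 Λ, ofReal (t ^ (s - 1)) = ofReal (Λ ^ s / s) := by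
  have h1 : IntegrableOn (fun t => t ^ (s - 1)) (Ioo 0 Λ) :=
    (intervalIntegral.integrableOn_Ioo_rpow_iff hΛ).2 (by linarith)
  rw [← ofReal_integral_eq_lintegral_ofReal h1]
  · rw [← integral_Ioc_eq_integral_Ioo, ← intervalIntegral.integral_of_le hΛ.le,
      integral_rpow (Or.inl (by linarith)), sub_add_cancel, Real.zero_rpow hs.ne', sub_zero]
  · filter_upwards [ae_mem_Ioo] with t ht using rpow_nonneg ht.1.le _

lemma exists_lintegral_rpow_mul_inv_pow_le {s : ℝ} (hs : 0 ≤ s) {N : ℕ} (hN : s + 1 < N) :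
    ∃ C > 0, ∀ w : ℝ, 0 ≤ w → ∫⁻ ρ in Ioi 0,
      ofReal ((1 + ρ) ^ s * ((1 + |w - ρ|) ^ N)⁻¹) ≤ ofReal (C * (1 + w) ^ s) := by
  have hint := integrable_one_add_norm (E := ℝ) (μ := volume) (r := N - s)
    (by rw [Module.finrank_self]; push_cast; linarith)
  have h0 : 0 ≤ ∫ x : ℝ, (1 + ‖x‖) ^ (-((N : ℝ) - s)) := integral_nonneg fun x => by positivity
  refine ⟨(∫ x : ℝ, (1 + ‖x‖) ^ (-((N : ℝ) - s))) + 1, by linarith, fun w hw => ?_⟩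
  calc _ ≤ ∫⁻ ρ in Ioi 0, ofReal ((1 + w) ^ s) * ofReal ((1 + ‖w - ρ‖) ^ (-((N : ℝ) - s))) := by
        refine setLIntegral_mono' measurableSet_Ioi fun ρ hρ => ?_
        have hρ' : (0 : ℝ) < ρ := hρ
        rw [← ofReal_mul (by positivity), norm_eq_abs]
        refine ofReal_le_ofReal ?_
        have h2 : 1 + ρ ≤ (1 + w) * (1 + |w - ρ|) := by
          have := neg_abs_le (w - ρ)
          nlinarith [abs_nonneg (w - ρ), mul_nonneg hw (abs_nonneg (w - ρ))]
        have h3 : (1 + |w - ρ|) ^ (-((N : ℝ) - s)) = (1 + |w - ρ|) ^ s * ((1 + |w - ρ|) ^ N)⁻¹ := by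
          rw [← rpow_natCast, ← rpow_neg (by positivity), ← rpow_add (by positivity)]
          congr 1; ring
        rw [h3, ← mul_assoc, ← mul_rpow (by positivity) (by positivity)]; gcongr
    _ ≤ ∫⁻ ρ : ℝ, ofReal ((1 + w) ^ s) *
        ofReal ((1 + ‖w - ρ‖) ^ (-((N : ℝ) - s))) := setLIntegral_le_lintegral _ _
    _ = ofReal ((1 + w) ^ s) * ofReal (∫ x : ℝ, (1 + ‖x‖) ^ (-((N : ℝ) - s))) := by
      rw [lintegral_const_mul' _ _ ofReal_ne_top, lintegral_sub_left_eq_self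
        (fun x => ofReal ((1 + ‖x‖) ^ (-((N : ℝ) - s)))) w,
        ofReal_integral_eq_lintegral_ofReal hint (Eventually.of_forall fun x => by positivity)]
    _ ≤ _ := by
      rw [← ofReal_mul (by positivity)]
      refine ofReal_le_ofReal ?_
      have : 0 ≤ (1 + w) ^ s := by positivity
      nlinarith

section

variable {n : ℕ} {a : ℝ} {N : ℕ}

lemma exists_lintegral_le_of_forall_le (hn : 3 ≤ n) (hN : ((n : ℝ) - 1) / 2 + 1 < N) :
    ∃ C > 0, ∀ {k t w : ℝ} {F : ℝ → ℝ≥0∞}, 0 ≤ k → 0 < t → 0 ≤ w →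
      (∀ r > 0, F r ≤ ofReal (k * ((1 + t * r) ^ (((n : ℝ) - 1) / 2) *
        ((1 + |w - t * r|) ^ N)⁻¹))) →
      ∫⁻ r in Ioi 0, F r ≤ ofReal (k * (t⁻¹ * (C * (1 + w) ^ (((n : ℝ) - 1) / 2)))) := by
  have hn' : (3 : ℝ) ≤ n := mod_cast hn
  obtain ⟨C, hC, h⟩ := exists_lintegral_rpow_mul_inv_pow_le (by linarith) hN
  refine ⟨C, hC, fun {k t w F} hk ht hw hF => ?_⟩
  set s := ((n : ℝ) - 1) / 2
  have hm : Measurable fun ρ => ofReal ((1 + ρ) ^ s * ((1 + |w - ρ|) ^ N)⁻¹) := by fun_prop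
  calc _ ≤ ∫⁻ r in Ioi 0, ofReal k * ofReal ((1 + t * r) ^ s * ((1 + |w - t * r|) ^ N)⁻¹) := by
        refine setLIntegral_mono' measurableSet_Ioi fun r hr => ?_
        rw [← ofReal_mul hk]
        exact hF r hr
    _ ≤ ofReal k * (ofReal t⁻¹ * ofReal (C * (1 + w) ^ s)) := by
      rw [lintegral_const_mul' _ _ ofReal_ne_top, lintegral_comp_mul_Ioi ht hm]; gcongr
      exact h w hw
    _ = _ := by rw [ofReal_mul hk, ofReal_mul (p := t⁻¹) (by positivity)]

lemma exists_lintegral_majHigh_right_le (hn : 3 ≤ n) (hN : ((n : ℝ) - 1) / 2 + 1 < N) :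
    ∃ C > 0, ∀ t r₁ : ℝ, 0 < t → 0 < r₁ →
      ∫⁻ r in Ioi 0, ofReal (r ^ ((n : ℝ) - 1)) * ofReal (majHigh n a N t r₁ r) ≤
        ofReal (C * (r₁ ^ (n - 2 * a) * t ^ (n - 2 * a - 1))) := by
  have hn' : (3 : ℝ) ≤ n := mod_cast hn
  obtain ⟨C, hC, h⟩ := exists_lintegral_le_of_forall_le hn hN
  refine ⟨C * 2 ^ (((n : ℝ) - 1) / 2), by positivity, fun t r₁ ht hr₁ => ?_⟩
  set s := ((n : ℝ) - 1) / 2 with hs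
  have hs0 : 0 ≤ s := by linarith
  set q := ((n : ℝ) + 1) / 2 - 2 * a with hq
  have hind : 0 ≤ (Ici 1).indicator (fun x => x ^ q) (t * r₁) :=
    indicator_apply_nonneg fun _ => by positivity
  refine (h hind ht (w := t * r₁) (by positivity) fun r hr => ?_).trans ?_
  · rw [← ofReal_mul (by positivity), majHigh]
    refine ofReal_le_ofReal ?_
    have h1 : r ^ ((n : ℝ) - 1) * t ^ ((n : ℝ) - 1) * (1 + t * r) ^ (-s) ≤ (1 + t * r) ^ s := by
      rw [← mul_rpow hr.le ht.le, mul_comm r]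
      calc _ ≤ (1 + t * r) ^ ((n : ℝ) - 1) * (1 + t * r) ^ (-s) := by bound
        _ = _ := by rw [← rpow_add (by positivity)]; congr 1; rw [hs]; ring
    calc _ = (Ici 1).indicator (fun x => x ^ q) (t * r₁) *
          ((r ^ ((n : ℝ) - 1) * t ^ ((n : ℝ) - 1) * (1 + t * r) ^ (-s)) *
            ((1 + |t * r₁ - t * r|) ^ N)⁻¹) := by rw [hs, hq]; ring
      _ ≤ _ := by gcongr
  · refine ofReal_le_ofReal ?_
    by_cases h1 : t * r₁ ∈ Ici (1 : ℝ)
    · rw [indicator_of_mem h1]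
      have hw : 0 < t * r₁ := by positivity
      have h1' : 1 ≤ t * r₁ := h1
      have h2 : (1 + t * r₁) ^ s ≤ 2 ^ s * (t * r₁) ^ s := by
        rw [← mul_rpow (by norm_num) hw.le]
        exact rpow_le_rpow (by positivity) (by linarith) hs0
      have h3 : (t * r₁) ^ q * (t * r₁) ^ s = t * (r₁ ^ (n - 2 * a) * t ^ (n - 2 * a - 1)) := by
        rw [← rpow_add hw, show q + s = n - 2 * a by rw [hs, hq]; ring,
          mul_rpow ht.le hr₁.le, rpow_sub_one ht.ne']
        field_simp
      calc _ ≤ (t * r₁) ^ q * (t⁻¹ * (C * (2 ^ s * (t * r₁) ^ s))) := by gcongr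
        _ = C * 2 ^ s * (t⁻¹ * ((t * r₁) ^ q * (t * r₁) ^ s)) := by ring
        _ = _ := by rw [h3]; field_simp
    · rw [indicator_of_notMem h1, zero_mul]; positivity

lemma exists_lintegral_majLow_right_le (hn : 3 ≤ n) (hN : ((n : ℝ) - 1) / 2 + 1 < N) (η c : ℝ) :
    ∃ C > 0, ∀ t r₁ : ℝ, 0 < t → 0 < r₁ →
      ∫⁻ r in Ioi 0, ofReal (r ^ ((n : ℝ) - 1)) * ofReal (majLow n N η c t r₁ r) ≤
        ofReal (C * (t ^ (η - 1) + r₁ ^ c * (Iic (2 / r₁)).indicator (fun t => t ^ (c - 1)) t)) := by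
  have hn' : (3 : ℝ) ≤ n := mod_cast hn
  obtain ⟨C, hC, h⟩ := exists_lintegral_le_of_forall_le hn hN
  refine ⟨C, hC, fun t r₁ ht hr₁ => ?_⟩
  set s := ((n : ℝ) - 1) / 2 with hs
  have hs0 : 0 ≤ s := by linarith
  have hind : 0 ≤ (t ^ η + (t * r₁) ^ c) * (Iic 2).indicator (1 : ℝ → ℝ) (t * r₁) :=
    mul_nonneg (by positivity) (indicator_apply_nonneg fun _ => zero_le_one)
  refine (h hind ht le_rfl fun r hr => ?_).trans ?_
  · rw [← ofReal_mul (by positivity), majLow]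
    refine ofReal_le_ofReal ?_
    have h1 : r ^ ((n : ℝ) - 1) * t ^ ((n : ℝ) - 1) * (1 + t * r) ^ (-(s + N)) ≤
        (1 + t * r) ^ s * ((1 + |0 - t * r|) ^ N)⁻¹ := by
      rw [← mul_rpow hr.le ht.le, mul_comm r, zero_sub, abs_neg, abs_of_pos (by positivity),
        ← rpow_natCast, ← rpow_neg (by positivity), ← rpow_add (by positivity)]
      calc _ ≤ (1 + t * r) ^ ((n : ℝ) - 1) * (1 + t * r) ^ (-(s + N)) := by bound
        _ = _ := by rw [← rpow_add (by positivity)]; congr 1; rw [hs]; ring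
    calc _ = (t ^ η + (t * r₁) ^ c) * (Iic 2).indicator (1 : ℝ → ℝ) (t * r₁) *
          (r ^ ((n : ℝ) - 1) * t ^ ((n : ℝ) - 1) * (1 + t * r) ^ (-(s + N))) := by rw [hs]; ring
      _ ≤ _ := by gcongr
  · refine ofReal_le_ofReal ?_
    have hiff : t * r₁ ∈ Iic (2 : ℝ) ↔ t ∈ Iic (2 / r₁) := (le_div_iff₀ hr₁).symm
    by_cases h1 : t * r₁ ∈ Iic (2 : ℝ)
    · rw [indicator_of_mem h1, indicator_of_mem (hiff.1 h1), Pi.one_apply, mul_one,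
        mul_rpow ht.le hr₁.le, rpow_sub_one ht.ne', rpow_sub_one ht.ne']
      refine le_of_eq ?_; field_simp; simp
    · rw [indicator_of_notMem h1, mul_zero, zero_mul, indicator_of_notMem (fun h => h1 (hiff.2 h))]
      positivity

lemma rpow_mul_rpow_mul_rpow_eq {r t : ℝ} (hr : 0 < r) (ht : 0 < t) :
    r ^ ((n : ℝ) - 1) * r ^ (2 * a - n) * t ^ ((n : ℝ) - 1) =
      t ^ (n - 2 * a) * (t * r) ^ (2 * a - 1) := by
  rw [mul_rpow ht.le hr.le, ← rpow_add hr, mul_comm, ← mul_assoc, ← rpow_add ht]; ring_nf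

lemma exists_lintegral_majHigh_left_le (hn : 3 ≤ n) (hN : ((n : ℝ) - 1) / 2 + 1 < N) :
    ∃ C > 0, ∀ t r₂ : ℝ, 0 < t → 0 < r₂ → ∫⁻ r in Ioi 0, ofReal (r ^ ((n : ℝ) - 1)) *
        (ofReal (r ^ (2 * a - n)) * ofReal (majHigh n a N t r r₂)) ≤
        ofReal (C * t ^ (n - 2 * a - 1)) := by
  have hn' : (3 : ℝ) ≤ n := mod_cast hn
  obtain ⟨C, hC, h⟩ := exists_lintegral_le_of_forall_le hn hN
  refine ⟨C, hC, fun t r₂ ht hr₂ => ?_⟩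
  set s := ((n : ℝ) - 1) / 2 with hs
  have hs0 : 0 ≤ s := by linarith
  set q := ((n : ℝ) + 1) / 2 - 2 * a with hq
  refine (h (k := t ^ (n - 2 * a) * (1 + t * r₂) ^ (-s)) (by positivity) ht (w := t * r₂)
    (by positivity) fun r hr => ?_).trans ?_
  · rw [← ofReal_mul (by positivity), ← ofReal_mul (by positivity), majHigh]
    refine ofReal_le_ofReal ?_
    have h1 : r ^ ((n : ℝ) - 1) * r ^ (2 * a - n) * t ^ ((n : ℝ) - 1) *
        (Ici 1).indicator (fun x => x ^ q) (t * r) ≤ t ^ (n - 2 * a) * (1 + t * r) ^ s := by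
      by_cases h1 : t * r ∈ Ici (1 : ℝ)
      · rw [indicator_of_mem h1]
        have e1 : r ^ ((n : ℝ) - 1) * r ^ (2 * a - n) * t ^ ((n : ℝ) - 1) * (t * r) ^ q =
            t ^ (n - 2 * a) * (t * r) ^ s := by
          rw [rpow_mul_rpow_mul_rpow_eq hr ht, mul_assoc, ← rpow_add (by positivity), hs, hq]
          ring_nf
        rw [e1]; gcongr; linarith
      · rw [indicator_of_notMem h1, mul_zero]; positivity
    calc _ = (r ^ ((n : ℝ) - 1) * r ^ (2 * a - n) * t ^ ((n : ℝ) - 1) *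
          (Ici 1).indicator (fun x => x ^ q) (t * r)) * (1 + t * r₂) ^ (-s) *
            ((1 + |t * r₂ - t * r|) ^ N)⁻¹ := by grind
      _ ≤ (t ^ (n - 2 * a) * (1 + t * r) ^ s) * (1 + t * r₂) ^ (-s) *
            ((1 + |t * r₂ - t * r|) ^ N)⁻¹ := by gcongr
      _ = _ := by ring
  · refine ofReal_le_ofReal (le_of_eq ?_)
    have h1 : (1 + t * r₂) ^ (-s) * (1 + t * r₂) ^ s = 1 := by
      rw [← rpow_add (by positivity), neg_add_cancel, rpow_zero]
    rw [rpow_sub_one ht.ne']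
    linear_combination t ^ (n - 2 * a) * t⁻¹ * C * h1

lemma exists_lintegral_majLow_left_le (hn : 3 ≤ n) (ha : 1 < a)
    (hN : ((n : ℝ) - 1) / 2 + 1 < N) {η c Λ : ℝ} (hη : 0 < η) (hc : 0 < c) :
    ∃ C > 0, ∀ t r₂ : ℝ, t ∈ Ioo 0 Λ → 0 < r₂ → ∫⁻ r in Ioi 0, ofReal (r ^ ((n : ℝ) - 1)) *
        (ofReal (r ^ (2 * a - n)) * ofReal (majLow n N η c t r r₂)) ≤
        ofReal (C * t ^ (n - 2 * a - 1)) := by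
  have hn' : (3 : ℝ) ≤ n := mod_cast hn
  obtain ⟨C, hC, h⟩ := exists_lintegral_le_of_forall_le hn hN
  set s := ((n : ℝ) - 1) / 2 with hs
  have hs0 : 0 ≤ s := by linarith
  set B := 2 ^ (2 * a - 1) * (|Λ| ^ η + 2 ^ c) * 3 ^ N with hB
  refine ⟨B * C, by positivity, fun t r₂ ht hr₂ => ?_⟩
  have ht0 : 0 < t := ht.1
  refine (h (k := t ^ (n - 2 * a) * B) (by positivity) ht0 le_rfl fun r hr => ?_).trans ?_
  · rw [← ofReal_mul (by positivity), ← ofReal_mul (by positivity), majLow]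
    refine ofReal_le_ofReal ?_
    have hρ : 0 < t * r := by positivity
    have e2 : (1 + t * r₂) ^ (-(s + N)) ≤ 1 := Real.rpow_le_one_of_one_le_of_nonpos
      (by nlinarith [mul_pos ht0 hr₂]) (by have : 0 ≤ N := Nat.cast_nonneg N
                                           linarith)
    have e3 : (t * r) ^ (2 * a - 1) * ((t ^ η + (t * r) ^ c) * (Iic 2).indicator 1 (t * r)) ≤
        B * ((1 + t * r) ^ s * ((1 + |0 - t * r|) ^ N)⁻¹) := by
      rw [zero_sub, abs_neg, abs_of_pos hρ]
      by_cases h1 : t * r ∈ Iic (2 : ℝ)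
      · have h1' : t * r ≤ 2 := h1
        rw [indicator_of_mem h1, Pi.one_apply, mul_one]
        have f1 : (t * r) ^ (2 * a - 1) ≤ 2 ^ (2 * a - 1) := rpow_le_rpow hρ.le h1' (by linarith)
        have f2 : (t * r) ^ c ≤ 2 ^ c := rpow_le_rpow hρ.le h1' hc.le
        have f3 : t ^ η ≤ |Λ| ^ η := rpow_le_rpow ht0.le (ht.2.le.trans (le_abs_self Λ)) hη.le
        have f4 : 1 ≤ 3 ^ N * ((1 + t * r) ^ s * ((1 + t * r) ^ N)⁻¹) := by
          have g1 : 1 ≤ (1 + t * r) ^ s := one_le_rpow (by linarith) hs0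
          have g2 : (1 + t * r) ^ N ≤ 3 ^ N := by gcongr; linarith
          have g3 : 1 ≤ 3 ^ N * ((1 + t * r) ^ N)⁻¹ := by
            rw [← div_eq_mul_inv, one_le_div (by positivity)]; exact g2
          nlinarith
        calc _ ≤ 2 ^ (2 * a - 1) * (|Λ| ^ η + 2 ^ c) := by gcongr
          _ ≤ 2 ^ (2 * a - 1) * (|Λ| ^ η + 2 ^ c) *
              (3 ^ N * ((1 + t * r) ^ s * ((1 + t * r) ^ N)⁻¹)) :=
            le_mul_of_one_le_right (by positivity) f4
          _ = _ := by rw [hB]; ring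
      · rw [indicator_of_notMem h1, mul_zero, mul_zero]; positivity
    have hi0 : 0 ≤ (t * r) ^ (2 * a - 1) * ((t ^ η + (t * r) ^ c) *
        (Iic 2).indicator (1 : ℝ → ℝ) (t * r)) :=
      mul_nonneg (by positivity) (mul_nonneg (by positivity)
        (indicator_apply_nonneg fun _ => zero_le_one))
    calc _ = (r ^ ((n : ℝ) - 1) * r ^ (2 * a - n) * t ^ ((n : ℝ) - 1)) *
          ((t ^ η + (t * r) ^ c) * (Iic 2).indicator 1 (t * r)) * (1 + t * r₂) ^ (-(s + N)) := by linarith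
      _ = t ^ (n - 2 * a) * ((t * r) ^ (2 * a - 1) * ((t ^ η + (t * r) ^ c) *
          (Iic 2).indicator 1 (t * r))) * (1 + t * r₂) ^ (-(s + N)) := by
        rw [rpow_mul_rpow_mul_rpow_eq hr ht0]; ring
      _ ≤ t ^ (n - 2 * a) * ((t * r) ^ (2 * a - 1) * ((t ^ η + (t * r) ^ c) *
          (Iic 2).indicator 1 (t * r))) * 1 := by gcongr
      _ ≤ t ^ (n - 2 * a) * (B * ((1 + t * r) ^ s * ((1 + |0 - t * r|) ^ N)⁻¹)) := by
        rw [mul_one]; gcongr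
      _ = _ := by ring
  · refine ofReal_le_ofReal (le_of_eq ?_)
    rw [rpow_sub_one ht0.ne']; field_simp; simp

end

section

variable {n : ℕ} {a : ℝ} {N : ℕ} {η c Λ : ℝ}

lemma Measurable.curried_comp {X : Type*} [MeasurableSpace X] {F : ℝ → ℝ → ℝ≥0∞}
    (hF : Measurable fun q : ℝ × ℝ => F q.1 q.2) {f g : X → ℝ} (hf : Measurable f)
    (hg : Measurable g) : Measurable fun x => F (f x) (g x) :=
  hF.comp (hf.prodMk hg)

@[fun_prop]
lemma measurable_majKernel {X : Type*} [MeasurableSpace X] {f g : X → ℝ} (hf : Measurable f)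
    (hg : Measurable g) : Measurable fun x => majKernel n a N η c Λ (f x) (g x) := by
  refine Measurable.lintegral_prod_right' (f := fun q : X × ℝ =>
    ofReal (majHigh n a N q.2 (f q.1) (g q.1)) + ofReal (majLow n N η c q.2 (f q.1) (g q.1))) ?_
  fun_prop

lemma lintegral_Iic_rpow_le {r : ℝ} (hr : 0 < r) (hc : 0 < c) :
    ∫⁻ t in Ioo 0 Λ, ofReal (r ^ c * (Iic (2 / r)).indicator (fun t => t ^ (c - 1)) t) ≤
      ofReal (3 ^ c / c) := by
  have h3 : (0 : ℝ) < 3 / r := by positivity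
  calc _ ≤ ∫⁻ t in Ioo 0 (3 / r), ofReal (r ^ c) * ofReal (t ^ (c - 1)) := by
        rw [← lintegral_indicator measurableSet_Ioo, ← lintegral_indicator measurableSet_Ioo]
        refine lintegral_mono fun t => ?_
        by_cases ht : t ∈ Ioo 0 Λ
        · rw [indicator_of_mem ht]
          by_cases h2 : t ∈ Iic (2 / r)
          · have : t ∈ Ioo 0 (3 / r) := ⟨ht.1, lt_of_le_of_lt h2 (by gcongr; norm_num)⟩
            rw [indicator_of_mem this, indicator_of_mem h2, ofReal_mul (by positivity)]
          · simp_all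
        · simp_all
    _ = ofReal (r ^ c) * ofReal ((3 / r) ^ c / c) := by
      rw [lintegral_const_mul' _ _ ofReal_ne_top, lintegral_Ioo_rpow h3 hc]
    _ = _ := by
      rw [← ofReal_mul (by positivity), div_rpow (by norm_num) hr.le]; congr 1; field_simp

lemma exists_lintegral_majKernel_right_le (hn : 3 ≤ n) (han : 2 * a < n)
    (hN : ((n : ℝ) - 1) / 2 + 1 < N) (hη : 0 < η) (hc : 0 < c) (hΛ : 0 < Λ) :
    ∃ C : ℝ≥0, ∀ r₁ > 0, ∫⁻ y : Rn n, majKernel n a N η c Λ r₁ ‖y‖ ≤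
      C * ofReal (1 + r₁ ^ (n - 2 * a)) := by
  obtain ⟨C1, hC1, h1⟩ := exists_lintegral_majHigh_right_le (a := a) hn hN
  obtain ⟨C2, hC2, h2⟩ := exists_lintegral_majLow_right_le hn hN η c
  have hna : 0 < n - 2 * a := by linarith
  set κ := (volume : Measure (Rn n)).toSphere univ with hκ
  set B := C1 * (Λ ^ (n - 2 * a) / (n - 2 * a)) + C2 * (Λ ^ η / η + 3 ^ c / c) with hB
  have hB0 : 0 ≤ B := by positivity
  refine ⟨κ.toNNReal * B.toNNReal, fun r₁ hr₁ => ?_⟩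
  have hx : 0 < r₁ ^ (n - 2 * a) := by positivity
  rw [lintegral_fun_norm (by omega) (by fun_prop), ← hκ, ENNReal.coe_mul,
    coe_toNNReal (measure_ne_top _ _), mul_assoc]
  refine mul_le_mul' le_rfl ?_
  calc _ = ∫⁻ r in Ioi 0, ∫⁻ t in Ioo 0 Λ, ofReal (r ^ ((n : ℝ) - 1)) *
        (ofReal (majHigh n a N t r₁ r) + ofReal (majLow n N η c t r₁ r)) := by
        refine lintegral_congr fun r => ?_
        rw [majKernel, lintegral_const_mul' _ _ ofReal_ne_top]
    _ = ∫⁻ t in Ioo 0 Λ, ∫⁻ r in Ioi 0, ofReal (r ^ ((n : ℝ) - 1)) *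
        (ofReal (majHigh n a N t r₁ r) + ofReal (majLow n N η c t r₁ r)) :=
      lintegral_lintegral_swap (Measurable.aemeasurable (by fun_prop))
    _ ≤ ∫⁻ t in Ioo 0 Λ, (ofReal (C1 * r₁ ^ (n - 2 * a)) *
          ofReal (t ^ (n - 2 * a - 1)) + ofReal C2 * (ofReal (t ^ (η - 1)) +
          ofReal (r₁ ^ c * (Iic (2 / r₁)).indicator (fun t => t ^ (c - 1)) t))) := by
      refine setLIntegral_mono' measurableSet_Ioo fun t ht => ?_
      simp only [mul_add]
      rw [lintegral_add_left (by fun_prop)]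
      refine add_le_add ((h1 t r₁ ht.1 hr₁).trans_eq ?_) ((h2 t r₁ ht.1 hr₁).trans_eq ?_)
      · rw [← mul_assoc, ofReal_mul (by positivity)]
      · have : 0 ≤ (Iic (2 / r₁)).indicator (fun t => t ^ (c - 1)) t :=
          indicator_apply_nonneg fun _ => rpow_nonneg ht.1.le _
        rw [ofReal_mul hC2.le, ofReal_add (rpow_nonneg ht.1.le _) (by positivity), mul_add]
    _ ≤ ofReal (C1 * r₁ ^ (n - 2 * a)) * ofReal (Λ ^ (n - 2 * a) / (n - 2 * a)) +
        ofReal C2 * (ofReal (Λ ^ η / η) + ofReal (3 ^ c / c)) := by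
      rw [lintegral_add_left (by fun_prop), lintegral_const_mul' _ _ ofReal_ne_top,
        lintegral_Ioo_rpow hΛ hna, lintegral_const_mul' _ _ ofReal_ne_top,
        lintegral_add_left (by fun_prop), lintegral_Ioo_rpow hΛ hη]
      gcongr
      exact lintegral_Iic_rpow_le hr₁ hc
    _ ≤ _ := by
      rw [← ofReal_add (by positivity) (by positivity), ← ofReal_mul (by positivity),
        ← ofReal_mul hC2.le, ← ofReal_add (by positivity) (by positivity),
        ← ofReal, ← ofReal_mul hB0]
      refine ofReal_le_ofReal ?_
      rw [hB]
      have e1 : 0 ≤ C1 * (Λ ^ (n - 2 * a) / (n - 2 * a)) := by positivity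
      have e2 : 0 ≤ C2 * (Λ ^ η / η + 3 ^ c / c) * r₁ ^ (n - 2 * a) := by positivity
      nlinarith

lemma exists_lintegral_majKernel_left_le (hn : 3 ≤ n) (ha : 1 < a) (han : 2 * a < n)
    (hN : ((n : ℝ) - 1) / 2 + 1 < N) (hη : 0 < η) (hc : 0 < c) (hΛ : 0 < Λ) :
    ∃ C : ℝ≥0, ∀ r₂ > 0,
      ∫⁻ x : Rn n, ofReal (‖x‖ ^ (2 * a - n)) * majKernel n a N η c Λ ‖x‖ r₂ ≤ C := by
  obtain ⟨C1, hC1, h1⟩ := exists_lintegral_majHigh_left_le (a := a) hn hN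
  obtain ⟨C2, hC2, h2⟩ := exists_lintegral_majLow_left_le (Λ := Λ) hn ha hN hη hc
  have hna : 0 < n - 2 * a := by linarith
  set κ := (volume : Measure (Rn n)).toSphere univ with hκ
  refine ⟨κ.toNNReal * ((C1 + C2) * (Λ ^ (n - 2 * a) / (n - 2 * a))).toNNReal, fun r₂ hr₂ => ?_⟩
  rw [lintegral_fun_norm (f := fun r => ofReal (r ^ (2 * a - n)) * majKernel n a N η c Λ r r₂)
    (by omega) (by fun_prop), ← hκ, ENNReal.coe_mul, coe_toNNReal (measure_ne_top _ _)]
  refine mul_le_mul' le_rfl ?_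
  calc _ = ∫⁻ r in Ioi 0, ∫⁻ t in Ioo 0 Λ, ofReal (r ^ ((n : ℝ) - 1)) * (ofReal (r ^ (2 * a - n)) *
        (ofReal (majHigh n a N t r r₂) + ofReal (majLow n N η c t r r₂))) := by
        refine lintegral_congr fun r => ?_
        rw [majKernel, ← lintegral_const_mul' _ _ ofReal_ne_top,
          ← lintegral_const_mul' _ _ ofReal_ne_top]
    _ = ∫⁻ t in Ioo 0 Λ, ∫⁻ r in Ioi 0, ofReal (r ^ ((n : ℝ) - 1)) * (ofReal (r ^ (2 * a - n)) *
        (ofReal (majHigh n a N t r r₂) + ofReal (majLow n N η c t r r₂))) :=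
      lintegral_lintegral_swap (Measurable.aemeasurable (by fun_prop))
    _ ≤ ∫⁻ t in Ioo 0 Λ, ofReal (C1 + C2) * ofReal (t ^ (n - 2 * a - 1)) := by
      refine setLIntegral_mono' measurableSet_Ioo fun t ht => ?_
      simp only [mul_add]
      rw [lintegral_add_left (by fun_prop), ofReal_add hC1.le hC2.le, add_mul,
        ← ofReal_mul hC1.le, ← ofReal_mul hC2.le]
      exact add_le_add (h1 t r₂ ht.1 hr₂) (h2 t r₂ ht hr₂)
    _ = _ := by
      rw [lintegral_const_mul' _ _ ofReal_ne_top, lintegral_Ioo_rpow hΛ hna,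
        ← ofReal_mul (by positivity), ofReal]

end

/-! ### Integrals of weights on `ℝⁿ` -/

lemma bracket_pos {n : ℕ} (x : Rn n) : 0 < bracket x := Real.sqrt_pos.2 (by positivity)

lemma one_le_bracket {n : ℕ} (x : Rn n) : 1 ≤ bracket x :=
  Real.one_le_sqrt.2 (by linarith [sq_nonneg ‖x‖])

lemma measurable_bracket {n : ℕ} : Measurable (bracket : Rn n → ℝ) := by unfold bracket; fun_prop

lemma exists_lintegral_bracket_mul_le {n : ℕ} (hn : 0 < n) {b d : ℝ} (hb : n < b) (hd0 : 0 ≤ d)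
    (hd : d < n) : ∃ C : ℝ≥0, ∀ x : Rn n,
      ∫⁻ z : Rn n, ofReal (bracket z ^ (-b) * (1 + ‖x - z‖ ^ (-d))) ≤ C := by
  have h1 : Integrable fun z : Rn n => bracket z ^ (-b) := by
    have := integrable_rpow_neg_one_add_norm_sq (E := Rn n) (μ := volume) (r := b) (by simpa using hb)
    refine this.congr (Eventually.of_forall fun z => ?_)
    simp only [bracket, Real.sqrt_eq_rpow]
    rw [← rpow_mul (by positivity)]
    congr 1; ring
  set f : ℝ → ℝ≥0∞ := (Iio 1).indicator fun y => ofReal (y ^ (-d)) with hf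
  have hfm : Measurable f := (measurable_id.pow_const _).ennreal_ofReal.indicator measurableSet_Iio
  have h2 : ∫⁻ z : Rn n, f ‖z‖ ≠ ⊤ := by
    rw [lintegral_fun_norm hn hfm]
    refine mul_ne_top (measure_ne_top _ _) ?_
    have : ∫⁻ y in Ioi 0, ofReal (y ^ ((n : ℝ) - 1)) * f y ≤
        ∫⁻ y in Ioo (0 : ℝ) 1, ofReal (y ^ ((n - d) - 1)) := by
      rw [← lintegral_indicator measurableSet_Ioi, ← lintegral_indicator measurableSet_Ioo]
      refine lintegral_mono fun y => ?_
      by_cases hy : y ∈ Ioo (0 : ℝ) 1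
      · rw [indicator_of_mem hy, indicator_of_mem (show y ∈ Ioi 0 from hy.1), hf,
          indicator_of_mem (show y ∈ Iio 1 from hy.2),
          ← ofReal_mul (rpow_nonneg hy.1.le _), ← rpow_add hy.1]
        refine le_of_eq ?_
        congr 2; ring
      · by_cases hy0 : y ∈ Ioi 0
        · simp_all
        · simp_all
    rw [lintegral_Ioo_rpow one_pos (by linarith)] at this
    exact (this.trans_lt ENNReal.ofReal_lt_top).ne
  have h0 : 0 ≤ ∫ z : Rn n, bracket z ^ (-b) := integral_nonneg fun z => by
    have := bracket_pos z; positivity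
  refine ⟨(2 * ∫ z : Rn n, bracket z ^ (-b)).toNNReal + (∫⁻ z : Rn n, f ‖z‖).toNNReal, fun x => ?_⟩
  calc _ ≤ ∫⁻ z : Rn n, (ofReal (2 * bracket z ^ (-b)) + f ‖x - z‖) := by
        refine lintegral_mono fun z => ?_
        have hz := one_le_bracket z
        have hz0 : 0 ≤ bracket z ^ (-b) := rpow_nonneg (by linarith) _
        by_cases h : ‖x - z‖ ∈ Iio (1 : ℝ)
        · rw [hf, indicator_of_mem h, ← ofReal_add (by positivity) (by positivity)]
          refine ofReal_le_ofReal ?_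
          have : bracket z ^ (-b) ≤ 1 := Real.rpow_le_one_of_one_le_of_nonpos hz (by linarith)
          have h3 : 0 ≤ ‖x - z‖ ^ (-d) := by positivity
          nlinarith
        · refine (ofReal_le_ofReal ?_).trans le_self_add
          have : ‖x - z‖ ^ (-d) ≤ 1 :=
            Real.rpow_le_one_of_one_le_of_nonpos (not_lt.1 h) (by linarith)
          nlinarith
    _ = _ := by
      rw [lintegral_add_left (by have := measurable_bracket (n := n); fun_prop),
        lintegral_sub_left_eq_self (fun z : Rn n => f ‖z‖) x,
        ← ofReal_integral_eq_lintegral_ofReal (h1.const_mul 2) (Eventually.of_forall fun z => by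
          have := bracket_pos z
          positivity), integral_const_mul]
      push_cast
      rw [coe_toNNReal h2, ofReal]

/-! ### Symbol bounds of the spectral cut-off and of the amplitude -/

lemma exists_symBound_spectral_cutoff {g : ℝ → ℂ} (hg : ContDiff ℝ ∞ g) {Λ s₀ : ℝ} (hs₀ : 0 < s₀)
    (hsΛ : s₀ < Λ) (h1 : ∀ t ∈ Ioo 0 s₀, g t = 1) (h0 : ∀ t, Λ < t → g t = 0) {η : ℝ} (hη : 0 < η)
    (N : ℕ) : ∃ C > 0, SymBound (Ioo 0 Λ) (N + 1) (fun t => C * (Λ - t)) g ∧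
      SymBound (Ioo 0 Λ) N (fun t => C * (t ^ η * (Λ - t))) (fun t => (t : ℂ) * deriv g t) := by
  obtain ⟨C, hC, hb⟩ := exists_bound_iteratedDeriv_of_eq_zero hg (hs₀.trans hsΛ) h0 (N + 1)
  have hsub : ∀ r, 0 ≤ r → Ioo r Λ ⊆ Ioi 0 := fun r hr t ht => hr.trans_lt ht.1
  have hS : SymBound (Ioo 0 Λ) (N + 1) (fun t => C * (Λ - t)) g :=
    SymBound.of_iteratedDeriv (hsub 0 le_rfl)
      (fun k _ t _ => hg.differentiableAt_iteratedDeriv' k t) hb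
  have hpos : 0 < (s₀ / 2) ^ η := by positivity
  set D := 2 ^ N * C * ((s₀ / 2) ^ η)⁻¹
  have hD : 0 < D := by positivity
  refine ⟨C + D, by positivity, hS.mono Subset.rfl (hsub 0 le_rfl) fun t ht => ?_, ?_⟩
  · have : 0 ≤ Λ - t := by linarith [ht.2]
    nlinarith
  have h2 : SymBound (Ioo 0 s₀) N (fun t => (C + D) * (t ^ η * (Λ - t)))
      (fun t => (t : ℂ) * deriv g t) := by
    refine (SymBound.zero (N := N) Ioo_subset_Ioi_self (β := fun _ => 0) (fun _ _ => le_rfl)).congr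
      isOpen_Ioo (fun t ht => ?_) |>.mono Subset.rfl Ioo_subset_Ioi_self fun t ht => ?_
    · have : g =ᶠ[𝓝 t] fun _ => 1 := by
        filter_upwards [isOpen_Ioo.mem_nhds ht] with u hu using h1 u hu
      rw [this.deriv_eq, deriv_const, mul_zero]
    · have h3 : 0 < t := ht.1
      have h4 : 0 < Λ - t := by linarith [ht.2]
      positivity
  have h3 := (hS.id_mul_deriv isOpen_Ioo (hsub 0 le_rfl)).mono (s' := Ioo (s₀ / 2) Λ)
    (β' := fun t => (C + D) * (t ^ η * (Λ - t))) (fun t ht => ⟨(half_pos hs₀).trans ht.1, ht.2⟩)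
    (hsub _ (by positivity)) fun t ht => by
      have h4 : 0 < Λ - t := by linarith [ht.2]
      have h5 : (s₀ / 2) ^ η ≤ t ^ η := rpow_le_rpow (by positivity) ht.1.le hη.le
      calc 2 ^ N * (C * (Λ - t)) = D * ((s₀ / 2) ^ η * (Λ - t)) := by simp only [D]; field_simp
        _ ≤ (C + D) * (t ^ η * (Λ - t)) := by gcongr; linarith
  refine (h2.union h3).mono (fun t ht => ?_) (hsub 0 le_rfl) fun t _ => le_rfl
  rcases lt_or_ge t s₀ with h | h
  · grind
  · grind

lemma SymBound.of_weighted_iteratedDeriv {g : ℝ → ℂ} {Λ η G : ℝ} (hη : 0 < η) (hG : 0 ≤ G) {N : ℕ}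
    (hd : ∀ k < N + 1, DifferentiableOn ℝ (iteratedDeriv k g) (Ioo 0 Λ))
    (h0 : ∀ t ∈ Ioo 0 Λ, ‖g t‖ ≤ G)
    (h1 : ∀ t ∈ Ioo 0 Λ, ∀ k ∈ Icc 1 (N + 1), ‖iteratedDeriv k g t‖ * t ^ ((k : ℝ) - η) ≤ G) :
    SymBound (Ioo 0 Λ) (N + 1) (fun _ => G * (1 + Λ ^ η)) g ∧
      SymBound (Ioo 0 Λ) N (fun t => 2 ^ N * G * t ^ η) (fun t => (t : ℂ) * deriv g t) := by
  have hd' : ∀ k < N + 1, ∀ t ∈ Ioo 0 Λ, DifferentiableAt ℝ (iteratedDeriv k g) t :=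
    fun k hk t ht => (hd k hk).differentiableAt (isOpen_Ioo.mem_nhds ht)
  have key : ∀ t ∈ Ioo 0 Λ, ∀ k ∈ Icc 1 (N + 1), ‖iteratedDeriv k g t‖ * t ^ k ≤ G * t ^ η := by
    intro t ht k hk
    have h2 : t ^ k = t ^ ((k : ℝ) - η) * t ^ η := by
      rw [← rpow_add ht.1, sub_add_cancel, rpow_natCast]
    rw [h2, ← mul_assoc]
    exact mul_le_mul_of_nonneg_right (h1 t ht k hk) (rpow_nonneg ht.1.le _)
  constructor
  · refine SymBound.of_iteratedDeriv Ioo_subset_Ioi_self hd' fun k hk t ht => ?_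
    have hΛ : 0 < Λ := ht.1.trans ht.2
    rcases Nat.eq_zero_or_pos k with rfl | hk0
    · have := h0 t ht
      have : 0 ≤ G * Λ ^ η := by positivity
      simpa using by linarith
    · have h3 : t ^ η ≤ Λ ^ η := rpow_le_rpow ht.1.le ht.2.le hη.le
      refine (key t ht k ⟨hk0, hk⟩).trans (mul_le_mul_of_nonneg_left (by linarith) hG)
  · have h2 : SymBound (Ioo 0 Λ) N (fun t => G * t ^ (η - 1)) (deriv g) := by
      refine SymBound.of_iteratedDeriv Ioo_subset_Ioi_self (fun k hk t ht => ?_) fun k hk t ht => ?_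
      · rw [← iteratedDeriv_succ']; exact hd' (k + 1) (by omega) t ht
      · rw [← iteratedDeriv_succ', rpow_sub_one ht.1.ne', ← mul_div_assoc, le_div_iff₀ ht.1,
          mul_assoc, ← pow_succ]
        exact key t ht (k + 1) ⟨by omega, by omega⟩
    refine ((SymBound.id Ioo_subset_Ioi_self).mul isOpen_Ioo Ioo_subset_Ioi_self h2).mono
      Subset.rfl Ioo_subset_Ioi_self fun t ht => le_of_eq ?_
    rw [rpow_sub_one ht.1.ne']
    have : t ≠ 0 := ht.1.ne'; field_simp

section

variable {n : ℕ} {a : ℝ}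

lemma exists_enorm_spectral_integral_le (hn : 3 ≤ n) (ha : 1 < a) (han : 2 * a < n) {Λ s₀ η : ℝ}
    (hs₀ : 0 < s₀) (hsΛ : s₀ < Λ) (hη : 0 < η) {χ : ℝ → ℂ} (hχ : ContDiff ℝ ∞ χ)
    (hχ1 : ∀ t ∈ Ioo 0 s₀, χ t = 1) (hχ0 : ∀ t, Λ < t → χ t = 0) :
    ∃ C c : ℝ, 0 < C ∧ 0 < c ∧ ∀ (G : ℝ) (g : ℝ → ℂ), 0 ≤ G →
      (∀ k < numDeriv n, DifferentiableOn ℝ (iteratedDeriv k g) (Ioo 0 Λ)) →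
      (∀ t ∈ Ioo 0 Λ, ‖g t‖ ≤ G) →
      (∀ t ∈ Ioo 0 Λ, ∀ k ∈ Icc 1 (numDeriv n), ‖iteratedDeriv k g t‖ * t ^ ((k : ℝ) - η) ≤ G) →
      ∀ r₁ r₂ : ℝ, 0 < r₁ → 0 < r₂ →
      ‖∫ t in Ioo 0 Λ, χ t * g t * (t ^ ((n : ℝ) - 1) : ℝ) *
        Phi n a (t * r₁ : ℝ) * poissonG ord(n) (t * r₂ : ℝ)‖ₑ ≤
        ofReal (C * G) * majKernel n a (numDeriv n) η c Λ r₁ r₂ := by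
  have hΛ : 0 < Λ := hs₀.trans hsΛ
  have hn' : (3 : ℝ) ≤ n := mod_cast hn
  obtain ⟨N, hN⟩ : ∃ N, numDeriv n = N + 2 := by
    have : 0 < ⌈(n : ℝ) / 2⌉₊ := Nat.ceil_pos.2 (by linarith)
    exact ⟨⌈(n : ℝ) / 2⌉₊ - 1, by rw [numDeriv]; omega⟩
  have hN2 : ((N + 2 : ℕ) : ℝ) ≤ ((n : ℝ) + 5) / 2 := by
    rw [← hN, numDeriv]
    have := Nat.ceil_lt_add_one (a := (n : ℝ) / 2) (by positivity); push_cast; linarith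
  rw [hN]
  obtain ⟨C1, c, hC1, hc, h1⟩ := exists_enorm_integral_Phi_mul_poissonG_le hn ha han hN2 hΛ hη
  obtain ⟨C2, hC2, h2, h2'⟩ := exists_symBound_spectral_cutoff hχ hs₀ hsΛ hχ1 hχ0 hη (N + 1)
  set L := 1 + Λ ^ η
  have hL : 1 ≤ L := by bound
  set D := 2 ^ (N + 1) * C2 * (L + 2 ^ (N + 1) + L) with hD
  have hD0 : 0 < D := by positivity
  refine ⟨C1 * D, c, by positivity, hc, fun G g hG hd hg0 hg1 r₁ r₂ hr₁ hr₂ => ?_⟩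
  obtain ⟨h3, h3'⟩ := SymBound.of_weighted_iteratedDeriv (N := N + 1) hη hG hd hg0 hg1
  have hI := (Ioo_subset_Ioi_self : Ioo 0 Λ ⊆ Ioi 0)
  have h4 : SymBound (Ioo 0 Λ) (N + 2) (fun t => G * D * (Λ - t)) (fun t => χ t * g t) := by
    refine (h2.mul isOpen_Ioo hI h3).mono Subset.rfl hI fun t ht => ?_
    have h5 : 0 ≤ Λ - t := by linarith [ht.2]
    have h6 : L * 2 ≤ L + 2 ^ (N + 1) + L := by
      have : (0 : ℝ) < 2 ^ (N + 1) := by positivity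
      linarith
    calc 2 ^ (N + 1 + 1) * (C2 * (Λ - t) * (G * L)) =
          G * (2 ^ (N + 1) * C2 * (L * 2)) * (Λ - t) := by ring
      _ ≤ G * D * (Λ - t) := by rw [hD]; gcongr
  have h5 : SymBound (Ioo 0 Λ) (N + 1) (fun t => G * D * (t ^ η * (Λ - t)))
      (fun t => (t : ℂ) * deriv (fun t => χ t * g t) t) := by
    have e1 := (h2'.mul isOpen_Ioo hI h3.of_succ).add isOpen_Ioo (h2.of_succ.mul isOpen_Ioo hI h3')
    refine (e1.congr isOpen_Ioo fun t ht => ?_).mono Subset.rfl hI fun t ht => ?_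
    · rw [deriv_fun_mul (h2.2.1 t ht) (h3.2.1 t ht)]
      ring
    · have h5 : 0 ≤ Λ - t := by linarith [ht.2]
      have h6 : 0 ≤ t ^ η := rpow_nonneg ht.1.le _
      calc _ = G * (2 ^ (N + 1) * C2 * (L + 2 ^ (N + 1))) * (t ^ η * (Λ - t)) := by ring
        _ ≤ G * D * (t ^ η * (Λ - t)) := by
          rw [hD]
          have h7 : L + 2 ^ (N + 1) ≤ L + 2 ^ (N + 1) + L := by linarith
          exact mul_le_mul_of_nonneg_right (mul_le_mul_of_nonneg_left (mul_le_mul_of_nonneg_left h7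
            (by positivity)) hG) (by positivity)
  rw [show C1 * D * G = C1 * (G * D) by ring]
  exact h1 (G * D) _ (by positivity) h4 h5 r₁ r₂ hr₁ hr₂

/-- The growth of the profile of the free resolvent. -/
lemma exists_norm_Phi_le (hn : 3 ≤ n) (ha : 1 < a) (han : 2 * a < n) :
    ∃ C : ℝ, 0 < C ∧ ∀ t : ℝ, 0 < t → ‖Phi n a t‖ ≤ C * (1 + t ^ (n - 2 * a)) := by
  obtain ⟨C1, c, P, hC1, hc, h1⟩ := exists_norm_Phi_sub_le hn ha han
  obtain ⟨C2, hC2, h2⟩ := exists_norm_phiRem_le hn ha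
  have hn' : (3 : ℝ) ≤ n := mod_cast hn
  set p := ord(n) with hp
  have hp0 : 0 ≤ p := by rw [hp]; linarith
  have hM := macConst_nonneg p
  set K := |helmC n| * (macConst p * 3 ^ p)
  have hK : 0 ≤ K := by positivity
  refine ⟨C1 * 8 ^ c + ‖P‖ + (K + C2), by positivity, fun t ht => ?_⟩
  have hx : 0 ≤ t ^ (n - 2 * a) := by positivity
  rcases le_total t 1 with h | h
  · have h3 := h1 t (ofReal_mem_domU ha ht) (by rw [norm_of_nonneg ht.le]; linarith)
    rw [norm_of_nonneg ht.le] at h3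
    have h4 : t ^ c ≤ 8 ^ c := rpow_le_rpow ht.le (by linarith) hc.le
    calc ‖Phi n a t‖ = ‖(Phi n a t - P) + P‖ := by ring_nf
      _ ≤ C1 * t ^ c + ‖P‖ := (norm_add_le _ _).trans (by gcongr)
      _ ≤ (C1 * 8 ^ c + ‖P‖ + (K + C2)) * 1 := by nlinarith
      _ ≤ _ := by gcongr; linarith
  · have h3 := h2 t (ofReal_mem_domU ha ht)
    have h4 := norm_mac_le hp0 (-I * t)
    have e1 : ‖-I * (t : ℂ)‖ = t := by simp [abs_of_pos ht]
    have e2 : (-I * (t : ℂ)).re = 0 := by simp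
    rw [e1, e2, neg_zero, Real.exp_zero, mul_one] at h4
    rw [norm_of_nonneg ht.le] at h3
    have h5 : t ^ (-(2 * (a + 1))) ≤ 1 := Real.rpow_le_one_of_one_le_of_nonpos h (by linarith)
    have h6 : (1 + 2 * t) ^ p ≤ 3 ^ p * t ^ p := by
      rw [← mul_rpow (by norm_num) ht.le]
      exact rpow_le_rpow (by positivity) (by linarith) hp0
    have h7 : t ^ (2 - 2 * a) * t ^ p ≤ t ^ (n - 2 * a) := by
      rw [← rpow_add ht]
      exact Real.rpow_le_rpow_of_exponent_le h (by rw [hp]; linarith)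
    have h8 : ‖(t : ℂ) ^ᵣ (2 - 2 * a) / a‖ ≤ t ^ (2 - 2 * a) := by
      rw [norm_div, Complex.norm_cpow_eq_rpow_re_of_pos ht, ofReal_re, norm_of_nonneg (by linarith)]
      exact div_le_self (by positivity) ha.le
    rw [Phi_eq_add_phiRem]
    calc _ ≤ t ^ (2 - 2 * a) * (|helmC n| * (macConst p * (3 ^ p * t ^ p))) + C2 * 1 := by
          refine (norm_add_le _ _).trans (add_le_add ?_ (h3.trans (by gcongr)))
          rw [norm_mul, norm_mul (helmC n : ℂ), norm_real, norm_eq_abs]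
          refine mul_le_mul h8 (mul_le_mul_of_nonneg_left (h4.trans ?_) (abs_nonneg _))
            (by positivity) (by positivity)
          gcongr
      _ = K * (t ^ (2 - 2 * a) * t ^ p) + C2 * 1 := by simp only [K]; ring
      _ ≤ K * t ^ (n - 2 * a) + C2 * 1 := by gcongr
      _ ≤ _ := by
        have : 0 ≤ C1 * 8 ^ c + ‖P‖ := by positivity
        nlinarith [mul_nonneg hC2.le hx]

lemma exists_norm_resolventPlus_le (hn : 3 ≤ n) (ha : 1 < a) (han : 2 * a < n) {Λ : ℝ} (hΛ : 0 < Λ) :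
    ∃ C : ℝ, 0 < C ∧ ∀ lam ∈ Ioc 0 Λ, ∀ x : Rn n, x ≠ 0 →
      ‖resolventPlus a lam x‖ ≤ C * (1 + ‖x‖ ^ (2 * a - n)) := by
  obtain ⟨C, hC, h⟩ := exists_norm_Phi_le hn ha han
  refine ⟨C * (1 + Λ ^ (n - 2 * a)), by positivity, fun lam hl x hx => ?_⟩
  have hx0 : 0 < ‖x‖ := norm_pos_iff.2 hx
  have hl0 : 0 < lam := hl.1
  rw [resolventPlus_eq hn ha han hl.1 hx, norm_mul, norm_of_nonneg (by positivity)]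
  have h1 := h (lam * ‖x‖) (by positivity)
  have h2 : lam ^ (n - 2 * a) ≤ Λ ^ (n - 2 * a) := rpow_le_rpow hl.1.le hl.2 (by linarith)
  have h3 : ‖x‖ ^ (2 * a - n) * ‖x‖ ^ (n - 2 * a) = 1 := by rw [← rpow_add hx0]; simp
  have h4 : 0 < ‖x‖ ^ (2 * a - n) := by positivity
  calc _ ≤ ‖x‖ ^ (2 * a - n) * (C * (1 + (lam * ‖x‖) ^ (n - 2 * a))) := by gcongr
    _ = C * (‖x‖ ^ (2 * a - n) + lam ^ (n - 2 * a) * (‖x‖ ^ (2 * a - n) * ‖x‖ ^ (n - 2 * a))) := by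
      rw [mul_rpow hl.1.le hx0.le]; ring
    _ ≤ C * (‖x‖ ^ (2 * a - n) + Λ ^ (n - 2 * a)) := by rw [h3, mul_one]; gcongr
    _ ≤ _ := by
      rw [mul_assoc]
      refine mul_le_mul_of_nonneg_left ?_ hC.le
      have : 0 < Λ ^ (n - 2 * a) := by positivity
      nlinarith

lemma resolventPlus_sub_resolventMinus (hn : 3 ≤ n) (ha : 1 < a) (han : 2 * a < n) {lam : ℝ}
    (hl : 0 < lam) {x : Rn n} (hx : x ≠ 0) :
    resolventPlus a lam x - resolventMinus a lam x = I * (helmC n / a * lam ^ (n - 2 * a) : ℝ) *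
        poissonG ord(n) (lam * ‖x‖ : ℝ) := by
  have hx0 : 0 < ‖x‖ := norm_pos_iff.2 hx
  rw [resolventMinus_eq hn ha han hl hx, resolventPlus_eq hn ha han hl hx, map_mul,
    conj_ofReal, ← mul_sub, Phi_sub_conj hn ha (by positivity), mul_rpow hl.le hx0.le]
  have h3 : ‖x‖ ^ (2 * a - n) * ‖x‖ ^ (n - 2 * a) = 1 := by rw [← rpow_add hx0]; simp
  have h3' : (‖x‖ ^ (2 * a - n) : ℝ) * ((‖x‖ ^ (n - 2 * a) : ℝ) : ℂ) = 1 := by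
    rw [← Complex.ofReal_mul, h3, ofReal_one]
  push_cast at h3' ⊢
  linear_combination (I * (helmC n / a * (lam ^ (n - 2 * a) : ℝ)) *
    poissonG ord(n) (lam * ‖x‖)) * h3'

lemma exists_norm_resolventPlus_sub_le (hn : 3 ≤ n) (ha : 1 < a) (han : 2 * a < n) {Λ : ℝ}
    (hΛ : 0 < Λ) : ∃ C > 0, ∀ lam ∈ Ioc 0 Λ, ∀ x : Rn n, x ≠ 0 →
      ‖resolventPlus a lam x - resolventMinus a lam x‖ ≤ C := by
  refine ⟨|helmC n / a| * Λ ^ (n - 2 * a) * 2 + 1, by positivity, fun lam hl x hx => ?_⟩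
  have hn' : (3 : ℝ) ≤ n := mod_cast hn
  have hl0 : 0 < lam := hl.1
  rw [resolventPlus_sub_resolventMinus hn ha han hl.1 hx, norm_mul, norm_mul, norm_I, one_mul,
    norm_real, norm_eq_abs, abs_mul, abs_of_pos (by positivity : 0 < lam ^ (n - 2 * a))]
  have h1 := norm_poissonG_ofReal_le (p := ord(n)) (by linarith) (lam * ‖x‖)
  have h2 : lam ^ (n - 2 * a) ≤ Λ ^ (n - 2 * a) := rpow_le_rpow hl.1.le hl.2 (by linarith)
  refine le_trans ?_ (le_add_of_nonneg_right zero_le_one); gcongr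

end

/-! ### The Schur test -/

lemma lintegral_mul_rpow_le {X : Type*} [MeasurableSpace X] {μ : Measure X} {k h : X → ℝ≥0∞}
    (hk : AEMeasurable k μ) (hh : AEMeasurable h μ) {s : ℝ} (hs : 1 ≤ s) :
    (∫⁻ y, k y * h y ∂μ) ^ s ≤ (∫⁻ y, k y ∂μ) ^ (s - 1) * ∫⁻ y, k y * h y ^ s ∂μ := by
  have hs0 : 0 < s := by linarith
  have hi : s⁻¹ ≤ 1 := inv_le_one_of_one_le₀ hs
  have h1 := ENNReal.lintegral_mul_norm_pow_le (μ := μ) hk (hk.mul (hh.pow_const s))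
    (p := 1 - s⁻¹) (q := s⁻¹) (by linarith) (by positivity) (by ring)
  have h2 : ∀ y, k y * h y = k y ^ (1 - s⁻¹) * ((k * fun y => h y ^ s) y) ^ s⁻¹ := fun y => by
    rw [Pi.mul_apply, ENNReal.mul_rpow_of_nonneg _ _ (by positivity), ← ENNReal.rpow_mul,
      mul_inv_cancel₀ hs0.ne', rpow_one, ← mul_assoc,
      ← ENNReal.rpow_add_of_nonneg _ _ (by linarith) (by positivity), sub_add_cancel,
      rpow_one]
  simp only [h2] at h1 ⊢
  refine (ENNReal.rpow_le_rpow h1 hs0.le).trans_eq ?_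
  rw [ENNReal.mul_rpow_of_nonneg _ _ hs0.le, ← ENNReal.rpow_mul, ← ENNReal.rpow_mul,
    inv_mul_cancel₀ hs0.ne', rpow_one, sub_mul, one_mul, inv_mul_cancel₀ hs0.ne']
  rfl

lemma kernelBoundedOnLp_of_schur {n : ℕ} {K : Rn n → Rn n → ℂ}
    (hK : AEStronglyMeasurable (fun q : Rn n × Rn n => K q.1 q.2) (volume.prod volume)) {C : ℝ≥0}
    (h1 : ∀ᵐ x, ∫⁻ y, ‖K x y‖ₑ ≤ C) (h2 : ∀ᵐ y, ∫⁻ x, ‖K x y‖ₑ ≤ C) {p : ℝ≥0∞} (hp : 1 ≤ p) :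
    KernelBoundedOnLp K p := by
  refine ⟨C, fun f hf => ?_⟩
  have hKf : AEStronglyMeasurable (fun q : Rn n × Rn n => K q.1 q.2 * f q.2) (volume.prod volume) :=
    hK.mul hf.1.comp_snd
  have hm : AEStronglyMeasurable (fun x => ∫ y, K x y * f y) volume := hKf.integral_prod_right'
  have hsec : ∀ᵐ x, AEStronglyMeasurable (fun y => K x y * f y) volume := hKf.prodMk_left
  have hKsec : ∀ᵐ x, AEStronglyMeasurable (fun y => K x y) volume := hK.prodMk_left
  set g : Rn n → ℝ≥0∞ := fun x => ∫⁻ y, ‖K x y‖ₑ * ‖f y‖ₑ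
  have hg : ∀ x, ‖∫ y, K x y * f y‖ₑ ≤ g x := fun x =>
    (enorm_integral_le_lintegral_enorm _).trans_eq (by simp only [enorm_mul, g])
  suffices H : (∀ᵐ x, g x < ⊤) ∧
      eLpNorm (fun x => ∫ y, K x y * f y) p volume ≤ C * eLpNorm f p volume by
    refine ⟨?_, ⟨hm, H.2.trans_lt (mul_lt_top coe_lt_top hf.2)⟩, H.2⟩
    filter_upwards [H.1, hsec] with x hx hx2
    refine ⟨hx2, ?_⟩
    simpa only [HasFiniteIntegral, enorm_mul] using hx
  rcases eq_or_ne p ⊤ with rfl | hpt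
  · have hb : ∀ᵐ x, g x ≤ C * eLpNorm f ⊤ volume := by
      filter_upwards [h1, hKsec] with x hx hx2
      calc g x ≤ ∫⁻ y, ‖K x y‖ₑ * eLpNorm f ⊤ volume := by
            refine lintegral_mono_ae ?_
            filter_upwards [ae_le_eLpNormEssSup (f := f) (μ := volume)] with y hy
            rw [eLpNorm_exponent_top]; gcongr
        _ = (∫⁻ y, ‖K x y‖ₑ) * eLpNorm f ⊤ volume := lintegral_mul_const' _ _ hf.2.ne
        _ ≤ _ := by gcongr
    refine ⟨hb.mono fun x hx => hx.trans_lt (mul_lt_top coe_lt_top hf.2), ?_⟩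
    rw [eLpNorm_exponent_top (f := fun x => ∫ y, K x y * f y)]
    exact essSup_le_of_ae_le _ (hb.mono fun x hx => (hg x).trans hx)
  · have hp0 : p ≠ 0 := (zero_lt_one.trans_le hp).ne'
    set s := p.toReal with hs_def
    have hs : 1 ≤ s := by rw [hs_def, ← ENNReal.toReal_one]; exact ENNReal.toReal_mono hpt hp
    have hs0 : 0 < s := by linarith
    have hfe : AEMeasurable (fun y => ‖f y‖ₑ ^ s) volume := hf.1.enorm.pow_const s
    have hb : ∫⁻ x, g x ^ s ≤ C ^ s * ∫⁻ y, ‖f y‖ₑ ^ s := by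
      calc ∫⁻ x, g x ^ s ≤ ∫⁻ x, (C : ℝ≥0∞) ^ (s - 1) * ∫⁻ y, ‖K x y‖ₑ * ‖f y‖ₑ ^ s := by
            refine lintegral_mono_ae ?_
            filter_upwards [h1, hKsec] with x hx hx2
            exact (lintegral_mul_rpow_le hx2.enorm hf.1.enorm hs).trans
              (mul_le_mul' (ENNReal.rpow_le_rpow hx (by linarith)) le_rfl)
        _ = (C : ℝ≥0∞) ^ (s - 1) * ∫⁻ x, ∫⁻ y, ‖K x y‖ₑ * ‖f y‖ₑ ^ s :=
          lintegral_const_mul' _ _ (ENNReal.rpow_ne_top_of_nonneg (by linarith) coe_ne_top)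
        _ = (C : ℝ≥0∞) ^ (s - 1) * ∫⁻ y, ∫⁻ x, ‖K x y‖ₑ * ‖f y‖ₑ ^ s := by
          rw [lintegral_lintegral_swap]
          exact hK.enorm.mul hfe.comp_snd
        _ ≤ (C : ℝ≥0∞) ^ (s - 1) * ∫⁻ y, C * ‖f y‖ₑ ^ s := by
          refine mul_le_mul' le_rfl (lintegral_mono_ae ?_)
          filter_upwards [h2] with y hy
          rw [lintegral_mul_const' _ _ (ENNReal.rpow_ne_top_of_nonneg hs0.le enorm_ne_top)]; gcongr
        _ = _ := by
          rw [lintegral_const_mul' _ _ coe_ne_top, ← mul_assoc]; congr 1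
          conv_rhs => rw [show s = (s - 1) + 1 by ring]
          rw [ENNReal.rpow_add_of_nonneg _ _ (by linarith) zero_le_one, rpow_one]
    have hN : eLpNorm f p volume = (∫⁻ y, ‖f y‖ₑ ^ s) ^ (1 / s) :=
      eLpNorm_eq_lintegral_rpow_enorm_toReal hp0 hpt
    have hfin : ∫⁻ y, ‖f y‖ₑ ^ s < ⊤ := lintegral_rpow_enorm_lt_top_of_eLpNorm_lt_top hp0 hpt hf.2
    constructor
    · have hgm : AEMeasurable g volume :=
        (hK.enorm.mul (hf.1.enorm.comp_snd (μ := volume))).lintegral_prod_right'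
      have := ae_lt_top' (hgm.pow_const s) (hb.trans_lt (mul_lt_top
        (ENNReal.rpow_lt_top_of_nonneg hs0.le coe_ne_top) hfin)).ne
      filter_upwards [this] with x hx
      rwa [ENNReal.rpow_lt_top_iff_of_pos hs0] at hx
    · rw [eLpNorm_eq_lintegral_rpow_enorm_toReal hp0 hpt, hN]
      calc _ ≤ (C ^ s * ∫⁻ y, ‖f y‖ₑ ^ s) ^ (1 / s) := by
            refine ENNReal.rpow_le_rpow (le_trans (lintegral_mono fun x => ?_) hb) (by positivity)
            exact ENNReal.rpow_le_rpow (hg x) hs0.le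
        _ = _ := by
          rw [ENNReal.mul_rpow_of_nonneg _ _ (by positivity), ← ENNReal.rpow_mul,
            mul_one_div_cancel hs0.ne', rpow_one]

/-! ### The amplitude -/

/-- A family which is measurable in one variable and continuous in the real variable is jointly
measurable. -/
lemma aestronglyMeasurable_uncurry_of_continuousOn {X : Type*} [MeasurableSpace X] {μ : Measure X}
    [SFinite μ] {Γ : ℝ → X → ℂ} {Λ : ℝ} (hm : ∀ t ∈ Ioo 0 Λ, AEStronglyMeasurable (Γ t) μ)
    (hc : ∀ᵐ z ∂μ, ContinuousOn (fun t => Γ t z) (Ioo 0 Λ)) :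
    AEStronglyMeasurable (fun w : ℝ × X => Γ w.1 w.2) ((volume.restrict (Ioo 0 Λ)).prod μ) := by
  obtain ⟨G, hGm, hGe⟩ : ∃ G : ℝ → X → ℂ, (∀ t, Measurable (G t)) ∧
      ∀ t ∈ Ioo 0 Λ, ∀ᵐ z ∂μ, G t z = Γ t z := by
    have : ∀ t, ∃ g : X → ℂ, Measurable g ∧ (t ∈ Ioo 0 Λ → ∀ᵐ z ∂μ, g z = Γ t z) := fun t => by
      by_cases h : t ∈ Ioo 0 Λ
      · exact ⟨(hm t h).mk, (hm t h).stronglyMeasurable_mk.measurable, fun _ =>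
          (hm t h).ae_eq_mk.symm⟩
      · exact ⟨0, measurable_const, fun h' => absurd h' h⟩
    choose G h1 h2 using this
    exact ⟨G, h1, h2⟩
  set d : ℕ → ℕ → ℝ := fun k m => ((m : ℝ) + 1) / (k + 1) with hd
  set F : ℕ → ℝ × X → ℂ := fun k w => G (d k ⌊w.1 * (k + 1)⌋₊) w.2
  have hF : ∀ k, Measurable (F k) := fun k => by
    have h1 : Measurable fun p : ℕ × X => G (d k p.1) p.2 :=
      measurable_from_prod_countable_right fun m => hGm (d k m)
    have h2 : Measurable fun w : ℝ × X => (⌊w.1 * (k + 1)⌋₊, w.2) :=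
      Measurable.prodMk (by fun_prop) measurable_snd
    exact h1.comp h2
  refine aestronglyMeasurable_of_tendsto_ae atTop (fun k => (hF k).aestronglyMeasurable) ?_
  have e1 : ∀ᵐ w : ℝ × X ∂((volume.restrict (Ioo 0 Λ)).prod μ), w.1 ∈ Ioo 0 Λ :=
    Measure.quasiMeasurePreserving_fst.ae ae_mem_Ioo
  have e2 : ∀ᵐ z ∂μ, ContinuousOn (fun t => Γ t z) (Ioo 0 Λ) ∧
      ∀ k m, d k m ∈ Ioo 0 Λ → G (d k m) z = Γ (d k m) z := by
    refine hc.and (ae_all_iff.2 fun k => ae_all_iff.2 fun m => ?_)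
    by_cases h : d k m ∈ Ioo 0 Λ
    · grind
    · simp_all
  have e3 : ∀ᵐ w : ℝ × X ∂((volume.restrict (Ioo 0 Λ)).prod μ),
      ContinuousOn (fun t => Γ t w.2) (Ioo 0 Λ) ∧
      ∀ k m, d k m ∈ Ioo 0 Λ → G (d k m) w.2 = Γ (d k m) w.2 :=
    Measure.quasiMeasurePreserving_snd.ae e2
  filter_upwards [e1, e3] with w hw ⟨h1, h2⟩
  have hlim : Tendsto (fun k : ℕ => d k ⌊w.1 * (k + 1)⌋₊) atTop (𝓝 w.1) := by
    have h0 := tendsto_one_div_add_atTop_nhds_zero_nat (𝕜 := ℝ)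
    refine tendsto_of_tendsto_of_tendsto_of_le_of_le tendsto_const_nhds
      (by simpa using h0.const_add w.1) (fun k => ?_) fun k => ?_
    · have := Nat.lt_floor_add_one (w.1 * ((k : ℝ) + 1))
      simp only [hd]
      rw [le_div_iff₀ (by positivity)]
      exact this.le
    · have hw0 : 0 < w.1 := hw.1
      have := Nat.floor_le (a := w.1 * ((k : ℝ) + 1)) (by positivity)
      simp only [hd]
      rw [div_le_iff₀ (by positivity), add_mul, inv_mul_cancel₀ (by positivity)]; linarith
  have h3 := ((h1 w.1 hw).continuousAt (isOpen_Ioo.mem_nhds hw)).tendsto.comp hlim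
  refine h3.congr' ?_
  filter_upwards [hlim.eventually (isOpen_Ioo.mem_nhds hw)] with k hk
  exact (h2 k _ hk).symm

section

variable {n : ℕ} {η Λ : ℝ} {Γ : ℝ → Rn n → Rn n → ℂ}

lemma enorm_le_gammaTilde {x y : Rn n} {t : ℝ} (ht : t ∈ Ioo 0 Λ) :
    ‖Γ t x y‖ₑ ≤ gammaTilde η Λ Γ x y := by
  refine le_trans ?_ (le_iSup₂ (f := fun lam (_ : lam ∈ Ioo (0 : ℝ) Λ) => (‖Γ lam x y‖ₑ +
      ⨆ k ∈ Icc 1 (numDeriv n),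
        ‖(lam ^ ((k : ℝ) - η) : ℝ) * iteratedDeriv k (fun t => Γ t x y) lam‖ₑ)) t ht)
  exact le_self_add

lemma enorm_iteratedDeriv_le_gammaTilde {x y : Rn n} {t : ℝ} (ht : t ∈ Ioo 0 Λ) {k : ℕ}
    (hk : k ∈ Icc 1 (numDeriv n)) :
    ‖(t ^ ((k : ℝ) - η) : ℝ) * iteratedDeriv k (fun t => Γ t x y) t‖ₑ ≤ gammaTilde η Λ Γ x y := by
  refine le_trans (le_trans ?_ le_add_self) (le_iSup₂ (f := fun lam (_ : lam ∈ Ioo (0 : ℝ) Λ) =>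
      (‖Γ lam x y‖ₑ + ⨆ k ∈ Icc 1 (numDeriv n),
        ‖(lam ^ ((k : ℝ) - η) : ℝ) * iteratedDeriv k (fun t => Γ t x y) lam‖ₑ)) t ht)
  exact le_iSup₂ (f := fun k (_ : k ∈ Icc 1 (numDeriv n)) =>
    ‖(t ^ ((k : ℝ) - η) : ℝ) * iteratedDeriv k (fun t => Γ t x y) t‖ₑ) k hk

end

lemma ENNReal.mul_le_sq_add_sq (p q : ℝ≥0∞) : p * q ≤ p ^ 2 + q ^ 2 := by
  rw [sq, sq]
  rcases le_total p q with h | h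
  · exact (mul_le_mul' h le_rfl).trans le_add_self
  · exact (mul_le_mul' le_rfl h).trans le_self_add

/-- A measurable majorant of the amplitude for which the weighted potential is integrable. -/
lemma exists_amplitude_majorant {n : ℕ} {a η β Λ : ℝ} (hn : 3 ≤ n) (ha : 1 < a) (han : 2 * a < n)
    (hβ : n < β) {V : Rn n → ℝ} (hVm : Measurable V)
    (hV : ∃ C : ℝ, ∀ x, |V x| ≤ C * bracket x ^ (-β)) {Γ : ℝ → Rn n → Rn n → ℂ}
    (hlow : (n : ℝ) < 4 * a → PosKernelBoundedOnL2 (gammaTilde η Λ Γ))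
    (hhigh : 4 * a ≤ n → ∃ C ε : ℝ, 0 < ε ∧ ∀ᵐ z : Rn n × Rn n, gammaTilde η Λ Γ z.1 z.2 ≤
      ofReal (C * bracket z.1 ^ (-((n : ℝ) / 2) - ε) * bracket z.2 ^ (-((n : ℝ) / 2) - ε))) :
    ∃ M : Rn n × Rn n → ℝ≥0∞, AEMeasurable M volume ∧
      (∀ᵐ z : Rn n × Rn n, gammaTilde η Λ Γ z.1 z.2 ≤ M z) ∧
      ∃ C : ℝ≥0, ∀ x : Rn n, ∫⁻ z : Rn n × Rn n, ofReal (1 + ‖x - z.1‖ ^ (2 * a - n)) *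
        (ofReal (√|V z.1|) * M z * ofReal (√|V z.2|)) ≤ C := by
  obtain ⟨CV, hCV⟩ := hV
  have hbr := fun x : Rn n => bracket_pos x
  have hCV0 : 0 ≤ CV := by
    have h1 := (abs_nonneg _).trans (hCV 0)
    exact nonneg_of_mul_nonneg_left h1 (rpow_pos_of_pos (hbr 0) _)
  have hn0 : 0 < n := by omega
  have hbm := measurable_bracket (n := n)
  have hVm' : Measurable fun x => √|V x| := by fun_prop
  rcases lt_or_ge (n : ℝ) (4 * a) with h4 | h4
  · obtain ⟨hm, C, hC⟩ := hlow h4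
    refine ⟨_, hm, Eventually.of_forall fun z => le_rfl, ?_⟩
    obtain ⟨C1, hC1⟩ := exists_lintegral_bracket_mul_le hn0 hβ (d := 2 * (n - 2 * a))
      (by linarith) (by linarith)
    have hvsq : ∀ z : Rn n, ofReal (√|V z|) ^ 2 ≤ ofReal CV *
        ofReal (bracket z ^ (-β)) := fun z => by
      rw [← ENNReal.ofReal_pow (sqrt_nonneg _), sq_sqrt (abs_nonneg _), ← ofReal_mul hCV0]
      exact ofReal_le_ofReal (hCV z)
    refine ⟨2 * (CV.toNNReal * C1) + C * (CV.toNNReal * C1), fun x => ?_⟩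
    have hI : ∫⁻ z : Rn n, ofReal CV * ofReal (bracket z ^ (-β) *
        (1 + ‖x - z‖ ^ (-(2 * (n - 2 * a))))) ≤ CV.toNNReal * C1 := by
      rw [lintegral_const_mul' _ _ ofReal_ne_top]
      exact mul_le_mul' le_rfl (hC1 x)
    set p : Rn n → ℝ≥0∞ := fun z => ofReal (1 + ‖x - z‖ ^ (2 * a - n)) * ofReal (√|V z|)
    set q : Rn n → ℝ≥0∞ := fun z => ∫⁻ y, gammaTilde η Λ Γ z y * ofReal (√|V y|)
    have hp : ∫⁻ z, p z ^ 2 ≤ 2 * (CV.toNNReal * C1) := by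
      calc _ ≤ ∫⁻ z : Rn n, 2 * (ofReal CV *
            ofReal (bracket z ^ (-β) * (1 + ‖x - z‖ ^ (-(2 * (n - 2 * a)))))) := by
            refine lintegral_mono fun z => ?_
            have hs : 0 ≤ ‖x - z‖ ^ (2 * a - n) := by positivity
            have h1 : (1 + ‖x - z‖ ^ (2 * a - n)) ^ 2 ≤
                2 * (1 + ‖x - z‖ ^ (-(2 * (n - 2 * a)))) := by
              have : ‖x - z‖ ^ (-(2 * (n - 2 * a))) = (‖x - z‖ ^ (2 * a - n)) ^ 2 := by
                rw [← rpow_natCast, ← rpow_mul (norm_nonneg _)]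
                congr 1; push_cast; ring
              rw [this]
              nlinarith [sq_nonneg (‖x - z‖ ^ (2 * a - n) - 1)]
            have hb0 := rpow_pos_of_pos (hbr z) (-β)
            calc p z ^ 2 = ofReal ((1 + ‖x - z‖ ^ (2 * a - n)) ^ 2) * ofReal (√|V z|) ^ 2 := by
                  rw [mul_pow, ENNReal.ofReal_pow (by positivity)]
              _ ≤ ofReal (2 * (1 + ‖x - z‖ ^ (-(2 * (n - 2 * a))))) *
                  (ofReal CV * ofReal (bracket z ^ (-β))) :=
                mul_le_mul' (ofReal_le_ofReal h1) (hvsq z)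
              _ = _ := by
                rw [ofReal_mul two_pos.le, ENNReal.ofReal_ofNat, ofReal_mul hb0.le]; ring
        _ ≤ _ := by
            rw [lintegral_const_mul' _ _ (by simp)]
            exact mul_le_mul' le_rfl hI
    have hq : ∫⁻ z, q z ^ 2 ≤ C * (CV.toNNReal * C1) := by
      refine (hC _ hVm'.ennreal_ofReal).trans (mul_le_mul' le_rfl ?_)
      refine (lintegral_mono fun z => (hvsq z).trans (mul_le_mul' le_rfl ?_)).trans hI
      refine ofReal_le_ofReal (le_mul_of_one_le_right (rpow_pos_of_pos (hbr z) _).le ?_)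
      have : 0 ≤ ‖x - z‖ ^ (-(2 * (n - 2 * a))) := by positivity
      linarith
    have hpm : Measurable p := by fun_prop
    have hjoint : AEMeasurable (fun z : Rn n × Rn n =>
        ofReal (1 + ‖x - z.1‖ ^ (2 * a - n)) * (ofReal (√|V z.1|) *
          gammaTilde η Λ Γ z.1 z.2 * ofReal (√|V z.2|))) (volume.prod volume) := by fun_prop
    rw [Measure.volume_eq_prod, lintegral_prod _ hjoint]
    calc _ = ∫⁻ z, p z * q z := by
          refine lintegral_congr fun z => ?_
          have : p z ≠ ⊤ := mul_ne_top ofReal_ne_top ofReal_ne_top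
          simp only [q]
          rw [← lintegral_const_mul' _ _ this]
          refine lintegral_congr fun y => ?_
          simp only [p]; ring
      _ ≤ ∫⁻ z, (p z ^ 2 + q z ^ 2) := lintegral_mono fun z => ENNReal.mul_le_sq_add_sq _ _
      _ = (∫⁻ z, p z ^ 2) + ∫⁻ z, q z ^ 2 := lintegral_add_left (hpm.pow_const 2) _
      _ ≤ _ := by push_cast; exact add_le_add hp hq
  · obtain ⟨C, ε, hε, hC⟩ := hhigh h4
    set e := -((n : ℝ) / 2) - ε with he
    set b : ℝ := β / 2 + n / 2 + ε with hb
    obtain ⟨C1, hC1⟩ := exists_lintegral_bracket_mul_le hn0 (b := b) (d := n - 2 * a)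
      (by rw [hb]; linarith) (by linarith) (by linarith)
    have hM : ∀ z : Rn n × Rn n, ofReal (C * bracket z.1 ^ e * bracket z.2 ^ e) ≤
        ofReal |C| * (ofReal (bracket z.1 ^ e) * ofReal (bracket z.2 ^ e)) := fun z => by
      have h1 := rpow_pos_of_pos (hbr z.1) e
      have h2 := rpow_pos_of_pos (hbr z.2) e
      rw [← ofReal_mul h1.le, ← ofReal_mul (abs_nonneg _), mul_assoc]
      exact ofReal_le_ofReal (mul_le_mul_of_nonneg_right (le_abs_self C) (by positivity))
    have hvb : ∀ z : Rn n, ofReal (√|V z|) * ofReal (bracket z ^ e) ≤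
        ofReal (√CV) * ofReal (bracket z ^ (-b)) := fun z => by
      have h1 : √|V z| ≤ √CV * bracket z ^ (-(β / 2)) := by
        rw [show bracket z ^ (-(β / 2)) = √(bracket z ^ (-β)) by
          rw [Real.sqrt_eq_rpow, ← rpow_mul (hbr z).le]; congr 1; ring,
          ← Real.sqrt_mul hCV0]
        exact Real.sqrt_le_sqrt (hCV z)
      rw [← ofReal_mul (sqrt_nonneg _), ← ofReal_mul (sqrt_nonneg _)]
      refine ofReal_le_ofReal ((mul_le_mul_of_nonneg_right h1
        (rpow_pos_of_pos (hbr z) _).le).trans_eq ?_)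
      rw [mul_assoc, ← rpow_add (hbr z)]
      congr 2; rw [hb, he]; ring
    refine ⟨_, ?_, hC.mono fun z hz => hz.trans (hM z), ?_⟩
    · exact Measurable.aemeasurable (by fun_prop)
    set k := ofReal |C| * ofReal (√CV) ^ 2
    have hk : k ≠ ⊤ := mul_ne_top ofReal_ne_top (ENNReal.pow_ne_top ofReal_ne_top)
    refine ⟨k.toNNReal * (C1 * C1), fun x => ?_⟩
    set f : Rn n → ℝ≥0∞ := fun z => ofReal (bracket z ^ (-b) * (1 + ‖x - z‖ ^ (-(n - 2 * a))))
    have hf : Measurable f := by fun_prop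
    calc _ ≤ ∫⁻ z : Rn n × Rn n, k * (f z.1 * f z.2) := by
          refine lintegral_mono fun z => ?_
          have h1 := rpow_pos_of_pos (hbr z.1) (-b)
          have h2 := rpow_pos_of_pos (hbr z.2) (-b)
          have h3 : ofReal (bracket z.2 ^ (-b)) ≤ f z.2 := by
            refine ofReal_le_ofReal (le_mul_of_one_le_right h2.le ?_)
            have : 0 ≤ ‖x - z.2‖ ^ (-(n - 2 * a)) := by positivity
            linarith
          have h4 : f z.1 = ofReal (1 + ‖x - z.1‖ ^ (2 * a - n)) * ofReal (bracket z.1 ^ (-b)) := by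
            rw [← ofReal_mul (by positivity), mul_comm, ← neg_sub (n : ℝ)]
          calc _ = ofReal (1 + ‖x - z.1‖ ^ (2 * a - n)) * (ofReal |C| *
                ((ofReal (√|V z.1|) * ofReal (bracket z.1 ^ e)) *
                (ofReal (√|V z.2|) * ofReal (bracket z.2 ^ e)))) := by ring
            _ ≤ ofReal (1 + ‖x - z.1‖ ^ (2 * a - n)) * (ofReal |C| *
                ((ofReal (√CV) * ofReal (bracket z.1 ^ (-b))) *
                (ofReal (√CV) * ofReal (bracket z.2 ^ (-b))))) :=
              mul_le_mul' le_rfl (mul_le_mul' le_rfl (mul_le_mul' (hvb z.1) (hvb z.2)))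
            _ = k * (f z.1 * ofReal (bracket z.2 ^ (-b))) := by rw [h4]; ring
            _ ≤ _ := mul_le_mul' le_rfl (mul_le_mul' le_rfl h3)
      _ = k * ((∫⁻ z, f z) * ∫⁻ z, f z) := by
          rw [lintegral_const_mul' _ _ hk, Measure.volume_eq_prod,
            lintegral_prod_mul hf.aemeasurable hf.aemeasurable]
      _ ≤ _ := by
          push_cast
          rw [coe_toNNReal hk]
          exact mul_le_mul' le_rfl (mul_le_mul' (hC1 x) (hC1 x))

/-! ### Superpositions of translated radial kernels -/

section

variable {n : ℕ} {u : Rn n × Rn n → ℝ≥0∞} {J : ℝ → ℝ → ℝ≥0∞}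

lemma lintegral_superposition_right (hu : AEMeasurable u volume)
    (hJ : Measurable fun q : ℝ × ℝ => J q.1 q.2) (x : Rn n) :
    ∫⁻ y : Rn n, ∫⁻ z, u z * J ‖x - z.1‖ ‖z.2 - y‖ = ∫⁻ z, u z * ∫⁻ y : Rn n, J ‖x - z.1‖ ‖y‖ := by
  have h1 : Measurable fun q : Rn n × (Rn n × Rn n) => J ‖x - q.2.1‖ ‖q.2.2 - q.1‖ :=
    hJ.curried_comp (by fun_prop) (by fun_prop)
  rw [lintegral_lintegral_swap (hu.comp_snd.mul h1.aemeasurable)]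
  refine lintegral_congr fun z => ?_
  have h2 : Measurable fun y : Rn n => J ‖x - z.1‖ ‖z.2 - y‖ :=
    hJ.curried_comp (by fun_prop) (by fun_prop)
  rw [lintegral_const_mul _ h2, lintegral_sub_left_eq_self (fun y : Rn n => J ‖x - z.1‖ ‖y‖) z.2]

lemma lintegral_superposition_left (hu : AEMeasurable u volume)
    (hJ : Measurable fun q : ℝ × ℝ => J q.1 q.2) (y : Rn n) :
    ∫⁻ x : Rn n, ∫⁻ z, u z * J ‖x - z.1‖ ‖z.2 - y‖ = ∫⁻ z, u z * ∫⁻ x : Rn n, J ‖x‖ ‖z.2 - y‖ := by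
  have h1 : Measurable fun q : Rn n × (Rn n × Rn n) => J ‖q.1 - q.2.1‖ ‖q.2.2 - y‖ :=
    hJ.curried_comp (by fun_prop) (by fun_prop)
  rw [lintegral_lintegral_swap (hu.comp_snd.mul h1.aemeasurable)]
  refine lintegral_congr fun z => ?_
  have h2 : Measurable fun x : Rn n => J ‖x - z.1‖ ‖z.2 - y‖ :=
    hJ.curried_comp (by fun_prop) (by fun_prop)
  rw [lintegral_const_mul _ h2, lintegral_sub_right_eq_self (fun x : Rn n => J ‖x‖ ‖z.2 - y‖) z.1]

end

/-! ### The integrand of the low energy kernel -/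

lemma ae_fst_ne_and_snd_ne {n : ℕ} (hn : 3 ≤ n) (x y : Rn n) :
    ∀ᵐ z : Rn n × Rn n, z.1 ≠ x ∧ z.2 ≠ y := by
  have : Nonempty (Fin n) := ⟨⟨0, by omega⟩⟩
  have h : ∀ x : Rn n, ∀ᵐ z : Rn n, z ≠ x := fun x => by simp [ae_iff]
  exact (Measure.quasiMeasurePreserving_fst.ae (h x)).and (Measure.quasiMeasurePreserving_snd.ae (h y))

section

variable {n : ℕ} {a : ℝ}

lemma exists_measurable_resolvent (hn : 3 ≤ n) (ha : 1 < a) (han : 2 * a < n) :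
    ∃ P D : ℝ × Rn n → ℂ, Measurable P ∧ Measurable D ∧ ∀ lam > 0, ∀ x : Rn n, x ≠ 0 →
      resolventPlus a lam x = P (lam, x) ∧
      resolventPlus a lam x - resolventMinus a lam x = D (lam, x) := by
  have hn' : (3 : ℝ) ≤ n := mod_cast hn
  obtain ⟨φ, hφ, hφe⟩ : ∃ φ : ℝ → ℂ, Measurable φ ∧ ∀ t > 0, φ t = Phi n a t := by
    classical
    refine ⟨(Ioi 0).piecewise (fun t => Phi n a t) 0, ?_, fun t ht => piecewise_eq_of_mem _ _ _ ht⟩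
    refine ContinuousOn.measurable_piecewise ?_ continuousOn_const measurableSet_Ioi
    exact (differentiableOn_Phi hn ha han).continuousOn.comp continuous_ofReal.continuousOn
      fun t ht => ofReal_mem_domU ha ht
  have hψ : Measurable fun t : ℝ => poissonG ord(n) t :=
    ((differentiable_poissonG (by linarith)).continuous.comp continuous_ofReal).measurable
  have hr : Measurable fun q : ℝ × Rn n => q.1 * ‖q.2‖ := by fun_prop
  refine ⟨fun q => (‖q.2‖ ^ (2 * a - n) : ℝ) * φ (q.1 * ‖q.2‖), fun q =>
    I * (helmC n / a * q.1 ^ (n - 2 * a) : ℝ) *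
      poissonG ord(n) (q.1 * ‖q.2‖ : ℝ), ?_, ?_, fun lam hl x hx => ⟨?_, ?_⟩⟩
  · fun_prop
  · have h1 : Measurable fun q : ℝ × Rn n =>
      I * (helmC n / a * q.1 ^ (n - 2 * a) : ℝ) := by fun_prop
    exact h1.mul (hψ.comp hr)
  · have : 0 < ‖x‖ := norm_pos_iff.2 hx
    simp only [resolventPlus_eq hn ha han hl hx, hφe _ (mul_pos hl this)]
  · exact resolventPlus_sub_resolventMinus hn ha han hl hx

variable {Λ : ℝ} {χ : ℝ → ℝ} {V : Rn n → ℝ} {Γ : ℝ → Rn n → Rn n → ℂ}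

/-- The integrand of the low energy kernel, as a function of `(lam, z)`. -/
def lowIntegrand (a : ℝ) (χ : ℝ → ℝ) (V : Rn n → ℝ) (Γ : ℝ → Rn n → Rn n → ℂ)
    (x y : Rn n) (w : ℝ × (Rn n × Rn n)) : ℂ :=
  (χ w.1 * w.1 ^ (2 * a - 1) : ℝ) * compositionIntegrand a V Γ w.1 x y w.2

/-- The measure `dlam dz` on `(0,Λ) × ℝ²ⁿ`. -/
noncomputable abbrev spectralMeasure (n : ℕ) (Λ : ℝ) : Measure (ℝ × (Rn n × Rn n)) :=
  (volume.restrict (Ioo 0 Λ)).prod volume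

lemma exists_measurable_lowIntegrand (hn : 3 ≤ n) (ha : 1 < a) (han : 2 * a < n)
    (hχ : Continuous χ) (hV : Measurable V)
    (hΓ : AEStronglyMeasurable (fun w : ℝ × (Rn n × Rn n) => Γ w.1 w.2.1 w.2.2)
      (spectralMeasure n Λ)) :
    ∃ H : Rn n × Rn n → ℝ × (Rn n × Rn n) → ℂ,
      (∀ x y, H (x, y) =ᵐ[spectralMeasure n Λ] lowIntegrand a χ V Γ x y) ∧
      ∀ {Y : Type} [MeasurableSpace Y] (ν : Measure Y) (q : Y → Rn n × Rn n)
        (f : Y → ℝ × (Rn n × Rn n)), Measurable q →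
        Measure.QuasiMeasurePreserving f ν (spectralMeasure n Λ) →
        AEStronglyMeasurable (fun y => H (q y) (f y)) ν := by
  obtain ⟨P, D, hP, hD, hPD⟩ := exists_measurable_resolvent hn ha han
  refine ⟨fun q w => ((χ w.1 * w.1 ^ (2 * a - 1) : ℝ) : ℂ) *
    (P (w.1, q.1 - w.2.1) * (sqrt |V w.2.1| : ℂ) * Γ w.1 w.2.1 w.2.2 *
    (sqrt |V w.2.2| : ℂ) * D (w.1, w.2.2 - q.2)), fun x y => ?_, fun ν q f hq hf => ?_⟩
  · have e1 : ∀ᵐ w : ℝ × (Rn n × Rn n) ∂(spectralMeasure n Λ), w.1 ∈ Ioo 0 Λ :=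
      Measure.quasiMeasurePreserving_fst.ae ae_mem_Ioo
    have e2 : ∀ᵐ w : ℝ × (Rn n × Rn n) ∂(spectralMeasure n Λ), w.2.1 ≠ x ∧ w.2.2 ≠ y :=
      Measure.quasiMeasurePreserving_snd.ae (ae_fst_ne_and_snd_ne hn x y)
    filter_upwards [e1, e2] with w h1 h2
    rw [lowIntegrand, compositionIntegrand, (hPD w.1 h1.1 (x - w.2.1) (sub_ne_zero.2 h2.1.symm)).1,
      (hPD w.1 h1.1 (w.2.2 - y) (sub_ne_zero.2 h2.2)).2]
  · have hfm := hf.measurable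
    have h1 : Measurable fun w : ℝ × (Rn n × Rn n) => ((χ w.1 * w.1 ^ (2 * a - 1) : ℝ) : ℂ) := by fun_prop
    have hv : Measurable fun x : Rn n => (sqrt |V x| : ℂ) := by fun_prop
    have m1 : Measurable fun y => ((f y).1, (q y).1 - (f y).2.1) := by fun_prop
    have m2 : Measurable fun y => ((f y).1, (f y).2.2 - (q y).2) := by fun_prop
    have g1 : Measurable fun y => (f y).2.1 := by fun_prop
    have g2 : Measurable fun y => (f y).2.2 := by fun_prop
    exact (h1.comp hfm).aestronglyMeasurable.mul
      (((((hP.comp m1).mul (hv.comp g1)).aestronglyMeasurable.mul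
        (hΓ.comp_quasiMeasurePreserving hf)).mul (hv.comp g2).aestronglyMeasurable).mul
        (hD.comp m2).aestronglyMeasurable)

end

section

variable {n : ℕ} {a η Λ : ℝ} {χ : ℝ → ℝ} {V : Rn n → ℝ} {Γ : ℝ → Rn n → Rn n → ℂ}
  {M : Rn n × Rn n → ℝ≥0∞}

lemma exists_enorm_lowIntegrand_le (hn : 3 ≤ n) (ha : 1 < a) (han : 2 * a < n) (hΛ : 0 < Λ)
    (hχ : Continuous χ) : ∃ C : ℝ≥0, ∀ (V : Rn n → ℝ) (Γ : ℝ → Rn n → Rn n → ℂ) (x y : Rn n)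
      (w : ℝ × (Rn n × Rn n)), w.1 ∈ Ioo 0 Λ → w.2.1 ≠ x → w.2.2 ≠ y →
      ‖lowIntegrand a χ V Γ x y w‖ₑ ≤ C * (ofReal (1 + ‖x - w.2.1‖ ^ (2 * a - n)) *
        (ofReal (√|V w.2.1|) * ‖Γ w.1 w.2.1 w.2.2‖ₑ * ofReal (√|V w.2.2|))) := by
  obtain ⟨C1, hC1, h1⟩ := exists_norm_resolventPlus_le hn ha han hΛ
  obtain ⟨C2, hC2, h2⟩ := exists_norm_resolventPlus_sub_le hn ha han hΛ
  obtain ⟨C3, hC3⟩ := (isCompact_Icc (a := 0) (b := Λ)).exists_bound_of_continuousOn hχ.continuousOn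
  have hC30 : 0 ≤ C3 := (norm_nonneg _).trans (hC3 0 (left_mem_Icc.2 hΛ.le))
  refine ⟨(C3 * Λ ^ (2 * a - 1) * C1 * C2).toNNReal, fun V Γ x y w hw hx hy => ?_⟩
  have e1 := h1 w.1 ⟨hw.1, hw.2.le⟩ (x - w.2.1) (sub_ne_zero.2 hx.symm)
  have e2 := h2 w.1 ⟨hw.1, hw.2.le⟩ (w.2.2 - y) (sub_ne_zero.2 hy)
  have e3 := hC3 w.1 ⟨hw.1.le, hw.2.le⟩
  have e4 : w.1 ^ (2 * a - 1) ≤ Λ ^ (2 * a - 1) := rpow_le_rpow hw.1.le hw.2.le (by linarith)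
  have e5 : 0 ≤ w.1 ^ (2 * a - 1) := rpow_nonneg hw.1.le _
  rw [← ofReal_norm (Γ w.1 w.2.1 w.2.2), ← ofReal_mul (sqrt_nonneg _),
    ← ofReal_mul (by positivity), ← ofReal_mul (by positivity),
    ← ofReal, ← ofReal_mul (by positivity), ← ofReal_norm]
  refine ofReal_le_ofReal ?_
  rw [lowIntegrand, compositionIntegrand, norm_mul, norm_mul (_ * _ * _ * _), norm_mul (_ * _ * _),
    norm_mul (_ * _), norm_mul (resolventPlus _ _ _), norm_real, norm_mul (χ w.1),
    norm_of_nonneg (sqrt_nonneg _), norm_of_nonneg (sqrt_nonneg _),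
    Real.norm_of_nonneg e5]
  calc _ ≤ C3 * Λ ^ (2 * a - 1) * (C1 * (1 + ‖x - w.2.1‖ ^ (2 * a - n)) * √|V w.2.1| *
        ‖Γ w.1 w.2.1 w.2.2‖ * √|V w.2.2| * C2) := by gcongr
    _ = _ := by ring

lemma integrable_lowIntegrand (hn : 3 ≤ n) (ha : 1 < a) (han : 2 * a < n) (hΛ : 0 < Λ)
    (hχ : Continuous χ) (hV : Measurable V)
    (hΓ : AEStronglyMeasurable (fun w : ℝ × (Rn n × Rn n) => Γ w.1 w.2.1 w.2.2)
      (spectralMeasure n Λ))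
    (hM : ∀ᵐ z : Rn n × Rn n, gammaTilde η Λ Γ z.1 z.2 ≤ M z)
    {x : Rn n} (hW : ∫⁻ z : Rn n × Rn n, ofReal (1 + ‖x - z.1‖ ^ (2 * a - n)) *
        (ofReal (√|V z.1|) * M z * ofReal (√|V z.2|)) ≠ ⊤) (y : Rn n) :
    Integrable (lowIntegrand a χ V Γ x y) (spectralMeasure n Λ) := by
  obtain ⟨H, hH, hHm⟩ := exists_measurable_lowIntegrand hn ha han hχ hV hΓ
  obtain ⟨C, hC⟩ := exists_enorm_lowIntegrand_le hn ha han hΛ hχ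
  have hm : AEStronglyMeasurable (lowIntegrand a χ V Γ x y) (spectralMeasure n Λ) :=
    (hHm _ (fun _ => (x, y)) id measurable_const (Measure.QuasiMeasurePreserving.id _)).congr
      (hH x y)
  refine ⟨hm, ?_⟩
  rw [HasFiniteIntegral, lintegral_prod _ hm.enorm]
  set W := ∫⁻ z : Rn n × Rn n, ofReal (1 + ‖x - z.1‖ ^ (2 * a - n)) *
        (ofReal (√|V z.1|) * M z * ofReal (√|V z.2|))
  calc _ ≤ ∫⁻ _ in Ioo 0 Λ, (C * W : ℝ≥0∞) := by
        refine setLIntegral_mono' measurableSet_Ioo fun t ht => ?_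
        rw [← lintegral_const_mul' _ _ coe_ne_top]
        refine lintegral_mono_ae ?_
        filter_upwards [hM, ae_fst_ne_and_snd_ne hn x y] with z hz hxy
        refine (hC V Γ x y (t, z) ht hxy.1 hxy.2).trans ?_
        have := (enorm_le_gammaTilde (η := η) (Γ := Γ) (x := z.1) (y := z.2) ht).trans hz; gcongr
    _ < ⊤ := by
        rw [lintegral_const]
        exact mul_lt_top (mul_lt_top coe_lt_top hW.lt_top) (by simp)

/-- The bound of the spectral integral for fixed intermediate points. -/
lemma exists_enorm_integral_lowIntegrand_le (hn : 3 ≤ n) (ha : 1 < a) (han : 2 * a < n)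
    {s₀ : ℝ} (hs₀ : 0 < s₀) (hsΛ : s₀ < Λ) (hη : 0 < η) (hχ : ContDiff ℝ ∞ χ)
    (hχ1 : ∀ t ∈ Ioo 0 s₀, χ t = 1) (hχ0 : ∀ t, Λ < t → χ t = 0) :
    ∃ (C : ℝ≥0) (c : ℝ), 0 < c ∧ ∀ (V : Rn n → ℝ) (Γ : ℝ → Rn n → Rn n → ℂ) (m : ℝ≥0∞)
      (x y : Rn n) (z : Rn n × Rn n), z.1 ≠ x → z.2 ≠ y →
      (∀ k < numDeriv n, DifferentiableOn ℝ (iteratedDeriv k (fun t => Γ t z.1 z.2)) (Ioo 0 Λ)) →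
      gammaTilde η Λ Γ z.1 z.2 ≤ m →
      ofReal (√|V z.1|) * m * ofReal (√|V z.2|) ≠ ⊤ →
      ‖∫ t in Ioo 0 Λ, lowIntegrand a χ V Γ x y (t, z)‖ₑ ≤
        C * (ofReal (√|V z.1|) * m * ofReal (√|V z.2|)) * (ofReal (‖x - z.1‖ ^ (2 * a - n)) *
            majKernel n a (numDeriv n) η c Λ ‖x - z.1‖ ‖z.2 - y‖) := by
  obtain ⟨C, c, hC, hc, h⟩ := exists_enorm_spectral_integral_le hn ha han hs₀ hsΛ hη
    (χ := fun t => (χ t : ℂ)) (ofRealCLM.contDiff.comp hχ)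
    (fun t ht => by rw [hχ1 t ht, ofReal_one])
    (fun t ht => by rw [hχ0 t ht, ofReal_zero])
  refine ⟨(|helmC n / a| * C).toNNReal, c, hc, fun V Γ m x y z hx hy hd hm hfin => ?_⟩
  have hr₁ : 0 < ‖x - z.1‖ := norm_pos_iff.2 (sub_ne_zero.2 hx.symm)
  have hr₂ : 0 < ‖z.2 - y‖ := norm_pos_iff.2 (sub_ne_zero.2 hy)
  set r₁ := ‖x - z.1‖
  set r₂ := ‖z.2 - y‖
  set b : ℂ := I * (helmC n / a * r₁ ^ (2 * a - n) * (√|V z.1| * √|V z.2|) : ℝ) with hb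
  have hrepr : ∫ t in Ioo 0 Λ, lowIntegrand a χ V Γ x y (t, z) =
      b * ∫ t in Ioo 0 Λ, χ t * Γ t z.1 z.2 * (t ^ ((n : ℝ) - 1) : ℝ) *
        Phi n a (t * r₁ : ℝ) * poissonG ord(n) (t * r₂ : ℝ) := by
    rw [← integral_const_mul]
    refine setIntegral_congr_fun measurableSet_Ioo fun t ht => ?_
    have e1 : t ^ ((n : ℝ) - 1) = t ^ (2 * a - 1) * t ^ (n - 2 * a) := by
      rw [← rpow_add ht.1]; congr 1; ring
    simp only [lowIntegrand, compositionIntegrand]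
    rw [resolventPlus_sub_resolventMinus hn ha han ht.1 (sub_ne_zero.2 hy),
      resolventPlus_eq hn ha han ht.1 (sub_ne_zero.2 hx.symm), e1, hb]
    simp only [Complex.ofReal_mul, r₁, r₂]; ring
  have hbn : ‖b‖ = |helmC n / a| * r₁ ^ (2 * a - n) * (√|V z.1| * √|V z.2|) := by
    rw [hb, norm_mul, norm_I, one_mul, norm_real, norm_eq_abs, abs_mul, abs_mul,
      abs_of_nonneg (by positivity : 0 ≤ r₁ ^ (2 * a - n)),
      abs_of_nonneg (by positivity : 0 ≤ √|V z.1| * √|V z.2|)]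
  rw [hrepr]
  rcases eq_or_ne m ⊤ with rfl | hmt
  · have hv : √|V z.1| * √|V z.2| = 0 := by
      by_contra hne
      rw [mul_eq_zero, not_or] at hne
      have p1 : ofReal √|V z.1| ≠ 0 :=
        (ENNReal.ofReal_pos.2 (lt_of_le_of_ne (sqrt_nonneg _) (Ne.symm hne.1))).ne'
      have p2 : ofReal √|V z.2| ≠ 0 :=
        (ENNReal.ofReal_pos.2 (lt_of_le_of_ne (sqrt_nonneg _) (Ne.symm hne.2))).ne'
      exact hfin (by rw [ENNReal.mul_top p1, ENNReal.top_mul p2])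
    have : b = 0 := by rw [← norm_eq_zero, hbn, hv, mul_zero]
    rw [this, zero_mul, enorm_zero]
    exact zero_le
  · have hle : ∀ {X : ℂ}, ‖X‖ₑ ≤ m → ‖X‖ ≤ m.toReal := fun {X} hX => by
      rw [← toReal_enorm]; exact ENNReal.toReal_mono hmt hX
    have hI := h m.toReal (fun t => Γ t z.1 z.2) ENNReal.toReal_nonneg hd
      (fun t ht => hle ((enorm_le_gammaTilde ht).trans hm)) (fun t ht k hk => by
        have h1 := hle ((enorm_iteratedDeriv_le_gammaTilde ht hk).trans hm)
        rwa [norm_mul, norm_of_nonneg (rpow_nonneg ht.1.le _), mul_comm] at h1)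
      r₁ r₂ hr₁ hr₂
    rw [enorm_mul, ← ofReal_norm b, hbn]
    refine (mul_le_mul' le_rfl hI).trans_eq ?_
    rw [ofReal_mul (by positivity), ofReal_mul (by positivity),
      ofReal_mul (by positivity), ofReal_mul hC.le, ENNReal.ofReal_toReal hmt,
      ← ofReal, ofReal_mul (abs_nonneg _)]
    ring

end

section

variable {n : ℕ} {a Λ : ℝ} {χ : ℝ → ℝ} {V : Rn n → ℝ} {Γ : ℝ → Rn n → Rn n → ℂ} {x y : Rn n}

lemma lowIntegrand_eq_zero (hχ0 : ∀ t, Λ ≤ t → χ t = 0) {t : ℝ} (ht : Λ ≤ t)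
    (z : Rn n × Rn n) : lowIntegrand a χ V Γ x y (t, z) = 0 := by
  simp [lowIntegrand, hχ0 t ht]

lemma integrable_lowIntegrand_Ioi (hχ0 : ∀ t, Λ ≤ t → χ t = 0)
    (h : Integrable (lowIntegrand a χ V Γ x y) (spectralMeasure n Λ)) :
    Integrable (lowIntegrand a χ V Γ x y) ((volume.restrict (Ioi 0)).prod volume) := by
  have e : ∀ s : Set ℝ, (volume.restrict s).prod (volume : Measure (Rn n × Rn n)) =
      (volume.prod volume).restrict (s ×ˢ univ) := fun s => by
    rw [← Measure.prod_restrict, Measure.restrict_univ]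
  rw [spectralMeasure, e] at h
  rw [e]
  refine IntegrableOn.of_forall_sdiff_eq_zero h (measurableSet_Ioi.prod MeasurableSet.univ) ?_
  rintro ⟨t, z⟩ ⟨⟨h1, -⟩, h2⟩
  refine lowIntegrand_eq_zero hχ0 (not_lt.1 fun h3 => h2 ⟨⟨h1, h3⟩, mem_univ _⟩) z

lemma lowEnergyKernel_eq_integral (hχ0 : ∀ t, Λ ≤ t → χ t = 0)
    (h : Integrable (lowIntegrand a χ V Γ x y) (spectralMeasure n Λ)) :
    lowEnergyKernel a χ V Γ x y = ∫ w, lowIntegrand a χ V Γ x y w ∂(spectralMeasure n Λ) := by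
  rw [integral_prod _ h, lowEnergyKernel]
  simp only [← integral_const_mul]
  refine setIntegral_eq_of_subset_of_forall_sdiff_eq_zero measurableSet_Ioi Ioo_subset_Ioi_self ?_
  intro t ht
  have : ∀ z, lowIntegrand a χ V Γ x y (t, z) = 0 := fun z =>
    lowIntegrand_eq_zero hχ0 (not_lt.1 fun h3 => ht.2 ⟨ht.1, h3⟩) z
  exact (integral_congr_ae (Eventually.of_forall this)).trans (integral_zero _ _)

end

theorem proposition3p1 (n : ℕ) (α η β lam₀ : ℝ)
    (hα : 2 < 2 * α) (hn : 2 * α < n) (hη : 0 < η) (hβ : n < β) (hlam₀ : 0 < lam₀)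
    -- the even smooth cut-off
    (χ : ℝ → ℝ) (hχ_smooth : ContDiff ℝ ∞ χ) (hχ_even : ∀ t, χ (-t) = χ t)
    (hχ_one : ∀ t, |t| < lam₀ → χ t = 1) (hχ_zero : ∀ t, 2 * lam₀ < |t| → χ t = 0)
    -- the potential
    (V : Rn n → ℝ) (hV_meas : Measurable V)
    (hV : ∃ C : ℝ, ∀ x, |V x| ≤ C * bracket x ^ (-β))
    -- the family of absolutely bounded operators, with kernels differentiable in `lam`
    (Γ : ℝ → Rn n → Rn n → ℂ)
    (hΓ : ∀ lam ∈ Ioo (0 : ℝ) (2 * lam₀), AbsolutelyBounded (Γ lam))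
    (hΓ_diff : ∀ᵐ z : Rn n × Rn n, ∀ k < numDeriv n,
      DifferentiableOn ℝ (iteratedDeriv k (fun t => Γ t z.1 z.2)) (Ioo (0 : ℝ) (2 * lam₀)))
    (hΓ_low : (n : ℝ) < 4 * α → PosKernelBoundedOnL2 (gammaTilde η (2 * lam₀) Γ))
    (hΓ_high : 4 * α ≤ n → ∃ C ε : ℝ, 0 < ε ∧ ∀ᵐ z : Rn n × Rn n,
      gammaTilde η (2 * lam₀) Γ z.1 z.2 ≤ ofReal
        (C * bracket z.1 ^ (-((n : ℝ) / 2) - ε) * bracket z.2 ^ (-((n : ℝ) / 2) - ε))) :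
    -- the integrals that define the kernel converge absolutely
    (∀ x y : Rn n, Integrable (fun w : ℝ × (Rn n × Rn n) => ((χ w.1 * w.1 ^ (2 * α - 1) : ℝ) : ℂ) *
        compositionIntegrand α V Γ w.1 x y w.2)
      ((volume.restrict (Ioi (0 : ℝ))).prod volume)) ∧
    -- the operator is bounded on every `L^p`
    ∀ p : ℝ≥0∞, 1 ≤ p → KernelBoundedOnLp (lowEnergyKernel α χ V Γ) p := by
  have ha : 1 < α := by linarith
  have hn3 : 3 ≤ n := by
    have : (2 : ℝ) < n := by linarith
    exact_mod_cast this
  set Λ := 2 * lam₀ with hΛ_def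
  have hΛ : 0 < Λ := by positivity
  have hχ0' : ∀ t, Λ < t → χ t = 0 := fun t ht => hχ_zero t (ht.trans_le (le_abs_self t))
  have hχ0 : ∀ t, Λ ≤ t → χ t = 0 := fun t ht => by
    have := closure_minimal (s := Ioi Λ) (t := {t | χ t = 0}) hχ0'
      (isClosed_singleton.preimage hχ_smooth.continuous)
    rw [closure_Ioi] at this
    exact this ht
  have hχ1 : ∀ t ∈ Ioo 0 lam₀, χ t = 1 := fun t ht => hχ_one t (by rw [abs_of_pos ht.1]; exact ht.2)
  obtain ⟨M, hMm, hM, CW, hW⟩ := exists_amplitude_majorant hn3 ha hn hβ hV_meas hV hΓ_low hΓ_high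
  have hcont : ∀ᵐ z : Rn n × Rn n, ContinuousOn (fun t => Γ t z.1 z.2) (Ioo 0 Λ) := by
    filter_upwards [hΓ_diff] with z hz
    have := hz 0 (Nat.succ_pos _)
    rw [iteratedDeriv_zero] at this
    exact this.continuousOn
  have hΓm : AEStronglyMeasurable (fun w : ℝ × (Rn n × Rn n) => Γ w.1 w.2.1 w.2.2)
      (spectralMeasure n Λ) :=
    aestronglyMeasurable_uncurry_of_continuousOn (Γ := fun t (z : Rn n × Rn n) => Γ t z.1 z.2)
      (fun t ht => (hΓ t ht).1) hcont
  have hint : ∀ x y, Integrable (lowIntegrand α χ V Γ x y) (spectralMeasure n Λ) :=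
    fun x y => integrable_lowIntegrand hn3 ha hn hΛ hχ_smooth.continuous hV_meas hΓm hM
      ((hW x).trans_lt coe_lt_top).ne y
  refine ⟨fun x y => integrable_lowIntegrand_Ioi hχ0 (hint x y), fun p hp => ?_⟩
  set u : Rn n × Rn n → ℝ≥0∞ := fun z => ofReal (√|V z.1|) * M z * ofReal (√|V z.2|)
  have hu : AEMeasurable u volume := by fun_prop
  have huW : ∫⁻ z, u z ≤ CW := by
    refine (lintegral_mono fun z => ?_).trans (hW 0)
    refine le_mul_of_one_le_left zero_le (ENNReal.one_le_ofReal.2 ?_)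
    have : 0 ≤ ‖(0 : Rn n) - z.1‖ ^ (2 * α - n) := by positivity
    linarith
  have hufin : ∀ᵐ z, u z ≠ ⊤ := (ae_lt_top' hu (huW.trans_lt coe_lt_top).ne).mono fun z hz => hz.ne
  obtain ⟨C, c, hc, hC⟩ :=
    exists_enorm_integral_lowIntegrand_le hn3 ha hn hlam₀ (by linarith) hη hχ_smooth hχ1 hχ0'
  have hN : ((n : ℝ) - 1) / 2 + 1 < numDeriv n := by
    rw [numDeriv]
    have := Nat.le_ceil ((n : ℝ) / 2); push_cast; linarith
  obtain ⟨CR, hCR⟩ := exists_lintegral_majKernel_right_le (a := α) hn3 hn hN hη hc hΛ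
  obtain ⟨CL, hCL⟩ := exists_lintegral_majKernel_left_le hn3 ha hn hN hη hc hΛ
  obtain ⟨J, hJ, hJm⟩ : ∃ J : ℝ → ℝ → ℝ≥0∞, (J = fun r₁ r₂ => ofReal (r₁ ^ (2 * α - n)) *
      majKernel n α (numDeriv n) η c Λ r₁ r₂) ∧ Measurable fun q : ℝ × ℝ => J q.1 q.2 :=
    ⟨_, rfl, by fun_prop⟩
  have hK : ∀ x y, ‖lowEnergyKernel α χ V Γ x y‖ₑ ≤
      C * ∫⁻ z, u z * J ‖x - z.1‖ ‖z.2 - y‖ := fun x y => by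
    rw [lowEnergyKernel_eq_integral hχ0 (hint x y), integral_prod_symm _ (hint x y),
      ← lintegral_const_mul' _ _ coe_ne_top]
    refine (enorm_integral_le_lintegral_enorm _).trans (lintegral_mono_ae ?_)
    filter_upwards [hM, hΓ_diff, hufin, ae_fst_ne_and_snd_ne hn3 x y] with z h1 h2 h3 h4
    refine (hC V Γ (M z) x y z h4.1 h4.2 h2 h1 h3).trans_eq ?_
    rw [hJ, mul_assoc]
  have hn0 : Nonempty (Fin n) := ⟨⟨0, by omega⟩⟩
  have hrow : ∀ x, ∫⁻ y, ‖lowEnergyKernel α χ V Γ x y‖ₑ ≤ C * (CR * CW) := fun x => by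
    refine (lintegral_mono fun y => hK x y).trans ?_
    rw [lintegral_const_mul' _ _ coe_ne_top, lintegral_superposition_right hu hJm]
    refine mul_le_mul' le_rfl ?_
    calc _ ≤ ∫⁻ z : Rn n × Rn n, CR * (ofReal (1 + ‖x - z.1‖ ^ (2 * α - n)) * u z) := by
          refine lintegral_mono_ae ?_
          filter_upwards [ae_fst_ne_and_snd_ne hn3 x x] with z hz
          have hr : 0 < ‖x - z.1‖ := norm_pos_iff.2 (sub_ne_zero.2 hz.1.symm)
          have e1 : ‖x - z.1‖ ^ (2 * α - n) * (1 + ‖x - z.1‖ ^ (n - 2 * α)) =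
              1 + ‖x - z.1‖ ^ (2 * α - n) := by
            rw [mul_add, ← rpow_add hr]
            simp [add_comm]
          simp only [hJ]
          rw [lintegral_const_mul' _ _ ofReal_ne_top, ← e1, ofReal_mul (by positivity)]
          calc _ ≤ u z * (ofReal (‖x - z.1‖ ^ (2 * α - n)) *
                (CR * ofReal (1 + ‖x - z.1‖ ^ (n - 2 * α)))) :=
              mul_le_mul' le_rfl (mul_le_mul' le_rfl (hCR _ hr))
            _ = _ := by ring
      _ ≤ _ := by
          rw [lintegral_const_mul' _ _ coe_ne_top]
          exact mul_le_mul' le_rfl (hW x)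
  have hcol : ∀ y, ∫⁻ x, ‖lowEnergyKernel α χ V Γ x y‖ₑ ≤ C * (CL * CW) := fun y => by
    refine (lintegral_mono fun x => hK x y).trans ?_
    rw [lintegral_const_mul' _ _ coe_ne_top, lintegral_superposition_left hu hJm]
    refine mul_le_mul' le_rfl ?_
    calc _ ≤ ∫⁻ z, CL * u z := by
          refine lintegral_mono_ae ?_
          filter_upwards [ae_fst_ne_and_snd_ne hn3 y y] with z hz
          rw [mul_comm, hJ]
          exact mul_le_mul' (hCL _ (norm_pos_iff.2 (sub_ne_zero.2 hz.2))) le_rfl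
      _ ≤ _ := by
          rw [lintegral_const_mul' _ _ coe_ne_top]
          exact mul_le_mul' le_rfl huW
  have hKm : AEStronglyMeasurable (fun q : Rn n × Rn n => lowEnergyKernel α χ V Γ q.1 q.2)
      (volume.prod volume) := by
    obtain ⟨H, hH, hHm⟩ :=
      exists_measurable_lowIntegrand hn3 ha hn hχ_smooth.continuous hV_meas hΓm
    have e : (fun q : Rn n × Rn n => lowEnergyKernel α χ V Γ q.1 q.2) =
        fun q => ∫ w, H q w ∂(spectralMeasure n Λ) := by
      funext q
      rw [lowEnergyKernel_eq_integral hχ0 (hint q.1 q.2)]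
      exact integral_congr_ae (hH q.1 q.2).symm
    rw [e]
    exact (hHm ((volume.prod volume).prod (spectralMeasure n Λ)) Prod.fst Prod.snd measurable_fst
      Measure.quasiMeasurePreserving_snd).integral_prod_right'
  refine kernelBoundedOnLp_of_schur (C := C * (CR * CW) + C * (CL * CW)) hKm
    (Eventually.of_forall fun x => (hrow x).trans ?_)
    (Eventually.of_forall fun y => (hcol y).trans ?_) hp
  · push_cast; exact le_self_add
  · push_cast; exact le_add_self
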